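/- Let $M$ be an oriented smooth 3-manifold (Hausdorff, $\sigma$-compact, without boundary) and let $\mathfrak g$ be a finite-dimensional real Lie algebra with a symmetric invariant bilinear form $\mathrm{Tr}$, $\mathrm{Tr}([X,Y],Z)=\mathrm{Tr}(X,[Y,Z])$. Put $\Omega^k(M,\mathfrak g)=\Omega^k(M)\otimes\mathfrak g$, with $[\alpha\otimes X,\beta\otimes Y]=\alpha\wedge\beta\otimes[X,Y]$, and write $dx^\mu\otimes\mathrm{Tr}(\iota_\mu a\wedge b)$ for the element $\xi\mapsto\mathrm{Tr}(\iota_\xi a\wedge b)$ of $\Omega^1(M,\Omega^3(M))$. *The Chern–Simons dg Lie algebra.* $V^{\rm CS}=\bigoplus_{k=0}^3\Omega^k(M,\mathfrak g)$, with elements $\lambda,A,E,\Lambda$ in degrees $0,1,2,3$, $\ell_1=d$, $\ell_2(a,b)=-[a,b]$, $\ell_n=0$ for $n\ge3$, and pairing $\langle\alpha,\beta\rangle=\int_M\mathrm{Tr}(\alpha\wedge\beta)$ in complementary degrees. *The extended dg Lie algebra.* $V^{\rm ext}_{-1}=\Gamma(TM)\ni\check\xi$, $V^{\rm ext}_0=\Gamma(TM)\times\Omega^0(M,\mathfrak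 g)\ni(\xi,\lambda)$, $V^{\rm ext}_1=\Omega^1(M,\mathfrak g)\ni A$, $V^{\rm ext}_2=\Omega^2(M,\mathfrak g)\ni E$, $V^{\rm ext}_3=\Omega^1(M,\Omega^3(M))\times\Omega^3(M,\mathfrak g)\ni(X,\Lambda)$, $V^{\rm ext}_4=\Omega^1(M,\Omega^3(M))\ni\check X$, with $$\ell_1(\check\xi)=(\check\xi,0),\quad \ell_1(\xi,\lambda)=d\lambda,\quad \ell_1(A)=dA,\quad \ell_1(E)=(0,dE),\quad \ell_1(X,\Lambda)=X,$$ $$\ell_2((\xi_1,\lambda_1),(\xi_2,\lambda_2))=([\xi_1,\xi_2],\,L_{\xi_1}\lambda_2-L_{\xi_2}\lambda_1-[\lambda_1,\lambda_2]),$$ $$\ell_2((\xi,\lambda),A)=L_\xi A-[\lambda,A],\quad \ell_2((\xi,\lambda),E)=L_\xi E-[\lambda,E],$$ $$\ell_2((\xi,\lambda),(X,\Lambda))=(dx^\mu\otimes\mathrm{Tr}(\iota_\mu d\lambda\,\Lambda)+L_\xi X,\ L_\xi\Lambda-[\lambda,\Lambda]),\quad \ell_2(A_1,A_2)=-[A_1,A_2],$$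 $$\ell_2(A,E)=(dx^\mu\otimes\mathrm{Tr}(\iota_\mu dA\wedge E)-dx^\mu\otimes\mathrm{Tr}(\iota_\mu A\,dE),\ -[A,E]),$$ $$\ell_2(\check\xi,(\xi,\lambda))=[\check\xi,\xi],\quad \ell_2(\check\xi,A)=(0,\iota_{\check\xi}A),\quad \ell_2(\check\xi,E)=\iota_{\check\xi}E,\quad \ell_2(\check\xi,(X,\Lambda))=\iota_{\check\xi}\Lambda,$$ $$\ell_2(\check\xi,\check X)=(L_{\check\xi}\check X,0),\quad \ell_2((\xi,\lambda),\check X)=L_\xi\check X,$$ $$\ell_2(A,(X,\Lambda))=dx^\mu\otimes\mathrm{Tr}(\iota_\mu A\,\Lambda),\quad \ell_2(E_1,E_2)=dx^\mu\otimes\mathrm{Tr}(\iota_\mu E_1\wedge E_2),$$ extended by graded antisymmetry; all other brackets vanish. The pairing is that of $V^{\rm CS}$ together with $\int_M\iota_\xi X$ and $\int_M\iota_{\check\xi}\check X$, extended by graded symmetry. *The maps.* $\psi_1:V^{\rm CS}\to V^{\rm ext}$ is the inclusion $\lambda\mapsto(0,\lambda)$, $A\mapsto A$, $E\mapsto E$,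 $\Lambda\mapsto(0,\Lambda)$; the only non-zero components of the graded antisymmetric map $\psi_2$ are $$\psi_2(A,\Lambda)=-(dx^\mu\otimes\mathrm{Tr}(\iota_\mu A\,\Lambda),0),\qquad \psi_2(E_1,E_2)=-(dx^\mu\otimes\mathrm{Tr}(\iota_\mu E_1\wedge E_2),0);$$ and $\psi_n=0$ for $n\ge3$. Pairings, and the identities involving them, are considered whenever at least one of the arguments has compact support (bilinearity whenever all the pairings involved have an argument with compact support). Then: 1. $V^{\rm CS}$ and $V^{\rm ext}$ are differential graded Lie algebras (i.e. $L_\infty$-algebras with $\ell_n=0$ for $n\ge 3$), and their pairings are graded symmetric of degree $-3$ and cyclic. If $\mathrm{Tr}$ is non-degenerate, then so are both pairings: an element which pairs to zero with all compactly supported elements vanishes. 2. $\psi=\{\psi_n\}$ is an $L_\infty$-morphism $V^{\rm CS}\to V^{\rm ext}$, a quasi-isomorphism ($\psi_1$ induces an isomorphism on $\ell_1$-cohomology), and cyclic. 3. If $M\neq\emptyset$ and $\mathrm{Tr}\neq0$, then $\psi$ is not a morphism of dg Lie algebras (not $\psi_n=0$ for all $n\ge2$), and indeed $\psi_1$ does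 not preserve the brackets $\ell_2$. 4. For $A\in\Omega^1(M,\mathfrak g)$ let $F=dA+\frac12[A,A]$. In $V^{\rm ext}$, $\ell_1(\xi,\lambda)+\ell_2((\xi,\lambda),A)=\delta_{(\xi,\lambda)}A:=L_\xi A+d\lambda+[A,\lambda]$, $\ell_1(A)-\frac12\ell_2(A,A)=F$, $\ell_1(\check\xi)-\ell_2(A,\check\xi)=(\check\xi,-\iota_{\check\xi}A)$ and $\ell_1(F)-\ell_2(A,F)=(-\mathcal N(A),\,dF+[A,F])$ with $\mathcal N(A)=dx^\mu\otimes\mathrm{Tr}(\iota_\mu dA\wedge F)-dx^\mu\otimes\mathrm{Tr}(\iota_\mu A\,dF)$; moreover the Noether identities $\mathcal N(A)=0$ and $dF+[A,F]=0$ hold. Diffeomorphisms are redundant up to terms proportional to $F$: for all vector fields $\xi,\check\xi$ and all $\lambda$, $$\delta_{(\xi+\check\xi,\,\lambda-\iota_{\check\xi}A)}A=\delta_{(\xi,\lambda)}A+\iota_{\check\xi}F,\qquad \delta_{(\xi,\lambda)}A=\delta_{(0,\lambda+\iota_\xi A)}A+\iota_\xi F .$$ -/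

import Mathlib

open scoped Manifold ContDiff TensorProduct

namespace ChernSimons

/-- The model space of the three-manifold. -/
abbrev E3 : Type := EuclideanSpace ℝ (Fin 3)

section Manifold
variable (M : Type*) [TopologicalSpace M] [ChartedSpace E3 M]

/-- Smooth real functions on `M`. -/
abbrev SmoothFun : Type _ := C^∞⟮𝓡 3, M; 𝓘(ℝ, ℝ), ℝ⟯

variable [IsManifold (𝓡 3) ∞ M]

/-- Smooth vector fields, the space `Γ(TM)`. -/
abbrev VField : Type _ := Cₛ^∞⟮𝓡 3; E3, (TangentSpace (𝓡 3) : M → Type)⟯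

variable {M}

noncomputable instance : SMul (SmoothFun M) (VField M) :=
  ⟨fun f X => ⟨fun p => f p • X p, f.contMDiff.smul_section X.contMDiff⟩⟩

theorem VField.smul_apply (f : SmoothFun M) (X : VField M) (p : M) : (f • X) p = f p • X p := rfl

noncomputable instance : Module (SmoothFun M) (VField M) where
  one_smul X := by ext p; exact one_smul ℝ (X p)
  mul_smul f g X := by ext p; exact mul_smul (f p) (g p) (X p)
  smul_zero f := by ext p; exact smul_zero (f p)
  smul_add f X Y := by ext p; exact smul_add (f p) (X p) (Y p)
  add_smul f g X := by ext p; exact add_smul (f p) (g p) (X p)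
  zero_smul X := by ext p; exact zero_smul ℝ (X p)

/-- The directional derivative of a smooth function along a vector field. -/
noncomputable def VField.deriv (X : VField M) (f : SmoothFun M) : SmoothFun M where
  val p := mvfderiv (𝓡 3) f p (X p)
  property := by
    have h1 : ContMDiff (𝓡 3).tangent (𝓘(ℝ, ℝ)).tangent ∞ (tangentMap (𝓡 3) 𝓘(ℝ, ℝ) f) :=
      f.contMDiff.contMDiff_tangentMap (by simp)
    exact (contMDiff_snd_tangentBundle_modelSpace ℝ 𝓘(ℝ, ℝ)).comp (h1.comp X.contMDiff)

theorem VField.deriv_apply (X : VField M) (f : SmoothFun M) (p : M) :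
    X.deriv f p = mvfderiv (𝓡 3) f p (X p) := rfl

/-- The Lie bracket of vector fields. -/
noncomputable def VField.bracket (X Y : VField M) : VField M where
  toFun := VectorField.mlieBracket (𝓡 3) X Y
  contMDiff_toFun := by
    have : IsManifold (𝓡 3) (minSmoothness ℝ 2) M :=
      IsManifold.of_le (n := ∞) (by
        rw [minSmoothness_of_isRCLikeNormedField]; exact WithTop.coe_le_coe.2 (le_top (a := (2 : ℕ∞))))
    have : IsManifold (𝓡 3) ((((⊤ : ℕ∞) : WithTop ℕ∞)) + 1) M :=
      IsManifold.of_le (n := ∞) (by simp)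
    exact ContDiff.mlieBracket_vectorField (I := 𝓡 3) (m := ⊤) (n := ⊤)
      X.contMDiff Y.contMDiff (by simp)

theorem VField.bracket_apply (X Y : VField M) (p : M) :
    X.bracket Y p = VectorField.mlieBracket (𝓡 3) X Y p := rfl

theorem VField.deriv_add (X : VField M) (f g : SmoothFun M) :
    X.deriv (f + g) = X.deriv f + X.deriv g := by
  ext p
  have h := mvfderiv_add (I := 𝓡 3) (f.mdifferentiableAt (x := p)) (g.mdifferentiableAt (x := p))
  exact congrArg (fun L => L (X p)) h

theorem VField.deriv_mul (X : VField M) (f g : SmoothFun M) :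
    X.deriv (f * g) = f * X.deriv g + g * X.deriv f := by
  ext p
  have h := mvfderiv_mul (I := 𝓡 3) (f.mdifferentiableAt (x := p)) (g.mdifferentiableAt (x := p))
  exact congrArg (fun L => L (X p)) h

theorem VField.deriv_const_smul (X : VField M) (c : ℝ) (f : SmoothFun M) :
    X.deriv (c • f) = c • X.deriv f := by
  have h : c • f = ContMDiffMap.const c * f := by ext p; rfl
  have h0 : X.deriv (ContMDiffMap.const c) = 0 := by
    ext p
    exact congrArg (fun L => L (X p)) (mvfderiv_const (I := 𝓡 3) (x := p) c)
  rw [h, X.deriv_mul, h0, mul_zero, add_zero]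
  ext p; rfl

theorem VField.add_deriv (X Y : VField M) (f : SmoothFun M) :
    (X + Y).deriv f = X.deriv f + Y.deriv f := by
  ext p; exact map_add (mvfderiv (𝓡 3) f p) (X p) (Y p)

theorem VField.smul_deriv (g : SmoothFun M) (X : VField M) (f : SmoothFun M) :
    (g • X).deriv f = g * X.deriv f := by
  ext p; exact map_smul (mvfderiv (𝓡 3) f p) (g p) (X p)

theorem VField.bracket_self (X : VField M) : X.bracket X = 0 := by
  ext p; exact congrFun (VectorField.mlieBracket_self (I := 𝓡 3) (V := X)) p

theorem VField.bracket_swap (X Y : VField M) : X.bracket Y = -Y.bracket X := by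
  ext p; exact VectorField.mlieBracket_swap_apply

theorem VField.bracket_add (X Y Z : VField M) :
    X.bracket (Y + Z) = X.bracket Y + X.bracket Z := by
  ext p; exact VectorField.mlieBracket_add_right Y.mdifferentiableAt Z.mdifferentiableAt

theorem VField.add_bracket (X Y Z : VField M) :
    (X + Y).bracket Z = X.bracket Z + Y.bracket Z := by
  ext p; exact VectorField.mlieBracket_add_left X.mdifferentiableAt Y.mdifferentiableAt

theorem VField.bracket_smul (X : VField M) (f : SmoothFun M) (Y : VField M) :
    X.bracket (f • Y) = X.deriv f • Y + f • X.bracket Y := by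
  ext p; exact VectorField.mlieBracket_smul_right f.mdifferentiableAt Y.mdifferentiableAt

theorem VField.smul_bracket (X : VField M) (f : SmoothFun M) (Y : VField M) :
    (f • X).bracket Y = f • X.bracket Y - Y.deriv f • X := by
  rw [VField.bracket_swap, VField.bracket_smul, VField.bracket_swap Y X, smul_neg]; abel

variable (M) in
/-- The space `Ωᵏ(M)` of smooth differential `k`-forms, as alternating `C^∞(M)`-multilinear maps
on vector fields. -/
abbrev Form (k : ℕ) : Type _ := VField M [⋀^Fin k]→ₗ[SmoothFun M] SmoothFun M

namespace Form

/-- Contraction `ι_ξ` with a vector field (inserted in the first argument). -/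
noncomputable def contr {k : ℕ} (ξ : VField M) : Form M (k + 1) →ₗ[ℝ] Form M k where
  toFun α := α.curryLeft ξ
  map_add' _ _ := rfl
  map_smul' _ _ := rfl

/-- The wedge product of scalar forms, as the alternating sum over shuffles
(so that `(α ∧ β)(X, Y) = α(X) β(Y) - α(Y) β(X)` for 1-forms). -/
noncomputable def wedge {p q : ℕ} (α : Form M p) (β : Form M q) : Form M (p + q) :=
  ((LinearMap.mul' (SmoothFun M) (SmoothFun M)).compAlternatingMap
    (AlternatingMap.domCoprod α β)).domDomCongr finSumFinEquiv

theorem add_wedge {p q : ℕ} (α α' : Form M p) (β : Form M q) :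
    wedge (α + α') β = wedge α β + wedge α' β := by
  have h := congrArg AlternatingMap.domCoprod' (TensorProduct.add_tmul (R := SmoothFun M) α α' β)
  rw [map_add] at h
  simp only [AlternatingMap.domCoprod'_apply] at h
  ext1 Y; simp [wedge, h]

theorem wedge_add {p q : ℕ} (α : Form M p) (β β' : Form M q) :
    wedge α (β + β') = wedge α β + wedge α β' := by
  have h := congrArg AlternatingMap.domCoprod' (TensorProduct.tmul_add (R := SmoothFun M) α β β')
  rw [map_add] at h
  simp only [AlternatingMap.domCoprod'_apply] at h
  ext1 Y; simp [wedge, h]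

theorem smul_wedge {p q : ℕ} (f : SmoothFun M) (α : Form M p) (β : Form M q) :
    wedge (f • α) β = f • wedge α β := by
  have h := congrArg AlternatingMap.domCoprod'
    (show (f • α) ⊗ₜ[SmoothFun M] β = f • (α ⊗ₜ[SmoothFun M] β) from rfl)
  rw [map_smul] at h
  simp only [AlternatingMap.domCoprod'_apply] at h
  ext1 Y; simp [wedge, h]

theorem wedge_smul {p q : ℕ} (f : SmoothFun M) (α : Form M p) (β : Form M q) :
    wedge α (f • β) = f • wedge α β := by
  have h := congrArg AlternatingMap.domCoprod'
    (show α ⊗ₜ[SmoothFun M] (f • β) = f • (α ⊗ₜ[SmoothFun M] β) from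
      (TensorProduct.mk (SmoothFun M) (Form M p) (Form M q) α).map_smul f β)
  rw [map_smul] at h
  simp only [AlternatingMap.domCoprod'_apply] at h
  ext1 Y; simp [wedge, h]

theorem const_smul {k : ℕ} (c : ℝ) (α : Form M k) :
    c • α = (ContMDiffMap.const c : SmoothFun M) • α := by ext Y p; rfl

/-- The wedge product as a real bilinear map. -/
noncomputable def wedgeBilin (p q : ℕ) : Form M p →ₗ[ℝ] Form M q →ₗ[ℝ] Form M (p + q) :=
  LinearMap.mk₂ ℝ wedge add_wedge
    (fun c α β => by rw [const_smul, smul_wedge, ← const_smul])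
    wedge_add
    (fun c α β => by rw [const_smul, wedge_smul, ← const_smul])

theorem two_swap (α : Form M 2) (x y : VField M) : α ![x, y] = -α ![y, x] := by
  have := α.map_swap ![y, x] (i := 0) (j := 1) (by simp)
  rw [← this]; congr 1; ext i; fin_cases i <;> simp

/-- The Lie derivative,
`(L_ξ α)(Y₁, …, Yₖ) = ξ (α(Y₁, …, Yₖ)) - ∑ᵢ α(Y₁, …, [ξ, Yᵢ], …, Yₖ)`. -/
noncomputable def lieDeriv {k : ℕ} (ξ : VField M) (α : Form M k) : Form M k where
  toFun Y := ξ.deriv (α Y) - ∑ i, α (Function.update Y i (ξ.bracket (Y i)))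
  map_update_add' := by
    intro inst Y i Z Z'
    obtain rfl : inst = instDecidableEqFin k := Subsingleton.elim _ _
    have key : ∀ W : VField M, ∑ l, α (Function.update (Function.update Y i W) l
        (ξ.bracket (Function.update Y i W l))) = α (Function.update Y i (ξ.bracket W)) +
        ∑ l ∈ Finset.univ.erase i, α (Function.update (Function.update Y l
          (ξ.bracket (Y l))) i W) := by
      intro W
      rw [← Finset.add_sum_erase _ _ (Finset.mem_univ i)]
      congr 1
      · simp
      · refine Finset.sum_congr rfl fun l hl => ?_
        have h := Finset.ne_of_mem_erase hl
        rw [Function.update_of_ne h, Function.update_comm h]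
    simp only [key, α.map_update_add, VField.deriv_add, VField.bracket_add, Finset.sum_add_distrib]
    abel
  map_update_smul' := by
    intro inst Y i f Z
    obtain rfl : inst = instDecidableEqFin k := Subsingleton.elim _ _
    have key : ∀ W : VField M, ∑ l, α (Function.update (Function.update Y i W) l
        (ξ.bracket (Function.update Y i W l))) = α (Function.update Y i (ξ.bracket W)) +
        ∑ l ∈ Finset.univ.erase i, α (Function.update (Function.update Y l
          (ξ.bracket (Y l))) i W) := by
      intro W
      rw [← Finset.add_sum_erase _ _ (Finset.mem_univ i)]
      congr 1
      · simp
      · refine Finset.sum_congr rfl fun l hl => ?_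
        have h := Finset.ne_of_mem_erase hl
        rw [Function.update_of_ne h, Function.update_comm h]
    simp only [key, α.map_update_add, α.map_update_smul, VField.deriv_mul, VField.bracket_smul,
      smul_eq_mul, ← Finset.mul_sum]
    ring
  map_eq_zero_of_eq' := by
    intro Y i j h hij
    have h0 : ξ.deriv (0 : SmoothFun M) = 0 := by simpa using ξ.deriv_const_smul 0 0
    rw [α.map_eq_zero_of_eq Y h hij, h0, zero_sub, neg_eq_zero,
      ← Finset.add_sum_erase _ _ (Finset.mem_univ i),
      ← Finset.add_sum_erase _ _ (Finset.mem_erase.2 ⟨hij.symm, Finset.mem_univ j⟩),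
      Finset.sum_eq_zero, add_zero]
    · have h1 : Function.update Y j (ξ.bracket (Y j)) =
          Function.update Y i (ξ.bracket (Y i)) ∘ Equiv.swap i j := by
        ext1 l
        by_cases hi : l = i
        · subst hi; simp [Function.update_of_ne hij, Function.update_of_ne hij.symm, h]
        · by_cases hj : l = j
          · subst hj; simp [h]
          · simp [Equiv.swap_apply_of_ne_of_ne hi hj, Function.update_of_ne hi,
              Function.update_of_ne hj]
      rw [h1, α.map_swap _ hij, add_neg_cancel]
    · intro l hl
      have hlj := Finset.ne_of_mem_erase hl
      have hli := Finset.ne_of_mem_erase (Finset.mem_of_mem_erase hl)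
      exact α.map_eq_zero_of_eq _
        (by rw [Function.update_of_ne hli.symm, Function.update_of_ne hlj.symm, h]) hij

/-- The exterior derivative of a function, `df(X) = X f`. -/
noncomputable def d₀ : Form M 0 →ₗ[ℝ] Form M 1 where
  toFun f := AlternatingMap.ofSubsingleton (SmoothFun M) (VField M) (SmoothFun M) (0 : Fin 1)
    { toFun := fun X => X.deriv (f ![])
      map_add' := fun X Y => X.add_deriv Y _
      map_smul' := fun g X => VField.smul_deriv g X _ }
  map_add' f g := by
    ext X : 1; exact (X 0).deriv_add _ _
  map_smul' c f := by
    ext X : 1; exact (X 0).deriv_const_smul _ _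

theorem one_add (α : Form M 1) (x y : VField M) : α ![x + y] = α ![x] + α ![y] :=
  AlternatingMap.map_vecCons_add α ![] x y

theorem one_smul (α : Form M 1) (f : SmoothFun M) (x : VField M) : α ![f • x] = f * α ![x] :=
  AlternatingMap.map_vecCons_smul α ![] f x

theorem one_neg (α : Form M 1) (x : VField M) : α ![-x] = -α ![x] := by
  simpa using one_smul α (-1) x

theorem two_add (α : Form M 2) (x y z : VField M) : α ![x + y, z] = α ![x, z] + α ![y, z] :=
  AlternatingMap.map_vecCons_add α ![z] x y

theorem two_smul (α : Form M 2) (f : SmoothFun M) (x z : VField M) :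
    α ![f • x, z] = f * α ![x, z] :=
  AlternatingMap.map_vecCons_smul α ![z] f x

theorem two_neg (α : Form M 2) (x z : VField M) : α ![-x, z] = -α ![x, z] := by
  simpa using two_smul α (-1) x z

theorem two_self (α : Form M 2) (x : VField M) : α ![x, x] = 0 :=
  α.map_eq_zero_of_eq ![x, x] (i := 0) (j := 1) rfl (by decide)

theorem two_add' (α : Form M 2) (x y z : VField M) : α ![z, x + y] = α ![z, x] + α ![z, y] := by
  rw [two_swap, two_add, two_swap α z x, two_swap α z y]; ring

theorem two_smul' (α : Form M 2) (f : SmoothFun M) (x z : VField M) :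
    α ![z, f • x] = f * α ![z, x] := by
  rw [two_swap, two_smul, two_swap α z x]; ring

/-- The exterior derivative of a one-form,
`dα(X, Y) = X α(Y) - Y α(X) - α([X, Y])`. -/
noncomputable def d₁ : Form M 1 →ₗ[ℝ] Form M 2 where
  toFun α :=
    { toFun := fun X => (X 0).deriv (α ![X 1]) - (X 1).deriv (α ![X 0]) -
        α ![(X 0).bracket (X 1)]
      map_update_add' := by
        intro inst Y i Z Z'
        obtain rfl : inst = instDecidableEqFin 2 := Subsingleton.elim _ _
        fin_cases i <;> simp [VField.add_deriv, VField.deriv_add, one_add, VField.bracket_add,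
          VField.add_bracket] <;> ring
      map_update_smul' := by
        intro inst Y i f Z
        obtain rfl : inst = instDecidableEqFin 2 := Subsingleton.elim _ _
        fin_cases i <;> simp [VField.smul_deriv, VField.deriv_mul, one_smul, one_add, one_neg,
          sub_eq_add_neg, VField.bracket_smul, VField.smul_bracket] <;> ring
      map_eq_zero_of_eq' := by
        intro Y i j h hij
        have h' : Y 0 = Y 1 := by
          fin_cases i <;> fin_cases j <;> simp_all
        have h0 : α ![(0 : VField M)] = 0 := α.map_coord_zero (0 : Fin 1) rfl
        simp [h', VField.bracket_self, h0] }
  map_add' α β := by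
    ext X : 1
    simp [VField.deriv_add]; ring
  map_smul' c α := by
    ext X : 1
    simp [VField.deriv_const_smul, smul_sub]

/-- The exterior derivative of a two-form, by the formula
`dα(X, Y, Z) = X α(Y, Z) - Y α(X, Z) + Z α(X, Y) - α([X, Y], Z) + α([X, Z], Y) - α([Y, Z], X)`. -/
noncomputable def d₂ : Form M 2 →ₗ[ℝ] Form M 3 where
  toFun α :=
    { toFun := fun X => (X 0).deriv (α ![X 1, X 2]) - (X 1).deriv (α ![X 0, X 2]) +
        (X 2).deriv (α ![X 0, X 1]) - α ![(X 0).bracket (X 1), X 2] +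
        α ![(X 0).bracket (X 2), X 1] - α ![(X 1).bracket (X 2), X 0]
      map_update_add' := by
        intro inst Y i Z Z'
        obtain rfl : inst = instDecidableEqFin 3 := Subsingleton.elim _ _
        fin_cases i <;> simp [VField.add_deriv, VField.deriv_add, two_add, two_add',
          VField.bracket_add, VField.add_bracket] <;> ring
      map_update_smul' := by
        intro inst Y i f Z
        obtain rfl : inst = instDecidableEqFin 3 := Subsingleton.elim _ _
        fin_cases i <;> simp [VField.smul_deriv, VField.deriv_mul, two_smul, two_smul', two_add,
          two_neg, sub_eq_add_neg, VField.bracket_smul, VField.smul_bracket]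
        · rw [two_swap α Z (Y 2), two_swap α Z (Y 1)]; ring
        · rw [two_swap α Z (Y 0)]; ring
        · rw [two_swap α Z (Y 1), two_swap α Z (Y 0)]; ring
      map_eq_zero_of_eq' := by
        intro Y i j h hij
        have h0 : ∀ x, α ![(0 : VField M), x] = 0 := fun x => α.map_coord_zero (0 : Fin 2) rfl
        have hd : ∀ X : VField M, X.deriv (0 : SmoothFun M) = 0 := fun X => by
          simpa using X.deriv_const_smul 0 0
        have h' : Y 0 = Y 1 ∨ Y 0 = Y 2 ∨ Y 1 = Y 2 := by
          fin_cases i <;> fin_cases j <;> simp_all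
        rcases h' with h' | h' | h'
        · simp [h', VField.bracket_self, h0, two_self, hd]
        · rw [h', VField.bracket_self, h0, two_self, hd, two_swap α (Y 2) (Y 1),
            VField.bracket_swap (Y 2) (Y 1), two_neg,
            show (-α ![Y 1, Y 2]) = (-1 : ℝ) • α ![Y 1, Y 2] by simp, VField.deriv_const_smul]
          simp
        · simp [h', VField.bracket_self, h0, two_self, hd] }
  map_add' α β := by
    ext X : 1
    simp [VField.deriv_add]; ring
  map_smul' c α := by
    ext X : 1
    simp [VField.deriv_const_smul, smul_sub, smul_add]

theorem lieDeriv_add {k : ℕ} (ξ : VField M) (α β : Form M k) :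
    lieDeriv ξ (α + β) = lieDeriv ξ α + lieDeriv ξ β := by
  ext1 Y
  simp only [lieDeriv, AlternatingMap.coe_mk, MultilinearMap.coe_mk, AlternatingMap.add_apply,
    VField.deriv_add, Finset.sum_add_distrib]
  abel

theorem lieDeriv_smul {k : ℕ} (ξ : VField M) (f : SmoothFun M) (α : Form M k) :
    lieDeriv ξ (f • α) = ξ.deriv f • α + f • lieDeriv ξ α := by
  ext1 Y
  simp only [lieDeriv, AlternatingMap.coe_mk, MultilinearMap.coe_mk, AlternatingMap.add_apply,
    AlternatingMap.smul_apply, VField.deriv_mul, smul_eq_mul, ← Finset.mul_sum]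
  ring

theorem lieDeriv_const_smul {k : ℕ} (ξ : VField M) (c : ℝ) (α : Form M k) :
    lieDeriv ξ (c • α) = c • lieDeriv ξ α := by
  have h0 : ξ.deriv (ContMDiffMap.const c) = 0 := by
    ext p
    exact congrArg (fun L => L (ξ p)) (mvfderiv_const (I := 𝓡 3) (x := p) c)
  rw [const_smul, lieDeriv_smul, h0, zero_smul, zero_add, ← const_smul]

/-- The Lie derivative as a real linear map. -/
noncomputable def lie {k : ℕ} (ξ : VField M) : Form M k →ₗ[ℝ] Form M k where
  toFun := lieDeriv ξ
  map_add' := lieDeriv_add ξ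
  map_smul' := lieDeriv_const_smul ξ

theorem contr_smul {k : ℕ} (f : SmoothFun M) (ξ : VField M) (α : Form M (k + 1)) :
    contr (f • ξ) α = f • contr ξ α := by
  ext1 Y; exact AlternatingMap.map_vecCons_smul α Y f ξ

theorem contr_add {k : ℕ} (ξ η : VField M) (α : Form M (k + 1)) :
    contr (ξ + η) α = contr ξ α + contr η α := by
  ext1 Y; exact AlternatingMap.map_vecCons_add α Y ξ η
end Form

end Manifold

section Manifold
variable {M : Type*} [TopologicalSpace M] [ChartedSpace E3 M] [IsManifold (𝓡 3) ∞ M]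
variable (M) in
/-- `Ω¹(M, Ω³(M))`: smooth one-forms with values in three-forms. -/
abbrev CovDensity : Type _ := VField M →ₗ[SmoothFun M] Form M 3

namespace CovDensity

/-- The Lie derivative, `(L_ξ X)(η) = L_ξ (X(η)) - X([ξ, η])`. -/
noncomputable def lie (ξ : VField M) (X : CovDensity M) : CovDensity M where
  toFun η := Form.lieDeriv ξ (X η) - X (ξ.bracket η)
  map_add' η η' := by
    rw [map_add, Form.lieDeriv_add, VField.bracket_add, map_add]; abel
  map_smul' f η := by
    rw [map_smul, Form.lieDeriv_smul, VField.bracket_smul, map_add, map_smul, map_smul,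
      RingHom.id_apply, smul_sub]
    abel

end CovDensity

section LieAlgebraValued
variable (M) (𝔤 : Type*) [LieRing 𝔤] [LieAlgebra ℝ 𝔤]

/-- `Ωᵏ(M, 𝔤) = Ωᵏ(M) ⊗ 𝔤`. -/
abbrev GForm (k : ℕ) : Type _ := Form M k ⊗[ℝ] 𝔤

variable {M 𝔤}

namespace GForm

/-- The exterior derivative on `Ω⁰(M, 𝔤)`. -/
noncomputable def d₀ : GForm M 𝔤 0 →ₗ[ℝ] GForm M 𝔤 1 := Form.d₀.rTensor 𝔤
/-- The exterior derivative on `Ω¹(M, 𝔤)`. -/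
noncomputable def d₁ : GForm M 𝔤 1 →ₗ[ℝ] GForm M 𝔤 2 := Form.d₁.rTensor 𝔤
/-- The exterior derivative on `Ω²(M, 𝔤)`. -/
noncomputable def d₂ : GForm M 𝔤 2 →ₗ[ℝ] GForm M 𝔤 3 := Form.d₂.rTensor 𝔤

/-- Contraction with a vector field. -/
noncomputable def contr {k : ℕ} (ξ : VField M) : GForm M 𝔤 (k + 1) →ₗ[ℝ] GForm M 𝔤 k :=
  (Form.contr ξ).rTensor 𝔤

/-- The Lie derivative along a vector field. -/
noncomputable def lie {k : ℕ} (ξ : VField M) : GForm M 𝔤 k →ₗ[ℝ] GForm M 𝔤 k :=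
  (Form.lie ξ).rTensor 𝔤

/-- The bracket `[α ⊗ X, β ⊗ Y] = α ∧ β ⊗ [X, Y]`. -/
noncomputable def bracket {p q : ℕ} : GForm M 𝔤 p →ₗ[ℝ] GForm M 𝔤 q →ₗ[ℝ] GForm M 𝔤 (p + q) :=
  TensorProduct.map₂ (Form.wedgeBilin p q)
    (LinearMap.mk₂ ℝ (fun X Y : 𝔤 => ⁅X, Y⁆) add_lie smul_lie lie_add lie_smul)

/-- The scalar form `Tr(a ∧ b)`, i.e. `Tr(α ⊗ X ∧ β ⊗ Y) = Tr(X, Y) α ∧ β`. -/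
noncomputable def tr (Tr : 𝔤 →ₗ[ℝ] 𝔤 →ₗ[ℝ] ℝ) {p q : ℕ} :
    GForm M 𝔤 p →ₗ[ℝ] GForm M 𝔤 q →ₗ[ℝ] Form M (p + q) :=
  (TensorProduct.map₂ (Form.wedgeBilin p q) Tr).compr₂ (TensorProduct.rid ℝ _).toLinearMap

theorem contr_add {k : ℕ} (ξ η : VField M) (a : GForm M 𝔤 (k + 1)) :
    contr (ξ + η) a = contr ξ a + contr η a := by
  have h : (Form.contr (ξ + η) : Form M (k + 1) →ₗ[ℝ] Form M k) =
    Form.contr ξ + Form.contr η := LinearMap.ext fun α => Form.contr_add ξ η α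
  rw [contr, h, LinearMap.rTensor_add]; rfl

theorem tr_contr_smul (Tr : 𝔤 →ₗ[ℝ] 𝔤 →ₗ[ℝ] ℝ) {p q : ℕ} (f : SmoothFun M) (ξ : VField M)
    (a : GForm M 𝔤 (p + 1)) (b : GForm M 𝔤 q) :
    tr Tr (contr (f • ξ) a) b = f • tr Tr (contr ξ a) b := by
  induction a using TensorProduct.induction_on with
  | zero => simp
  | add a a' ha ha' => simp only [map_add, LinearMap.add_apply, ha, ha', smul_add]
  | tmul α X =>
    induction b using TensorProduct.induction_on with
    | zero => simp
    | add b b' hb hb' => simp only [map_add, hb, hb', smul_add]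
    | tmul β Y =>
      have h : Form.wedge (Form.contr (f • ξ) α) β = f • Form.wedge (Form.contr ξ α) β := by
        rw [Form.contr_smul, Form.smul_wedge]
      change Tr X Y • Form.wedge (Form.contr (f • ξ) α) β =
        f • (Tr X Y • Form.wedge (Form.contr ξ α) β)
      rw [h, smul_comm]

/-- `dx^μ ⊗ Tr(ι_μ a ∧ b)`, that is, `ξ ↦ Tr(ι_ξ a ∧ b)`. -/
noncomputable def covTr (Tr : 𝔤 →ₗ[ℝ] 𝔤 →ₗ[ℝ] ℝ) {p q : ℕ} (a : GForm M 𝔤 (p + 1))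
    (b : GForm M 𝔤 q) : VField M →ₗ[SmoothFun M] Form M (p + q) where
  toFun ξ := tr Tr (contr ξ a) b
  map_add' ξ η := by rw [contr_add, map_add, LinearMap.add_apply]
  map_smul' f ξ := tr_contr_smul Tr f ξ a b

end GForm
end LieAlgebraValued

section Integration
variable [T2Space M]
theorem VField.exists_extension (p : M) (v : TangentSpace (𝓡 3) p) :
    ∃ X : VField M, X p = v := by
  obtain ⟨s, hs, hX⟩ := FiberBundle.exists_contMDiffOn_extend (k := ∞) (𝓡 3) E3 v
  obtain ⟨u, hus, hu, hpu⟩ := mem_nhds_iff.1 hs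
  obtain ⟨f, -, hf⟩ := (SmoothBumpFunction.nhds_basis_tsupport (I := 𝓡 3) p).mem_iff.1
    (hu.mem_nhds hpu)
  refine ⟨⟨_, ContMDiffOn.smul_section_of_tsupport (f.contMDiff.contMDiffOn) hu hf
    (hX.mono hus)⟩, ?_⟩
  simp
end Integration

end Manifold

section Integration
variable (M : Type*) [TopologicalSpace M] [ChartedSpace E3 M] [IsManifold (𝓡 3) ∞ M]

/-- An orientation of `M`, given by an atlas of smooth charts whose transition maps have
positive Jacobian determinant. -/
structure OrientedAtlas where
  charts : Set (OpenPartialHomeomorph M E3)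
  smooth : charts ⊆ IsManifold.maximalAtlas (𝓡 3) ∞ M
  cover : ∀ p : M, ∃ φ ∈ charts, p ∈ φ.source
  positive : ∀ φ ∈ charts, ∀ ψ ∈ charts, ∀ x ∈ (φ.symm.trans ψ).source,
    0 < (fderiv ℝ (φ.symm.trans ψ) x).det

variable {M} [T2Space M]

/-- The value of a form at a point on tangent vectors, computed by extending these to global
vector fields. -/
noncomputable def Form.evalAt {k : ℕ} (α : Form M k) (p : M)
    (v : Fin k → TangentSpace (𝓡 3) p) : ℝ :=
  α (fun i => (VField.exists_extension p (v i)).choose) p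

variable [SigmaCompactSpace M]

theorem OrientedAtlas.exists_partition (𝒜 : OrientedAtlas M) :
    ∃ ρ : SmoothPartitionOfUnity 𝒜.charts (𝓡 3) M Set.univ,
      ρ.IsSubordinate fun φ => φ.1.source :=
  SmoothPartitionOfUnity.exists_isSubordinate (𝓡 3) isClosed_univ _
    (fun φ => φ.1.open_source) fun p _ => by
      obtain ⟨φ, hφ, hp⟩ := 𝒜.cover p
      exact Set.mem_iUnion.2 ⟨⟨φ, hφ⟩, hp⟩

/-- The integral of a (compactly supported) three-form over the oriented manifold `M`: the sum,
over a partition of unity subordinate to the oriented atlas, of Lebesgue integrals in charts. -/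
noncomputable def OrientedAtlas.integral (𝒜 : OrientedAtlas M) (α : Form M 3) : ℝ :=
  ∑ᶠ φ : 𝒜.charts, ∫ x in φ.1.target,
    𝒜.exists_partition.choose φ (φ.1.symm x) *
      α.evalAt (φ.1.symm x) fun i =>
        mfderiv 𝓘(ℝ, E3) (𝓡 3) φ.1.symm x (EuclideanSpace.single i (1 : ℝ))

end Integration

section CompactSupport
variable {M : Type*} [TopologicalSpace M] [ChartedSpace E3 M] [IsManifold (𝓡 3) ∞ M]

/-- `X` vanishes outside a compact set. -/
def VField.IsCpt (X : VField M) : Prop := ∃ K : Set M, IsCompact K ∧ ∀ p ∉ K, X p = 0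

/-- `α` vanishes outside a compact set. -/
def Form.IsCpt {k : ℕ} (α : Form M k) : Prop :=
  ∃ K : Set M, IsCompact K ∧ ∀ p ∉ K, ∀ Y, α Y p = 0

/-- `X` vanishes outside a compact set. -/
def CovDensity.IsCpt (X : CovDensity M) : Prop :=
  ∃ K : Set M, IsCompact K ∧ ∀ p ∉ K, ∀ η Y, X η Y p = 0

/-- The scalar form obtained from a `𝔤`-valued form by applying a functional on `𝔤`. -/
noncomputable def GForm.component {𝔤 : Type*} [LieRing 𝔤] [LieAlgebra ℝ 𝔤] {k : ℕ}
    (f : 𝔤 →ₗ[ℝ] ℝ) : GForm M 𝔤 k →ₗ[ℝ] Form M k :=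
  (TensorProduct.rid ℝ (Form M k)).toLinearMap ∘ₗ f.lTensor (Form M k)

/-- `a` vanishes outside a compact set. -/
def GForm.IsCpt {𝔤 : Type*} [LieRing 𝔤] [LieAlgebra ℝ 𝔤] {k : ℕ} (a : GForm M 𝔤 k) : Prop :=
  ∃ K : Set M, IsCompact K ∧ ∀ p ∉ K, ∀ (f : 𝔤 →ₗ[ℝ] ℝ) Y, GForm.component f a Y p = 0

end CompactSupport

section LInfinity

/-- The sign `(-1)^m`. -/
noncomputable def sgn (m : ℤ) : ℝ := if Even m then 1 else -1

/-- The Koszul sign `χ(σ; v)` of the permutation `v ∘ σ` of graded antisymmetric arguments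
`v` of degrees `d`. -/
noncomputable def koszulSign {n : ℕ} (σ : Equiv.Perm (Fin n)) (d : Fin n → ℤ) : ℝ :=
  ∏ i, ∏ j, if i < j ∧ σ j < σ i then -sgn (d (σ i) * d (σ j)) else 1

/-- `(i, n - i)`-shuffles. -/
def IsShuffle {n : ℕ} (i : ℕ) (σ : Equiv.Perm (Fin n)) : Prop :=
  ∀ a b : Fin n, a < b → ((b : ℕ) < i ∨ i ≤ (a : ℕ)) → σ a < σ b

/-- Shuffles for an ordered partition `n = i₁ + ⋯ + iₖ`. -/
def IsMultiShuffle {n : ℕ} (c : Composition n) (σ : Equiv.Perm (Fin n)) : Prop :=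
  ∀ j : Fin c.length, StrictMono fun l : Fin (c.blocksFun j) => σ (c.embedding j l)

variable {V V' : Type*} [AddCommGroup V] [Module ℝ V] [AddCommGroup V'] [Module ℝ V']

open Classical in
/-- `∑ᵢ (-1)^{i(n-i)} ∑_σ χ(σ; v) f_{n+1-i}(ℓᵢ(v_{σ(1)}, …, v_{σ(i)}), v_{σ(i+1)}, …, v_{σ(n)})`,
the sum being over `1 ≤ i ≤ n` (in the code, `i + 1`) and over `(i, n - i)`-shuffles `σ`. -/
noncomputable def homotopySum (f : (n : ℕ) → (Fin n → V) → V') (ℓ : (n : ℕ) → (Fin n → V) → V)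
    {n : ℕ} (d : Fin n → ℤ) (v : Fin n → V) : V' :=
  ∑ i : Fin n, sgn (((i : ℕ) + 1) * (n - ((i : ℕ) + 1))) •
    ∑ σ : Equiv.Perm (Fin n) with IsShuffle (i + 1) σ,
      koszulSign σ d • f (n - i) fun j =>
        if (j : ℕ) = 0 then ℓ (i + 1) fun k => v (σ ⟨k, by omega⟩)
        else v (σ ⟨i + j, by omega⟩)

open Classical in
/-- The right-hand side of the relations of a morphism of `L∞`-algebras: the sum over ordered
partitions `n = i₁ + ⋯ + iₖ` and over the corresponding shuffles of
`(1/k!) (-1)^{k(k-1)/2} (-1)^Z χ(σ; v) ℓ'ₖ(ψ_{i₁}(v_{σ(1)}, …), …, ψ_{iₖ}(…, v_{σ(n)}))` with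
`Z = ∑ⱼ (k - j) iⱼ + ∑ⱼ (1 - iⱼ) ∑_{l ≤ i₁ + ⋯ + i_{j-1}} |v_{σ(l)}|`. -/
noncomputable def morphismSum (ψ : (n : ℕ) → (Fin n → V) → V')
    (ℓ' : (n : ℕ) → (Fin n → V') → V') {n : ℕ} (d : Fin n → ℤ) (v : Fin n → V) : V' :=
  ∑ c : Composition n,
    ((c.length.factorial : ℝ)⁻¹ * sgn (c.length * (c.length - 1) / 2)) •
      ∑ σ : Equiv.Perm (Fin n) with IsMultiShuffle c σ,
        (sgn (∑ j : Fin c.length, ((c.length : ℤ) - ((j : ℕ) + 1)) * c.blocksFun j +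
            ∑ j : Fin c.length, (1 - (c.blocksFun j : ℤ)) *
              ∑ l ∈ Finset.univ.filter (fun l : Fin n => (l : ℕ) < c.sizeUpTo j), d (σ l)) * koszulSign σ d) •
          ℓ' c.length fun j => ψ (c.blocksFun j) fun l => v (σ (c.embedding j l))

/-- A family of maps `fₙ : V^n → V'`, `n ≥ 1`, which are multilinear, graded antisymmetric and
of degree `D n`. -/
structure IsGradedAntisymmetric (𝒱 : ℤ → Submodule ℝ V) (𝒱' : ℤ → Submodule ℝ V')
    (D : ℕ → ℤ) (f : (n : ℕ) → (Fin n → V) → V') : Prop where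
  multilinear : ∀ n, 1 ≤ n → ∃ F : MultilinearMap ℝ (fun _ : Fin n => V) V', ⇑F = f n
  degree : ∀ n, 1 ≤ n → ∀ (d : Fin n → ℤ) (v : Fin n → V), (∀ i, v i ∈ 𝒱 (d i)) →
    f n v ∈ 𝒱' (D n + ∑ i, d i)
  antisymm : ∀ n, 1 ≤ n → ∀ (d : Fin n → ℤ) (v : Fin n → V), (∀ i, v i ∈ 𝒱 (d i)) →
    ∀ i j : Fin n, (i : ℕ) + 1 = j →
      f n (fun l => v (Equiv.swap i j l)) = (-sgn (d i * d j)) • f n v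

/-- `V = ⨁ₖ 𝒱ₖ` with the brackets `ℓₙ`, `n ≥ 1`, is an `L∞`-algebra. -/
structure IsLInftyAlgebra (𝒱 : ℤ → Submodule ℝ V) (ℓ : (n : ℕ) → (Fin n → V) → V) : Prop where
  grading : DirectSum.IsInternal 𝒱
  brackets : IsGradedAntisymmetric 𝒱 𝒱 (fun n => 2 - n) ℓ
  homotopy : ∀ n, 1 ≤ n → ∀ (d : Fin n → ℤ) (v : Fin n → V), (∀ i, v i ∈ 𝒱 (d i)) →
    homotopySum ℓ ℓ d v = 0

/-- A differential graded Lie algebra is an `L∞`-algebra with `ℓₙ = 0` for `n ≥ 3`. -/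
structure IsDGLieAlgebra (𝒱 : ℤ → Submodule ℝ V) (ℓ : (n : ℕ) → (Fin n → V) → V) : Prop
    extends IsLInftyAlgebra 𝒱 ℓ where
  higher : ∀ n, 3 ≤ n → ∀ v, ℓ n v = 0

/-- `ψ` is a morphism of `L∞`-algebras from `(𝒱, ℓ)` to `(𝒱', ℓ')`. -/
structure IsLInftyMorphism (𝒱 : ℤ → Submodule ℝ V) (ℓ : (n : ℕ) → (Fin n → V) → V)
    (𝒱' : ℤ → Submodule ℝ V') (ℓ' : (n : ℕ) → (Fin n → V') → V')
    (ψ : (n : ℕ) → (Fin n → V) → V') : Prop where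
  maps : IsGradedAntisymmetric 𝒱 𝒱' (fun n => 1 - n) ψ
  relations : ∀ n, 1 ≤ n → ∀ (d : Fin n → ℤ) (v : Fin n → V), (∀ i, v i ∈ 𝒱 (d i)) →
    homotopySum ψ ℓ d v = morphismSum ψ ℓ' d v

/-- An `L∞`-morphism is a quasi-isomorphism if `ψ₁` induces a bijection of the cohomology of
`ℓ₁` with the cohomology of `ℓ'₁`, in each degree. -/
structure IsLInftyQuasiIso (𝒱 : ℤ → Submodule ℝ V) (ℓ : (n : ℕ) → (Fin n → V) → V)
    (𝒱' : ℤ → Submodule ℝ V') (ℓ' : (n : ℕ) → (Fin n → V') → V')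
    (ψ : (n : ℕ) → (Fin n → V) → V') : Prop extends IsLInftyMorphism 𝒱 ℓ 𝒱' ℓ' ψ where
  injective : ∀ k, ∀ v ∈ 𝒱 k, ℓ 1 ![v] = 0 → (∃ w ∈ 𝒱' (k - 1), ψ 1 ![v] = ℓ' 1 ![w]) →
    ∃ u ∈ 𝒱 (k - 1), v = ℓ 1 ![u]
  surjective : ∀ k, ∀ w ∈ 𝒱' k, ℓ' 1 ![w] = 0 → ∃ v ∈ 𝒱 k, ℓ 1 ![v] = 0 ∧
    ∃ u ∈ 𝒱' (k - 1), w = ψ 1 ![v] + ℓ' 1 ![u]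

/-- `ψ` is a morphism of differential graded Lie algebras: an `L∞`-morphism without higher
components, i.e. given by the linear map `ψ₁` alone. -/
structure IsDGLieMorphism (𝒱 : ℤ → Submodule ℝ V) (ℓ : (n : ℕ) → (Fin n → V) → V)
    (𝒱' : ℤ → Submodule ℝ V') (ℓ' : (n : ℕ) → (Fin n → V') → V')
    (ψ : (n : ℕ) → (Fin n → V) → V') : Prop extends IsLInftyMorphism 𝒱 ℓ 𝒱' ℓ' ψ where
  strict : ∀ n, 2 ≤ n → ∀ v, ψ n v = 0

/-- `pair` is a cyclic, graded symmetric pairing of degree `-p` on the `L∞`-algebra `(𝒱, ℓ)`.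
As it is given by integration, it is only considered when one of the vectors involved lies in
the subspace of compactly supported vectors, singled out by `cpt`. -/
structure IsCyclicPairing (𝒱 : ℤ → Submodule ℝ V) (ℓ : (n : ℕ) → (Fin n → V) → V) (p : ℤ)
    (cpt : V → Prop) (pair : V → V → ℝ) : Prop where
  add_left : ∀ u v w, (cpt u ∧ cpt v) ∨ cpt w → pair (u + v) w = pair u w + pair v w
  smul_left : ∀ (c : ℝ) u w, cpt u ∨ cpt w → pair (c • u) w = c * pair u w
  add_right : ∀ u v w, cpt u ∨ (cpt v ∧ cpt w) → pair u (v + w) = pair u v + pair u w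
  smul_right : ∀ (c : ℝ) u w, cpt u ∨ cpt w → pair u (c • w) = c * pair u w
  degree : ∀ i j, i + j ≠ p → ∀ u ∈ 𝒱 i, ∀ w ∈ 𝒱 j, pair u w = 0
  symm : ∀ i j, ∀ u ∈ 𝒱 i, ∀ w ∈ 𝒱 j, cpt u ∨ cpt w → pair u w = sgn (i * j) * pair w u
  cyclic : ∀ n, 1 ≤ n → ∀ (d : Fin (n + 1) → ℤ) (v : Fin (n + 1) → V), (∀ i, v i ∈ 𝒱 (d i)) →
    (∃ i, cpt (v i)) →
    pair (v 0) (ℓ n fun i => v i.succ) =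
      sgn (n + (d 0 + d (Fin.last n)) * n + d (Fin.last n) * ∑ i : Fin n, d i.castSucc) *
        pair (v (Fin.last n)) (ℓ n fun i => v i.castSucc)

/-- The pairing is non-degenerate: a vector which pairs to zero with all compactly supported
vectors vanishes. -/
def PairingNondegenerate (cpt : V → Prop) (pair : V → V → ℝ) : Prop :=
  (∀ u, (∀ w, cpt w → pair u w = 0) → u = 0) ∧ ∀ w, (∀ u, cpt u → pair u w = 0) → w = 0

/-- An `L∞`-morphism `ψ` is cyclic if it preserves the given pairings. -/
structure IsCyclicMorphism (𝒱 : ℤ → Submodule ℝ V) (cpt : V → Prop) (pair : V → V → ℝ)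
    (pair' : V' → V' → ℝ) (ψ : (n : ℕ) → (Fin n → V) → V') : Prop where
  preserves : ∀ u v, cpt u ∨ cpt v → pair' (ψ 1 ![u]) (ψ 1 ![v]) = pair u v
  higher : ∀ n, 3 ≤ n → ∀ (d : Fin n → ℤ) (v : Fin n → V), (∀ i, v i ∈ 𝒱 (d i)) →
    (∃ i, cpt (v i)) →
    ∑ i : Fin (n - 1), sgn ((i : ℕ) + (n - ((i : ℕ) + 1) - 1) *
        ∑ j ∈ Finset.univ.filter (fun j : Fin n => (j : ℕ) ≤ i), d j) *
      pair' (ψ (i + 1) fun j => v ⟨j, by omega⟩)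
        (ψ (n - (i + 1)) fun j => v ⟨i + 1 + j, by omega⟩) = 0

end LInfinity

section ChernSimonsTheory
variable (M : Type*) [TopologicalSpace M] [ChartedSpace E3 M] [IsManifold (𝓡 3) ∞ M]
variable (𝔤 : Type*) [LieRing 𝔤] [LieAlgebra ℝ 𝔤]

/-- The graded vector space `Ω⁰(M, 𝔤) ⊕ Ω¹(M, 𝔤) ⊕ Ω²(M, 𝔤) ⊕ Ω³(M, 𝔤)` of Chern-Simons theory,
with components `λ, A, E, Λ` in the degrees `0, 1, 2, 3`. -/
def CSSpace : Type _ := GForm M 𝔤 0 × GForm M 𝔤 1 × GForm M 𝔤 2 × GForm M 𝔤 3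

/-- The extended graded vector space. The components are `ξ'` in degree `-1`, `(ξ, λ)` in degree
`0`, `A` in degree `1`, `E` in degree `2`, `(X, Λ)` in degree `3` and `X'` in degree `4`, where
`ξ', ξ` are vector fields and `X, X'` are one-forms with values in three-forms. -/
def ExtSpace : Type _ :=
  VField M × (VField M × GForm M 𝔤 0) × GForm M 𝔤 1 × GForm M 𝔤 2 ×
    (CovDensity M × GForm M 𝔤 3) × CovDensity M

variable {M 𝔤}

noncomputable instance : AddCommGroup (CSSpace M 𝔤) :=
  inferInstanceAs (AddCommGroup (GForm M 𝔤 0 × GForm M 𝔤 1 × GForm M 𝔤 2 × GForm M 𝔤 3))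
noncomputable instance : Module ℝ (CSSpace M 𝔤) :=
  inferInstanceAs (Module ℝ (GForm M 𝔤 0 × GForm M 𝔤 1 × GForm M 𝔤 2 × GForm M 𝔤 3))
noncomputable instance : AddCommGroup (ExtSpace M 𝔤) :=
  inferInstanceAs (AddCommGroup (VField M × (VField M × GForm M 𝔤 0) × GForm M 𝔤 1 ×
    GForm M 𝔤 2 × (CovDensity M × GForm M 𝔤 3) × CovDensity M))
noncomputable instance : Module ℝ (ExtSpace M 𝔤) :=
  inferInstanceAs (Module ℝ (VField M × (VField M × GForm M 𝔤 0) × GForm M 𝔤 1 ×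
    GForm M 𝔤 2 × (CovDensity M × GForm M 𝔤 3) × CovDensity M))

namespace CSSpace

abbrev gauge (u : CSSpace M 𝔤) : GForm M 𝔤 0 := u.1
abbrev field (u : CSSpace M 𝔤) : GForm M 𝔤 1 := u.2.1
abbrev eom (u : CSSpace M 𝔤) : GForm M 𝔤 2 := u.2.2.1
abbrev noether (u : CSSpace M 𝔤) : GForm M 𝔤 3 := u.2.2.2

variable (M 𝔤) in
/-- The subspace of elements of degree `k`. -/
def degree (k : ℤ) : Submodule ℝ (CSSpace M 𝔤) where
  carrier := {u | (k ≠ 0 → u.gauge = 0) ∧ (k ≠ 1 → u.field = 0) ∧ (k ≠ 2 → u.eom = 0) ∧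
    (k ≠ 3 → u.noether = 0)}
  zero_mem' := ⟨fun _ => rfl, fun _ => rfl, fun _ => rfl, fun _ => rfl⟩
  add_mem' := by
    rintro u v ⟨h0, h1, h2, h3⟩ ⟨k0, k1, k2, k3⟩
    refine ⟨fun h => ?_, fun h => ?_, fun h => ?_, fun h => ?_⟩
    · exact (congrArg₂ (· + ·) (h0 h) (k0 h)).trans (add_zero _)
    · exact (congrArg₂ (· + ·) (h1 h) (k1 h)).trans (add_zero _)
    · exact (congrArg₂ (· + ·) (h2 h) (k2 h)).trans (add_zero _)
    · exact (congrArg₂ (· + ·) (h3 h) (k3 h)).trans (add_zero _)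
  smul_mem' := by
    rintro c u ⟨h0, h1, h2, h3⟩
    refine ⟨fun h => ?_, fun h => ?_, fun h => ?_, fun h => ?_⟩
    · exact (congrArg (c • ·) (h0 h)).trans (smul_zero c)
    · exact (congrArg (c • ·) (h1 h)).trans (smul_zero c)
    · exact (congrArg (c • ·) (h2 h)).trans (smul_zero c)
    · exact (congrArg (c • ·) (h3 h)).trans (smul_zero c)

/-- Elements with compact support. -/
def IsCpt (u : CSSpace M 𝔤) : Prop :=
  u.gauge.IsCpt ∧ u.field.IsCpt ∧ u.eom.IsCpt ∧ u.noether.IsCpt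

/-- The differential `ℓ₁ = d`. -/
noncomputable def bracket₁ (u : CSSpace M 𝔤) : CSSpace M 𝔤 :=
  (0, GForm.d₀ u.gauge, GForm.d₁ u.field, GForm.d₂ u.eom)

/-- The bracket `ℓ₂(a, b) = -[a, b]`. -/
noncomputable def bracket₂ (u v : CSSpace M 𝔤) : CSSpace M 𝔤 :=
  (-GForm.bracket u.gauge v.gauge,
   -(GForm.bracket u.gauge v.field : GForm M 𝔤 (0 + 1)) - GForm.bracket u.field v.gauge,
   -(GForm.bracket u.gauge v.eom : GForm M 𝔤 (0 + 2)) - GForm.bracket u.eom v.gauge -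
     (GForm.bracket u.field v.field : GForm M 𝔤 (1 + 1)),
   -(GForm.bracket u.gauge v.noether : GForm M 𝔤 (0 + 3)) - GForm.bracket u.noether v.gauge -
     (GForm.bracket u.field v.eom : GForm M 𝔤 (1 + 2)) -
     (GForm.bracket u.eom v.field : GForm M 𝔤 (2 + 1)))

/-- The brackets `ℓₙ` of Chern-Simons theory. -/
noncomputable def brackets : (n : ℕ) → (Fin n → CSSpace M 𝔤) → CSSpace M 𝔤
  | 1, v => bracket₁ (v 0)
  | 2, v => bracket₂ (v 0) (v 1)
  | _, _ => 0

/-- The pairing `∫ Tr(α ∧ β)` of forms of complementary degrees. -/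
noncomputable def pairing [T2Space M] [SigmaCompactSpace M] (𝒜 : OrientedAtlas M)
    (Tr : 𝔤 →ₗ[ℝ] 𝔤 →ₗ[ℝ] ℝ) (u v : CSSpace M 𝔤) : ℝ :=
  𝒜.integral (GForm.tr Tr u.gauge v.noether : Form M (0 + 3)) +
    𝒜.integral (GForm.tr Tr u.field v.eom : Form M (1 + 2)) +
    𝒜.integral (GForm.tr Tr u.eom v.field : Form M (2 + 1)) +
    𝒜.integral (GForm.tr Tr u.noether v.gauge : Form M (3 + 0))

end CSSpace

namespace ExtSpace

abbrev vecCopy (u : ExtSpace M 𝔤) : VField M := u.1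
abbrev vec (u : ExtSpace M 𝔤) : VField M := u.2.1.1
abbrev gauge (u : ExtSpace M 𝔤) : GForm M 𝔤 0 := u.2.1.2
abbrev field (u : ExtSpace M 𝔤) : GForm M 𝔤 1 := u.2.2.1
abbrev eom (u : ExtSpace M 𝔤) : GForm M 𝔤 2 := u.2.2.2.1
abbrev cov (u : ExtSpace M 𝔤) : CovDensity M := u.2.2.2.2.1.1
abbrev noether (u : ExtSpace M 𝔤) : GForm M 𝔤 3 := u.2.2.2.2.1.2
abbrev covCopy (u : ExtSpace M 𝔤) : CovDensity M := u.2.2.2.2.2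

/-- The element `ξ'` of degree `-1`. -/
noncomputable def ofVecCopy (ξ : VField M) : ExtSpace M 𝔤 := (ξ, (0, 0), 0, 0, (0, 0), 0)
/-- The element `(ξ, λ)` of degree `0`. -/
noncomputable def ofGauge (ξ : VField M) (l : GForm M 𝔤 0) : ExtSpace M 𝔤 := (0, (ξ, l), 0, 0, (0, 0), 0)
/-- The element `A` of degree `1`. -/
noncomputable def ofField (A : GForm M 𝔤 1) : ExtSpace M 𝔤 := (0, (0, 0), A, 0, (0, 0), 0)
/-- The element `E` of degree `2`. -/
noncomputable def ofEom (E : GForm M 𝔤 2) : ExtSpace M 𝔤 := (0, (0, 0), 0, E, (0, 0), 0)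
/-- The element `(X, Λ)` of degree `3`. -/
noncomputable def ofNoether (X : CovDensity M) (L : GForm M 𝔤 3) : ExtSpace M 𝔤 :=
  (0, (0, 0), 0, 0, (X, L), 0)

variable (M 𝔤) in
/-- The subspace of elements of degree `k`. -/
def degree (k : ℤ) : Submodule ℝ (ExtSpace M 𝔤) where
  carrier := {u | (k ≠ -1 → u.vecCopy = 0) ∧ (k ≠ 0 → u.vec = 0 ∧ u.gauge = 0) ∧
    (k ≠ 1 → u.field = 0) ∧ (k ≠ 2 → u.eom = 0) ∧ (k ≠ 3 → u.cov = 0 ∧ u.noether = 0) ∧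
    (k ≠ 4 → u.covCopy = 0)}
  zero_mem' := ⟨fun _ => rfl, fun _ => ⟨rfl, rfl⟩, fun _ => rfl, fun _ => rfl,
    fun _ => ⟨rfl, rfl⟩, fun _ => rfl⟩
  add_mem' := by
    rintro u v ⟨h0, h1, h2, h3, h4, h5⟩ ⟨k0, k1, k2, k3, k4, k5⟩
    refine ⟨fun h => ?_, fun h => ⟨?_, ?_⟩, fun h => ?_, fun h => ?_, fun h => ⟨?_, ?_⟩,
      fun h => ?_⟩
    · exact (congrArg₂ (· + ·) (h0 h) (k0 h)).trans (add_zero _)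
    · exact (congrArg₂ (· + ·) (h1 h).1 (k1 h).1).trans (add_zero _)
    · exact (congrArg₂ (· + ·) (h1 h).2 (k1 h).2).trans (add_zero _)
    · exact (congrArg₂ (· + ·) (h2 h) (k2 h)).trans (add_zero _)
    · exact (congrArg₂ (· + ·) (h3 h) (k3 h)).trans (add_zero _)
    · exact (congrArg₂ (· + ·) (h4 h).1 (k4 h).1).trans (add_zero _)
    · exact (congrArg₂ (· + ·) (h4 h).2 (k4 h).2).trans (add_zero _)
    · exact (congrArg₂ (· + ·) (h5 h) (k5 h)).trans (add_zero _)
  smul_mem' := by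
    rintro c u ⟨h0, h1, h2, h3, h4, h5⟩
    refine ⟨fun h => ?_, fun h => ⟨?_, ?_⟩, fun h => ?_, fun h => ?_, fun h => ⟨?_, ?_⟩,
      fun h => ?_⟩
    · exact (congrArg (c • ·) (h0 h)).trans (smul_zero c)
    · exact (congrArg (c • ·) (h1 h).1).trans (smul_zero c)
    · exact (congrArg (c • ·) (h1 h).2).trans (smul_zero c)
    · exact (congrArg (c • ·) (h2 h)).trans (smul_zero c)
    · exact (congrArg (c • ·) (h3 h)).trans (smul_zero c)
    · exact (congrArg (c • ·) (h4 h).1).trans (smul_zero c)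
    · exact (congrArg (c • ·) (h4 h).2).trans (smul_zero c)
    · exact (congrArg (c • ·) (h5 h)).trans (smul_zero c)

/-- Elements with compact support. -/
def IsCpt (u : ExtSpace M 𝔤) : Prop :=
  u.vecCopy.IsCpt ∧ u.vec.IsCpt ∧ u.gauge.IsCpt ∧ u.field.IsCpt ∧ u.eom.IsCpt ∧
    u.cov.IsCpt ∧ u.noether.IsCpt ∧ u.covCopy.IsCpt

/-- The differential: `ξ' ↦ (ξ', 0)`, `(ξ, λ) ↦ dλ`, `A ↦ dA`, `E ↦ (0, dE)`,
`(X, Λ) ↦ X`. -/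
noncomputable def bracket₁ (u : ExtSpace M 𝔤) : ExtSpace M 𝔤 :=
  (0, (u.vecCopy, 0), GForm.d₀ u.gauge, GForm.d₁ u.field, (0, GForm.d₂ u.eom), u.cov)

/-- The bracket `ℓ₂`, the components being listed in the order of degrees `-1, …, 4`. Each
of the brackets of homogeneous elements appears in both orders, as dictated by graded
antisymmetry; for instance `ℓ₂(ξ', A) = ι_{ξ'} A = ℓ₂(A, ξ')` in degree `0`. -/
noncomputable def bracket₂ (Tr : 𝔤 →ₗ[ℝ] 𝔤 →ₗ[ℝ] ℝ) (u v : ExtSpace M 𝔤) : ExtSpace M 𝔤 :=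
  (u.vecCopy.bracket v.vec + u.vec.bracket v.vecCopy,
   (u.vec.bracket v.vec,
    GForm.lie u.vec v.gauge - GForm.lie v.vec u.gauge - GForm.bracket u.gauge v.gauge +
      GForm.contr u.vecCopy v.field + GForm.contr v.vecCopy u.field),
   GForm.lie u.vec v.field - GForm.lie v.vec u.field -
      (GForm.bracket u.gauge v.field : GForm M 𝔤 (0 + 1)) +
      (GForm.bracket v.gauge u.field : GForm M 𝔤 (0 + 1)) +
      GForm.contr u.vecCopy v.eom - GForm.contr v.vecCopy u.eom,
   GForm.lie u.vec v.eom - GForm.lie v.vec u.eom -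
      (GForm.bracket u.gauge v.eom : GForm M 𝔤 (0 + 2)) +
      (GForm.bracket v.gauge u.eom : GForm M 𝔤 (0 + 2)) -
      (GForm.bracket u.field v.field : GForm M 𝔤 (1 + 1)) +
      GForm.contr u.vecCopy v.noether + GForm.contr v.vecCopy u.noether,
   ((GForm.covTr Tr (p := 0) (GForm.d₀ u.gauge) v.noether : CovDensity M) -
      GForm.covTr Tr (p := 0) (GForm.d₀ v.gauge) u.noether +
      CovDensity.lie u.vec v.cov - CovDensity.lie v.vec u.cov +
      ((GForm.covTr Tr (p := 1) (GForm.d₁ u.field) v.eom : CovDensity M) -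
        GForm.covTr Tr (p := 0) u.field (GForm.d₂ v.eom)) -
      ((GForm.covTr Tr (p := 1) (GForm.d₁ v.field) u.eom : CovDensity M) -
        GForm.covTr Tr (p := 0) v.field (GForm.d₂ u.eom)) +
      CovDensity.lie u.vecCopy v.covCopy - CovDensity.lie v.vecCopy u.covCopy,
    GForm.lie u.vec v.noether - GForm.lie v.vec u.noether -
      (GForm.bracket u.gauge v.noether : GForm M 𝔤 (0 + 3)) +
      (GForm.bracket v.gauge u.noether : GForm M 𝔤 (0 + 3)) -
      (GForm.bracket u.field v.eom : GForm M 𝔤 (1 + 2)) +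
      (GForm.bracket v.field u.eom : GForm M 𝔤 (1 + 2))),
   CovDensity.lie u.vec v.covCopy - CovDensity.lie v.vec u.covCopy +
      (GForm.covTr Tr (p := 0) u.field v.noether : CovDensity M) +
      (GForm.covTr Tr (p := 0) v.field u.noether : CovDensity M) +
      (GForm.covTr Tr (p := 1) u.eom v.eom : CovDensity M))

/-- The brackets `ℓₙ` of the extended Chern-Simons theory. -/
noncomputable def brackets (Tr : 𝔤 →ₗ[ℝ] 𝔤 →ₗ[ℝ] ℝ) :
    (n : ℕ) → (Fin n → ExtSpace M 𝔤) → ExtSpace M 𝔤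
  | 1, v => bracket₁ (v 0)
  | 2, v => bracket₂ Tr (v 0) (v 1)
  | _, _ => 0

/-- The extended pairing, with the additional terms `∫ ι_ξ X` and `∫ ι_{ξ'} X'`. -/
noncomputable def pairing [T2Space M] [SigmaCompactSpace M] (𝒜 : OrientedAtlas M)
    (Tr : 𝔤 →ₗ[ℝ] 𝔤 →ₗ[ℝ] ℝ) (u v : ExtSpace M 𝔤) : ℝ :=
  𝒜.integral (v.covCopy u.vecCopy) + 𝒜.integral (u.covCopy v.vecCopy) +
    𝒜.integral (v.cov u.vec) + 𝒜.integral (u.cov v.vec) +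
    𝒜.integral (GForm.tr Tr u.gauge v.noether : Form M (0 + 3)) +
    𝒜.integral (GForm.tr Tr u.field v.eom : Form M (1 + 2)) +
    𝒜.integral (GForm.tr Tr u.eom v.field : Form M (2 + 1)) +
    𝒜.integral (GForm.tr Tr u.noether v.gauge : Form M (3 + 0))

/-- The gauge variation `δ_{(ξ,λ)} A = L_ξ A + dλ + [A, λ]`. -/
noncomputable def gaugeVariation (ξ : VField M) (l : GForm M 𝔤 0) (A : GForm M 𝔤 1) :
    GForm M 𝔤 1 :=
  GForm.lie ξ A + GForm.d₀ l + GForm.bracket A l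

/-- The curvature `F = dA + ½ [A, A]`. -/
noncomputable def curvature (A : GForm M 𝔤 1) : GForm M 𝔤 2 :=
  GForm.d₁ A + (1 / 2 : ℝ) • GForm.bracket A A

/-- The left-hand side `dF + [A, F]` of the Bianchi identity. -/
noncomputable def bianchi (A : GForm M 𝔤 1) : GForm M 𝔤 3 :=
  GForm.d₂ (curvature A) + (GForm.bracket A (curvature A) : GForm M 𝔤 (1 + 2))

/-- The left-hand side `dx^μ ⊗ Tr(ι_μ dA ∧ F) - dx^μ ⊗ Tr(ι_μ A dF)` of the Noether identity
for diffeomorphisms. -/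
noncomputable def diffNoether (Tr : 𝔤 →ₗ[ℝ] 𝔤 →ₗ[ℝ] ℝ) (A : GForm M 𝔤 1) : CovDensity M :=
  (GForm.covTr Tr (p := 1) (GForm.d₁ A) (curvature A) : CovDensity M) -
    GForm.covTr Tr (p := 0) A (GForm.d₂ (curvature A))

end ExtSpace

/-- The inclusion `ψ₁`. -/
noncomputable def incl (u : CSSpace M 𝔤) : ExtSpace M 𝔤 :=
  (0, (0, u.gauge), u.field, u.eom, (0, u.noether), 0)

/-- The map `ψ₂`, with components `ψ₂(A, Λ) = ψ₂(Λ, A) = -(dx^μ ⊗ Tr(ι_μ A Λ), 0)` and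
`ψ₂(E₁, E₂) = -(dx^μ ⊗ Tr(ι_μ E₁ ∧ E₂), 0)`, in degree `3`. -/
noncomputable def homotopy₂ (Tr : 𝔤 →ₗ[ℝ] 𝔤 →ₗ[ℝ] ℝ) (u v : CSSpace M 𝔤) : ExtSpace M 𝔤 :=
  (0, (0, 0), 0, 0,
   (-((GForm.covTr Tr (p := 0) u.field v.noether : CovDensity M) +
      (GForm.covTr Tr (p := 0) v.field u.noether : CovDensity M) +
      (GForm.covTr Tr (p := 1) u.eom v.eom : CovDensity M)), 0), 0)

/-- The components `ψₙ` of the morphism from Chern-Simons theory to its extension. -/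
noncomputable def psi (Tr : 𝔤 →ₗ[ℝ] 𝔤 →ₗ[ℝ] ℝ) :
    (n : ℕ) → (Fin n → CSSpace M 𝔤) → ExtSpace M 𝔤
  | 1, v => incl (v 0)
  | 2, v => homotopy₂ Tr (v 0) (v 1)
  | _, _ => 0

end ChernSimonsTheory

end ChernSimons

open ChernSimons

/-!
The `L∞` relations of the extended theory are identities between Lie algebra valued forms on `M`,
and the proof consists in reducing them to as few such identities as possible.

*Cartan calculus.* For scalar forms of degree at most three, `d`, `L_ξ`, `ι_ξ` and the wedge
product are explicit expressions in the values on vector fields, so the rules of the Cartan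
calculus follow from the Lie-Rinehart structure of `(C^∞(M), Γ(TM))`. They pass to `Ω(M) ⊗ 𝔤`
because they only involve bilinear operations on the two tensor factors (`map₂_derivation`,
`map₂_adjoint`, `map₂_jacobi`). The dimension of `M` enters only through the vanishing of
four-forms: forms are tensorial, since cut-off coordinate fields span the tangent spaces near a
point (`exists_frame`), and alternating four-linear maps vanish as two of any four basis vectors
coincide (`CovDensity.eq_zero_of_alternating`). Contracting the four-forms `α ∧ ν` and `β ∧ β'` and
the derivative `dν` of a three-form yields `ι_ξ α ∧ ν = α ∧ ι_ξ ν`, the skew-symmetry of `ι_ξ β ∧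
β'` in `β, β'`, and `L_ξ ν = d ι_ξ ν`.

*The dg Lie algebras.* All these rules are collected in the structure `CartanData`, from which the
rest of the algebra follows without reference to the manifold. As all `ℓₙ` with `n ≥ 3` vanish, the
relations amount to `ℓ₁² = 0`, the Leibniz rule and the Jacobi identity, and by graded antisymmetry
the latter two are only needed for arguments of non-decreasing degree and total degree at most
three and four, respectively (`isDGLieAlgebra_of`, `CartanData.leibniz`, `CartanData.jacobi`). The
brackets of Chern-Simons theory are those of the extended theory on the subspace of forms once the
covector densities `dx^μ ⊗ Tr(ι_μ a ∧ b)` are replaced by zero (`CartanData.withoutPairing`), so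
the same computation covers both theories.

*The morphism.* The bracket of two forms in the extended theory differs from their bracket in
Chern-Simons theory by covector densities, and this difference is the boundary of `ψ₂`
(`CartanData.homotopy_relation`). Since `ψ₂` is a cocycle (`CartanData.homotopy_cocycle`) whose
values have vanishing brackets with forms and with each other, no higher components are needed. The
forms are a direct summand of the complex, whose complement consists of two copies of the vector
fields and two copies of the covector densities, each pair joined by `ℓ₁ = id`; hence `ψ₁` is a
quasi-isomorphism. It preserves the pairing, and the values of `ψ₂` pair to zero with forms. For `A
= dx ⊗ X` and `Λ = ν ⊗ Y` with `Tr(X, Y) ≠ 0` the bracket `ℓ₂(A, Λ)` vanishes in Chern-Simons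
theory but not in the extended one (`exists_psi_ne`), so `ψ` is not strict.

*The pairings.* Stokes' theorem for forms with compact support (`OrientedAtlas.integral_d₂`)
reduces by a partition of unity to a single chart, where it is the vanishing of the integral of a
partial derivative. With it, and with the invariance of `Tr`, the cyclicity becomes one integration
by parts for each of the six combinations of degrees `i ≤ j ≤ k` with `i + j + k = 3`
(`ExtSpace.pairing_bracket₂_of_le`). Non-degeneracy is the fundamental lemma of the calculus of
variations, applied to the components with respect to a basis of `𝔤`.

*Noether identities and redundancy.* The Bianchi identity is the Jacobi identity of three copies of
`A`, and `𝒩(A) = 0` follows from it together with `Tr(ι_ξ F ∧ F) = 0`, another vanishing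
contraction of a four-form (`CartanData.noether_curvature`). The redundancy of diffeomorphisms is
Cartan's formula `L_ξ A = d ι_ξ A + ι_ξ dA` (`CartanData.variation_redundancy`).
-/

set_option linter.unusedSectionVars false
set_option linter.unusedSimpArgs false

namespace ChernSimons

/-! ### Vector fields acting on functions -/

section LieRinehart
variable {M : Type*} [TopologicalSpace M] [ChartedSpace E3 M] [IsManifold (𝓡 3) ∞ M]

theorem VField.jacobi (X Y Z : VField M) :
    X.bracket (Y.bracket Z) = (X.bracket Y).bracket Z + Y.bracket (X.bracket Z) := by
  have h2 : minSmoothness ℝ 2 ≤ (∞ : WithTop ℕ∞) := by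
    rw [minSmoothness_of_isRCLikeNormedField]; exact WithTop.coe_le_coe.2 (le_top (a := (2 : ℕ∞)))
  have h3 : minSmoothness ℝ 3 ≤ (∞ : WithTop ℕ∞) := by
    rw [minSmoothness_of_isRCLikeNormedField]; exact WithTop.coe_le_coe.2 (le_top (a := (3 : ℕ∞)))
  have : IsManifold (𝓡 3) (minSmoothness ℝ 3) M := IsManifold.of_le (n := ∞) h3
  ext p
  exact congrFun (VectorField.leibniz_identity_mlieBracket (I := 𝓡 3)
    (X.contMDiff.of_le h2) (Y.contMDiff.of_le h2) (Z.contMDiff.of_le h2)) p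

theorem VField.bracket_zero (X : VField M) : X.bracket 0 = 0 := by
  simpa using X.bracket_add 0 0

theorem VField.zero_bracket (X : VField M) : VField.bracket 0 X = 0 := by
  rw [VField.bracket_swap, VField.bracket_zero, neg_zero]

theorem VField.deriv_zero (X : VField M) : X.deriv 0 = 0 := by
  simpa using X.deriv_add 0 0

theorem VField.deriv_neg (X : VField M) (f : SmoothFun M) : X.deriv (-f) = -X.deriv f := by
  rw [eq_neg_iff_add_eq_zero, ← VField.deriv_add, neg_add_cancel, VField.deriv_zero]

theorem VField.deriv_sub (X : VField M) (f g : SmoothFun M) :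
    X.deriv (f - g) = X.deriv f - X.deriv g := by
  rw [sub_eq_add_neg, VField.deriv_add, VField.deriv_neg, sub_eq_add_neg]

theorem VField.const_smul (c : ℝ) (X : VField M) :
    c • X = (ContMDiffMap.const c : SmoothFun M) • X := rfl

theorem VField.deriv_const (X : VField M) (c : ℝ) :
    X.deriv (ContMDiffMap.const c) = 0 := by
  ext p; exact congrArg (fun L => L (X p)) (mvfderiv_const (I := 𝓡 3) (x := p) c)

theorem VField.bracket_const_smul (c : ℝ) (X Y : VField M) :
    X.bracket (c • Y) = c • X.bracket Y := by
  rw [VField.const_smul, VField.bracket_smul, VField.deriv_const, zero_smul, zero_add]; rfl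

theorem VField.const_smul_bracket (c : ℝ) (X Y : VField M) :
    (c • X).bracket Y = c • X.bracket Y := by
  rw [VField.bracket_swap, VField.bracket_const_smul, VField.bracket_swap Y X, smul_neg, neg_neg]

theorem VField.const_smul_deriv (c : ℝ) (X : VField M) (f : SmoothFun M) :
    (c • X).deriv f = c • X.deriv f := by
  rw [VField.const_smul, VField.smul_deriv]; rfl

/-- The bracket of vector fields acts on functions as the commutator. This follows from the
Jacobi identity for `X`, `Y` and `f Z` by the Leibniz rule, where `Z` is arbitrary. -/
theorem VField.bracket_deriv [T2Space M] (X Y : VField M) (f : SmoothFun M) :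
    (X.bracket Y).deriv f = X.deriv (Y.deriv f) - Y.deriv (X.deriv f) := by
  ext p
  obtain ⟨v, hv⟩ := exists_ne (0 : E3)
  obtain ⟨Z, hZ⟩ := VField.exists_extension (M := M) p v
  -- expanding the Jacobi identity leaves the difference of the two sides as a multiple of `Z`
  have h := VField.jacobi X Y (f • Z)
  simp only [VField.bracket_smul, VField.bracket_add, VField.jacobi X Y Z] at h
  have h' : ((X.bracket Y).deriv f - (X.deriv (Y.deriv f) - Y.deriv (X.deriv f))) • Z = 0 := by
    simp only [sub_smul, smul_add] at h ⊢
    rw [← sub_eq_zero] at h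
    rw [← neg_eq_zero, ← h]
    abel
  have h0 : ((X.bracket Y).deriv f - (X.deriv (Y.deriv f) - Y.deriv (X.deriv f))) p • v = 0 := by
    rw [← hZ]; exact congrArg (fun W : VField M => W p) h'
  exact sub_eq_zero.1 ((smul_eq_zero.1 h0).resolve_right hv)

end LieRinehart

/-! ### Forms of low degree -/

section ScalarForms
variable {M : Type*} [TopologicalSpace M] [ChartedSpace E3 M] [IsManifold (𝓡 3) ∞ M]
namespace Form

/-- The wedge product as a sum over all permutations: each shuffle is counted `p! q!` times. -/
theorem factorial_smul_wedge_apply {p q : ℕ} (α : Form M p) (β : Form M q)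
    (Y : Fin (p + q) → VField M) :
    (p.factorial * q.factorial) • wedge α β Y = ∑ σ : Equiv.Perm (Fin (p + q)),
      Equiv.Perm.sign σ • (α (fun i => Y (σ (Fin.castAdd q i))) *
        β (fun j => Y (σ (Fin.natAdd p j)))) := by
  have h := congrArg (fun m => LinearMap.mul' (SmoothFun M) (SmoothFun M)
    (m fun i => Y (finSumFinEquiv i))) (MultilinearMap.domCoprod_alternization_eq α β)
  simp only [MultilinearMap.alternatization_apply, Fintype.card_fin, AlternatingMap.smul_apply,
    map_sum, map_nsmul] at h
  change _ = (p.factorial * q.factorial) • wedge α β Y at h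
  rw [← h, ← Equiv.sum_comp (Equiv.permCongr finSumFinEquiv)]
  refine Finset.sum_congr rfl fun σ _ => ?_
  rw [Units.smul_def, Units.smul_def, map_zsmul]
  simp [Equiv.Perm.sign_permCongr]

theorem ext_zero {α β : Form M 0} (h : α ![] = β ![]) : α = β := by
  ext1 Y; rwa [Subsingleton.elim Y ![]]

theorem ext_one {α β : Form M 1} (h : ∀ X, α ![X] = β ![X]) : α = β := by
  ext1 Y; have : Y = ![Y 0] := by ext i; fin_cases i; rfl
  rw [this, h]

theorem ext_two {α β : Form M 2} (h : ∀ X Y, α ![X, Y] = β ![X, Y]) : α = β := by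
  ext1 Y; have : Y = ![Y 0, Y 1] := by ext i; fin_cases i <;> rfl
  rw [this, h]

theorem ext_three {α β : Form M 3} (h : ∀ X Y Z, α ![X, Y, Z] = β ![X, Y, Z]) : α = β := by
  ext1 Y; have : Y = ![Y 0, Y 1, Y 2] := by ext i; fin_cases i <;> rfl
  rw [this, h]

theorem zero_wedge_apply {q : ℕ} (f : Form M 0) (β : Form M q) (Y : Fin (0 + q) → VField M) :
    wedge f β Y = f ![] * β (fun i => Y (Fin.natAdd 0 i)) := by
  have h := factorial_smul_wedge_apply f β Y
  have key : ∀ σ : Equiv.Perm (Fin (0 + q)), Equiv.Perm.sign σ •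
      (f (fun i => Y (σ (Fin.castAdd q i))) * β (fun j => Y (σ (Fin.natAdd 0 j)))) =
        f ![] * β (fun i => Y (Fin.natAdd 0 i)) := by
    intro σ
    let e : Fin (0 + q) ≃ Fin q := finCongr (zero_add q)
    have he : ∀ j : Fin q, Fin.natAdd 0 j = e.symm j := fun j => by ext; simp [e]
    have h1 : (fun j => Y (σ (Fin.natAdd 0 j))) =
        (fun j => Y (Fin.natAdd 0 j)) ∘ (e.permCongr σ) := by
      ext1 j; simp [he]
    rw [h1, AlternatingMap.map_perm, Subsingleton.elim (fun i => Y (σ (Fin.castAdd q i))) ![],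
      Equiv.Perm.sign_permCongr, mul_smul_comm, smul_smul, Int.units_mul_self, _root_.one_smul]
  rw [Finset.sum_congr rfl fun σ _ => key σ, Finset.sum_const, Finset.card_univ,
    Fintype.card_perm, Fintype.card_fin, Nat.factorial_zero, one_mul,
    congrArg Nat.factorial (zero_add q)] at h
  have hq : (q.factorial : ℝ) ≠ 0 := Nat.cast_ne_zero.2 q.factorial_ne_zero
  rw [← Nat.cast_smul_eq_nsmul ℝ, ← Nat.cast_smul_eq_nsmul ℝ] at h
  exact smul_right_injective _ hq h

theorem wedge_zero_apply {q : ℕ} (β : Form M q) (f : Form M 0) (Y : Fin q → VField M) :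
    (wedge β f : Form M q) Y = f ![] * β Y := by
  have h := factorial_smul_wedge_apply β f Y
  have key : ∀ σ : Equiv.Perm (Fin (q + 0)), Equiv.Perm.sign σ •
      (β (fun i => Y (σ (Fin.castAdd 0 i))) * f (fun j => Y (σ (Fin.natAdd q j)))) =
        f ![] * β Y := by
    intro σ
    have h1 : (fun j => Y (σ (Fin.castAdd 0 j))) = Y ∘ σ := rfl
    rw [h1, Subsingleton.elim (fun i => Y (σ (Fin.natAdd q i))) ![]]
    refine (congrArg (fun x => Equiv.Perm.sign σ • (x * f ![]))
      (AlternatingMap.map_perm β Y σ)).trans ?_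
    rw [smul_mul_assoc, smul_smul, Int.units_mul_self, _root_.one_smul, mul_comm]
  rw [Finset.sum_congr rfl fun σ _ => key σ, Finset.sum_const, Finset.card_univ,
    Fintype.card_perm, Fintype.card_fin, Nat.factorial_zero, mul_one,
    congrArg Nat.factorial (add_zero q)] at h
  have hq : (q.factorial : ℝ) ≠ 0 := Nat.cast_ne_zero.2 q.factorial_ne_zero
  rw [← Nat.cast_smul_eq_nsmul ℝ, ← Nat.cast_smul_eq_nsmul ℝ] at h
  exact smul_right_injective _ hq h

theorem wedge_zero {q : ℕ} (β : Form M q) (f : Form M 0) :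
    (wedge β f : Form M q) = f ![] • β := by
  ext1 Y; exact wedge_zero_apply β f Y

theorem zero_wedge_zero (f : Form M 0) (β : Form M 0) :
    (wedge f β : Form M (0 + 0)) = (f ![] • β : Form M 0) := by
  ext1 Y; refine (zero_wedge_apply f β Y).trans ?_
  exact congrArg (fun Z => f ![] * β Z) (Subsingleton.elim _ _)
theorem zero_wedge_one (f : Form M 0) (β : Form M 1) :
    (wedge f β : Form M (0 + 1)) = (f ![] • β : Form M 1) := by
  ext1 Y; refine (zero_wedge_apply f β Y).trans ?_
  exact congrArg (fun Z => f ![] * β Z) (funext fun i => congrArg Y (by ext; simp))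
theorem zero_wedge_two (f : Form M 0) (β : Form M 2) :
    (wedge f β : Form M (0 + 2)) = (f ![] • β : Form M 2) := by
  ext1 Y; refine (zero_wedge_apply f β Y).trans ?_
  exact congrArg (fun Z => f ![] * β Z) (funext fun i => congrArg Y (by ext; simp))
theorem zero_wedge_three (f : Form M 0) (β : Form M 3) :
    (wedge f β : Form M (0 + 3)) = (f ![] • β : Form M 3) := by
  ext1 Y; refine (zero_wedge_apply f β Y).trans ?_
  exact congrArg (fun Z => f ![] * β Z) (funext fun i => congrArg Y (by ext; simp))

theorem univ_perm_two : (Finset.univ : Finset (Equiv.Perm (Fin 2))) = {1, Equiv.swap 0 1} := by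
  decide

theorem univ_perm_three : (Finset.univ : Finset (Equiv.Perm (Fin 3))) =
    {1, Equiv.swap 0 1, Equiv.swap 0 2, Equiv.swap 1 2, finRotate 3, (finRotate 3)⁻¹} := by
  decide

theorem apply_one (α : Form M 1) (Y : Fin 1 → VField M) : α Y = α ![Y 0] :=
  congrArg α (funext fun i => by fin_cases i; rfl)

/-- The arguments of a form in a fixed normal form, in which the explicit formulas below are stated.
-/
theorem apply_two (α : Form M 2) (Y : Fin 2 → VField M) : α Y = α ![Y 0, Y 1] :=
  congrArg α (funext fun i => by fin_cases i <;> rfl)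

theorem wedge_one_one (α β : Form M 1) (X Y : VField M) :
    (wedge α β : Form M (1 + 1)) ![X, Y] = α ![X] * β ![Y] - α ![Y] * β ![X] := by
  have h : (1 * 1) • (wedge α β : Form M (1 + 1)) ![X, Y] = ∑ σ : Equiv.Perm (Fin 2),
      Equiv.Perm.sign σ • (α ![![X, Y] (σ 0)] * β ![![X, Y] (σ 1)]) :=
    (factorial_smul_wedge_apply α β ![X, Y]).trans (Finset.sum_congr rfl fun σ _ => by
      exact congrArg (Equiv.Perm.sign σ • ·) (congrArg₂ (· * ·) (apply_one _ _) (apply_one _ _)))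
  rw [univ_perm_two, Finset.sum_pair (by decide), Equiv.Perm.sign_swap (by decide), mul_one,
    _root_.one_smul] at h
  rw [h]
  simp [Units.smul_def, sub_eq_add_neg]

theorem wedge_one_two (α : Form M 1) (β : Form M 2) (X Y Z : VField M) :
    (wedge α β : Form M (1 + 2)) ![X, Y, Z] =
      α ![X] * β ![Y, Z] - α ![Y] * β ![X, Z] + α ![Z] * β ![X, Y] := by
  have h : (1 * 2) • (wedge α β : Form M (1 + 2)) ![X, Y, Z] = ∑ σ : Equiv.Perm (Fin 3),
      Equiv.Perm.sign σ • (α ![![X, Y, Z] (σ 0)] * β ![![X, Y, Z] (σ 1), ![X, Y, Z] (σ 2)]) :=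
    (factorial_smul_wedge_apply α β ![X, Y, Z]).trans (Finset.sum_congr rfl fun σ _ => by
      exact congrArg (Equiv.Perm.sign σ • ·) (congrArg₂ (· * ·) (apply_one _ _) (apply_two _ _)))
  rw [univ_perm_three] at h
  repeat rw [Finset.sum_insert (by decide)] at h
  rw [Finset.sum_singleton, Equiv.Perm.sign_inv, sign_finRotate,
    Equiv.Perm.sign_swap (by decide), Equiv.Perm.sign_swap (by decide),
    Equiv.Perm.sign_swap (by decide)] at h
  simp [Units.smul_def, Equiv.swap_apply_of_ne_of_ne, Equiv.Perm.inv_def] at h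
  rw [two_swap β Y X, two_swap β Z Y, two_swap β Z X, two_mul] at h
  ext p
  have hp := congrArg (fun f : SmoothFun M => f p) h
  simp at hp ⊢
  linarith

theorem wedge_two_one (β : Form M 2) (α : Form M 1) (X Y Z : VField M) :
    (wedge β α : Form M (2 + 1)) ![X, Y, Z] =
      α ![X] * β ![Y, Z] - α ![Y] * β ![X, Z] + α ![Z] * β ![X, Y] := by
  have h : (2 * 1) • (wedge β α : Form M (2 + 1)) ![X, Y, Z] = ∑ σ : Equiv.Perm (Fin 3),
      Equiv.Perm.sign σ • (β ![![X, Y, Z] (σ 0), ![X, Y, Z] (σ 1)] * α ![![X, Y, Z] (σ 2)]) :=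
    (factorial_smul_wedge_apply β α ![X, Y, Z]).trans (Finset.sum_congr rfl fun σ _ => by
      exact congrArg (Equiv.Perm.sign σ • ·) (congrArg₂ (· * ·) (apply_two _ _) (apply_one _ _)))
  rw [univ_perm_three] at h
  repeat rw [Finset.sum_insert (by decide)] at h
  rw [Finset.sum_singleton, Equiv.Perm.sign_inv, sign_finRotate,
    Equiv.Perm.sign_swap (by decide), Equiv.Perm.sign_swap (by decide),
    Equiv.Perm.sign_swap (by decide)] at h
  simp [Units.smul_def, Equiv.swap_apply_of_ne_of_ne, Equiv.Perm.inv_def] at h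
  rw [two_swap β Y X, two_swap β Z Y, two_swap β Z X, two_mul] at h
  ext p
  have hp := congrArg (fun f : SmoothFun M => f p) h
  simp at hp ⊢
  linarith

theorem contr_one (ξ : VField M) (α : Form M 1) : contr ξ α ![] = α ![ξ] := rfl

theorem contr_three (ξ X Y : VField M) (α : Form M 3) :
    contr ξ α ![X, Y] = α ![ξ, X, Y] := rfl

theorem d₀_apply (f : Form M 0) (X : VField M) : d₀ f ![X] = X.deriv (f ![]) := rfl

theorem d₁_apply (α : Form M 1) (X Y : VField M) :
    d₁ α ![X, Y] = X.deriv (α ![Y]) - Y.deriv (α ![X]) - α ![X.bracket Y] := rfl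

theorem d₂_apply (α : Form M 2) (X Y Z : VField M) :
    d₂ α ![X, Y, Z] = X.deriv (α ![Y, Z]) - Y.deriv (α ![X, Z]) + Z.deriv (α ![X, Y]) -
      α ![X.bracket Y, Z] + α ![X.bracket Z, Y] - α ![Y.bracket Z, X] := rfl

theorem contr_two (ξ X : VField M) (α : Form M 2) : contr ξ α ![X] = α ![ξ, X] := rfl

theorem lie_apply {k : ℕ} (ξ : VField M) (α : Form M k) (Y : Fin k → VField M) :
    lie ξ α Y = ξ.deriv (α Y) - ∑ i, α (Function.update Y i (ξ.bracket (Y i))) := rfl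

theorem lie_zero (ξ : VField M) (f : Form M 0) : lie ξ f ![] = ξ.deriv (f ![]) := by
  simp [lie_apply]

theorem lie_one (ξ X : VField M) (α : Form M 1) :
    lie ξ α ![X] = ξ.deriv (α ![X]) - α ![ξ.bracket X] := by
  have h : α (Function.update ![X] 0 (ξ.bracket X)) = α ![ξ.bracket X] :=
    congrArg α (funext fun i => by fin_cases i; rfl)
  simp [lie_apply, h]

theorem lie_two (ξ X Y : VField M) (α : Form M 2) :
    lie ξ α ![X, Y] = ξ.deriv (α ![X, Y]) - (α ![ξ.bracket X, Y] + α ![X, ξ.bracket Y]) := by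
  have h : ∀ i, Function.update ![X, Y] i (ξ.bracket (![X, Y] i)) =
      ![![ξ.bracket X, Y], ![X, ξ.bracket Y]] i := fun i => by
    funext j; fin_cases i <;> fin_cases j <;> rfl
  simp only [lie_apply, h, Fin.sum_univ_two]; rfl

theorem lie_three (ξ X Y Z : VField M) (α : Form M 3) :
    lie ξ α ![X, Y, Z] = ξ.deriv (α ![X, Y, Z]) -
      (α ![ξ.bracket X, Y, Z] + α ![X, ξ.bracket Y, Z] + α ![X, Y, ξ.bracket Z]) := by
  have h : ∀ i, Function.update ![X, Y, Z] i (ξ.bracket (![X, Y, Z] i)) =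
      ![![ξ.bracket X, Y, Z], ![X, ξ.bracket Y, Z], ![X, Y, ξ.bracket Z]] i := fun i => by
    funext j; fin_cases i <;> fin_cases j <;> rfl
  simp only [lie_apply, h, Fin.sum_univ_three]; rfl

theorem three_swap₀₁ (α : Form M 3) (X Y Z : VField M) : α ![Y, X, Z] = -α ![X, Y, Z] := by
  rw [← α.map_swap ![X, Y, Z] (i := 0) (j := 1) (by decide)]
  exact congrArg α (funext fun i => by fin_cases i <;> rfl)

theorem three_swap₁₂ (α : Form M 3) (X Y Z : VField M) : α ![X, Z, Y] = -α ![X, Y, Z] :=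
  two_swap (contr X α) Z Y

theorem one_sub (α : Form M 1) (X Y : VField M) : α ![X - Y] = α ![X] - α ![Y] := by
  rw [sub_eq_add_neg, one_add, one_neg, sub_eq_add_neg]

theorem two_sub (α : Form M 2) (X Y Z : VField M) : α ![X - Y, Z] = α ![X, Z] - α ![Y, Z] := by
  rw [sub_eq_add_neg, two_add, two_neg, sub_eq_add_neg]

theorem two_sub' (α : Form M 2) (X Y Z : VField M) : α ![Z, X - Y] = α ![Z, X] - α ![Z, Y] := by
  rw [two_swap, two_sub, two_swap α Z X, two_swap α Z Y]; ring

theorem three_add (α : Form M 3) (X X' Y Z : VField M) :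
    α ![X + X', Y, Z] = α ![X, Y, Z] + α ![X', Y, Z] :=
  AlternatingMap.map_vecCons_add α ![Y, Z] X X'

theorem three_smul (α : Form M 3) (f : SmoothFun M) (X Y Z : VField M) :
    α ![f • X, Y, Z] = f * α ![X, Y, Z] :=
  AlternatingMap.map_vecCons_smul α ![Y, Z] f X

theorem three_neg (α : Form M 3) (X Y Z : VField M) : α ![-X, Y, Z] = -α ![X, Y, Z] := by
  simpa using three_smul α (-1) X Y Z

theorem three_sub (α : Form M 3) (X X' Y Z : VField M) :
    α ![X - X', Y, Z] = α ![X, Y, Z] - α ![X', Y, Z] := by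
  rw [sub_eq_add_neg, three_add, three_neg, sub_eq_add_neg]

theorem three_sub' (α : Form M 3) (X Y Y' Z : VField M) :
    α ![X, Y - Y', Z] = α ![X, Y, Z] - α ![X, Y', Z] :=
  two_sub (contr X α) Y Y' Z

theorem three_sub'' (α : Form M 3) (X Y Z Z' : VField M) :
    α ![X, Y, Z - Z'] = α ![X, Y, Z] - α ![X, Y, Z'] :=
  two_sub' (contr X α) Z Z' Y

/-! ### Cartan calculus of scalar forms -/

theorem d₁_d₀ [T2Space M] (f : Form M 0) : d₁ (d₀ f) = 0 := by
  refine ext_two fun X Y => ?_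
  simp only [d₁_apply, d₀_apply, VField.bracket_deriv]
  exact sub_self _

theorem d₂_d₁ [T2Space M] (α : Form M 1) : d₂ (d₁ α) = 0 := by
  refine ext_three fun X Y Z => ?_
  have hj : (X.bracket Y).bracket Z = X.bracket (Y.bracket Z) - Y.bracket (X.bracket Z) := by
    rw [VField.jacobi X Y Z, add_sub_cancel_right]
  simp only [d₂_apply, d₁_apply, VField.deriv_sub, VField.bracket_deriv, hj, one_sub,
    VField.bracket_swap (X.bracket Z) Y, VField.bracket_swap (Y.bracket Z) X, one_neg,
    AlternatingMap.zero_apply]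
  ring

theorem lie_lie_zero [T2Space M] (ξ η : VField M) (α : Form M 0) :
    lie ξ (lie η α) - lie η (lie ξ α) = lie (ξ.bracket η) α := by
  refine ext_zero ?_
  simp only [AlternatingMap.sub_apply, lie_zero, VField.bracket_deriv]

theorem lie_lie_one [T2Space M] (ξ η : VField M) (α : Form M 1) :
    lie ξ (lie η α) - lie η (lie ξ α) = lie (ξ.bracket η) α := by
  refine ext_one fun X => ?_
  have hj : ∀ Z, (ξ.bracket η).bracket Z = ξ.bracket (η.bracket Z) - η.bracket (ξ.bracket Z) :=
    fun Z => by rw [VField.jacobi ξ η Z, add_sub_cancel_right]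
  simp only [AlternatingMap.sub_apply, lie_one, VField.bracket_deriv, hj, one_sub,
    VField.deriv_sub]
  ring

theorem lie_lie_two [T2Space M] (ξ η : VField M) (α : Form M 2) :
    lie ξ (lie η α) - lie η (lie ξ α) = lie (ξ.bracket η) α := by
  refine ext_two fun X Y => ?_
  have hj : ∀ Z, (ξ.bracket η).bracket Z = ξ.bracket (η.bracket Z) - η.bracket (ξ.bracket Z) :=
    fun Z => by rw [VField.jacobi ξ η Z, add_sub_cancel_right]
  simp only [AlternatingMap.sub_apply, lie_two, VField.bracket_deriv, hj, two_sub, two_sub',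
    VField.deriv_sub, VField.deriv_add]
  ring

theorem lie_lie_three [T2Space M] (ξ η : VField M) (α : Form M 3) :
    lie ξ (lie η α) - lie η (lie ξ α) = lie (ξ.bracket η) α := by
  refine ext_three fun X Y Z => ?_
  have hj : ∀ Z, (ξ.bracket η).bracket Z = ξ.bracket (η.bracket Z) - η.bracket (ξ.bracket Z) :=
    fun Z => by rw [VField.jacobi ξ η Z, add_sub_cancel_right]
  simp only [AlternatingMap.sub_apply, lie_three, VField.bracket_deriv, hj, three_sub, three_sub',
    three_sub'', VField.deriv_sub, VField.deriv_add]
  ring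

theorem d₀_lie [T2Space M] (ξ : VField M) (f : Form M 0) : d₀ (lie ξ f) = lie ξ (d₀ f) := by
  refine ext_one fun X => ?_
  simp only [d₀_apply, lie_one, lie_zero, VField.bracket_deriv]
  ring

theorem lie_zero_eq (ξ : VField M) (f : Form M 0) : lie ξ f = contr ξ (d₀ f) := by
  refine ext_zero ?_
  rw [lie_zero, contr_one, d₀_apply]

theorem lie_one_eq (ξ : VField M) (α : Form M 1) :
    lie ξ α = d₀ (contr ξ α) + contr ξ (d₁ α) := by
  refine ext_one fun X => ?_
  simp only [lie_one, AlternatingMap.add_apply, d₀_apply, contr_one, contr_two, d₁_apply]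
  ring

theorem lie_two_eq (ξ : VField M) (α : Form M 2) :
    lie ξ α = d₁ (contr ξ α) + contr ξ (d₂ α) := by
  refine ext_two fun X Y => ?_
  simp only [lie_two, AlternatingMap.add_apply, d₁_apply, contr_two, contr_three, d₂_apply,
    two_swap α X (ξ.bracket Y), two_swap α ξ (X.bracket Y)]
  ring

theorem d₁_lie [T2Space M] (ξ : VField M) (α : Form M 1) : d₁ (lie ξ α) = lie ξ (d₁ α) := by
  rw [lie_one_eq, lie_two_eq, map_add, d₁_d₀, d₂_d₁, map_zero, add_zero, zero_add]

theorem d₂_lie [T2Space M] (ξ : VField M) (α : Form M 2) : d₂ (lie ξ α) = lie ξ (d₂ α) := by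
  refine ext_three fun X Y Z => ?_
  have hj : ∀ Y Z, ξ.bracket (Y.bracket Z) = (ξ.bracket Y).bracket Z + Y.bracket (ξ.bracket Z) :=
    fun Y Z => VField.jacobi ξ Y Z
  simp only [d₂_apply, lie_three, lie_two, VField.deriv_sub, VField.deriv_add,
    VField.bracket_deriv, hj, two_add]
  ring

theorem lie_contr_one (ξ η : VField M) (α : Form M 1) :
    lie ξ (contr η α) - contr η (lie (k := 1) ξ α) = contr (ξ.bracket η) α := by
  refine ext_zero ?_
  simp only [AlternatingMap.sub_apply, lie_zero, contr_one, lie_one]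
  ring

theorem lie_contr_two (ξ η : VField M) (α : Form M 2) :
    lie ξ (contr η α) - contr η (lie (k := 2) ξ α) = contr (ξ.bracket η) α := by
  refine ext_one fun X => ?_
  simp only [AlternatingMap.sub_apply, lie_one, contr_two, lie_two]
  ring

theorem lie_contr_three (ξ η : VField M) (α : Form M 3) :
    lie ξ (contr η α) - contr η (lie (k := 3) ξ α) = contr (ξ.bracket η) α := by
  refine ext_two fun X Y => ?_
  simp only [AlternatingMap.sub_apply, lie_two, contr_three, lie_three]
  ring

theorem contr_contr_two (ξ η : VField M) (α : Form M 2) :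
    contr ξ (contr η α) = -contr η (contr ξ α) := by
  refine ext_zero ?_
  simp only [AlternatingMap.neg_apply, contr_one]
  exact two_swap α η ξ

theorem contr_contr_three (ξ η : VField M) (α : Form M 3) :
    contr ξ (contr η α) = -contr η (contr ξ α) := by
  refine ext_one fun X => ?_
  simp only [AlternatingMap.neg_apply, contr_two]
  exact three_swap₀₁ α ξ η X

theorem add_lie {k : ℕ} (ξ η : VField M) (α : Form M k) :
    lie (ξ + η) α = lie ξ α + lie η α := by
  ext1 Y
  simp only [lie_apply, AlternatingMap.add_apply, VField.add_deriv, VField.add_bracket,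
    α.map_update_add, Finset.sum_add_distrib]
  ring

theorem smul_lie {k : ℕ} (c : ℝ) (ξ : VField M) (α : Form M k) :
    lie (c • ξ) α = c • lie ξ α := by
  ext1 Y
  have h : ∀ (i : Fin k) (Z : VField M), α (Function.update Y i (c • Z)) =
      c • α (Function.update Y i Z) := fun i Z => by
    rw [VField.const_smul, α.map_update_smul]; rfl
  simp only [lie_apply, AlternatingMap.smul_apply, VField.const_smul_deriv,
    VField.const_smul_bracket, h, ← Finset.smul_sum, smul_sub]

theorem const_smul_contr {k : ℕ} (c : ℝ) (ξ : VField M) (α : Form M (k + 1)) :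
    contr (c • ξ) α = c • contr ξ α := by
  rw [VField.const_smul, contr_smul]; rfl

end Form
end ScalarForms

section ScalarForms
variable {M : Type*} [TopologicalSpace M] [ChartedSpace E3 M] [IsManifold (𝓡 3) ∞ M]
namespace Form

/-! ### Derivations of the wedge product -/

theorem zero_wedge_comm (f g : Form M 0) :
    (wedge f g : Form M (0 + 0)) = (wedge g f : Form M (0 + 0)) := by
  refine ext_zero ?_
  rw [zero_wedge_zero, zero_wedge_zero]
  exact mul_comm _ _

theorem zero_wedge_one_comm (f : Form M 0) (α : Form M 1) :
    (wedge f α : Form M (0 + 1)) = (wedge α f : Form M (1 + 0)) :=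
  (zero_wedge_one f α).trans (wedge_zero α f).symm

theorem zero_wedge_two_comm (f : Form M 0) (α : Form M 2) :
    (wedge f α : Form M (0 + 2)) = (wedge α f : Form M (2 + 0)) :=
  (zero_wedge_two f α).trans (wedge_zero α f).symm

theorem zero_wedge_three_comm (f : Form M 0) (α : Form M 3) :
    (wedge f α : Form M (0 + 3)) = (wedge α f : Form M (3 + 0)) :=
  (zero_wedge_three f α).trans (wedge_zero α f).symm

theorem one_wedge_comm (α β : Form M 1) :
    (wedge α β : Form M (1 + 1)) = -(wedge β α : Form M (1 + 1)) := by
  refine ext_two fun X Y => ?_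
  refine (wedge_one_one α β X Y).trans (Eq.trans ?_ (congrArg Neg.neg (wedge_one_one β α X Y)).symm)
  ring

theorem one_wedge_two_comm (α : Form M 1) (β : Form M 2) :
    (wedge α β : Form M (1 + 2)) = (wedge β α : Form M (2 + 1)) := by
  refine ext_three fun X Y Z => ?_
  exact (wedge_one_two α β X Y Z).trans (wedge_two_one β α X Y Z).symm

theorem d₀_smul (f g : Form M 0) :
    d₀ (f ![] • g) = g ![] • d₀ f + f ![] • d₀ g := by
  refine ext_one fun X => ?_
  simp only [d₀_apply, AlternatingMap.add_apply, AlternatingMap.smul_apply, smul_eq_mul,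
    VField.deriv_mul]
  ring

theorem d₁_smul (f : Form M 0) (α : Form M 1) :
    d₁ (f ![] • α) = (wedge (d₀ f) α : Form M (1 + 1)) + f ![] • d₁ α := by
  refine ext_two fun X Y => ?_
  refine Eq.trans ?_ (congrArg (· + (f ![] • d₁ α) ![X, Y]) (wedge_one_one (d₀ f) α X Y)).symm
  simp only [d₁_apply, d₀_apply, AlternatingMap.smul_apply, smul_eq_mul, VField.deriv_mul]
  ring

theorem d₂_smul (f : Form M 0) (α : Form M 2) :
    d₂ (f ![] • α) = (wedge (d₀ f) α : Form M (1 + 2)) + f ![] • d₂ α := by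
  refine ext_three fun X Y Z => ?_
  refine Eq.trans ?_
    (congrArg (· + (f ![] • d₂ α) ![X, Y, Z]) (wedge_one_two (d₀ f) α X Y Z)).symm
  simp only [d₂_apply, d₀_apply, AlternatingMap.smul_apply, smul_eq_mul, VField.deriv_mul]
  ring

theorem d₀_zero_wedge (f g : Form M 0) :
    d₀ (wedge f g : Form M (0 + 0)) =
      (wedge (d₀ f) g : Form M (1 + 0)) + (wedge f (d₀ g) : Form M (0 + 1)) := by
  rw [zero_wedge_zero, zero_wedge_one]
  exact (d₀_smul f g).trans (congrArg (· + f ![] • d₀ g) (wedge_zero (d₀ f) g).symm)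

theorem d₁_zero_wedge (f : Form M 0) (α : Form M 1) :
    d₁ (wedge f α : Form M (0 + 1)) =
      (wedge (d₀ f) α : Form M (1 + 1)) + (wedge f (d₁ α) : Form M (0 + 2)) := by
  rw [zero_wedge_one, zero_wedge_two]; exact d₁_smul f α

theorem d₂_zero_wedge (f : Form M 0) (α : Form M 2) :
    d₂ (wedge f α : Form M (0 + 2)) =
      (wedge (d₀ f) α : Form M (1 + 2)) + (wedge f (d₂ α) : Form M (0 + 3)) := by
  rw [zero_wedge_two, zero_wedge_three]; exact d₂_smul f α

theorem d₂_one_wedge (α β : Form M 1) :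
    d₂ (wedge α β : Form M (1 + 1)) =
      (wedge (d₁ α) β : Form M (2 + 1)) - (wedge α (d₁ β) : Form M (1 + 2)) := by
  refine ext_three fun X Y Z => ?_
  refine Eq.trans ?_ (congrArg₂ (· - ·) (wedge_two_one (d₁ α) β X Y Z)
    (wedge_one_two α (d₁ β) X Y Z)).symm
  have h := wedge_one_one α β
  change d₂ (wedge α β : Form M (1 + 1)) ![X, Y, Z] = _
  simp only [d₂_apply]
  erw [h, h, h, h, h, h]
  simp only [d₁_apply, VField.deriv_sub, VField.deriv_mul]
  ring

theorem lie_smul {k : ℕ} (ξ : VField M) (f : Form M 0) (α : Form M k) :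
    lie ξ (f ![] • α) = (lie ξ f) ![] • α + f ![] • lie ξ α := by
  rw [lie_zero]; exact lieDeriv_smul ξ (f ![]) α

theorem lie_zero_wedge (ξ : VField M) (f g : Form M 0) :
    lie ξ (wedge f g : Form M (0 + 0)) =
      (wedge (lie ξ f) g : Form M (0 + 0)) + (wedge f (lie ξ g) : Form M (0 + 0)) := by
  rw [zero_wedge_zero, zero_wedge_zero, zero_wedge_zero]; exact lie_smul ξ f g

theorem lie_zero_wedge_one (ξ : VField M) (f : Form M 0) (g : Form M 1) :
    lie ξ (wedge f g : Form M (0 + 1)) =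
      (wedge (lie ξ f) g : Form M (0 + 1)) + (wedge f (lie ξ g) : Form M (0 + 1)) := by
  rw [zero_wedge_one, zero_wedge_one, zero_wedge_one]; exact lie_smul ξ f g

theorem lie_zero_wedge_two (ξ : VField M) (f : Form M 0) (g : Form M 2) :
    lie ξ (wedge f g : Form M (0 + 2)) =
      (wedge (lie ξ f) g : Form M (0 + 2)) + (wedge f (lie ξ g) : Form M (0 + 2)) := by
  rw [zero_wedge_two, zero_wedge_two, zero_wedge_two]; exact lie_smul ξ f g

theorem lie_zero_wedge_three (ξ : VField M) (f : Form M 0) (g : Form M 3) :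
    lie ξ (wedge f g : Form M (0 + 3)) =
      (wedge (lie ξ f) g : Form M (0 + 3)) + (wedge f (lie ξ g) : Form M (0 + 3)) := by
  rw [zero_wedge_three, zero_wedge_three, zero_wedge_three]; exact lie_smul ξ f g

theorem lie_one_wedge (ξ : VField M) (α β : Form M 1) :
    lie ξ (wedge α β : Form M (1 + 1)) =
      (wedge (lie ξ α) β : Form M (1 + 1)) + (wedge α (lie ξ β) : Form M (1 + 1)) := by
  refine ext_two fun X Y => ?_
  refine (lie_two ξ X Y (wedge α β : Form M (1 + 1))).trans (Eq.trans ?_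
    (congrArg₂ (· + ·) (wedge_one_one (lie ξ α) β X Y) (wedge_one_one α (lie ξ β) X Y)).symm)
  have h := wedge_one_one α β
  erw [h, h, h]
  simp only [lie_one, VField.deriv_sub, VField.deriv_mul]
  ring

theorem lie_one_wedge_two (ξ : VField M) (α : Form M 1) (β : Form M 2) :
    lie ξ (wedge α β : Form M (1 + 2)) =
      (wedge (lie ξ α) β : Form M (1 + 2)) + (wedge α (lie ξ β) : Form M (1 + 2)) := by
  refine ext_three fun X Y Z => ?_
  refine (lie_three ξ X Y Z (wedge α β : Form M (1 + 2))).trans (Eq.trans ?_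
    (congrArg₂ (· + ·) (wedge_one_two (lie ξ α) β X Y Z)
      (wedge_one_two α (lie ξ β) X Y Z)).symm)
  have h := wedge_one_two α β
  erw [h, h, h, h]
  simp only [lie_one, lie_two, VField.deriv_sub, VField.deriv_add, VField.deriv_mul]
  ring

theorem contr_zero_wedge_one (ξ : VField M) (f : Form M 0) (α : Form M 1) :
    (contr ξ (wedge f α : Form M (0 + 1)) : Form M 0) =
      (wedge f (contr ξ α : Form M 0) : Form M (0 + 0)) := by
  rw [zero_wedge_one, zero_wedge_zero]; rfl

theorem contr_zero_wedge_two (ξ : VField M) (f : Form M 0) (α : Form M 2) :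
    (contr ξ (wedge f α : Form M (0 + 2)) : Form M 1) =
      (wedge f (contr ξ α : Form M 1) : Form M (0 + 1)) := by
  rw [zero_wedge_two, zero_wedge_one]; rfl

theorem contr_zero_wedge_three (ξ : VField M) (f : Form M 0) (α : Form M 3) :
    (contr ξ (wedge f α : Form M (0 + 3)) : Form M 2) =
      (wedge f (contr ξ α : Form M 2) : Form M (0 + 2)) := by
  rw [zero_wedge_three, zero_wedge_two]; rfl

theorem contr_one_wedge (ξ : VField M) (α β : Form M 1) :
    (contr ξ (wedge α β : Form M (1 + 1)) : Form M 1) =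
      (wedge (contr ξ α : Form M 0) β : Form M (0 + 1)) -
        (wedge α (contr ξ β : Form M 0) : Form M (1 + 0)) := by
  rw [zero_wedge_one]
  refine Eq.trans ?_ (congrArg (_ - ·) (wedge_zero α (contr ξ β)).symm)
  refine ext_one fun X => ?_
  refine (wedge_one_one α β ξ X).trans ?_
  simp only [AlternatingMap.sub_apply, AlternatingMap.smul_apply, contr_one, smul_eq_mul]
  ring

theorem contr_one_wedge_two (ξ : VField M) (α : Form M 1) (β : Form M 2) :
    (contr ξ (wedge α β : Form M (1 + 2)) : Form M 2) =
      (wedge (contr ξ α : Form M 0) β : Form M (0 + 2)) -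
        (wedge α (contr ξ β : Form M 1) : Form M (1 + 1)) := by
  rw [zero_wedge_two]
  refine ext_two fun X Y => ?_
  refine (wedge_one_two α β ξ X Y).trans (Eq.trans ?_
    (congrArg ((contr ξ α ![] • β) ![X, Y] - ·) (wedge_one_one α (contr ξ β) X Y)).symm)
  simp only [AlternatingMap.smul_apply, contr_one, contr_two, smul_eq_mul]
  ring

theorem one_wedge_assoc (α β γ : Form M 1) :
    (wedge (wedge α β : Form M (1 + 1)) γ : Form M (2 + 1)) =
      (wedge α (wedge β γ : Form M (1 + 1)) : Form M (1 + 2)) := by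
  refine ext_three fun X Y Z => ?_
  refine (wedge_two_one (wedge α β : Form M (1 + 1)) γ X Y Z).trans (Eq.trans ?_
    (wedge_one_two α (wedge β γ : Form M (1 + 1)) X Y Z).symm)
  have h := wedge_one_one α β
  have h' := wedge_one_one β γ
  erw [h, h, h, h', h', h']
  ring

theorem zero_wedge_assoc_zero (f g : Form M 0) (α : Form M 0) :
    (wedge f (wedge g α : Form M (0 + 0)) : Form M (0 + 0)) =
      (wedge (wedge f g : Form M (0 + 0)) α : Form M (0 + 0)) := by
  rw [zero_wedge_zero f g, zero_wedge_zero, zero_wedge_zero, zero_wedge_zero, smul_smul]; rfl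

theorem zero_wedge_left_comm_zero (f g : Form M 0) (α : Form M 0) :
    (wedge f (wedge g α : Form M (0 + 0)) : Form M (0 + 0)) =
      (wedge g (wedge f α : Form M (0 + 0)) : Form M (0 + 0)) := by
  simp only [zero_wedge_zero]; exact smul_comm _ _ _

theorem zero_wedge_assoc_one (f g : Form M 0) (α : Form M 1) :
    (wedge f (wedge g α : Form M (0 + 1)) : Form M (0 + 1)) =
      (wedge (wedge f g : Form M (0 + 0)) α : Form M (0 + 1)) := by
  rw [zero_wedge_zero f g, zero_wedge_one, zero_wedge_one, zero_wedge_one, smul_smul]; rfl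

theorem zero_wedge_left_comm_one (f g : Form M 0) (α : Form M 1) :
    (wedge f (wedge g α : Form M (0 + 1)) : Form M (0 + 1)) =
      (wedge g (wedge f α : Form M (0 + 1)) : Form M (0 + 1)) := by
  simp only [zero_wedge_one]; exact smul_comm _ _ _

theorem zero_wedge_assoc_two (f g : Form M 0) (α : Form M 2) :
    (wedge f (wedge g α : Form M (0 + 2)) : Form M (0 + 2)) =
      (wedge (wedge f g : Form M (0 + 0)) α : Form M (0 + 2)) := by
  rw [zero_wedge_zero f g, zero_wedge_two, zero_wedge_two, zero_wedge_two, smul_smul]; rfl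

theorem zero_wedge_left_comm_two (f g : Form M 0) (α : Form M 2) :
    (wedge f (wedge g α : Form M (0 + 2)) : Form M (0 + 2)) =
      (wedge g (wedge f α : Form M (0 + 2)) : Form M (0 + 2)) := by
  simp only [zero_wedge_two]; exact smul_comm _ _ _

theorem zero_wedge_assoc_three (f g : Form M 0) (α : Form M 3) :
    (wedge f (wedge g α : Form M (0 + 3)) : Form M (0 + 3)) =
      (wedge (wedge f g : Form M (0 + 0)) α : Form M (0 + 3)) := by
  rw [zero_wedge_zero f g, zero_wedge_three, zero_wedge_three, zero_wedge_three, smul_smul]; rfl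

theorem zero_wedge_left_comm_three (f g : Form M 0) (α : Form M 3) :
    (wedge f (wedge g α : Form M (0 + 3)) : Form M (0 + 3)) =
      (wedge g (wedge f α : Form M (0 + 3)) : Form M (0 + 3)) := by
  simp only [zero_wedge_three]; exact smul_comm _ _ _

theorem zero_one_wedge_assoc (f : Form M 0) (α β : Form M 1) :
    (wedge f (wedge α β : Form M (1 + 1)) : Form M (0 + 2)) =
      (wedge (wedge f α : Form M (0 + 1)) β : Form M (1 + 1)) := by
  rw [zero_wedge_one, zero_wedge_two]; exact (smul_wedge _ _ _).symm

theorem zero_one_wedge_left_comm (f : Form M 0) (α β : Form M 1) :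
    (wedge f (wedge α β : Form M (1 + 1)) : Form M (0 + 2)) =
      (wedge α (wedge f β : Form M (0 + 1)) : Form M (1 + 1)) := by
  rw [zero_wedge_one, zero_wedge_two]; exact (wedge_smul _ _ _).symm

theorem zero_one_two_wedge_assoc (f : Form M 0) (α : Form M 1) (β : Form M 2) :
    (wedge f (wedge α β : Form M (1 + 2)) : Form M (0 + 3)) =
      (wedge (wedge f α : Form M (0 + 1)) β : Form M (1 + 2)) := by
  rw [zero_wedge_one, zero_wedge_three]; exact (smul_wedge _ _ _).symm

theorem zero_one_two_wedge_left_comm (f : Form M 0) (α : Form M 1) (β : Form M 2) :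
    (wedge f (wedge α β : Form M (1 + 2)) : Form M (0 + 3)) =
      (wedge α (wedge f β : Form M (0 + 2)) : Form M (1 + 2)) := by
  rw [zero_wedge_two, zero_wedge_three]; exact (wedge_smul _ _ _).symm

theorem zero_two_one_wedge_assoc (f : Form M 0) (α : Form M 2) (β : Form M 1) :
    (wedge f (wedge α β : Form M (2 + 1)) : Form M (0 + 3)) =
      (wedge (wedge f α : Form M (0 + 2)) β : Form M (2 + 1)) := by
  rw [zero_wedge_two, zero_wedge_three]; exact (smul_wedge _ _ _).symm

theorem one_wedge_left_comm (α β γ : Form M 1) :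
    (wedge α (wedge β γ : Form M (1 + 1)) : Form M (1 + 2)) =
      -(wedge β (wedge α γ : Form M (1 + 1)) : Form M (1 + 2)) := by
  refine ext_three fun X Y Z => ?_
  refine (wedge_one_two α (wedge β γ : Form M (1 + 1)) X Y Z).trans (Eq.trans ?_
    (congrArg Neg.neg (wedge_one_two β (wedge α γ : Form M (1 + 1)) X Y Z)).symm)
  have h := wedge_one_one α γ
  have h' := wedge_one_one β γ
  erw [h, h, h, h', h', h']
  ring

end Form
end ScalarForms

/-! ### Operations on tensor products -/

section TensorProducts
variable {P P' Q Q' R R' S U V W A B C D : Type*}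
  [AddCommGroup P] [Module ℝ P] [AddCommGroup P'] [Module ℝ P']
  [AddCommGroup Q] [Module ℝ Q] [AddCommGroup Q'] [Module ℝ Q']
  [AddCommGroup R] [Module ℝ R] [AddCommGroup R'] [Module ℝ R']
  [AddCommGroup S] [Module ℝ S] [AddCommGroup U] [Module ℝ U] [AddCommGroup V] [Module ℝ V]
  [AddCommGroup W] [Module ℝ W]
  [AddCommGroup A] [Module ℝ A] [AddCommGroup B] [Module ℝ B] [AddCommGroup C] [Module ℝ C]
  [AddCommGroup D] [Module ℝ D]

/-- A derivation rule for a product of forms carries over to coefficients multiplied by an arbitrary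
bilinear map `m`. -/
theorem map₂_derivation (w : P →ₗ[ℝ] Q →ₗ[ℝ] R) (w₁ : P' →ₗ[ℝ] Q →ₗ[ℝ] R')
    (w₂ : P →ₗ[ℝ] Q' →ₗ[ℝ] R') (D : R →ₗ[ℝ] R') (D₁ : P →ₗ[ℝ] P') (D₂ : Q →ₗ[ℝ] Q')
    (h : ∀ α β, D (w α β) = w₁ (D₁ α) β + w₂ α (D₂ β)) (m : U →ₗ[ℝ] V →ₗ[ℝ] W)
    (a : P ⊗[ℝ] U) (b : Q ⊗[ℝ] V) :
    D.rTensor W (TensorProduct.map₂ w m a b) =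
      TensorProduct.map₂ w₁ m (D₁.rTensor U a) b + TensorProduct.map₂ w₂ m a (D₂.rTensor V b) := by
  induction a using TensorProduct.induction_on with
  | zero => simp
  | add a a' ha ha' =>
    simp only [map_add, LinearMap.add_apply, ha, ha']; abel
  | tmul α X =>
    induction b using TensorProduct.induction_on with
    | zero => simp
    | add b b' hb hb' => simp only [map_add, hb, hb']; abel
    | tmul β Y =>
      simp only [TensorProduct.map₂_apply_tmul, TensorProduct.map_tmul, LinearMap.rTensor_tmul, h,
        TensorProduct.add_tmul]

/-- An adjunction between operators on forms carries over to forms with coefficients. -/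
theorem map₂_adjoint (w : P' →ₗ[ℝ] Q →ₗ[ℝ] R) (w' : P →ₗ[ℝ] Q' →ₗ[ℝ] R) (D₁ : P →ₗ[ℝ] P')
    (D₂ : Q →ₗ[ℝ] Q') (h : ∀ α β, w (D₁ α) β = w' α (D₂ β)) (m : U →ₗ[ℝ] V →ₗ[ℝ] W)
    (a : P ⊗[ℝ] U) (b : Q ⊗[ℝ] V) :
    TensorProduct.map₂ w m (D₁.rTensor U a) b = TensorProduct.map₂ w' m a (D₂.rTensor V b) := by
  induction a using TensorProduct.induction_on with
  | zero => simp
  | add a a' ha ha' => simp only [map_add, LinearMap.add_apply, ha, ha']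
  | tmul α X =>
    induction b using TensorProduct.induction_on with
    | zero => simp
    | add b b' hb hb' => simp only [map_add, hb, hb']
    | tmul β Y =>
      simp only [TensorProduct.map₂_apply_tmul, TensorProduct.map_tmul, LinearMap.rTensor_tmul, h]

theorem map₂_neg_left (w : P →ₗ[ℝ] Q →ₗ[ℝ] R) (m : U →ₗ[ℝ] V →ₗ[ℝ] W) (a : P ⊗[ℝ] U)
    (b : Q ⊗[ℝ] V) : TensorProduct.map₂ (-w) m a b = -TensorProduct.map₂ w m a b := by
  induction a using TensorProduct.induction_on with
  | zero => simp
  | add a a' ha ha' => simp only [map_add, LinearMap.add_apply, ha, ha']; abel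
  | tmul α X =>
    induction b using TensorProduct.induction_on with
    | zero => simp
    | add b b' hb hb' => simp only [map_add, hb, hb']; abel
    | tmul β Y =>
      simp only [TensorProduct.map₂_apply_tmul, TensorProduct.map_tmul, LinearMap.neg_apply,
        TensorProduct.neg_tmul]

theorem map₂_neg_right (w : P →ₗ[ℝ] Q →ₗ[ℝ] R) (m : U →ₗ[ℝ] V →ₗ[ℝ] W) (a : P ⊗[ℝ] U)
    (b : Q ⊗[ℝ] V) : TensorProduct.map₂ w (-m) a b = -TensorProduct.map₂ w m a b := by
  induction a using TensorProduct.induction_on with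
  | zero => simp
  | add a a' ha ha' => simp only [map_add, LinearMap.add_apply, ha, ha']; abel
  | tmul α X =>
    induction b using TensorProduct.induction_on with
    | zero => simp
    | add b b' hb hb' => simp only [map_add, hb, hb']; abel
    | tmul β Y =>
      simp only [TensorProduct.map₂_apply_tmul, TensorProduct.map_tmul, LinearMap.neg_apply,
        TensorProduct.tmul_neg]

/-- An operator which only acts on the second factor of a product of forms, such as the contraction
of the product of a function with a form. -/
theorem map₂_rTensor_right (w : P →ₗ[ℝ] Q →ₗ[ℝ] R) (w' : P →ₗ[ℝ] Q' →ₗ[ℝ] R') (D : R →ₗ[ℝ] R')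
    (D₂ : Q →ₗ[ℝ] Q') (h : ∀ α β, D (w α β) = w' α (D₂ β)) (m : U →ₗ[ℝ] V →ₗ[ℝ] W)
    (a : P ⊗[ℝ] U) (b : Q ⊗[ℝ] V) :
    D.rTensor W (TensorProduct.map₂ w m a b) = TensorProduct.map₂ w' m a (D₂.rTensor V b) := by
  induction a using TensorProduct.induction_on with
  | zero => simp
  | add a a' ha ha' => simp only [map_add, LinearMap.add_apply, ha, ha']
  | tmul α X =>
    induction b using TensorProduct.induction_on with
    | zero => simp
    | add b b' hb hb' => simp only [map_add, hb, hb']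
    | tmul β Y =>
      simp only [TensorProduct.map₂_apply_tmul, TensorProduct.map_tmul, LinearMap.rTensor_tmul, h]

/-- The variant of `map₂_derivation` for a first factor of odd degree. -/
theorem map₂_antiderivation (w : P →ₗ[ℝ] Q →ₗ[ℝ] R) (w₁ : P' →ₗ[ℝ] Q →ₗ[ℝ] R')
    (w₂ : P →ₗ[ℝ] Q' →ₗ[ℝ] R') (D : R →ₗ[ℝ] R') (D₁ : P →ₗ[ℝ] P') (D₂ : Q →ₗ[ℝ] Q')
    (h : ∀ α β, D (w α β) = w₁ (D₁ α) β - w₂ α (D₂ β)) (m : U →ₗ[ℝ] V →ₗ[ℝ] W)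
    (a : P ⊗[ℝ] U) (b : Q ⊗[ℝ] V) :
    D.rTensor W (TensorProduct.map₂ w m a b) =
      TensorProduct.map₂ w₁ m (D₁.rTensor U a) b -
        TensorProduct.map₂ w₂ m a (D₂.rTensor V b) := by
  rw [map₂_derivation w w₁ (-w₂) D D₁ D₂ (fun α β => (h α β).trans (sub_eq_add_neg _ _)),
    map₂_neg_left, ← sub_eq_add_neg]

theorem map₂_symm (w : P →ₗ[ℝ] Q →ₗ[ℝ] R) (w' : Q →ₗ[ℝ] P →ₗ[ℝ] R)
    (h : ∀ α β, w α β = w' β α) (m : U →ₗ[ℝ] V →ₗ[ℝ] W) (m' : V →ₗ[ℝ] U →ₗ[ℝ] W)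
    (hm : ∀ X Y, m X Y = m' Y X) (a : P ⊗[ℝ] U) (b : Q ⊗[ℝ] V) :
    TensorProduct.map₂ w m a b = TensorProduct.map₂ w' m' b a := by
  induction a using TensorProduct.induction_on with
  | zero => simp
  | add a a' ha ha' => simp only [map_add, LinearMap.add_apply, ha, ha']
  | tmul α X =>
    induction b using TensorProduct.induction_on with
    | zero => simp
    | add b b' hb hb' => simp only [map_add, LinearMap.add_apply, hb, hb']
    | tmul β Y => simp only [TensorProduct.map₂_apply_tmul, TensorProduct.map_tmul, h, hm]

theorem map₂_skew (w : P →ₗ[ℝ] Q →ₗ[ℝ] R) (w' : Q →ₗ[ℝ] P →ₗ[ℝ] R)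
    (h : ∀ α β, w α β = w' β α) (m : U →ₗ[ℝ] V →ₗ[ℝ] W) (m' : V →ₗ[ℝ] U →ₗ[ℝ] W)
    (hm : ∀ X Y, m X Y = -m' Y X) (a : P ⊗[ℝ] U) (b : Q ⊗[ℝ] V) :
    TensorProduct.map₂ w m a b = -TensorProduct.map₂ w' m' b a := by
  induction a using TensorProduct.induction_on with
  | zero => simp
  | add a a' ha ha' => simp only [map_add, LinearMap.add_apply, ha, ha']; abel
  | tmul α X =>
    induction b using TensorProduct.induction_on with
    | zero => simp
    | add b b' hb hb' => simp only [map_add, LinearMap.add_apply, hb, hb']; abel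
    | tmul β Y =>
      simp only [TensorProduct.map₂_apply_tmul, TensorProduct.map_tmul, h, hm,
        TensorProduct.tmul_neg]

theorem map₂_assoc (w₁ : P →ₗ[ℝ] Q →ₗ[ℝ] P') (w₂ : P' →ₗ[ℝ] R →ₗ[ℝ] S)
    (w₃ : Q →ₗ[ℝ] R →ₗ[ℝ] Q') (w₄ : P →ₗ[ℝ] Q' →ₗ[ℝ] S)
    (h : ∀ α β γ, w₂ (w₁ α β) γ = w₄ α (w₃ β γ))
    (m₁ : U →ₗ[ℝ] V →ₗ[ℝ] A) (m₂ : A →ₗ[ℝ] W →ₗ[ℝ] B)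
    (m₃ : V →ₗ[ℝ] W →ₗ[ℝ] C) (m₄ : U →ₗ[ℝ] C →ₗ[ℝ] B)
    (hm : ∀ X Y Z, m₂ (m₁ X Y) Z = m₄ X (m₃ Y Z))
    (a : P ⊗[ℝ] U) (b : Q ⊗[ℝ] V) (c : R ⊗[ℝ] W) :
    TensorProduct.map₂ w₂ m₂ (TensorProduct.map₂ w₁ m₁ a b) c =
      TensorProduct.map₂ w₄ m₄ a (TensorProduct.map₂ w₃ m₃ b c) := by
  induction a using TensorProduct.induction_on with
  | zero => simp
  | add a a' ha ha' => simp only [map_add, LinearMap.add_apply, ha, ha']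
  | tmul α X =>
    induction b using TensorProduct.induction_on with
    | zero => simp
    | add b b' hb hb' => simp only [map_add, LinearMap.add_apply, hb, hb']
    | tmul β Y =>
      induction c using TensorProduct.induction_on with
      | zero => simp
      | add c c' hc hc' => simp only [map_add, hc, hc']
      | tmul γ Z => simp only [TensorProduct.map₂_apply_tmul, TensorProduct.map_tmul, h, hm]

/-- The Jacobi identity for products of forms with values in a Lie algebra. -/
theorem map₂_jacobi (w₁ : Q →ₗ[ℝ] R →ₗ[ℝ] Q') (w₂ : P →ₗ[ℝ] Q' →ₗ[ℝ] S)
    (w₃ : P →ₗ[ℝ] Q →ₗ[ℝ] P') (w₄ : P' →ₗ[ℝ] R →ₗ[ℝ] S)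
    (w₅ : P →ₗ[ℝ] R →ₗ[ℝ] R') (w₆ : Q →ₗ[ℝ] R' →ₗ[ℝ] S)
    (h : ∀ α β γ, w₂ α (w₁ β γ) = w₄ (w₃ α β) γ)
    (h' : ∀ α β γ, w₂ α (w₁ β γ) = w₆ β (w₅ α γ))
    (m : U →ₗ[ℝ] U →ₗ[ℝ] U) (hm : ∀ X Y Z, m X (m Y Z) = m (m X Y) Z + m Y (m X Z))
    (a : P ⊗[ℝ] U) (b : Q ⊗[ℝ] U) (d : R ⊗[ℝ] U) :
    TensorProduct.map₂ w₂ m a (TensorProduct.map₂ w₁ m b d) =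
      TensorProduct.map₂ w₄ m (TensorProduct.map₂ w₃ m a b) d +
        TensorProduct.map₂ w₆ m b (TensorProduct.map₂ w₅ m a d) := by
  induction a using TensorProduct.induction_on with
  | zero => simp
  | add a a' ha ha' => simp only [map_add, LinearMap.add_apply, ha, ha']; abel
  | tmul α X =>
    induction b using TensorProduct.induction_on with
    | zero => simp
    | add b b' hb hb' => simp only [map_add, LinearMap.add_apply, hb, hb']; abel
    | tmul β Y =>
      induction d using TensorProduct.induction_on with
      | zero => simp
      | add c c' hc hc' => simp only [map_add, hc, hc']; abel
      | tmul γ Z =>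
        simp only [TensorProduct.map₂_apply_tmul, TensorProduct.map_tmul]
        rw [← h', ← h, hm, TensorProduct.tmul_add]

/-- The signs of the product of one-forms and of the Lie bracket cancel. -/
theorem map₂_symm_of_anticomm (w : P →ₗ[ℝ] P →ₗ[ℝ] R) (h : ∀ α β, w α β = -w β α)
    (m : U →ₗ[ℝ] U →ₗ[ℝ] W) (hm : ∀ X Y, m X Y = -m Y X) (a b : P ⊗[ℝ] U) :
    TensorProduct.map₂ w m a b = TensorProduct.map₂ w m b a := by
  rw [map₂_symm w (-w) h m (-m) hm, map₂_neg_left, map₂_neg_right, neg_neg]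

/-- The variant of `map₂_jacobi` for two one-forms `a` and `b`. -/
theorem map₂_jacobi_of_neg (w₁ : Q →ₗ[ℝ] R →ₗ[ℝ] Q') (w₂ : P →ₗ[ℝ] Q' →ₗ[ℝ] S)
    (w₃ : P →ₗ[ℝ] Q →ₗ[ℝ] P') (w₄ : P' →ₗ[ℝ] R →ₗ[ℝ] S)
    (w₅ : P →ₗ[ℝ] R →ₗ[ℝ] R') (w₆ : Q →ₗ[ℝ] R' →ₗ[ℝ] S)
    (h : ∀ α β γ, w₂ α (w₁ β γ) = w₄ (w₃ α β) γ)
    (h' : ∀ α β γ, w₂ α (w₁ β γ) = -w₆ β (w₅ α γ))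
    (m : U →ₗ[ℝ] U →ₗ[ℝ] U) (hm : ∀ X Y Z, m X (m Y Z) = m (m X Y) Z + m Y (m X Z))
    (a : P ⊗[ℝ] U) (b : Q ⊗[ℝ] U) (d : R ⊗[ℝ] U) :
    TensorProduct.map₂ w₂ m a (TensorProduct.map₂ w₁ m b d) =
      TensorProduct.map₂ w₄ m (TensorProduct.map₂ w₃ m a b) d -
        TensorProduct.map₂ w₆ m b (TensorProduct.map₂ w₅ m a d) := by
  rw [map₂_jacobi w₁ w₂ w₃ w₄ w₅ (-w₆) h h' m hm, map₂_neg_left, ← sub_eq_add_neg]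

end TensorProducts

section LieAlgebraValued
variable {M : Type*} [TopologicalSpace M] [ChartedSpace E3 M] [IsManifold (𝓡 3) ∞ M]
variable {𝔤 : Type*} [LieRing 𝔤] [LieAlgebra ℝ 𝔤]

namespace GForm

/-! ### Cartan calculus of Lie algebra valued forms -/

/-- The commutator rule for Lie derivatives, once it is known for scalar forms. -/
theorem lie_lie_of {k : ℕ} (h : ∀ (ξ η : VField M) (α : Form M k),
      Form.lie ξ (Form.lie η α) - Form.lie η (Form.lie ξ α) = Form.lie (ξ.bracket η) α)
    (ξ η : VField M) (a : GForm M 𝔤 k) :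
    lie (ξ.bracket η) a = lie ξ (lie η a) - lie η (lie ξ a) :=
  eq_sub_of_add_eq (LinearMap.congr_fun (f := lie (ξ.bracket η) + lie η ∘ₗ lie ξ)
    (g := lie ξ ∘ₗ lie η) (TensorProduct.ext' fun α X =>
      (TensorProduct.add_tmul _ _ _).symm.trans
        (congrArg (· ⊗ₜ X) (eq_sub_iff_add_eq.1 (h ξ η α).symm))) a)

section Cartan
variable [T2Space M]

theorem d₁_d₀ (a : GForm M 𝔤 0) : d₁ (d₀ a) = 0 :=
  LinearMap.congr_fun (f := d₁ ∘ₗ d₀) (g := 0) (TensorProduct.ext' fun α X =>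
    (congrArg (· ⊗ₜ X) (Form.d₁_d₀ α)).trans (TensorProduct.zero_tmul _ _)) a

theorem d₂_d₁ (a : GForm M 𝔤 1) : d₂ (d₁ a) = 0 :=
  LinearMap.congr_fun (f := d₂ ∘ₗ d₁) (g := 0) (TensorProduct.ext' fun α X =>
    (congrArg (· ⊗ₜ X) (Form.d₂_d₁ α)).trans (TensorProduct.zero_tmul _ _)) a

theorem d₀_lie (ξ : VField M) (a : GForm M 𝔤 0) : d₀ (lie ξ a) = lie ξ (d₀ a) :=
  LinearMap.congr_fun (f := d₀ ∘ₗ lie ξ) (g := lie ξ ∘ₗ d₀) (TensorProduct.ext' fun α X =>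
    congrArg (· ⊗ₜ X) (Form.d₀_lie ξ α)) a

theorem d₁_lie (ξ : VField M) (a : GForm M 𝔤 1) : d₁ (lie ξ a) = lie ξ (d₁ a) :=
  LinearMap.congr_fun (f := d₁ ∘ₗ lie ξ) (g := lie ξ ∘ₗ d₁) (TensorProduct.ext' fun α X =>
    congrArg (· ⊗ₜ X) (Form.d₁_lie ξ α)) a

theorem d₂_lie (ξ : VField M) (a : GForm M 𝔤 2) : d₂ (lie ξ a) = lie ξ (d₂ a) :=
  LinearMap.congr_fun (f := d₂ ∘ₗ lie ξ) (g := lie ξ ∘ₗ d₂) (TensorProduct.ext' fun α X =>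
    congrArg (· ⊗ₜ X) (Form.d₂_lie ξ α)) a

theorem bracket_lie_zero (ξ η : VField M) (a : GForm M 𝔤 0) :
    lie (ξ.bracket η) a = lie ξ (lie η a) - lie η (lie ξ a) := lie_lie_of Form.lie_lie_zero ξ η a
theorem bracket_lie_one (ξ η : VField M) (a : GForm M 𝔤 1) :
    lie (ξ.bracket η) a = lie ξ (lie η a) - lie η (lie ξ a) := lie_lie_of Form.lie_lie_one ξ η a
theorem bracket_lie_two (ξ η : VField M) (a : GForm M 𝔤 2) :
    lie (ξ.bracket η) a = lie ξ (lie η a) - lie η (lie ξ a) := lie_lie_of Form.lie_lie_two ξ η a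
theorem bracket_lie_three (ξ η : VField M) (a : GForm M 𝔤 3) :
    lie (ξ.bracket η) a = lie ξ (lie η a) - lie η (lie ξ a) := lie_lie_of Form.lie_lie_three ξ η a

end Cartan

theorem lie_zero_eq (ξ : VField M) (a : GForm M 𝔤 0) : lie ξ a = contr ξ (d₀ a) :=
  LinearMap.congr_fun (f := lie ξ) (g := contr ξ ∘ₗ d₀) (TensorProduct.ext' fun α X =>
    congrArg (· ⊗ₜ X) (Form.lie_zero_eq ξ α)) a

theorem lie_one_eq (ξ : VField M) (a : GForm M 𝔤 1) :
    lie ξ a = d₀ (contr ξ a) + contr ξ (d₁ a) :=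
  LinearMap.congr_fun (f := lie ξ) (g := d₀ ∘ₗ contr ξ + contr ξ ∘ₗ d₁)
    (TensorProduct.ext' fun α X => (congrArg (· ⊗ₜ X) (Form.lie_one_eq ξ α)).trans
      (TensorProduct.add_tmul _ _ _)) a

theorem lie_two_eq (ξ : VField M) (a : GForm M 𝔤 2) :
    lie ξ a = d₁ (contr ξ a) + contr ξ (d₂ a) :=
  LinearMap.congr_fun (f := lie ξ) (g := d₁ ∘ₗ contr ξ + contr ξ ∘ₗ d₂)
    (TensorProduct.ext' fun α X => (congrArg (· ⊗ₜ X) (Form.lie_two_eq ξ α)).trans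
      (TensorProduct.add_tmul _ _ _)) a

/-- The commutator of a Lie derivative with a contraction, once it is known for scalar forms. -/
theorem bracket_contr_of {k : ℕ} (h : ∀ (ξ η : VField M) (α : Form M (k + 1)),
      Form.lie ξ (Form.contr η α) - Form.contr η (Form.lie ξ α) = Form.contr (ξ.bracket η) α)
    (ξ η : VField M) (a : GForm M 𝔤 (k + 1)) :
    contr (ξ.bracket η) a = lie ξ (contr η a) - contr η (lie ξ a) :=
  eq_sub_of_add_eq (LinearMap.congr_fun (f := contr (ξ.bracket η) + contr η ∘ₗ lie ξ)
    (g := lie ξ ∘ₗ contr η) (TensorProduct.ext' fun α X =>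
      (TensorProduct.add_tmul _ _ _).symm.trans
        (congrArg (· ⊗ₜ X) (eq_sub_iff_add_eq.1 (h ξ η α).symm))) a)

theorem bracket_contr_one (ξ η : VField M) (a : GForm M 𝔤 1) :
    (contr (ξ.bracket η) a : GForm M 𝔤 0) = lie ξ (contr η a) - contr η (lie (k := 1) ξ a) :=
  bracket_contr_of Form.lie_contr_one ξ η a
theorem bracket_contr_two (ξ η : VField M) (a : GForm M 𝔤 2) :
    (contr (ξ.bracket η) a : GForm M 𝔤 1) = lie ξ (contr η a) - contr η (lie (k := 2) ξ a) :=
  bracket_contr_of Form.lie_contr_two ξ η a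
theorem bracket_contr_three (ξ η : VField M) (a : GForm M 𝔤 3) :
    (contr (ξ.bracket η) a : GForm M 𝔤 2) = lie ξ (contr η a) - contr η (lie (k := 3) ξ a) :=
  bracket_contr_of Form.lie_contr_three ξ η a

theorem contr_contr_two (ξ η : VField M) (a : GForm M 𝔤 2) :
    (contr ξ (contr η a : GForm M 𝔤 1) : GForm M 𝔤 0) = -contr η (contr ξ a : GForm M 𝔤 1) :=
  eq_neg_of_add_eq_zero_left (G := GForm M 𝔤 0)
      (LinearMap.congr_fun (f := contr ξ ∘ₗ contr η + contr η ∘ₗ contr ξ)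
    (g := 0) (TensorProduct.ext' fun α X => (TensorProduct.add_tmul _ _ _).symm.trans
      ((congrArg (· ⊗ₜ X) (eq_neg_iff_add_eq_zero.1 (Form.contr_contr_two ξ η α))).trans
        (TensorProduct.zero_tmul _ _))) a)

theorem contr_contr_three (ξ η : VField M) (a : GForm M 𝔤 3) :
    (contr ξ (contr η a : GForm M 𝔤 2) : GForm M 𝔤 1) = -contr η (contr ξ a : GForm M 𝔤 2) :=
  eq_neg_of_add_eq_zero_left (G := GForm M 𝔤 1)
      (LinearMap.congr_fun (f := contr ξ ∘ₗ contr η + contr η ∘ₗ contr ξ)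
    (g := 0) (TensorProduct.ext' fun α X => (TensorProduct.add_tmul _ _ _).symm.trans
      ((congrArg (· ⊗ₜ X) (eq_neg_iff_add_eq_zero.1 (Form.contr_contr_three ξ η α))).trans
        (TensorProduct.zero_tmul _ _))) a)

theorem add_lie {k : ℕ} (ξ η : VField M) (a : GForm M 𝔤 k) :
    lie (ξ + η) a = lie ξ a + lie η a :=
  LinearMap.congr_fun (f := lie (ξ + η)) (g := lie ξ + lie η) (TensorProduct.ext' fun α X =>
    (congrArg (· ⊗ₜ X) (Form.add_lie ξ η α)).trans (TensorProduct.add_tmul _ _ _)) a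

theorem smul_lie {k : ℕ} (c : ℝ) (ξ : VField M) (a : GForm M 𝔤 k) :
    lie (c • ξ) a = c • lie ξ a :=
  LinearMap.congr_fun (f := lie (c • ξ)) (g := c • lie ξ) (TensorProduct.ext' fun α X =>
    congrArg (· ⊗ₜ X) (Form.smul_lie c ξ α)) a

theorem smul_contr {k : ℕ} (c : ℝ) (ξ : VField M) (a : GForm M 𝔤 (k + 1)) :
    contr (c • ξ) a = c • contr ξ a :=
  LinearMap.congr_fun (f := contr (c • ξ)) (g := c • contr ξ) (TensorProduct.ext' fun α X =>
    congrArg (· ⊗ₜ X) (Form.const_smul_contr c ξ α)) a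

end GForm
end LieAlgebraValued

section LieAlgebraValued
variable {M : Type*} [TopologicalSpace M] [ChartedSpace E3 M] [IsManifold (𝓡 3) ∞ M]
variable {𝔤 : Type*} [LieRing 𝔤] [LieAlgebra ℝ 𝔤]

namespace GForm

/-! ### Brackets and traces of Lie algebra valued forms -/

/-- The bracket of a `0`-form and a `0`-form, as a form of degree `0`. -/
noncomputable def br₀₀ :
    GForm M 𝔤 0 →ₗ[ℝ] GForm M 𝔤 0 →ₗ[ℝ] GForm M 𝔤 0 := bracket

/-- The bracket of a `0`-form and a `1`-form, as a form of degree `1`. -/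
noncomputable def br₀₁ :
    GForm M 𝔤 0 →ₗ[ℝ] GForm M 𝔤 1 →ₗ[ℝ] GForm M 𝔤 1 := bracket

/-- The bracket of a `0`-form and a `2`-form, as a form of degree `2`. -/
noncomputable def br₀₂ :
    GForm M 𝔤 0 →ₗ[ℝ] GForm M 𝔤 2 →ₗ[ℝ] GForm M 𝔤 2 := bracket

/-- The bracket of a `0`-form and a `3`-form, as a form of degree `3`. -/
noncomputable def br₀₃ :
    GForm M 𝔤 0 →ₗ[ℝ] GForm M 𝔤 3 →ₗ[ℝ] GForm M 𝔤 3 := bracket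

/-- The bracket of a `1`-form and a `1`-form, as a form of degree `2`. -/
noncomputable def br₁₁ :
    GForm M 𝔤 1 →ₗ[ℝ] GForm M 𝔤 1 →ₗ[ℝ] GForm M 𝔤 2 := bracket

/-- The bracket of a `1`-form and a `2`-form, as a form of degree `3`. -/
noncomputable def br₁₂ :
    GForm M 𝔤 1 →ₗ[ℝ] GForm M 𝔤 2 →ₗ[ℝ] GForm M 𝔤 3 := bracket

/-- The trace of the product of a `0`-form and a `2`-form, as a form of degree `2`. -/
noncomputable def tr₀₂ (Tr : 𝔤 →ₗ[ℝ] 𝔤 →ₗ[ℝ] ℝ) :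
    GForm M 𝔤 0 →ₗ[ℝ] GForm M 𝔤 2 →ₗ[ℝ] Form M 2 := tr Tr

/-- The trace of the product of a `0`-form and a `3`-form, as a form of degree `3`. -/
noncomputable def tr₀₃ (Tr : 𝔤 →ₗ[ℝ] 𝔤 →ₗ[ℝ] ℝ) :
    GForm M 𝔤 0 →ₗ[ℝ] GForm M 𝔤 3 →ₗ[ℝ] Form M 3 := tr Tr

/-- The trace of the product of a `1`-form and a `1`-form, as a form of degree `2`. -/
noncomputable def tr₁₁ (Tr : 𝔤 →ₗ[ℝ] 𝔤 →ₗ[ℝ] ℝ) :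
    GForm M 𝔤 1 →ₗ[ℝ] GForm M 𝔤 1 →ₗ[ℝ] Form M 2 := tr Tr

/-- The trace of the product of a `1`-form and a `2`-form, as a form of degree `3`. -/
noncomputable def tr₁₂ (Tr : 𝔤 →ₗ[ℝ] 𝔤 →ₗ[ℝ] ℝ) :
    GForm M 𝔤 1 →ₗ[ℝ] GForm M 𝔤 2 →ₗ[ℝ] Form M 3 := tr Tr

variable (𝔤) in
/-- The Lie bracket of `𝔤` as a bilinear map. -/
noncomputable def lieBilin : 𝔤 →ₗ[ℝ] 𝔤 →ₗ[ℝ] 𝔤 :=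
  LinearMap.mk₂ ℝ (fun X Y : 𝔤 => ⁅X, Y⁆) _root_.add_lie _root_.smul_lie lie_add lie_smul

theorem lieBilin_skew (X Y : 𝔤) : lieBilin 𝔤 X Y = -lieBilin 𝔤 Y X := (lie_skew X Y).symm

theorem lieBilin_jacobi (X Y Z : 𝔤) : lieBilin 𝔤 X (lieBilin 𝔤 Y Z) =
    lieBilin 𝔤 (lieBilin 𝔤 X Y) Z + lieBilin 𝔤 Y (lieBilin 𝔤 X Z) := leibniz_lie X Y Z

theorem br₀₀_comm (a b : GForm M 𝔤 0) : br₀₀ a b = -br₀₀ b a :=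
  map₂_skew (Form.wedgeBilin (M := M) 0 0) (Form.wedgeBilin (M := M) 0 0) Form.zero_wedge_comm _ _
      lieBilin_skew a b

/-- Brackets in which the form of higher degree comes first are expressed by the bilinear maps
above, in which the form of lower degree comes first. -/
theorem bracket₁₀ (a : GForm M 𝔤 1) (b : GForm M 𝔤 0) :
    (bracket a b : GForm M 𝔤 (1 + 0)) = -br₀₁ b a :=
  map₂_skew (Form.wedgeBilin (M := M) 1 0) (Form.wedgeBilin (M := M) 0 1)
      (fun f g => (Form.zero_wedge_one_comm g f).symm) _ _
    lieBilin_skew a b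

theorem bracket₂₀ (a : GForm M 𝔤 2) (b : GForm M 𝔤 0) :
    (bracket a b : GForm M 𝔤 (2 + 0)) = -br₀₂ b a :=
  map₂_skew (Form.wedgeBilin (M := M) 2 0) (Form.wedgeBilin (M := M) 0 2)
      (fun f g => (Form.zero_wedge_two_comm g f).symm) _ _
    lieBilin_skew a b

theorem bracket₃₀ (a : GForm M 𝔤 3) (b : GForm M 𝔤 0) :
    (bracket a b : GForm M 𝔤 (3 + 0)) = -br₀₃ b a :=
  map₂_skew (Form.wedgeBilin (M := M) 3 0) (Form.wedgeBilin (M := M) 0 3)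
      (fun f g => (Form.zero_wedge_three_comm g f).symm) _ _
    lieBilin_skew a b

theorem bracket₂₁ (a : GForm M 𝔤 2) (b : GForm M 𝔤 1) :
    (bracket a b : GForm M 𝔤 (2 + 1)) = -br₁₂ b a :=
  map₂_skew (Form.wedgeBilin (M := M) 2 1) (Form.wedgeBilin (M := M) 1 2)
      (fun f g => (Form.one_wedge_two_comm g f).symm) _ _
    lieBilin_skew a b

theorem br₁₁_comm (a b : GForm M 𝔤 1) : br₁₁ a b = br₁₁ b a :=
  map₂_symm_of_anticomm (Form.wedgeBilin (M := M) 1 1) Form.one_wedge_comm (lieBilin 𝔤)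
      lieBilin_skew a b

theorem d₀_br₀₀ (a b : GForm M 𝔤 0) : d₀ (br₀₀ a b) = br₀₁ a (d₀ b) - br₀₁ b (d₀ a) :=
  (map₂_derivation (Form.wedgeBilin (M := M) 0 0) (Form.wedgeBilin (M := M) 1 0)
      (Form.wedgeBilin (M := M) 0 1) Form.d₀ Form.d₀ Form.d₀ Form.d₀_zero_wedge
    (lieBilin 𝔤) a b).trans
      ((congrArg (· + br₀₁ a (d₀ b)) (bracket₁₀ (d₀ a) b)).trans (by abel))

theorem d₁_br₀₁ (a : GForm M 𝔤 0) (b : GForm M 𝔤 1) :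
    d₁ (br₀₁ a b) = br₁₁ (d₀ a) b + br₀₂ a (d₁ b) :=
  map₂_derivation (Form.wedgeBilin (M := M) 0 1) (Form.wedgeBilin (M := M) 1 1)
      (Form.wedgeBilin (M := M) 0 2) Form.d₁ Form.d₀ Form.d₁ Form.d₁_zero_wedge
    (lieBilin 𝔤) a b

theorem d₂_br₀₂ (a : GForm M 𝔤 0) (b : GForm M 𝔤 2) :
    d₂ (br₀₂ a b) = br₁₂ (d₀ a) b + br₀₃ a (d₂ b) :=
  map₂_derivation (Form.wedgeBilin (M := M) 0 2) (Form.wedgeBilin (M := M) 1 2)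
      (Form.wedgeBilin (M := M) 0 3) Form.d₂ Form.d₀ Form.d₂ Form.d₂_zero_wedge
    (lieBilin 𝔤) a b

theorem d₂_br₁₁ (a b : GForm M 𝔤 1) :
    d₂ (br₁₁ a b) = -br₁₂ b (d₁ a) - br₁₂ a (d₁ b) :=
  (map₂_antiderivation (Form.wedgeBilin (M := M) 1 1) (Form.wedgeBilin (M := M) 2 1)
      (Form.wedgeBilin (M := M) 1 2) Form.d₂ Form.d₁ Form.d₁ Form.d₂_one_wedge
    (lieBilin 𝔤) a b).trans (congrArg (· - br₁₂ a (d₁ b)) (bracket₂₁ (d₁ a) b))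

theorem lie_br₀₀ (ξ : VField M) (a : GForm M 𝔤 0) (b : GForm M 𝔤 0) :
    lie ξ (br₀₀ a b) = br₀₀ (lie ξ a) b + br₀₀ a (lie ξ b) :=
  map₂_derivation (Form.wedgeBilin (M := M) 0 0) (Form.wedgeBilin (M := M) 0 0)
      (Form.wedgeBilin (M := M) 0 0) (Form.lie ξ) (Form.lie ξ) (Form.lie ξ)
    (Form.lie_zero_wedge ξ) (lieBilin 𝔤) a b

theorem lie_br₀₁ (ξ : VField M) (a : GForm M 𝔤 0) (b : GForm M 𝔤 1) :
    lie ξ (br₀₁ a b) = br₀₁ (lie ξ a) b + br₀₁ a (lie ξ b) :=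
  map₂_derivation (Form.wedgeBilin (M := M) 0 1) (Form.wedgeBilin (M := M) 0 1)
      (Form.wedgeBilin (M := M) 0 1) (Form.lie ξ) (Form.lie ξ) (Form.lie ξ)
    (Form.lie_zero_wedge_one ξ) (lieBilin 𝔤) a b

theorem lie_br₀₂ (ξ : VField M) (a : GForm M 𝔤 0) (b : GForm M 𝔤 2) :
    lie ξ (br₀₂ a b) = br₀₂ (lie ξ a) b + br₀₂ a (lie ξ b) :=
  map₂_derivation (Form.wedgeBilin (M := M) 0 2) (Form.wedgeBilin (M := M) 0 2)
      (Form.wedgeBilin (M := M) 0 2) (Form.lie ξ) (Form.lie ξ) (Form.lie ξ)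
    (Form.lie_zero_wedge_two ξ) (lieBilin 𝔤) a b

theorem lie_br₀₃ (ξ : VField M) (a : GForm M 𝔤 0) (b : GForm M 𝔤 3) :
    lie ξ (br₀₃ a b) = br₀₃ (lie ξ a) b + br₀₃ a (lie ξ b) :=
  map₂_derivation (Form.wedgeBilin (M := M) 0 3) (Form.wedgeBilin (M := M) 0 3)
      (Form.wedgeBilin (M := M) 0 3) (Form.lie ξ) (Form.lie ξ) (Form.lie ξ)
    (Form.lie_zero_wedge_three ξ) (lieBilin 𝔤) a b

theorem lie_br₁₁ (ξ : VField M) (a : GForm M 𝔤 1) (b : GForm M 𝔤 1) :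
    lie ξ (br₁₁ a b) = br₁₁ (lie ξ a) b + br₁₁ a (lie ξ b) :=
  map₂_derivation (Form.wedgeBilin (M := M) 1 1) (Form.wedgeBilin (M := M) 1 1)
      (Form.wedgeBilin (M := M) 1 1) (Form.lie ξ) (Form.lie ξ) (Form.lie ξ)
    (Form.lie_one_wedge ξ) (lieBilin 𝔤) a b

theorem lie_br₁₂ (ξ : VField M) (a : GForm M 𝔤 1) (b : GForm M 𝔤 2) :
    lie ξ (br₁₂ a b) = br₁₂ (lie ξ a) b + br₁₂ a (lie ξ b) :=
  map₂_derivation (Form.wedgeBilin (M := M) 1 2) (Form.wedgeBilin (M := M) 1 2)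
      (Form.wedgeBilin (M := M) 1 2) (Form.lie ξ) (Form.lie ξ) (Form.lie ξ)
    (Form.lie_one_wedge_two ξ) (lieBilin 𝔤) a b

theorem contr_br₀₁ (ξ : VField M) (a : GForm M 𝔤 0) (b : GForm M 𝔤 1) :
    (contr ξ (br₀₁ a b) : GForm M 𝔤 0) = br₀₀ a (contr ξ b) :=
  map₂_rTensor_right (Form.wedgeBilin (M := M) 0 1) (Form.wedgeBilin (M := M) 0 0) (Form.contr ξ)
      (Form.contr ξ)
    (Form.contr_zero_wedge_one ξ) (lieBilin 𝔤) a b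

theorem contr_br₀₂ (ξ : VField M) (a : GForm M 𝔤 0) (b : GForm M 𝔤 2) :
    (contr ξ (br₀₂ a b) : GForm M 𝔤 1) = br₀₁ a (contr ξ b) :=
  map₂_rTensor_right (Form.wedgeBilin (M := M) 0 2) (Form.wedgeBilin (M := M) 0 1) (Form.contr ξ)
      (Form.contr ξ)
    (Form.contr_zero_wedge_two ξ) (lieBilin 𝔤) a b

theorem contr_br₀₃ (ξ : VField M) (a : GForm M 𝔤 0) (b : GForm M 𝔤 3) :
    (contr ξ (br₀₃ a b) : GForm M 𝔤 2) = br₀₂ a (contr ξ b) :=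
  map₂_rTensor_right (Form.wedgeBilin (M := M) 0 3) (Form.wedgeBilin (M := M) 0 2) (Form.contr ξ)
      (Form.contr ξ)
    (Form.contr_zero_wedge_three ξ) (lieBilin 𝔤) a b

theorem contr_br₁₁ (ξ : VField M) (a b : GForm M 𝔤 1) :
    (contr ξ (br₁₁ a b) : GForm M 𝔤 1) = br₀₁ (contr ξ a) b + br₀₁ (contr ξ b) a :=
  (map₂_antiderivation (Form.wedgeBilin (M := M) 1 1) (Form.wedgeBilin (M := M) 0 1)
      (Form.wedgeBilin (M := M) 1 0) (Form.contr ξ) (Form.contr ξ)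
    (Form.contr ξ) (Form.contr_one_wedge ξ) (lieBilin 𝔤) a b).trans
      ((congrArg (br₀₁ (contr ξ a) b - ·) (bracket₁₀ a (contr ξ b))).trans (by abel))

theorem contr_br₁₂ (ξ : VField M) (a : GForm M 𝔤 1) (b : GForm M 𝔤 2) :
    (contr ξ (br₁₂ a b) : GForm M 𝔤 2) = br₀₂ (contr ξ a) b - br₁₁ a (contr ξ b) :=
  map₂_antiderivation (Form.wedgeBilin (M := M) 1 2) (Form.wedgeBilin (M := M) 0 2)
      (Form.wedgeBilin (M := M) 1 1) (Form.contr ξ) (Form.contr ξ)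
    (Form.contr ξ) (Form.contr_one_wedge_two ξ) (lieBilin 𝔤) a b

theorem jacobi₀₀₀ (a b : GForm M 𝔤 0) (c : GForm M 𝔤 0) :
    br₀₀ a (br₀₀ b c) = br₀₀ (br₀₀ a b) c + br₀₀ b (br₀₀ a c) :=
  map₂_jacobi (Form.wedgeBilin (M := M) 0 0) (Form.wedgeBilin (M := M) 0 0)
      (Form.wedgeBilin (M := M) 0 0) (Form.wedgeBilin (M := M) 0 0) (Form.wedgeBilin (M := M) 0 0)
      (Form.wedgeBilin (M := M) 0 0)
    Form.zero_wedge_assoc_zero Form.zero_wedge_left_comm_zero (lieBilin 𝔤) lieBilin_jacobi a b c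

theorem jacobi₀₀₁ (a b : GForm M 𝔤 0) (c : GForm M 𝔤 1) :
    br₀₁ a (br₀₁ b c) = br₀₁ (br₀₀ a b) c + br₀₁ b (br₀₁ a c) :=
  map₂_jacobi (Form.wedgeBilin (M := M) 0 1) (Form.wedgeBilin (M := M) 0 1)
      (Form.wedgeBilin (M := M) 0 0) (Form.wedgeBilin (M := M) 0 1) (Form.wedgeBilin (M := M) 0 1)
      (Form.wedgeBilin (M := M) 0 1)
    Form.zero_wedge_assoc_one Form.zero_wedge_left_comm_one (lieBilin 𝔤) lieBilin_jacobi a b c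

theorem jacobi₀₀₂ (a b : GForm M 𝔤 0) (c : GForm M 𝔤 2) :
    br₀₂ a (br₀₂ b c) = br₀₂ (br₀₀ a b) c + br₀₂ b (br₀₂ a c) :=
  map₂_jacobi (Form.wedgeBilin (M := M) 0 2) (Form.wedgeBilin (M := M) 0 2)
      (Form.wedgeBilin (M := M) 0 0) (Form.wedgeBilin (M := M) 0 2) (Form.wedgeBilin (M := M) 0 2)
      (Form.wedgeBilin (M := M) 0 2)
    Form.zero_wedge_assoc_two Form.zero_wedge_left_comm_two (lieBilin 𝔤) lieBilin_jacobi a b c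

theorem jacobi₀₀₃ (a b : GForm M 𝔤 0) (c : GForm M 𝔤 3) :
    br₀₃ a (br₀₃ b c) = br₀₃ (br₀₀ a b) c + br₀₃ b (br₀₃ a c) :=
  map₂_jacobi (Form.wedgeBilin (M := M) 0 3) (Form.wedgeBilin (M := M) 0 3)
      (Form.wedgeBilin (M := M) 0 0) (Form.wedgeBilin (M := M) 0 3) (Form.wedgeBilin (M := M) 0 3)
      (Form.wedgeBilin (M := M) 0 3)
    Form.zero_wedge_assoc_three Form.zero_wedge_left_comm_three (lieBilin 𝔤) lieBilin_jacobi a b c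

theorem jacobi₀₁₁ (a : GForm M 𝔤 0) (b c : GForm M 𝔤 1) :
    br₀₂ a (br₁₁ b c) = br₁₁ (br₀₁ a b) c + br₁₁ b (br₀₁ a c) :=
  map₂_jacobi (Form.wedgeBilin (M := M) 1 1) (Form.wedgeBilin (M := M) 0 2)
      (Form.wedgeBilin (M := M) 0 1) (Form.wedgeBilin (M := M) 1 1) (Form.wedgeBilin (M := M) 0 1)
      (Form.wedgeBilin (M := M) 1 1)
    Form.zero_one_wedge_assoc Form.zero_one_wedge_left_comm (lieBilin 𝔤) lieBilin_jacobi a b c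

theorem jacobi₀₁₂ (a : GForm M 𝔤 0) (b : GForm M 𝔤 1) (c : GForm M 𝔤 2) :
    br₀₃ a (br₁₂ b c) = br₁₂ (br₀₁ a b) c + br₁₂ b (br₀₂ a c) :=
  map₂_jacobi (Form.wedgeBilin (M := M) 1 2) (Form.wedgeBilin (M := M) 0 3)
      (Form.wedgeBilin (M := M) 0 1) (Form.wedgeBilin (M := M) 1 2) (Form.wedgeBilin (M := M) 0 2)
      (Form.wedgeBilin (M := M) 1 2)
    Form.zero_one_two_wedge_assoc Form.zero_one_two_wedge_left_comm (lieBilin 𝔤) lieBilin_jacobi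
    a b c

theorem jacobi₁₁₁ (a b c : GForm M 𝔤 1) :
    br₁₂ a (br₁₁ b c) = -br₁₂ c (br₁₁ a b) - br₁₂ b (br₁₁ a c) :=
  (map₂_jacobi_of_neg (Form.wedgeBilin (M := M) 1 1) (Form.wedgeBilin (M := M) 1 2)
      (Form.wedgeBilin (M := M) 1 1)
    (Form.wedgeBilin (M := M) 2 1) (Form.wedgeBilin (M := M) 1 1) (Form.wedgeBilin (M := M) 1 2)
    (fun f g h => (Form.one_wedge_assoc f g h).symm) Form.one_wedge_left_comm (lieBilin 𝔤)
    lieBilin_jacobi a b c).trans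
      (congrArg (· - br₁₂ b (br₁₁ a c)) (bracket₂₁ (br₁₁ a b) c))

/-! ### Invariance of traces -/

section Trace
variable {Tr : 𝔤 →ₗ[ℝ] 𝔤 →ₗ[ℝ] ℝ}

theorem rid_rTensor {P Q : Type*} [AddCommGroup P] [Module ℝ P] [AddCommGroup Q] [Module ℝ Q]
    (D : P →ₗ[ℝ] Q) (x : P ⊗[ℝ] ℝ) :
    TensorProduct.rid ℝ Q (D.rTensor ℝ x) = D (TensorProduct.rid ℝ P x) :=
  LinearMap.congr_fun (f := (TensorProduct.rid ℝ Q).toLinearMap ∘ₗ D.rTensor ℝ)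
    (g := D ∘ₗ (TensorProduct.rid ℝ P).toLinearMap)
    (TensorProduct.ext' fun α X => (map_smul D X α).symm) x

theorem tr₃₀ (hsymm : ∀ X Y, Tr X Y = Tr Y X) (a : GForm M 𝔤 3) (b : GForm M 𝔤 0) :
    (tr Tr a b : Form M (3 + 0)) = tr₀₃ Tr b a :=
  congrArg (TensorProduct.rid ℝ (Form M 3)) (map₂_symm (Form.wedgeBilin (M := M) 3 0)
      (Form.wedgeBilin (M := M) 0 3)
    (fun f g => (Form.zero_wedge_three_comm g f).symm) Tr Tr hsymm a b)

theorem tr₂₁ (hsymm : ∀ X Y, Tr X Y = Tr Y X) (a : GForm M 𝔤 2) (b : GForm M 𝔤 1) :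
    (tr Tr a b : Form M (2 + 1)) = tr₁₂ Tr b a :=
  congrArg (TensorProduct.rid ℝ (Form M 3)) (map₂_symm (Form.wedgeBilin (M := M) 2 1)
      (Form.wedgeBilin (M := M) 1 2)
    (fun f g => (Form.one_wedge_two_comm g f).symm) Tr Tr hsymm a b)

theorem tr₀₃_br₀₀ (hinv : ∀ X Y Z, Tr ⁅X, Y⁆ Z = Tr X ⁅Y, Z⁆) (a b : GForm M 𝔤 0)
    (c : GForm M 𝔤 3) : tr₀₃ Tr (br₀₀ a b) c = tr₀₃ Tr a (br₀₃ b c) :=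
  congrArg (TensorProduct.rid ℝ (Form M 3)) (map₂_assoc (Form.wedgeBilin (M := M) 0 0)
      (Form.wedgeBilin (M := M) 0 3) (Form.wedgeBilin (M := M) 0 3) (Form.wedgeBilin (M := M) 0 3)
    (fun f g h => (Form.zero_wedge_assoc_three f g h).symm) (lieBilin 𝔤) Tr (lieBilin 𝔤) Tr
    hinv a b c)

theorem tr₁₂_br₀₁ (hinv : ∀ X Y Z, Tr ⁅X, Y⁆ Z = Tr X ⁅Y, Z⁆) (a : GForm M 𝔤 0)
    (b : GForm M 𝔤 1) (c : GForm M 𝔤 2) : tr₁₂ Tr (br₀₁ a b) c = tr₀₃ Tr a (br₁₂ b c) :=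
  congrArg (TensorProduct.rid ℝ (Form M 3)) (map₂_assoc (Form.wedgeBilin (M := M) 0 1)
      (Form.wedgeBilin (M := M) 1 2) (Form.wedgeBilin (M := M) 1 2) (Form.wedgeBilin (M := M) 0 3)
    (fun f g h => (Form.zero_one_two_wedge_assoc f g h).symm) (lieBilin 𝔤) Tr (lieBilin 𝔤) Tr
    hinv a b c)

theorem tr₁₂_br₁₁ (hsymm : ∀ X Y, Tr X Y = Tr Y X) (hinv : ∀ X Y Z, Tr ⁅X, Y⁆ Z = Tr X ⁅Y, Z⁆)
    (a b c : GForm M 𝔤 1) : tr₁₂ Tr c (br₁₁ a b) = tr₁₂ Tr a (br₁₁ b c) :=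
  (tr₂₁ hsymm (br₁₁ a b) c).symm.trans (congrArg (TensorProduct.rid ℝ (Form M 3))
    (map₂_assoc (Form.wedgeBilin (M := M) 1 1) (Form.wedgeBilin (M := M) 2 1)
        (Form.wedgeBilin (M := M) 1 1) (Form.wedgeBilin (M := M) 1 2) Form.one_wedge_assoc
      (lieBilin 𝔤) Tr (lieBilin 𝔤) Tr hinv a b c))

theorem tr₁₂_br₀₂ (hsymm : ∀ X Y, Tr X Y = Tr Y X) (hinv : ∀ X Y Z, Tr ⁅X, Y⁆ Z = Tr X ⁅Y, Z⁆)
    (a : GForm M 𝔤 0) (b : GForm M 𝔤 1) (c : GForm M 𝔤 2) :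
    tr₁₂ Tr b (br₀₂ a c) = -tr₀₃ Tr a (br₁₂ b c) := by
  have h : (tr Tr (br₀₂ a c) b : Form M (2 + 1)) = tr₀₃ Tr a (bracket c b : GForm M 𝔤 (2 + 1)) :=
    congrArg (TensorProduct.rid ℝ (Form M 3)) (map₂_assoc (Form.wedgeBilin (M := M) 0 2)
        (Form.wedgeBilin (M := M) 2 1) (Form.wedgeBilin (M := M) 2 1) (Form.wedgeBilin (M := M) 0 3)
      (fun f g h => (Form.zero_two_one_wedge_assoc f g h).symm) (lieBilin 𝔤) Tr (lieBilin 𝔤) Tr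
      hinv a c b)
  have h' : tr₀₃ Tr a (bracket c b : GForm M 𝔤 (2 + 1)) = tr₀₃ Tr a (-br₁₂ b c) :=
    congrArg (tr₀₃ Tr a) (bracket₂₁ c b)
  rw [← tr₂₁ hsymm, h, h']
  exact map_neg (tr₀₃ Tr a) (br₁₂ b c)

theorem d₂_tr₀₂ (Tr : 𝔤 →ₗ[ℝ] 𝔤 →ₗ[ℝ] ℝ) (a : GForm M 𝔤 0) (b : GForm M 𝔤 2) :
    Form.d₂ (tr₀₂ Tr a b) = tr₁₂ Tr (d₀ a) b + tr₀₃ Tr a (d₂ b) :=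
  (rid_rTensor Form.d₂ _).symm.trans ((congrArg (TensorProduct.rid ℝ (Form M 3))
    (map₂_derivation (Form.wedgeBilin (M := M) 0 2) (Form.wedgeBilin (M := M) 1 2)
        (Form.wedgeBilin (M := M) 0 3) Form.d₂ Form.d₀ Form.d₂ Form.d₂_zero_wedge
      Tr a b)).trans (map_add _ _ _))

theorem d₂_tr₁₁ (hsymm : ∀ X Y, Tr X Y = Tr Y X) (a b : GForm M 𝔤 1) :
    Form.d₂ (tr₁₁ Tr a b) = tr₁₂ Tr b (d₁ a) - tr₁₂ Tr a (d₁ b) :=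
  (rid_rTensor Form.d₂ _).symm.trans ((congrArg (TensorProduct.rid ℝ (Form M 3))
    (map₂_antiderivation (Form.wedgeBilin (M := M) 1 1) (Form.wedgeBilin (M := M) 2 1)
        (Form.wedgeBilin (M := M) 1 2) Form.d₂ Form.d₁ Form.d₁
      Form.d₂_one_wedge Tr a b)).trans ((map_sub _ _ _).trans
        (congrArg (· - tr₁₂ Tr a (d₁ b)) (tr₂₁ hsymm (d₁ a) b))))

theorem lie_tr₀₃ (Tr : 𝔤 →ₗ[ℝ] 𝔤 →ₗ[ℝ] ℝ) (ξ : VField M) (a : GForm M 𝔤 0)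
    (b : GForm M 𝔤 3) :
    Form.lie ξ (tr₀₃ Tr a b) = tr₀₃ Tr (lie ξ a) b + tr₀₃ Tr a (lie ξ b) :=
  (rid_rTensor (Form.lie ξ) _).symm.trans ((congrArg (TensorProduct.rid ℝ (Form M 3))
    (map₂_derivation (Form.wedgeBilin (M := M) 0 3) (Form.wedgeBilin (M := M) 0 3)
        (Form.wedgeBilin (M := M) 0 3) (Form.lie ξ) (Form.lie ξ) (Form.lie ξ)
      (Form.lie_zero_wedge_three ξ) Tr a b)).trans (map_add _ _ _))

theorem lie_tr₁₂ (Tr : 𝔤 →ₗ[ℝ] 𝔤 →ₗ[ℝ] ℝ) (ξ : VField M) (a : GForm M 𝔤 1)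
    (b : GForm M 𝔤 2) :
    Form.lie ξ (tr₁₂ Tr a b) = tr₁₂ Tr (lie ξ a) b + tr₁₂ Tr a (lie ξ b) :=
  (rid_rTensor (Form.lie ξ) _).symm.trans ((congrArg (TensorProduct.rid ℝ (Form M 3))
    (map₂_derivation (Form.wedgeBilin (M := M) 1 2) (Form.wedgeBilin (M := M) 1 2)
        (Form.wedgeBilin (M := M) 1 2) (Form.lie ξ) (Form.lie ξ) (Form.lie ξ)
      (Form.lie_one_wedge_two ξ) Tr a b)).trans (map_add _ _ _))

end Trace
end GForm
end LieAlgebraValued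

/-! ### Cut-off coordinate frames -/

section Charts
variable {M : Type*} [TopologicalSpace M] [ChartedSpace E3 M]

/-- The `i`-th coordinate vector field of a chart, on the source of this chart. -/
noncomputable def coordField (φ : OpenPartialHomeomorph M E3) (i : Fin 3) (q : M) :
    TangentSpace (𝓡 3) q :=
  (mfderiv 𝓘(ℝ, E3) (𝓡 3) φ.symm (φ q) (EuclideanSpace.single i (1 : ℝ)) : E3)

theorem mdifferentiable_chart {φ : OpenPartialHomeomorph M E3}
    (hφ : φ ∈ IsManifold.maximalAtlas (𝓡 3) ∞ M) : φ.MDifferentiable (𝓡 3) 𝓘(ℝ, E3) :=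
  ⟨fun x hx => ((contMDiffAt_of_mem_maximalAtlas hφ hx).mdifferentiableAt
      (by simp)).mdifferentiableWithinAt,
    fun x hx => ((contMDiffAt_symm_of_mem_maximalAtlas hφ hx).mdifferentiableAt
      (by simp)).mdifferentiableWithinAt⟩

/-- The `i`-th coordinate of a tangent vector in a chart. -/
noncomputable def chartCoord (φ : OpenPartialHomeomorph M E3) (q : M) (v : TangentSpace (𝓡 3) q)
    (i : Fin 3) : ℝ :=
  let w : E3 := mfderiv (𝓡 3) 𝓘(ℝ, E3) φ q v
  w i

theorem sum_chartCoord_smul_coordField {φ : OpenPartialHomeomorph M E3}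
    (hφ : φ ∈ IsManifold.maximalAtlas (𝓡 3) ∞ M) {q : M} (hq : q ∈ φ.source)
    (v : TangentSpace (𝓡 3) q) :
    v = ∑ i, chartCoord φ q v i • coordField φ i q := by
  have h := congrArg (fun L => L v) ((mdifferentiable_chart hφ).symm_comp_deriv hq)
  have h0 : ∀ w : E3, w = ∑ i, w i • EuclideanSpace.single i (1 : ℝ) := fun w => by
    ext j; simp [Pi.single_apply]
  have h1 : mfderiv (𝓡 3) 𝓘(ℝ, E3) φ q v = ∑ i, chartCoord φ q v i •
      (EuclideanSpace.single i (1 : ℝ) : E3) := h0 _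
  refine h.symm.trans ?_
  change mfderiv 𝓘(ℝ, E3) (𝓡 3) φ.symm (φ q) (mfderiv (𝓡 3) 𝓘(ℝ, E3) φ q v) = _
  conv_lhs => rw [h1]
  exact (map_sum (mfderiv 𝓘(ℝ, E3) (𝓡 3) φ.symm (φ q)) _ _).trans
    (Finset.sum_congr rfl fun i _ => map_smul (mfderiv 𝓘(ℝ, E3) (𝓡 3) φ.symm (φ q)) _ _)

theorem chartCoord_coordField {φ : OpenPartialHomeomorph M E3}
    (hφ : φ ∈ IsManifold.maximalAtlas (𝓡 3) ∞ M) {q : M} (hq : q ∈ φ.source) (i j : Fin 3) :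
    chartCoord φ q (coordField φ i q) j = if i = j then 1 else 0 := by
  have h := congrArg (fun L => L (EuclideanSpace.single i (1 : ℝ)))
    ((mdifferentiable_chart hφ).comp_symm_deriv (φ.map_source hq))
  rw [φ.left_inv hq] at h
  have h' : (mfderiv (𝓡 3) 𝓘(ℝ, E3) φ q (coordField φ i q) : E3) =
      EuclideanSpace.single i (1 : ℝ) := h
  simp only [chartCoord, h', eq_comm (a := i)]
  simp

end Charts

section Frames
variable {M : Type*} [TopologicalSpace M] [ChartedSpace E3 M] [IsManifold (𝓡 3) ∞ M]

/-- The smooth function `χ · (g ∘ φ)`, where `φ` is a chart and `χ` is supported in its source. -/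
noncomputable def cutoffFun (φ : OpenPartialHomeomorph M E3)
    (hφ : φ ∈ IsManifold.maximalAtlas (𝓡 3) ∞ M) (χ : SmoothFun M) (hχ : tsupport χ ⊆ φ.source)
    (g : E3 → ℝ) (hg : ContDiff ℝ ∞ g) : SmoothFun M where
  val q := χ q • g (φ q)
  property := contMDiff_of_tsupport fun q hq => by
    have hq : q ∈ φ.source := hχ (tsupport_smul_subset_left _ _ hq)
    exact χ.contMDiff.contMDiffAt.smul
      (hg.contMDiff.contMDiffAt.comp q (contMDiffAt_of_mem_maximalAtlas hφ hq))

theorem contMDiffOn_coordField {φ : OpenPartialHomeomorph M E3}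
    (hφ : φ ∈ IsManifold.maximalAtlas (𝓡 3) ∞ M) (i : Fin 3) :
    ContMDiffOn (𝓡 3) (𝓡 3).tangent ∞
      (fun q => (⟨q, coordField φ i q⟩ : TangentBundle (𝓡 3) M)) φ.source := by
  have h1 := (contMDiffOn_symm_of_mem_maximalAtlas hφ).contMDiffOn_tangentMapWithin (m := ∞)
    (by simp) φ.open_target.uniqueMDiffOn
  have h2 : ContMDiff (𝓡 3) (𝓡 3).tangent ∞
      (fun x : E3 => (⟨x, (EuclideanSpace.single i (1 : ℝ) : E3)⟩ : TangentBundle (𝓡 3) E3)) :=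
    contMDiff_vectorSpace_iff_contDiff.2 contDiff_const
  have h3 := h1.comp (h2.contMDiffOn (s := φ.target)) (fun x hx => hx)
  refine (h3.comp (contMDiffOn_of_mem_maximalAtlas hφ) fun q hq => φ.map_source hq).congr ?_
  intro q hq
  have h4 : mfderivWithin 𝓘(ℝ, E3) (𝓡 3) φ.symm φ.target (φ q) =
      mfderiv 𝓘(ℝ, E3) (𝓡 3) φ.symm (φ q) :=
    mfderivWithin_of_isOpen φ.open_target (φ.map_source hq)
  simp only [Function.comp, tangentMapWithin, h4]
  exact congrArg (fun q' => (⟨q', (coordField φ i q : E3)⟩ : TangentBundle (𝓡 3) M))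
    (φ.left_inv hq).symm

/-- The vector field `χ ∂ᵢ`, where `∂ᵢ` is a coordinate vector field of a chart and `χ` is supported
in the source of this chart. -/
noncomputable def cutoffField (φ : OpenPartialHomeomorph M E3)
    (hφ : φ ∈ IsManifold.maximalAtlas (𝓡 3) ∞ M) (χ : SmoothFun M) (hχ : tsupport χ ⊆ φ.source)
    (i : Fin 3) : VField M :=
  ⟨fun q => χ q • coordField φ i q, ContMDiffOn.smul_section_of_tsupport
    (χ.contMDiff.contMDiffOn) φ.open_source hχ (contMDiffOn_coordField hφ i)⟩

theorem cutoffField_apply (φ : OpenPartialHomeomorph M E3)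
    (hφ : φ ∈ IsManifold.maximalAtlas (𝓡 3) ∞ M) (χ : SmoothFun M) (hχ : tsupport χ ⊆ φ.source)
    (i : Fin 3) (q : M) : cutoffField φ hφ χ hχ i q = χ q • coordField φ i q := rfl

/-- Where `χ` is locally constant equal to `1`, the cut-off does not affect derivatives. -/
theorem VField.deriv_cutoffFun (φ : OpenPartialHomeomorph M E3)
    (hφ : φ ∈ IsManifold.maximalAtlas (𝓡 3) ∞ M) (χ : SmoothFun M) (hχ : tsupport χ ⊆ φ.source)
    (g : E3 → ℝ) (hg : ContDiff ℝ ∞ g) (X : VField M) (q : M) (hq : χ =ᶠ[nhds q] 1) :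
    X.deriv (cutoffFun φ hφ χ hχ g hg) q =
      fderiv ℝ g (φ q) (mfderiv (𝓡 3) 𝓘(ℝ, E3) φ q (X q) : E3) := by
  have hqs : q ∈ φ.source := hχ (subset_tsupport _ (by simp [hq.eq_of_nhds]))
  have h1 : (cutoffFun φ hφ χ hχ g hg : M → ℝ) =ᶠ[nhds q] g ∘ φ := by
    filter_upwards [hq] with y hy
    change χ y • g (φ y) = _
    rw [hy]; simp
  have h2 : MDifferentiableAt (𝓡 3) 𝓘(ℝ, E3) φ q :=
    (contMDiffAt_of_mem_maximalAtlas hφ hqs).mdifferentiableAt (by simp)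
  have h3 : MDifferentiableAt 𝓘(ℝ, E3) 𝓘(ℝ, ℝ) g (φ q) :=
    (hg.contMDiff.contMDiffAt).mdifferentiableAt (by simp)
  have h4 : mfderiv (𝓡 3) 𝓘(ℝ, ℝ) (cutoffFun φ hφ χ hχ g hg : M → ℝ) q =
      mfderiv (𝓡 3) 𝓘(ℝ, ℝ) (g ∘ φ) q := h1.mfderiv_eq
  rw [VField.deriv_apply]
  change mfderiv (𝓡 3) 𝓘(ℝ, ℝ) (cutoffFun φ hφ χ hχ g hg : M → ℝ) q (X q) = _
  rw [h4, mfderiv_comp q h3 h2, mfderiv_eq_fderiv]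
  rfl

/-- The `i`-th coordinate of a chart, cut off by a function `χ`. -/
noncomputable def cutoffCoord (φ : OpenPartialHomeomorph M E3)
    (hφ : φ ∈ IsManifold.maximalAtlas (𝓡 3) ∞ M) (χ : SmoothFun M) (hχ : tsupport χ ⊆ φ.source)
    (i : Fin 3) : SmoothFun M :=
  cutoffFun φ hφ χ hχ (EuclideanSpace.proj (𝕜 := ℝ) i : E3 →L[ℝ] ℝ)
    (EuclideanSpace.proj (𝕜 := ℝ) i).contDiff

theorem VField.deriv_cutoffCoord (φ : OpenPartialHomeomorph M E3)
    (hφ : φ ∈ IsManifold.maximalAtlas (𝓡 3) ∞ M) (χ : SmoothFun M) (hχ : tsupport χ ⊆ φ.source)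
    (i : Fin 3) (X : VField M) (q : M) (hq : χ =ᶠ[nhds q] 1) :
    X.deriv (cutoffCoord φ hφ χ hχ i) q = chartCoord φ q (X q) i := by
  rw [cutoffCoord, VField.deriv_cutoffFun _ _ _ _ _ _ _ _ hq, ContinuousLinearMap.fderiv]
  rfl

/-- Where the cut-off functions are `1`, every vector field is the combination of the cut-off
coordinate fields with its coordinates as coefficients. -/
theorem VField.smul_eq_sum_cutoffField (φ : OpenPartialHomeomorph M E3)
    (hφ : φ ∈ IsManifold.maximalAtlas (𝓡 3) ∞ M) (χ : SmoothFun M) (hχ : tsupport χ ⊆ φ.source)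
    (θ : SmoothFun M) (hθ : ∀ q, θ q ≠ 0 → χ =ᶠ[nhds q] 1) (X : VField M) :
    θ • X = ∑ i, (θ * X.deriv (cutoffCoord φ hφ χ hχ i)) • cutoffField φ hφ χ hχ i := by
  ext1 q
  have hsum : ∀ Y : Fin 3 → VField M, (∑ i, Y i) q = ∑ i, Y i q := fun Y => by
    simp [Fin.sum_univ_three]
  rw [VField.smul_apply, hsum]
  by_cases h : θ q = 0
  · rw [h, zero_smul, Finset.sum_eq_zero]
    intro i _
    change (θ q * X.deriv (cutoffCoord φ hφ χ hχ i) q) • cutoffField φ hφ χ hχ i q = 0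
    rw [h, zero_mul]; exact zero_smul ℝ (cutoffField φ hφ χ hχ i q)
  · have hχq := hθ q h
    have hq : q ∈ φ.source := hχ (subset_tsupport _ (by simp [hχq.eq_of_nhds]))
    conv_lhs => rw [sum_chartCoord_smul_coordField hφ hq (X q)]
    rw [Finset.smul_sum]
    refine Finset.sum_congr rfl fun i _ => ?_
    change _ = (θ q * X.deriv (cutoffCoord φ hφ χ hχ i) q) • χ q • coordField φ i q
    rw [VField.deriv_cutoffCoord _ _ _ _ _ _ _ hχq, hχq.eq_of_nhds, Pi.one_apply, one_smul,
      mul_smul]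

variable [T2Space M] [SigmaCompactSpace M]

/-- Smooth cut-off functions which are `1` near a compact set. -/
theorem exists_cutoff {K U : Set M} (hK : IsCompact K) (hU : IsOpen U) (hKU : K ⊆ U) :
    ∃ χ : SmoothFun M, (∀ q ∈ K, χ =ᶠ[nhds q] 1) ∧ tsupport χ ⊆ U ∧ HasCompactSupport χ ∧
      ∀ q, 0 ≤ χ q := by
  have : LocallyCompactSpace M := ChartedSpace.locallyCompactSpace E3 M
  obtain ⟨L, hL, hKL, hLU⟩ := exists_compact_between hK hU hKU
  obtain ⟨χ, h1, h0, hr⟩ := exists_contMDiffMap_one_nhds_of_subset_interior (n := ⊤) (𝓡 3)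
    hK.isClosed hKL
  have hs : tsupport χ ⊆ L := closure_minimal (fun q hq => by
    by_contra hqL; exact hq (h0 q hqL)) hL.isClosed
  exact ⟨χ, fun q hq => (eventually_nhdsSet_iff_forall.1 h1) q hq, hs.trans hLU,
    hL.of_isClosed_subset (isClosed_tsupport _) hs, fun q => (hr q).1⟩

end Frames

/-! ### Tensoriality and the vanishing of four-forms -/

section Tensoriality
variable {M : Type*} [TopologicalSpace M] [ChartedSpace E3 M] [IsManifold (𝓡 3) ∞ M]
  [T2Space M] [SigmaCompactSpace M]

/-- Near every point there are three vector fields `E i` and functions `x i` such that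
`X = ∑ i, X(x i) E i` for every vector field `X`. The function `θ`, which is `1` at the point, turns
this local formula into a global identity. -/
theorem exists_frame (p : M) : ∃ (E : Fin 3 → VField M) (x : Fin 3 → SmoothFun M)
    (θ : SmoothFun M), θ p = 1 ∧
      (∀ X : VField M, θ • X = ∑ i, (θ * X.deriv (x i)) • E i) ∧
      ∀ i j, (E i).deriv (x j) p = if i = j then 1 else 0 := by
  obtain ⟨χ, hχ1, hχ, -⟩ := exists_cutoff (isCompact_singleton (x := p))
    (chartAt E3 p).open_source (by simp)
  have hφ : chartAt E3 p ∈ IsManifold.maximalAtlas (𝓡 3) ∞ M :=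
    IsManifold.chart_mem_maximalAtlas p
  have hp := hχ1 p rfl
  obtain ⟨θ, hθ1, hθ, -⟩ := exists_cutoff (isCompact_singleton (x := p))
    (isOpen_setOfPred_eventually_nhds (p := fun q => χ q = 1)) (Set.singleton_subset_iff.2 hp)
  refine ⟨cutoffField _ hφ χ hχ, cutoffCoord _ hφ χ hχ, θ, (hθ1 p rfl).eq_of_nhds,
    VField.smul_eq_sum_cutoffField _ hφ χ hχ θ fun q hq => hθ (subset_tsupport _ hq),
    fun i j => ?_⟩
  rw [VField.deriv_cutoffCoord _ _ _ _ _ _ _ hp, cutoffField_apply, hp.eq_of_nhds, Pi.one_apply,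
    one_smul, chartCoord_coordField hφ (mem_chart_source E3 p)]

/-- A `C^∞(M)`-linear map is determined at a point by its values on a frame. -/
theorem linearMap_apply_eq (L : VField M →ₗ[SmoothFun M] SmoothFun M) {p : M}
    {E : Fin 3 → VField M} {x : Fin 3 → SmoothFun M} {θ : SmoothFun M} (hθ : θ p = 1)
    (h : ∀ X : VField M, θ • X = ∑ i, (θ * X.deriv (x i)) • E i) (X : VField M) :
    L X p = ∑ i, X.deriv (x i) p * L (E i) p := by
  have h1 := congrArg (fun Y => L Y p) (h X)
  simp only [Fin.sum_univ_three, map_add, map_smul] at h1 ⊢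
  change θ p * L X p = θ p * (X.deriv (x 0)) p * L (E 0) p + θ p * (X.deriv (x 1)) p * L (E 1) p +
    θ p * (X.deriv (x 2)) p * L (E 2) p at h1
  simpa [hθ] using h1

/-- A `C^∞(M)`-linear map from vector fields to functions is tensorial: its value at a point
depends only on the value of the vector field at this point. -/
theorem linearMap_apply_congr (L : VField M →ₗ[SmoothFun M] SmoothFun M) {p : M} {X Y : VField M}
    (h : X p = Y p) : L X p = L Y p := by
  obtain ⟨E, x, θ, hθ, hE, -⟩ := exists_frame p
  rw [linearMap_apply_eq L hθ hE X, linearMap_apply_eq L hθ hE Y]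
  exact Finset.sum_congr rfl fun i _ => by rw [VField.deriv_apply, h, VField.deriv_apply]

namespace Form

theorem update_apply_congr {k : ℕ} (α : Form M k) (Z : Fin k → VField M) (i : Fin k) {p : M}
    {X Y : VField M} (h : X p = Y p) :
    α (Function.update Z i X) p = α (Function.update Z i Y) p :=
  linearMap_apply_congr (α.toMultilinearMap.toLinearMap Z i) h

theorem apply_congr {k : ℕ} (α : Form M k) {p : M} {Y Z : Fin k → VField M}
    (h : ∀ i, Y i p = Z i p) : α Y p = α Z p := by
  have key : ∀ s : Finset (Fin k), α (s.piecewise Z Y) p = α Y p := by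
    intro s
    induction s using Finset.induction_on with
    | empty => simp
    | insert i s hi ih =>
      rw [← ih, Finset.piecewise_insert,
        update_apply_congr α (s.piecewise Z Y) i (Y := s.piecewise Z Y i)
          (by rw [Finset.piecewise_eq_of_notMem _ _ _ hi, h]), Function.update_eq_self]
  simpa using (key Finset.univ).symm

/-- The pointwise evaluation of forms on tangent vectors does not depend on the extension of these
to vector fields. -/
theorem evalAt_apply {k : ℕ} (α : Form M k) (p : M) (Y : Fin k → VField M) :
    α.evalAt p (fun i => Y i p) = α Y p :=
  apply_congr α fun i => (VField.exists_extension p (Y i p)).choose_spec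

theorem evalAt_eq {k : ℕ} (α : Form M k) (p : M) (Y : Fin k → VField M)
    (v : Fin k → TangentSpace (𝓡 3) p) (h : ∀ i, Y i p = v i) : α.evalAt p v = α Y p := by
  rw [← evalAt_apply]; simp only [h]

end Form

theorem linearMap_apply_eq_zero (L : VField M →ₗ[SmoothFun M] SmoothFun M) {p : M}
    {E : Fin 3 → VField M} {x : Fin 3 → SmoothFun M} {θ : SmoothFun M} (hθ : θ p = 1)
    (h : ∀ X : VField M, θ • X = ∑ i, (θ * X.deriv (x i)) • E i) (hE : ∀ i, L (E i) p = 0)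
    (X : VField M) : L X p = 0 := by
  rw [linearMap_apply_eq L hθ h X]
  exact Finset.sum_eq_zero fun i _ => by rw [hE, mul_zero]

/-- A three-form which vanishes on a frame at a point vanishes at this point. -/
theorem Form.three_apply_eq_zero (α : Form M 3) {p : M}
    {E : Fin 3 → VField M} {x : Fin 3 → SmoothFun M} {θ : SmoothFun M} (hθ : θ p = 1)
    (h : ∀ X : VField M, θ • X = ∑ i, (θ * X.deriv (x i)) • E i)
    (hE : ∀ i j k, α ![E i, E j, E k] p = 0) (X Y Z : VField M) : α ![X, Y, Z] p = 0 := by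
  have u0 : ∀ X Y Z W : VField M, Function.update ![X, Y, Z] 0 W = ![W, Y, Z] :=
    fun X Y Z W => by funext i; fin_cases i <;> rfl
  have u1 : ∀ X Y Z W : VField M, Function.update ![X, Y, Z] 1 W = ![X, W, Z] :=
    fun X Y Z W => by funext i; fin_cases i <;> rfl
  have u2 : ∀ X Y Z W : VField M, Function.update ![X, Y, Z] 2 W = ![X, Y, W] :=
    fun X Y Z W => by funext i; fin_cases i <;> rfl
  refine u0 X Y Z X ▸ linearMap_apply_eq_zero (α.toMultilinearMap.toLinearMap ![X, Y, Z] 0) hθ h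
    (fun i => ?_) X
  change α (Function.update _ _ _) p = 0
  refine (u0 X Y Z (E i)).symm ▸ u1 (E i) Y Z Y ▸
    linearMap_apply_eq_zero (α.toMultilinearMap.toLinearMap ![E i, Y, Z] 1) hθ h (fun j => ?_) Y
  change α (Function.update _ _ _) p = 0
  refine (u1 (E i) Y Z (E j)).symm ▸ u2 (E i) (E j) Z Z ▸
    linearMap_apply_eq_zero (α.toMultilinearMap.toLinearMap ![E i, E j, Z] 2) hθ h (fun k => ?_) Z
  change α (Function.update _ _ _) p = 0
  rw [u2]; exact hE i j k

/-- An alternating `C^∞(M)`-multilinear map of four vector fields on a three-manifold vanishes. -/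
theorem CovDensity.eq_zero_of_alternating (T : CovDensity M)
    (h : ∀ X Y Z, T X ![X, Y, Z] = 0) : T = 0 := by
  refine LinearMap.ext fun ξ => Form.ext_three fun X Y Z => ?_
  ext p
  obtain ⟨E, x, θ, hθ, hE, -⟩ := exists_frame p
  have hskew : ∀ X X' Y Z, T X ![X', Y, Z] = -T X' ![X, Y, Z] := fun X X' Y Z => by
    have h1 := h (X + X') Y Z
    rw [map_add, AlternatingMap.add_apply, Form.three_add, Form.three_add, h X, h X'] at h1
    linear_combination h1
  have key : ∀ i X Y Z, T (E i) ![X, Y, Z] p = 0 := by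
    intro i
    refine Form.three_apply_eq_zero (T (E i)) hθ hE fun j k l => ?_
    -- two of four indices of a frame with three members coincide
    have hp : ∀ i j k l : Fin 3, i = j ∨ i = k ∨ i = l ∨ j = k ∨ j = l ∨ k = l := by decide
    have h0 : T (E i) ![E j, E k, E l] = 0 := by
      rcases hp i j k l with rfl | rfl | rfl | rfl | rfl | rfl
      · exact h _ _ _
      · rw [Form.three_swap₀₁, h, neg_zero]
      · rw [Form.three_swap₁₂, Form.three_swap₀₁, h, neg_zero, neg_zero]
      · exact (T (E i)).map_eq_zero_of_eq _ (i := 0) (j := 1) rfl (by decide)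
      · exact (T (E i)).map_eq_zero_of_eq _ (i := 0) (j := 2) rfl (by decide)
      · exact (T (E i)).map_eq_zero_of_eq _ (i := 1) (j := 2) rfl (by decide)
    rw [h0]; rfl
  let L : VField M →ₗ[SmoothFun M] SmoothFun M :=
    { toFun := fun ξ => T ξ ![X, Y, Z]
      map_add' := fun ξ η => by rw [map_add, AlternatingMap.add_apply]
      map_smul' := fun f ξ => by rw [map_smul, AlternatingMap.smul_apply]; rfl }
  exact linearMap_apply_eq_zero L hθ hE (fun i => key i X Y Z) ξ

namespace Form

/-- The contraction of the four-form `α ∧ ν` vanishes. -/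
theorem contr_one_wedge_three (ξ : VField M) (α : Form M 1) (ν : Form M 3) :
    (wedge (contr ξ α : Form M 0) ν : Form M (0 + 3)) =
      (wedge α (contr ξ ν : Form M 2) : Form M (1 + 2)) := by
  let T : CovDensity M :=
    { toFun := fun ξ => α ![ξ] • ν - (wedge α (contr ξ ν : Form M 2) : Form M (1 + 2))
      map_add' := fun ξ η => by
        rw [one_add, add_smul, contr_add, wedge_add]; abel
      map_smul' := fun f ξ => by
        rw [one_smul, contr_smul, wedge_smul, mul_smul, RingHom.id_apply, smul_sub] }
  have hT : T = 0 := CovDensity.eq_zero_of_alternating T fun X Y Z => by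
    change α ![X] * ν ![X, Y, Z] - (wedge α (contr X ν : Form M 2) : Form M (1 + 2)) ![X, Y, Z] = 0
    rw [wedge_one_two, contr_three, contr_three, contr_three,
      show ν ![X, X, Z] = 0 from ν.map_eq_zero_of_eq _ (i := 0) (j := 1) rfl (by decide),
      show ν ![X, X, Y] = 0 from ν.map_eq_zero_of_eq _ (i := 0) (j := 1) rfl (by decide)]
    ring
  exact (zero_wedge_three _ ν).trans (sub_eq_zero.1 (LinearMap.congr_fun hT ξ))

/-- The contraction of the four-form `α ∧ β` vanishes. -/
theorem contr_two_wedge_two (ξ : VField M) (α β : Form M 2) :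
    (wedge (contr ξ α : Form M 1) β : Form M (1 + 2)) =
      -(wedge (contr ξ β : Form M 1) α : Form M (1 + 2)) := by
  let T : CovDensity M :=
    { toFun := fun ξ => (wedge (contr ξ α : Form M 1) β : Form M (1 + 2)) +
        (wedge (contr ξ β : Form M 1) α : Form M (1 + 2))
      map_add' := fun ξ η => by
        rw [contr_add, contr_add, add_wedge, add_wedge]; abel
      map_smul' := fun f ξ => by
        rw [contr_smul, contr_smul, smul_wedge, smul_wedge, RingHom.id_apply, smul_add] }
  have hT : T = 0 := CovDensity.eq_zero_of_alternating T fun X Y Z => by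
    change (wedge (contr X α : Form M 1) β : Form M (1 + 2)) ![X, Y, Z] +
      (wedge (contr X β : Form M 1) α : Form M (1 + 2)) ![X, Y, Z] = 0
    simp only [wedge_one_two, contr_two, two_self]
    ring
  exact eq_neg_of_add_eq_zero_left (LinearMap.congr_fun hT ξ)

theorem three_smul' (α : Form M 3) (f : SmoothFun M) (X Y Z : VField M) :
    α ![X, f • Y, Z] = f * α ![X, Y, Z] :=
  two_smul (contr X α) f Y Z

theorem three_smul'' (α : Form M 3) (f : SmoothFun M) (X Y Z : VField M) :
    α ![X, Y, f • Z] = f * α ![X, Y, Z] :=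
  two_smul' (contr X α) f Z Y

/-- Cartan's formula for three-forms. The difference of the two sides is the contraction of the
four-form `dν`: it is `C^∞(M)`-linear in `ξ` and alternating in `ξ` and the three arguments. -/
theorem lie_three_eq (ξ : VField M) (ν : Form M 3) : lie ξ ν = d₂ (contr ξ ν) := by
  let T : CovDensity M :=
    { toFun := fun ξ => lie ξ ν - d₂ (contr ξ ν)
      map_add' := fun ξ η => by
        rw [contr_add, map_add, add_lie]; abel
      map_smul' := fun f ξ => ext_three fun X Y Z => by
        simp only [AlternatingMap.sub_apply, AlternatingMap.smul_apply, RingHom.id_apply,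
          lie_three, d₂_apply, contr_three, VField.smul_deriv, VField.smul_bracket, three_sub,
          three_sub', three_sub'', three_smul, three_smul', three_smul'', VField.deriv_mul,
          smul_eq_mul]
        rw [three_swap₀₁ ν ξ X Z, three_swap₁₂ ν X ξ Y, three_swap₀₁ ν ξ X Y]
        ring }
  have hT : T = 0 := CovDensity.eq_zero_of_alternating T fun X Y Z => by
    change lie X ν ![X, Y, Z] - d₂ (contr X ν) ![X, Y, Z] = 0
    have h0 : ∀ Y, ν ![X, X, Y] = 0 :=
      fun Y => ν.map_eq_zero_of_eq _ (i := 0) (j := 1) rfl (by decide)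
    have h1 : ∀ Y, ν ![X, Y, X] = 0 :=
      fun Y => ν.map_eq_zero_of_eq _ (i := 0) (j := 2) rfl (by decide)
    simp only [lie_three, d₂_apply, contr_three, h0, h1, VField.bracket_self, VField.deriv_zero]
    rw [three_swap₁₂ ν X Y (X.bracket Z),
      show ν ![0, Y, Z] = 0 from ν.map_coord_zero (0 : Fin 3) rfl]
    ring
  exact sub_eq_zero.1 (LinearMap.congr_fun hT ξ)

end Form
end Tensoriality

section Tensors
variable {P P' R U W : Type*} [AddCommGroup P] [Module ℝ P] [AddCommGroup P'] [Module ℝ P']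
  [AddCommGroup R] [Module ℝ R] [AddCommGroup U] [Module ℝ U] [AddCommGroup W] [Module ℝ W]

/-- A skew adjunction between operators on forms carries over to forms whose coefficients are
multiplied by a symmetric map; see `map₂_adjoint_of_skew` for a skew-symmetric one. -/
theorem map₂_skewAdjoint (w : P' →ₗ[ℝ] P →ₗ[ℝ] R) (D : P →ₗ[ℝ] P')
    (h : ∀ α β, w (D α) β = -w (D β) α) (m : U →ₗ[ℝ] U →ₗ[ℝ] W) (hm : ∀ X Y, m X Y = m Y X)
    (a b : P ⊗[ℝ] U) :
    TensorProduct.map₂ w m (D.rTensor U a) b = -TensorProduct.map₂ w m (D.rTensor U b) a := by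
  induction a using TensorProduct.induction_on with
  | zero => simp
  | add a a' ha ha' => simp only [map_add, LinearMap.add_apply, ha, ha']; abel
  | tmul α X =>
    induction b using TensorProduct.induction_on with
    | zero => simp
    | add b b' hb hb' => simp only [map_add, LinearMap.add_apply, hb, hb']; abel
    | tmul β Y =>
      simp only [LinearMap.rTensor_tmul, TensorProduct.map₂_apply_tmul, TensorProduct.map_tmul]
      rw [h, hm, TensorProduct.neg_tmul]

end Tensors

namespace GForm
variable {M : Type*} [TopologicalSpace M] [ChartedSpace E3 M] [IsManifold (𝓡 3) ∞ M]
  [T2Space M] [SigmaCompactSpace M]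
variable {𝔤 : Type*} [LieRing 𝔤] [LieAlgebra ℝ 𝔤] (Tr : 𝔤 →ₗ[ℝ] 𝔤 →ₗ[ℝ] ℝ)

theorem tr₀₃_contr (ξ : VField M) (a : GForm M 𝔤 1) (b : GForm M 𝔤 3) :
    tr₀₃ Tr (contr ξ a) b = tr₁₂ Tr a (contr ξ b) :=
  congrArg (TensorProduct.rid ℝ (Form M 3))
    (map₂_adjoint (Form.wedgeBilin (M := M) 0 3) (Form.wedgeBilin (M := M) 1 2) (Form.contr ξ)
        (Form.contr ξ)
      (Form.contr_one_wedge_three ξ) Tr a b)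

theorem tr₁₂_contr {Tr : 𝔤 →ₗ[ℝ] 𝔤 →ₗ[ℝ] ℝ} (hsymm : ∀ X Y, Tr X Y = Tr Y X) (ξ : VField M)
    (a b : GForm M 𝔤 2) : tr₁₂ Tr (contr ξ a) b = -tr₁₂ Tr (contr ξ b) a :=
  (congrArg (TensorProduct.rid ℝ (Form M 3))
    (map₂_skewAdjoint (Form.wedgeBilin (M := M) 1 2) (Form.contr ξ) (Form.contr_two_wedge_two ξ) Tr
        hsymm
      a b)).trans (map_neg (TensorProduct.rid ℝ (Form M 3)) _)

theorem lie_three_eq (ξ : VField M) (a : GForm M 𝔤 3) : lie ξ a = d₂ (contr ξ a) :=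
  LinearMap.congr_fun (f := lie ξ) (g := d₂ ∘ₗ contr ξ)
    (TensorProduct.ext' fun α X => congrArg (· ⊗ₜ X) (Form.lie_three_eq ξ α)) a

end GForm
end ChernSimons

namespace ChernSimons

/-! ### Homotopy relations in low arity -/

section LInfinity
variable {V V' : Type*} [AddCommGroup V] [Module ℝ V] [AddCommGroup V'] [Module ℝ V']

theorem sgn_even {m : ℤ} (h : Even m) : sgn m = 1 := if_pos h
theorem sgn_odd {m : ℤ} (h : Odd m) : sgn m = -1 := if_neg (Int.not_even_iff_odd.2 h)

theorem koszulSign_one {n : ℕ} (d : Fin n → ℤ) : koszulSign 1 d = 1 := by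
  refine Finset.prod_eq_one fun i _ => Finset.prod_eq_one fun j _ => if_neg ?_
  rintro ⟨h, h'⟩; exact lt_asymm h h'

theorem koszulSign_swap (d : Fin 2 → ℤ) : koszulSign (Equiv.swap 0 1) d = -sgn (d 1 * d 0) := by
  simp [koszulSign, Fin.prod_univ_two]

/-- With one argument, the homotopy sum for `f = ℓ` is the square of the differential. -/
theorem homotopySum_one (f : (n : ℕ) → (Fin n → V) → V') (ℓ : (n : ℕ) → (Fin n → V) → V)
    (d : Fin 1 → ℤ) (v : Fin 1 → V) : homotopySum f ℓ d v = f 1 ![ℓ 1 ![v 0]] := by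
  have h1 : (Finset.univ : Finset (Equiv.Perm (Fin 1))) = {1} := by decide
  rw [homotopySum, Fin.sum_univ_one, h1, Finset.sum_filter, Finset.sum_singleton,
    if_pos (by unfold IsShuffle; decide), koszulSign_one, _root_.one_smul, sgn_even (by decide),
    _root_.one_smul]
  refine congrArg (f 1) (funext fun j => ?_)
  fin_cases j
  exact congrArg (ℓ 1) (funext fun k => by fin_cases k; rfl)

/-- With two arguments, the vanishing of the homotopy sum for `f = ℓ` is the Leibniz rule. -/
theorem homotopySum_two (f : (n : ℕ) → (Fin n → V) → V') (ℓ : (n : ℕ) → (Fin n → V) → V)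
    (d : Fin 2 → ℤ) (v : Fin 2 → V) : homotopySum f ℓ d v =
      -(f 2 ![ℓ 1 ![v 0], v 1] - sgn (d 1 * d 0) • f 2 ![ℓ 1 ![v 1], v 0]) +
        f 1 ![ℓ 2 ![v 0, v 1]] := by
  have hne : (1 : Equiv.Perm (Fin 2)) ∉ ({Equiv.swap 0 1} : Finset (Equiv.Perm (Fin 2))) := by
    decide
  rw [homotopySum, Fin.sum_univ_two, Form.univ_perm_two, Finset.sum_filter, Finset.sum_filter,
    Finset.sum_insert hne, Finset.sum_insert hne, Finset.sum_singleton, Finset.sum_singleton,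
    if_pos (by unfold IsShuffle; decide), if_pos (by unfold IsShuffle; decide),
    if_pos (by unfold IsShuffle; decide), if_neg (by unfold IsShuffle; decide),
    koszulSign_one, koszulSign_swap, _root_.one_smul, _root_.one_smul, add_zero]
  have s0 : sgn ((((0 : Fin 2) : ℕ) + 1) * ((2 : ℕ) - (((0 : Fin 2) : ℕ) + 1))) = -1 :=
    sgn_odd (by decide)
  have s1 : sgn ((((1 : Fin 2) : ℕ) + 1) * ((2 : ℕ) - (((1 : Fin 2) : ℕ) + 1))) = 1 :=
    sgn_even (by decide)
  rw [s0, s1, _root_.one_smul, neg_smul, neg_smul, _root_.one_smul, ← sub_eq_add_neg]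
  have e0 : ∀ σ : Equiv.Perm (Fin 2), (f (2 - ((0 : Fin 2) : ℕ)) fun j => if (j : ℕ) = 0 then
      ℓ (((0 : Fin 2) : ℕ) + 1) fun k => v (σ ⟨k, by omega⟩)
        else v (σ ⟨((0 : Fin 2) : ℕ) + j, by omega⟩)) = f 2 ![ℓ 1 ![v (σ 0)], v (σ 1)] :=
    fun σ => congrArg (f 2) (funext fun j => by
      fin_cases j
      · exact congrArg (ℓ 1) (funext fun k => by fin_cases k; rfl)
      · rfl)
  have e1 : (f (2 - ((1 : Fin 2) : ℕ)) fun j => if (j : ℕ) = 0 then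
      ℓ (((1 : Fin 2) : ℕ) + 1) fun k => v ((1 : Equiv.Perm (Fin 2)) ⟨k, by omega⟩)
        else v ((1 : Equiv.Perm (Fin 2)) ⟨((1 : Fin 2) : ℕ) + j, by omega⟩)) =
          f 1 ![ℓ 2 ![v 0, v 1]] :=
    congrArg (f 1) (funext fun j => by
      fin_cases j
      exact congrArg (ℓ 2) (funext fun k => by fin_cases k <;> rfl))
  exact congrArg₂ (· + ·) (congrArg Neg.neg (congrArg₂ (· - ·) (e0 1)
    (congrArg (sgn (d 1 * d 0) • ·) (e0 (Equiv.swap 0 1))))) e1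

theorem koszulSign_swap₁₂ (d : Fin 3 → ℤ) :
    koszulSign (Equiv.swap 1 2) d = -sgn (d 2 * d 1) := by
  have h0 : Equiv.swap (1 : Fin 3) 2 0 = 0 := by decide
  have h1 : Equiv.swap (1 : Fin 3) 2 1 = 2 := by decide
  have h2 : Equiv.swap (1 : Fin 3) 2 2 = 1 := by decide
  simp [koszulSign, Fin.prod_univ_three, h0, h1, h2]

theorem koszulSign_finRotate (d : Fin 3 → ℤ) :
    koszulSign (finRotate 3) d = sgn (d 1 * d 0) * sgn (d 2 * d 0) := by
  have h0 : finRotate 3 0 = 1 := by decide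
  have h1 : finRotate 3 1 = 2 := by decide
  have h2 : finRotate 3 2 = 0 := by decide
  simp only [koszulSign, Fin.prod_univ_three, h0, h1, h2]
  simp

/-- With three arguments, the vanishing of the homotopy sum for `f = ℓ` is the Jacobi identity,
provided that there are no trilinear maps. -/
theorem homotopySum_three (f : (n : ℕ) → (Fin n → V) → V') (ℓ : (n : ℕ) → (Fin n → V) → V)
    (hf3 : ∀ v, f 3 v = 0) (hℓ3 : ∀ v, ℓ 3 v = 0) (hf1 : ∀ v : Fin 1 → V, v 0 = 0 → f 1 v = 0)
    (d : Fin 3 → ℤ) (v : Fin 3 → V) : homotopySum f ℓ d v =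
      f 2 ![ℓ 2 ![v 0, v 1], v 2] - sgn (d 2 * d 1) • f 2 ![ℓ 2 ![v 0, v 2], v 1] +
        (sgn (d 1 * d 0) * sgn (d 2 * d 0)) • f 2 ![ℓ 2 ![v 1, v 2], v 0] := by
  have hfilter : ∀ inst : DecidablePred fun σ : Equiv.Perm (Fin 3) => IsShuffle 2 σ,
      @Finset.filter _ (fun σ : Equiv.Perm (Fin 3) => IsShuffle 2 σ) inst Finset.univ =
        {1, Equiv.swap 1 2, finRotate 3} := by
    have hdec : ∀ σ : Equiv.Perm (Fin 3), (∀ a b : Fin 3, a < b →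
        ((b : ℕ) < 2 ∨ 2 ≤ (a : ℕ)) → σ a < σ b) ↔
          σ ∈ ({1, Equiv.swap 1 2, finRotate 3} : Finset (Equiv.Perm (Fin 3))) := by decide
    intro inst
    ext σ
    exact (Finset.mem_filter.trans (and_iff_right (Finset.mem_univ σ))).trans (hdec σ)
  have hn1 : (1 : Equiv.Perm (Fin 3)) ∉
      ({Equiv.swap 1 2, finRotate 3} : Finset (Equiv.Perm (Fin 3))) := by decide
  have hn2 : Equiv.swap 1 2 ∉ ({finRotate 3} : Finset (Equiv.Perm (Fin 3))) := by decide
  have s1 : sgn ((((1 : Fin 3) : ℕ) + 1) * ((3 : ℕ) - (((1 : Fin 3) : ℕ) + 1))) = 1 :=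
    sgn_even (by decide)
  have e1 : ∀ σ : Equiv.Perm (Fin 3), (f (3 - ((1 : Fin 3) : ℕ)) fun j => if (j : ℕ) = 0 then
      ℓ (((1 : Fin 3) : ℕ) + 1) fun k => v (σ ⟨k, by omega⟩)
        else v (σ ⟨((1 : Fin 3) : ℕ) + j, by omega⟩)) =
          f 2 ![ℓ 2 ![v (σ 0), v (σ 1)], v (σ 2)] :=
    fun σ => congrArg (f 2) (funext fun j => by
      fin_cases j
      · exact congrArg (ℓ 2) (funext fun k => by fin_cases k <;> rfl)
      · rfl)
  have e := (congrArg₂ (· + ·) (congrArg₂ (· - ·) (e1 1)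
    (congrArg (sgn (d 2 * d 1) • ·) (e1 (Equiv.swap 1 2))))
      (congrArg ((sgn (d 1 * d 0) * sgn (d 2 * d 0)) • ·) (e1 (finRotate 3))))
  refine Eq.trans ?_ e
  rw [homotopySum, Fin.sum_univ_three]
  have t0 : ∀ σ : Equiv.Perm (Fin 3), (f (3 - ((0 : Fin 3) : ℕ)) fun j => if (j : ℕ) = 0 then
      ℓ (((0 : Fin 3) : ℕ) + 1) fun k => v (σ ⟨k, by omega⟩)
        else v (σ ⟨((0 : Fin 3) : ℕ) + j, by omega⟩)) = 0 := fun σ => hf3 _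
  have t2 : ∀ σ : Equiv.Perm (Fin 3), (f (3 - ((2 : Fin 3) : ℕ)) fun j => if (j : ℕ) = 0 then
      ℓ (((2 : Fin 3) : ℕ) + 1) fun k => v (σ ⟨k, by omega⟩)
        else v (σ ⟨((2 : Fin 3) : ℕ) + j, by omega⟩)) = 0 := fun σ => hf1 _ (hℓ3 _)
  have aux : ∀ a b c e : V', a = 0 → c = 0 → b = e → a + b + c = e := by
    rintro a b c e rfl rfl rfl; simp
  refine aux _ _ _ _ ?_ ?_ ?_
  · rw [Finset.sum_eq_zero fun σ _ => (congrArg (koszulSign σ d • ·) (t0 σ)).trans (smul_zero _),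
      smul_zero]
  · rw [Finset.sum_eq_zero fun σ _ => (congrArg (koszulSign σ d • ·) (t2 σ)).trans (smul_zero _),
      smul_zero]
  rw [s1, _root_.one_smul]
  refine (Finset.sum_congr (hfilter _) fun _ _ => rfl).trans ?_
  rw [Finset.sum_insert hn1, Finset.sum_insert hn2, Finset.sum_singleton, koszulSign_one,
    koszulSign_swap₁₂, koszulSign_finRotate, _root_.one_smul, neg_smul, ← add_assoc,
    ← sub_eq_add_neg]

/-- With four or more arguments, every term of the homotopy sum contains a map with at least three
arguments. -/
theorem homotopySum_of_four_le (f : (n : ℕ) → (Fin n → V) → V') (ℓ : (n : ℕ) → (Fin n → V) → V)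
    (hf : ∀ n, 3 ≤ n → ∀ v, f n v = 0) (hℓ : ∀ n, 3 ≤ n → ∀ v, ℓ n v = 0)
    (hf0 : ∀ n (v : Fin n → V) (j : Fin n), v j = 0 → f n v = 0) {n : ℕ} (hn : 4 ≤ n)
    (d : Fin n → ℤ) (v : Fin n → V) : homotopySum f ℓ d v = 0 := by
  refine Finset.sum_eq_zero fun i _ => ?_
  rw [Finset.sum_eq_zero, smul_zero]
  intro σ _
  by_cases hi : 2 ≤ (i : ℕ)
  · rw [hf0 _ _ ⟨0, by omega⟩, smul_zero]
    exact (if_pos rfl).trans (hℓ _ (by omega) _)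
  · rw [hf _ (by omega), smul_zero]

/-- The contribution of the composition of `n` with a single block. -/
theorem morphismSum_single_term (ψ : (n : ℕ) → (Fin n → V) → V')
    (ℓ' : (n : ℕ) → (Fin n → V') → V') {n : ℕ} (hn : 0 < n) (d : Fin n → ℤ) (v : Fin n → V)
    (inst : DecidablePred fun σ : Equiv.Perm (Fin n) =>
      IsMultiShuffle (Composition.single n hn) σ) :
    (((Composition.single n hn).length.factorial : ℝ)⁻¹ *
        sgn ((Composition.single n hn).length * ((Composition.single n hn).length - 1) / 2)) •
      ∑ σ : Equiv.Perm (Fin n) with IsMultiShuffle (Composition.single n hn) σ,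
        (sgn (∑ j : Fin (Composition.single n hn).length,
            (((Composition.single n hn).length : ℤ) - ((j : ℕ) + 1)) *
              (Composition.single n hn).blocksFun j +
            ∑ j : Fin (Composition.single n hn).length,
              (1 - ((Composition.single n hn).blocksFun j : ℤ)) *
              ∑ l ∈ Finset.univ.filter
                (fun l : Fin n => (l : ℕ) < (Composition.single n hn).sizeUpTo j), d (σ l)) *
                  koszulSign σ d) •
          (ℓ' (Composition.single n hn).length fun j => ψ ((Composition.single n hn).blocksFun j)
            fun l => v (σ ((Composition.single n hn).embedding j l))) = ℓ' 1 ![ψ n v] := by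
  -- a shuffle with a single block is a strictly monotone permutation
  have hσ : Finset.univ.filter (fun σ : Equiv.Perm (Fin n) =>
      IsMultiShuffle (Composition.single n hn) σ) = {1} := by
    ext σ
    refine (Finset.mem_filter.trans (and_iff_right (Finset.mem_univ σ))).trans ?_
    rw [Finset.mem_singleton]
    constructor
    · intro h
      have h0 : StrictMono fun l : Fin n => σ l := fun a b hab => by
        have := h (0 : Fin 1) (a := a) (b := b) hab
        simpa using this
      have h1 : h0.orderIsoOfSurjective _ σ.surjective = OrderIso.refl (Fin n) :=
        Subsingleton.elim _ _
      exact Equiv.ext fun i => congrArg (fun e : Fin n ≃o Fin n => e i) h1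
    · rintro rfl j a b hab
      exact ((Composition.single n hn).embedding j).strictMono hab
  have h0 : ∑ j : Fin (Composition.single n hn).length,
      (((Composition.single n hn).length : ℤ) - ((j : ℕ) + 1)) *
        (Composition.single n hn).blocksFun j = 0 :=
    Finset.sum_eq_zero fun j _ => by
      have : (j : ℕ) = 0 := Nat.lt_one_iff.1 j.2
      simp [this]
  have h1 : ∑ j : Fin (Composition.single n hn).length,
      (1 - ((Composition.single n hn).blocksFun j : ℤ)) *
        ∑ l ∈ Finset.univ.filter (fun l : Fin n => (l : ℕ) <
          (Composition.single n hn).sizeUpTo j), d ((1 : Equiv.Perm (Fin n)) l) = 0 :=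
    Finset.sum_eq_zero fun j _ => by
      have : (j : ℕ) = 0 := Nat.lt_one_iff.1 j.2
      simp [this]
  have h2 : ((Composition.single n hn).length.factorial : ℝ)⁻¹ *
      sgn ((Composition.single n hn).length * ((Composition.single n hn).length - 1) / 2) = 1 := by
    simp [Composition.single_length, sgn]
  rw [hσ, Finset.sum_singleton, h0, h1, h2, koszulSign_one, sgn_even (by decide), mul_one,
    _root_.one_smul, _root_.one_smul]
  refine congrArg (ℓ' 1) (funext fun j => ?_)
  obtain ⟨j, hj⟩ := j
  obtain rfl : j = 0 := Nat.lt_one_iff.1 hj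
  exact congrArg (ψ n) (funext fun l => congrArg v (Composition.single_embedding hn l))

theorem morphismSum_one (ψ : (n : ℕ) → (Fin n → V) → V') (ℓ' : (n : ℕ) → (Fin n → V') → V')
    (d : Fin 1 → ℤ) (v : Fin 1 → V) : morphismSum ψ ℓ' d v = ℓ' 1 ![ψ 1 ![v 0]] := by
  have hu : (Finset.univ : Finset (Composition 1)) = {Composition.single 1 one_pos} := by
    refine Finset.eq_singleton_iff_unique_mem.2 ⟨Finset.mem_univ _, fun c _ => ?_⟩
    exact (Composition.eq_single_iff_length one_pos).2
      (le_antisymm c.length_le (c.length_pos_of_pos one_pos))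
  rw [morphismSum, hu, Finset.sum_singleton]
  refine (morphismSum_single_term ψ ℓ' one_pos d v _).trans ?_
  exact congrArg (fun x => ℓ' 1 ![ψ 1 x]) (funext fun j => by fin_cases j; rfl)

/-- The two compositions of `2` contribute the differential of the quadratic component and the
bracket of the linear components. -/
theorem morphismSum_two (ψ : (n : ℕ) → (Fin n → V) → V') (ℓ' : (n : ℕ) → (Fin n → V') → V')
    (d : Fin 2 → ℤ) (v : Fin 2 → V) : morphismSum ψ ℓ' d v = ℓ' 1 ![ψ 2 ![v 0, v 1]] +
      (1 / 2 : ℝ) • (ℓ' 2 ![ψ 1 ![v 0], ψ 1 ![v 1]] -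
        sgn (d 1 * d 0) • ℓ' 2 ![ψ 1 ![v 1], ψ 1 ![v 0]]) := by
  have hu : (Finset.univ : Finset (Composition 2)) =
      {Composition.single 2 two_pos, Composition.ones 2} := by
    ext c
    have h1 := c.length_le
    have h2 := c.length_pos_of_pos two_pos
    rw [Finset.mem_insert, Finset.mem_singleton, Composition.eq_single_iff_length,
      Composition.eq_ones_iff_length]
    exact iff_of_true (Finset.mem_univ c) (by omega)
  have hne : Composition.single 2 two_pos ∉ ({Composition.ones 2} : Finset (Composition 2)) := by
    decide
  rw [morphismSum, hu, Finset.sum_insert hne, Finset.sum_singleton]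
  refine congrArg₂ (· + ·) ((morphismSum_single_term ψ ℓ' two_pos d v _).trans ?_) ?_
  · exact congrArg (fun x => ℓ' 1 ![ψ 2 x]) (funext fun j => by fin_cases j <;> rfl)
  have hσ : ∀ inst : DecidablePred fun σ : Equiv.Perm (Fin 2) =>
      IsMultiShuffle (Composition.ones 2) σ, @Finset.filter _
        (fun σ : Equiv.Perm (Fin 2) => IsMultiShuffle (Composition.ones 2) σ) inst Finset.univ =
          {1, Equiv.swap 0 1} := fun inst => by
    rw [Finset.filter_true_of_mem, Form.univ_perm_two]
    intro σ _ j a b hab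
    have ha : (a : ℕ) < 1 := by simpa using a.2
    have hb : (b : ℕ) < 1 := by simpa using b.2
    have : (a : ℕ) < b := hab
    omega
  have h2 : ((Composition.ones 2).length.factorial : ℝ)⁻¹ *
      sgn ((Composition.ones 2).length * ((Composition.ones 2).length - 1) / 2) = -(1 / 2) := by
    have : sgn (1 : ℤ) = -1 := sgn_odd (by decide)
    simp [Composition.ones_length, this]
  have h3 : ∀ σ : Equiv.Perm (Fin 2), (sgn (∑ j : Fin (Composition.ones 2).length,
      (((Composition.ones 2).length : ℤ) - ((j : ℕ) + 1)) * (Composition.ones 2).blocksFun j +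
        ∑ j : Fin (Composition.ones 2).length, (1 - ((Composition.ones 2).blocksFun j : ℤ)) *
          ∑ l ∈ Finset.univ.filter
            (fun l : Fin 2 => (l : ℕ) < (Composition.ones 2).sizeUpTo j), d (σ l)) *
              koszulSign σ d) • (ℓ' (Composition.ones 2).length fun j =>
                ψ ((Composition.ones 2).blocksFun j) fun l =>
                  v (σ ((Composition.ones 2).embedding j l))) =
      -(koszulSign σ d • ℓ' 2 ![ψ 1 ![v (σ 0)], ψ 1 ![v (σ 1)]]) := fun σ => by
    have h4 : ∑ j : Fin (Composition.ones 2).length,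
        (((Composition.ones 2).length : ℤ) - ((j : ℕ) + 1)) * (Composition.ones 2).blocksFun j =
          1 := (Fin.sum_univ_two (M := ℤ) _).trans (by decide)
    have h5 : ∑ j : Fin (Composition.ones 2).length, (1 - ((Composition.ones 2).blocksFun j : ℤ)) *
          ∑ l ∈ Finset.univ.filter
            (fun l : Fin 2 => (l : ℕ) < (Composition.ones 2).sizeUpTo j), d (σ l) = 0 :=
      Finset.sum_eq_zero fun j _ => by simp
    rw [h4, h5, sgn_odd (by decide), neg_one_mul, neg_smul]
    refine congrArg (fun x => -(koszulSign σ d • x)) (congrArg (ℓ' 2) (funext fun j => ?_))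
    fin_cases j
    · exact congrArg (ψ 1) (funext fun l => by fin_cases l; rfl)
    · exact congrArg (ψ 1) (funext fun l => by fin_cases l; rfl)
  rw [Finset.sum_congr (hσ _) fun σ _ => h3 σ, h2, Finset.sum_insert (by decide),
    Finset.sum_singleton, koszulSign_one, koszulSign_swap, _root_.one_smul, neg_smul, neg_smul,
    neg_neg, neg_add_eq_sub, ← smul_neg, neg_sub]
  rfl

theorem morphismSum_eq_zero (ψ : (n : ℕ) → (Fin n → V) → V') (ℓ' : (n : ℕ) → (Fin n → V') → V')
    {n : ℕ} (h : ∀ (m : ℕ) (k : Fin m → ℕ) (x : (i : Fin m) → Fin (k i) → V), ∑ i, k i = n →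
      ℓ' m (fun i => ψ (k i) (x i)) = 0) (d : Fin n → ℤ) (v : Fin n → V) :
    morphismSum ψ ℓ' d v = 0 := by
  refine Finset.sum_eq_zero fun c _ => ?_
  rw [Finset.sum_eq_zero fun σ _ => ?_, smul_zero]
  rw [h _ _ _ c.sum_blocksFun, smul_zero]

end LInfinity
end ChernSimons

namespace ChernSimons

/-! ### A criterion for differential graded Lie algebras -/

section LInfinity
variable {V : Type*} [AddCommGroup V] [Module ℝ V]

theorem sgn_mul_self (m : ℤ) : sgn m * sgn m = 1 := by
  unfold sgn; split_ifs <;> norm_num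

theorem sgn_eq (m : ℤ) : sgn m = 1 ∨ sgn m = -1 := by
  unfold sgn; split_ifs <;> simp

/-- The Jacobiator of a graded antisymmetric bracket. -/
noncomputable def jacobiator (b : V → V → V) (d₀ d₁ d₂ : ℤ) (x y z : V) : V :=
  b (b x y) z - sgn (d₂ * d₁) • b (b x z) y + (sgn (d₁ * d₀) * sgn (d₂ * d₀)) • b (b y z) x

/-- By graded antisymmetry, the Jacobi identity needs to be checked only for arguments whose
degrees are in increasing order. -/
theorem jacobiator_eq_zero_of_sorted (𝒱 : ℤ → Submodule ℝ V) (b : V → V → V)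
    (hsmul : ∀ (c : ℝ) x y, b (c • x) y = c • b x y)
    (hanti : ∀ i j, ∀ x ∈ 𝒱 i, ∀ y ∈ 𝒱 j, b y x = (-sgn (i * j)) • b x y)
    (h : ∀ i j k, i ≤ j → j ≤ k → ∀ x ∈ 𝒱 i, ∀ y ∈ 𝒱 j, ∀ z ∈ 𝒱 k,
      jacobiator b i j k x y z = 0) (i j k : ℤ) (x y z : V) (hx : x ∈ 𝒱 i) (hy : y ∈ 𝒱 j)
    (hz : z ∈ 𝒱 k) : jacobiator b i j k x y z = 0 := by
  -- transpositions of neighbouring arguments change the Jacobiator by a sign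
  have s01 : ∀ i j k x y z, x ∈ 𝒱 i → y ∈ 𝒱 j → z ∈ 𝒱 k → jacobiator b j i k y x z = 0 →
      jacobiator b i j k x y z = 0 := by
    intro i j k x y z hx hy hz h0
    have h1 : jacobiator b i j k x y z = (-sgn (i * j)) • jacobiator b j i k y x z := by
      simp only [jacobiator, hanti i j x hx y hy, hsmul, smul_add, smul_sub, smul_smul,
        mul_comm j i]
      rcases sgn_eq (i * j) with e | e <;> rw [e] <;> module
    rw [h1, h0, smul_zero]
  have s12 : ∀ i j k x y z, x ∈ 𝒱 i → y ∈ 𝒱 j → z ∈ 𝒱 k → jacobiator b i k j x z y = 0 →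
      jacobiator b i j k x y z = 0 := by
    intro i j k x y z hx hy hz h0
    have h1 : jacobiator b i j k x y z = (-sgn (j * k)) • jacobiator b i k j x z y := by
      simp only [jacobiator, hanti j k y hy z hz, hsmul, smul_add, smul_sub, smul_smul,
        mul_comm k j]
      rcases sgn_eq (j * k) with e | e <;> rw [e] <;> module
    rw [h1, h0, smul_zero]
  rcases le_total i j with h1 | h1 <;> rcases le_total j k with h2 | h2
  · exact h i j k h1 h2 x hx y hy z hz
  · apply s12 i j k x y z hx hy hz
    rcases le_total i k with h3 | h3
    · exact h i k j h3 h2 x hx z hz y hy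
    · exact s01 i k j x z y hx hz hy (h k i j h3 h1 z hz x hx y hy)
  · apply s01 i j k x y z hx hy hz
    rcases le_total i k with h3 | h3
    · exact h j i k h1 h3 y hy x hx z hz
    · exact s12 j i k y x z hy hx hz (h j k i h2 h3 y hy z hz x hx)
  · apply s01 i j k x y z hx hy hz
    apply s12 j i k y x z hy hx hz
    exact s01 j k i y z x hy hz hx (h k j i h2 h1 z hz y hy x hx)

/-- A linear map and a graded antisymmetric bilinear map, extended by zero to `n ≥ 3` arguments,
form a graded antisymmetric family. -/
theorem isGradedAntisymmetric_of_two {V' : Type*} [AddCommGroup V'] [Module ℝ V']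
    (𝒱 : ℤ → Submodule ℝ V) (𝒱' : ℤ → Submodule ℝ V') (D : ℕ → ℤ)
    (f : (n : ℕ) → (Fin n → V) → V') (f₁ : V → V') (f₂ : V → V → V')
    (h1 : ∀ v, f 1 v = f₁ (v 0)) (h2 : ∀ v, f 2 v = f₂ (v 0) (v 1))
    (h3 : ∀ n, 3 ≤ n → ∀ v, f n v = 0)
    (add₁ : ∀ x y, f₁ (x + y) = f₁ x + f₁ y) (smul₁ : ∀ (c : ℝ) x, f₁ (c • x) = c • f₁ x)
    (add₂ : ∀ x y z, f₂ (x + y) z = f₂ x z + f₂ y z)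
    (smul₂ : ∀ (c : ℝ) x y, f₂ (c • x) y = c • f₂ x y)
    (add₂' : ∀ x y z, f₂ x (y + z) = f₂ x y + f₂ x z)
    (smul₂' : ∀ (c : ℝ) x y, f₂ x (c • y) = c • f₂ x y)
    (deg₁ : ∀ i, ∀ x ∈ 𝒱 i, f₁ x ∈ 𝒱' (D 1 + i))
    (deg₂ : ∀ i j, ∀ x ∈ 𝒱 i, ∀ y ∈ 𝒱 j, f₂ x y ∈ 𝒱' (D 2 + (i + j)))
    (anti : ∀ i j, ∀ x ∈ 𝒱 i, ∀ y ∈ 𝒱 j, f₂ y x = (-sgn (i * j)) • f₂ x y) :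
    IsGradedAntisymmetric 𝒱 𝒱' D f where
  multilinear n hn := by
    rcases (by omega : n = 1 ∨ n = 2 ∨ 3 ≤ n) with rfl | rfl | hn
    · refine ⟨{ toFun := f 1, map_update_add' := ?_, map_update_smul' := ?_ }, rfl⟩
      · intro _ v i x y
        obtain rfl : i = 0 := Subsingleton.elim _ _
        simp [h1, add₁]
      · intro _ v i c x
        obtain rfl : i = 0 := Subsingleton.elim _ _
        simp [h1, smul₁]
    · refine ⟨{ toFun := f 2, map_update_add' := ?_, map_update_smul' := ?_ }, rfl⟩
      · intro _ v i x y
        fin_cases i <;> simp [h2, add₂, add₂', Function.update]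
      · intro _ v i c x
        fin_cases i <;> simp [h2, smul₂, smul₂', Function.update]
    · exact ⟨0, funext fun v => (h3 n hn v).symm⟩
  degree n hn d v hv := by
    rcases (by omega : n = 1 ∨ n = 2 ∨ 3 ≤ n) with rfl | rfl | hn
    · rw [h1, Fin.sum_univ_one]; exact deg₁ _ _ (hv 0)
    · rw [h2, Fin.sum_univ_two]; exact deg₂ _ _ _ (hv 0) _ (hv 1)
    · rw [h3 n hn]; exact Submodule.zero_mem _
  antisymm n hn d v hv i j hij := by
    rcases (by omega : n = 1 ∨ n = 2 ∨ 3 ≤ n) with rfl | rfl | hn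
    · omega
    · obtain ⟨rfl, rfl⟩ : i = 0 ∧ j = 1 := by omega
      rw [h2, h2]; exact anti _ _ _ (hv 0) _ (hv 1)
    · rw [h3 n hn, h3 n hn, smul_zero]

/-- A criterion for differential graded Lie algebras: by graded antisymmetry, the Leibniz rule and
the Jacobi identity are needed only for arguments of non-decreasing degree. -/
theorem isDGLieAlgebra_of (𝒱 : ℤ → Submodule ℝ V) (ℓ : (n : ℕ) → (Fin n → V) → V)
    (b₁ : V → V) (b₂ : V → V → V)
    (h1 : ∀ v, ℓ 1 v = b₁ (v 0)) (h2 : ∀ v, ℓ 2 v = b₂ (v 0) (v 1))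
    (h0 : ∀ v, ℓ 0 v = 0) (h3 : ∀ n, 3 ≤ n → ∀ v, ℓ n v = 0)
    (grading : DirectSum.IsInternal 𝒱)
    (add₁ : ∀ x y, b₁ (x + y) = b₁ x + b₁ y) (smul₁ : ∀ (c : ℝ) x, b₁ (c • x) = c • b₁ x)
    (add₂ : ∀ x y z, b₂ (x + y) z = b₂ x z + b₂ y z)
    (smul₂ : ∀ (c : ℝ) x y, b₂ (c • x) y = c • b₂ x y)
    (add₂' : ∀ x y z, b₂ x (y + z) = b₂ x y + b₂ x z)
    (smul₂' : ∀ (c : ℝ) x y, b₂ x (c • y) = c • b₂ x y)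
    (deg₁ : ∀ i, ∀ x ∈ 𝒱 i, b₁ x ∈ 𝒱 (1 + i))
    (deg₂ : ∀ i j, ∀ x ∈ 𝒱 i, ∀ y ∈ 𝒱 j, b₂ x y ∈ 𝒱 (i + j))
    (anti : ∀ i j, ∀ x ∈ 𝒱 i, ∀ y ∈ 𝒱 j, b₂ y x = (-sgn (i * j)) • b₂ x y)
    (sq : ∀ x, b₁ (b₁ x) = 0)
    (leibniz : ∀ i j, i ≤ j → ∀ x ∈ 𝒱 i, ∀ y ∈ 𝒱 j,
      b₁ (b₂ x y) = b₂ (b₁ x) y - sgn (j * i) • b₂ (b₁ y) x)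
    (jacobi : ∀ i j k, i ≤ j → j ≤ k → ∀ x ∈ 𝒱 i, ∀ y ∈ 𝒱 j, ∀ z ∈ 𝒱 k,
      jacobiator b₂ i j k x y z = 0) : IsDGLieAlgebra 𝒱 ℓ where
  grading := grading
  higher := h3
  brackets := isGradedAntisymmetric_of_two 𝒱 𝒱 _ ℓ b₁ b₂ h1 h2 h3 add₁ smul₁ add₂ smul₂ add₂' smul₂'
    (fun i x hx => by simpa using deg₁ i x hx)
    (fun i j x hx y hy => by simpa using deg₂ i j x hx y hy) anti
  homotopy n hn d v hv := by
    have hz1 : b₁ 0 = 0 := by simpa using smul₁ 0 0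
    have hz2 : ∀ x, b₂ 0 x = 0 := fun x => by simpa using smul₂ 0 0 x
    have hz2' : ∀ x, b₂ x 0 = 0 := fun x => by simpa using smul₂' 0 x 0
    rcases (by omega : n = 1 ∨ n = 2 ∨ n = 3 ∨ 4 ≤ n) with rfl | rfl | rfl | hn
    · rw [homotopySum_one, h1, h1]; exact sq _
    · rw [homotopySum_two, h1, h1, h1, h2, h2, h2, neg_add_eq_zero]
      refine Eq.symm ?_
      change b₁ (b₂ (v 0) (v 1)) = b₂ (b₁ (v 0)) (v 1) - sgn (d 1 * d 0) • b₂ (b₁ (v 1)) (v 0)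
      rcases le_total (d 0) (d 1) with h | h
      · exact leibniz _ _ h _ (hv 0) _ (hv 1)
      · have e := leibniz _ _ h _ (hv 1) _ (hv 0)
        have h0 : b₁ (b₂ (v 0) (v 1)) = (-sgn (d 1 * d 0)) • b₁ (b₂ (v 1) (v 0)) := by
          rw [anti _ _ _ (hv 1) _ (hv 0), smul₁]
        have h5 := sgn_mul_self (d 1 * d 0)
        rw [h0, e, mul_comm (d 0) (d 1), smul_sub, smul_smul, neg_mul, h5]
        module
    · rw [homotopySum_three ℓ ℓ (h3 3 le_rfl) (h3 3 le_rfl) (fun v hv => by rw [h1, hv, hz1]),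
        h2, h2, h2, h2, h2, h2]
      exact jacobiator_eq_zero_of_sorted 𝒱 b₂ smul₂ anti jacobi _ _ _ _ _ _ (hv 0) (hv 1) (hv 2)
    · refine homotopySum_of_four_le ℓ ℓ h3 h3 (fun n v j hj => ?_) hn d v
      rcases (by omega : n = 0 ∨ n = 1 ∨ n = 2 ∨ 3 ≤ n) with rfl | rfl | rfl | hn
      · exact h0 v
      · obtain rfl : j = 0 := Subsingleton.elim _ _
        rw [h1, hj, hz1]
      · rw [h2]
        fin_cases j
        · exact (congrArg (b₂ · (v 1)) hj).trans (hz2 _)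
        · exact (congrArg (b₂ (v 0) ·) hj).trans (hz2' _)
      · exact h3 n hn v

end LInfinity
end ChernSimons

namespace ChernSimons

/-! ### Abstract Cartan calculus -/

/-- The operations and rules of the Cartan calculus of Lie algebra valued forms on a three-manifold
that enter the extended Chern-Simons theory: vector fields `V`, forms `G₀, …, G₃` of degrees
`0, …, 3`, and covector densities `C`, with exterior derivatives `d`, Lie derivatives `lie`,
contractions `ι`, graded brackets `br` of forms and the pairings `c₁₃ A Λ = dx^μ ⊗ Tr(ι_μ A Λ)` and
`c₂₂ E E' = dx^μ ⊗ Tr(ι_μ E ∧ E')`. The signs are those of a bracket with the form of lower degree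
in front. -/
structure CartanData (V G₀ G₁ G₂ G₃ C : Type*) [AddCommGroup V] [AddCommGroup G₀] [AddCommGroup G₁]
    [AddCommGroup G₂] [AddCommGroup G₃] [AddCommGroup C] [Module ℝ V] [Module ℝ G₀] [Module ℝ G₁]
    [Module ℝ G₂] [Module ℝ G₃] [Module ℝ C] where
  vb : V →ₗ[ℝ] V →ₗ[ℝ] V
  d₀ : G₀ →ₗ[ℝ] G₁
  d₁ : G₁ →ₗ[ℝ] G₂
  d₂ : G₂ →ₗ[ℝ] G₃
  lie₀ : V →ₗ[ℝ] G₀ →ₗ[ℝ] G₀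
  lie₁ : V →ₗ[ℝ] G₁ →ₗ[ℝ] G₁
  lie₂ : V →ₗ[ℝ] G₂ →ₗ[ℝ] G₂
  lie₃ : V →ₗ[ℝ] G₃ →ₗ[ℝ] G₃
  lieC : V →ₗ[ℝ] C →ₗ[ℝ] C
  ι₁ : V →ₗ[ℝ] G₁ →ₗ[ℝ] G₀
  ι₂ : V →ₗ[ℝ] G₂ →ₗ[ℝ] G₁
  ι₃ : V →ₗ[ℝ] G₃ →ₗ[ℝ] G₂
  br₀₀ : G₀ →ₗ[ℝ] G₀ →ₗ[ℝ] G₀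
  br₀₁ : G₀ →ₗ[ℝ] G₁ →ₗ[ℝ] G₁
  br₀₂ : G₀ →ₗ[ℝ] G₂ →ₗ[ℝ] G₂
  br₀₃ : G₀ →ₗ[ℝ] G₃ →ₗ[ℝ] G₃
  br₁₁ : G₁ →ₗ[ℝ] G₁ →ₗ[ℝ] G₂
  br₁₂ : G₁ →ₗ[ℝ] G₂ →ₗ[ℝ] G₃
  c₁₃ : G₁ →ₗ[ℝ] G₃ →ₗ[ℝ] C
  c₂₂ : G₂ →ₗ[ℝ] G₂ →ₗ[ℝ] C
  vb_skew : ∀ x y, vb x y = -vb y x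
  vb_jacobi : ∀ x y z, vb (vb x y) z = vb x (vb y z) - vb y (vb x z)
  d₁_d₀ : ∀ l, d₁ (d₀ l) = 0
  d₂_d₁ : ∀ A, d₂ (d₁ A) = 0
  d₀_lie : ∀ x l, d₀ (lie₀ x l) = lie₁ x (d₀ l)
  d₁_lie : ∀ x A, d₁ (lie₁ x A) = lie₂ x (d₁ A)
  d₂_lie : ∀ x E, d₂ (lie₂ x E) = lie₃ x (d₂ E)
  vb_lie₀ : ∀ x y l, lie₀ (vb x y) l = lie₀ x (lie₀ y l) - lie₀ y (lie₀ x l)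
  vb_lie₁ : ∀ x y A, lie₁ (vb x y) A = lie₁ x (lie₁ y A) - lie₁ y (lie₁ x A)
  vb_lie₂ : ∀ x y E, lie₂ (vb x y) E = lie₂ x (lie₂ y E) - lie₂ y (lie₂ x E)
  vb_lie₃ : ∀ x y L, lie₃ (vb x y) L = lie₃ x (lie₃ y L) - lie₃ y (lie₃ x L)
  vb_lieC : ∀ x y X, lieC (vb x y) X = lieC x (lieC y X) - lieC y (lieC x X)
  lie₀_eq : ∀ x l, lie₀ x l = ι₁ x (d₀ l)
  lie₁_eq : ∀ x A, lie₁ x A = d₀ (ι₁ x A) + ι₂ x (d₁ A)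
  lie₂_eq : ∀ x E, lie₂ x E = d₁ (ι₂ x E) + ι₃ x (d₂ E)
  lie₃_eq : ∀ x L, lie₃ x L = d₂ (ι₃ x L)
  vb_ι₁ : ∀ x y A, ι₁ (vb x y) A = lie₀ x (ι₁ y A) - ι₁ y (lie₁ x A)
  vb_ι₂ : ∀ x y E, ι₂ (vb x y) E = lie₁ x (ι₂ y E) - ι₂ y (lie₂ x E)
  vb_ι₃ : ∀ x y L, ι₃ (vb x y) L = lie₂ x (ι₃ y L) - ι₃ y (lie₃ x L)
  ι₁_ι₂ : ∀ x y E, ι₁ x (ι₂ y E) = -ι₁ y (ι₂ x E)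
  ι₂_ι₃ : ∀ x y L, ι₂ x (ι₃ y L) = -ι₂ y (ι₃ x L)
  br₀₀_comm : ∀ l m, br₀₀ l m = -br₀₀ m l
  br₁₁_comm : ∀ A B, br₁₁ A B = br₁₁ B A
  d₀_br₀₀ : ∀ l m, d₀ (br₀₀ l m) = br₀₁ l (d₀ m) - br₀₁ m (d₀ l)
  d₁_br₀₁ : ∀ l A, d₁ (br₀₁ l A) = br₁₁ (d₀ l) A + br₀₂ l (d₁ A)
  d₂_br₀₂ : ∀ l E, d₂ (br₀₂ l E) = br₁₂ (d₀ l) E + br₀₃ l (d₂ E)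
  d₂_br₁₁ : ∀ A B, d₂ (br₁₁ A B) = -br₁₂ B (d₁ A) - br₁₂ A (d₁ B)
  lie_br₀₀ : ∀ x l m, lie₀ x (br₀₀ l m) = br₀₀ (lie₀ x l) m + br₀₀ l (lie₀ x m)
  lie_br₀₁ : ∀ x l A, lie₁ x (br₀₁ l A) = br₀₁ (lie₀ x l) A + br₀₁ l (lie₁ x A)
  lie_br₀₂ : ∀ x l E, lie₂ x (br₀₂ l E) = br₀₂ (lie₀ x l) E + br₀₂ l (lie₂ x E)
  lie_br₀₃ : ∀ x l L, lie₃ x (br₀₃ l L) = br₀₃ (lie₀ x l) L + br₀₃ l (lie₃ x L)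
  lie_br₁₁ : ∀ x A B, lie₂ x (br₁₁ A B) = br₁₁ (lie₁ x A) B + br₁₁ A (lie₁ x B)
  lie_br₁₂ : ∀ x A E, lie₃ x (br₁₂ A E) = br₁₂ (lie₁ x A) E + br₁₂ A (lie₂ x E)
  ι_br₀₁ : ∀ x l A, ι₁ x (br₀₁ l A) = br₀₀ l (ι₁ x A)
  ι_br₀₂ : ∀ x l E, ι₂ x (br₀₂ l E) = br₀₁ l (ι₂ x E)
  ι_br₀₃ : ∀ x l L, ι₃ x (br₀₃ l L) = br₀₂ l (ι₃ x L)
  ι_br₁₁ : ∀ x A B, ι₂ x (br₁₁ A B) = br₀₁ (ι₁ x A) B + br₀₁ (ι₁ x B) A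
  ι_br₁₂ : ∀ x A E, ι₃ x (br₁₂ A E) = br₀₂ (ι₁ x A) E - br₁₁ A (ι₂ x E)
  jacobi₀₀₀ : ∀ l m n, br₀₀ l (br₀₀ m n) = br₀₀ (br₀₀ l m) n + br₀₀ m (br₀₀ l n)
  jacobi₀₀₁ : ∀ l m A, br₀₁ l (br₀₁ m A) = br₀₁ (br₀₀ l m) A + br₀₁ m (br₀₁ l A)
  jacobi₀₀₂ : ∀ l m E, br₀₂ l (br₀₂ m E) = br₀₂ (br₀₀ l m) E + br₀₂ m (br₀₂ l E)
  jacobi₀₀₃ : ∀ l m L, br₀₃ l (br₀₃ m L) = br₀₃ (br₀₀ l m) L + br₀₃ m (br₀₃ l L)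
  jacobi₀₁₁ : ∀ l A B, br₀₂ l (br₁₁ A B) = br₁₁ (br₀₁ l A) B + br₁₁ A (br₀₁ l B)
  jacobi₀₁₂ : ∀ l A E, br₀₃ l (br₁₂ A E) = br₁₂ (br₀₁ l A) E + br₁₂ A (br₀₂ l E)
  jacobi₁₁₁ : ∀ A B D, br₁₂ A (br₁₁ B D) = -br₁₂ D (br₁₁ A B) - br₁₂ B (br₁₁ A D)
  c₂₂_comm : ∀ E F, c₂₂ E F = -c₂₂ F E
  lie_c₁₃ : ∀ x A L, lieC x (c₁₃ A L) = c₁₃ (lie₁ x A) L + c₁₃ A (lie₃ x L)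
  lie_c₂₂ : ∀ x E F, lieC x (c₂₂ E F) = c₂₂ (lie₂ x E) F + c₂₂ E (lie₂ x F)
  c₂₂_ι₃ : ∀ x E L, c₂₂ E (ι₃ x L) = -c₁₃ (ι₂ x E) L
  br₁₂_ι₃ : ∀ x A L, br₁₂ A (ι₃ x L) = br₀₃ (ι₁ x A) L
  br₁₂_ι₂ : ∀ x E F, br₁₂ (ι₂ x E) F = br₁₂ (ι₂ x F) E
  c₂₂_br₁₁ : ∀ A B E, c₂₂ (br₁₁ A B) E = c₁₃ A (br₁₂ B E) + c₁₃ B (br₁₂ A E)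
  c₁₃_br₀₁ : ∀ l A L, c₁₃ (br₀₁ l A) L = -c₁₃ A (br₀₃ l L)
  c₂₂_br₀₂ : ∀ l E F, c₂₂ (br₀₂ l E) F = -c₂₂ E (br₀₂ l F)

namespace CartanData
variable {V G₀ G₁ G₂ G₃ C : Type*} [AddCommGroup V] [AddCommGroup G₀] [AddCommGroup G₁]
  [AddCommGroup G₂] [AddCommGroup G₃] [AddCommGroup C] [Module ℝ V] [Module ℝ G₀] [Module ℝ G₁]
  [Module ℝ G₂] [Module ℝ G₃] [Module ℝ C] (K : CartanData V G₀ G₁ G₂ G₃ C)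

/-- The underlying space of the extended theory. -/
abbrev Space (V G₀ G₁ G₂ G₃ C : Type*) : Type _ := V × (V × G₀) × G₁ × G₂ × (C × G₃) × C

/-- The differential. -/
def b₁ (u : Space V G₀ G₁ G₂ G₃ C) : Space V G₀ G₁ G₂ G₃ C :=
  (0, (u.1, 0), K.d₀ u.2.1.2, K.d₁ u.2.2.1, (0, K.d₂ u.2.2.2.1), u.2.2.2.2.1.1)

/-- The bracket. -/
def b₂ : Space V G₀ G₁ G₂ G₃ C → Space V G₀ G₁ G₂ G₃ C → Space V G₀ G₁ G₂ G₃ C :=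
  fun (x, (ξ, l), A, E, (X, L), Y) (x', (ξ', l'), A', E', (X', L'), Y') =>
    (K.vb x ξ' + K.vb ξ x',
     (K.vb ξ ξ', K.lie₀ ξ l' - K.lie₀ ξ' l - K.br₀₀ l l' + K.ι₁ x A' + K.ι₁ x' A),
     K.lie₁ ξ A' - K.lie₁ ξ' A - K.br₀₁ l A' + K.br₀₁ l' A + K.ι₂ x E' - K.ι₂ x' E,
     K.lie₂ ξ E' - K.lie₂ ξ' E - K.br₀₂ l E' + K.br₀₂ l' E - K.br₁₁ A A' + K.ι₃ x L' + K.ι₃ x' L,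
     (K.c₁₃ (K.d₀ l) L' - K.c₁₃ (K.d₀ l') L + K.lieC ξ X' - K.lieC ξ' X +
        (K.c₂₂ (K.d₁ A) E' - K.c₁₃ A (K.d₂ E')) - (K.c₂₂ (K.d₁ A') E - K.c₁₃ A' (K.d₂ E)) +
        K.lieC x Y' - K.lieC x' Y,
      K.lie₃ ξ L' - K.lie₃ ξ' L - K.br₀₃ l L' + K.br₀₃ l' L - K.br₁₂ A E' + K.br₁₂ A' E),
     K.lieC ξ Y' - K.lieC ξ' Y + K.c₁₃ A L' + K.c₁₃ A' L + K.c₂₂ E E')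

/-- The elements of degree `-1`. -/
def ofV (x : V) : Space V G₀ G₁ G₂ G₃ C := (x, (0, 0), 0, 0, (0, 0), 0)
/-- The elements of degree `0`. -/
def ofG (ξ : V) (l : G₀) : Space V G₀ G₁ G₂ G₃ C := (0, (ξ, l), 0, 0, (0, 0), 0)
/-- The elements of degree `1`. -/
def ofA (A : G₁) : Space V G₀ G₁ G₂ G₃ C := (0, (0, 0), A, 0, (0, 0), 0)
/-- The elements of degree `2`. -/
def ofE (E : G₂) : Space V G₀ G₁ G₂ G₃ C := (0, (0, 0), 0, E, (0, 0), 0)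
/-- The elements of degree `3`. -/
def ofN (X : C) (L : G₃) : Space V G₀ G₁ G₂ G₃ C := (0, (0, 0), 0, 0, (X, L), 0)
/-- The elements of degree `4`. -/
def ofC (Y : C) : Space V G₀ G₁ G₂ G₃ C := (0, (0, 0), 0, 0, (0, 0), Y)

/-- The homogeneous elements: those of degree `-1, …, 4`, and zero. -/
inductive Homogeneous : ℤ → Space V G₀ G₁ G₂ G₃ C → Prop
  | zero (k : ℤ) : Homogeneous k 0
  | ofV (x : V) : Homogeneous (-1) (ofV x)
  | ofG (ξ : V) (l : G₀) : Homogeneous 0 (ofG ξ l)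
  | ofA (A : G₁) : Homogeneous 1 (ofA A)
  | ofE (E : G₂) : Homogeneous 2 (ofE E)
  | ofN (X : C) (L : G₃) : Homogeneous 3 (ofN X L)
  | ofC (Y : C) : Homogeneous 4 (ofC Y)

theorem b₂_add_left (u v w : Space V G₀ G₁ G₂ G₃ C) : K.b₂ (u + v) w = K.b₂ u w + K.b₂ v w := by
  simp only [b₂, Prod.mk_add_mk, Prod.fst_add, Prod.snd_add, LinearMap.map_add, LinearMap.add_apply,
    Prod.mk.injEq]
  refine ⟨by abel, ⟨trivial, by abel⟩, by abel, by abel, ⟨by abel, by abel⟩, by abel⟩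

theorem b₂_smul_left (c : ℝ) (u v : Space V G₀ G₁ G₂ G₃ C) :
    K.b₂ (c • u) v = c • K.b₂ u v := by
  simp only [b₂, Prod.smul_mk, Prod.smul_fst, Prod.smul_snd, LinearMap.map_smul,
      LinearMap.smul_apply,
    Prod.mk.injEq]
  refine ⟨by module, ⟨trivial, by module⟩, by module, by module, ⟨by module, by module⟩,
    by module⟩

theorem b₂_add_right (u v w : Space V G₀ G₁ G₂ G₃ C) : K.b₂ u (v + w) = K.b₂ u v + K.b₂ u w := by
  simp only [b₂, Prod.mk_add_mk, Prod.fst_add, Prod.snd_add, LinearMap.map_add, LinearMap.add_apply,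
    Prod.mk.injEq]
  refine ⟨by abel, ⟨trivial, by abel⟩, by abel, by abel, ⟨by abel, by abel⟩, by abel⟩

theorem b₂_smul_right (c : ℝ) (u v : Space V G₀ G₁ G₂ G₃ C) :
    K.b₂ u (c • v) = c • K.b₂ u v := by
  simp only [b₂, Prod.smul_mk, Prod.smul_fst, Prod.smul_snd, LinearMap.map_smul,
      LinearMap.smul_apply,
    Prod.mk.injEq]
  refine ⟨by module, ⟨trivial, by module⟩, by module, by module, ⟨by module, by module⟩,
    by module⟩

@[simp] theorem b₂_zero_left (u : Space V G₀ G₁ G₂ G₃ C) : K.b₂ 0 u = 0 := by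
  simpa using K.b₂_smul_left 0 0 u

@[simp] theorem b₂_zero_right (u : Space V G₀ G₁ G₂ G₃ C) : K.b₂ u 0 = 0 := by
  simpa using K.b₂_smul_right 0 u 0

theorem b₁_b₁ (u : Space V G₀ G₁ G₂ G₃ C) : K.b₁ (K.b₁ u) = 0 := by
  simp only [b₁, map_zero, K.d₁_d₀, K.d₂_d₁]; rfl

@[simp] theorem ofV_add (x x' : V) :
    (ofV x + ofV x' : Space V G₀ G₁ G₂ G₃ C) = ofV (x + x') := by
      simp only [ofV, Prod.mk_add_mk, add_zero]

@[simp] theorem ofV_sub (x x' : V) :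
    (ofV x - ofV x' : Space V G₀ G₁ G₂ G₃ C) = ofV (x - x') := by
      simp only [ofV, Prod.mk_sub_mk, sub_zero]

@[simp] theorem ofV_neg (x : V) : (-ofV x : Space V G₀ G₁ G₂ G₃ C) = ofV (-x) := by
  simp only [ofV, Prod.neg_mk, neg_zero]

@[simp] theorem ofG_add (ξ ξ' : V) (l l' : G₀) :
    (ofG ξ l + ofG ξ' l' : Space V G₀ G₁ G₂ G₃ C) = ofG (ξ + ξ') (l + l') := by
      simp only [ofG, Prod.mk_add_mk, add_zero]

@[simp] theorem ofG_sub (ξ ξ' : V) (l l' : G₀) :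
    (ofG ξ l - ofG ξ' l' : Space V G₀ G₁ G₂ G₃ C) = ofG (ξ - ξ') (l - l') := by
      simp only [ofG, Prod.mk_sub_mk, sub_zero]

@[simp] theorem ofG_neg (ξ : V) (l : G₀) : (-ofG ξ l : Space V G₀ G₁ G₂ G₃ C) = ofG (-ξ) (-l) := by
  simp only [ofG, Prod.neg_mk, neg_zero]

@[simp] theorem ofA_add (A A' : G₁) :
    (ofA A + ofA A' : Space V G₀ G₁ G₂ G₃ C) = ofA (A + A') := by
      simp only [ofA, Prod.mk_add_mk, add_zero]

@[simp] theorem ofA_sub (A A' : G₁) :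
    (ofA A - ofA A' : Space V G₀ G₁ G₂ G₃ C) = ofA (A - A') := by
      simp only [ofA, Prod.mk_sub_mk, sub_zero]

@[simp] theorem ofA_neg (A : G₁) : (-ofA A : Space V G₀ G₁ G₂ G₃ C) = ofA (-A) := by
  simp only [ofA, Prod.neg_mk, neg_zero]

@[simp] theorem ofE_add (E E' : G₂) :
    (ofE E + ofE E' : Space V G₀ G₁ G₂ G₃ C) = ofE (E + E') := by
      simp only [ofE, Prod.mk_add_mk, add_zero]

@[simp] theorem ofE_sub (E E' : G₂) :
    (ofE E - ofE E' : Space V G₀ G₁ G₂ G₃ C) = ofE (E - E') := by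
      simp only [ofE, Prod.mk_sub_mk, sub_zero]

@[simp] theorem ofE_neg (E : G₂) : (-ofE E : Space V G₀ G₁ G₂ G₃ C) = ofE (-E) := by
  simp only [ofE, Prod.neg_mk, neg_zero]

theorem ofE_smul (c : ℝ) (E : G₂) :
    (c • ofE E : Space V G₀ G₁ G₂ G₃ C) = ofE (c • E) := by simp only [ofE, Prod.smul_mk, smul_zero]

@[simp] theorem ofN_zero : (ofN (0 : C) (0 : G₃) : Space V G₀ G₁ G₂ G₃ C) = 0 := rfl

@[simp] theorem ofN_add (X X' : C) (L L' : G₃) :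
    (ofN X L + ofN X' L' : Space V G₀ G₁ G₂ G₃ C) = ofN (X + X') (L + L') := by
      simp only [ofN, Prod.mk_add_mk, add_zero]

@[simp] theorem ofN_sub (X X' : C) (L L' : G₃) :
    (ofN X L - ofN X' L' : Space V G₀ G₁ G₂ G₃ C) = ofN (X - X') (L - L') := by
      simp only [ofN, Prod.mk_sub_mk, sub_zero]

@[simp] theorem ofN_neg (X : C) (L : G₃) : (-ofN X L : Space V G₀ G₁ G₂ G₃ C) = ofN (-X) (-L) := by
  simp only [ofN, Prod.neg_mk, neg_zero]

theorem ofN_smul (c : ℝ) (X : C) (L : G₃) :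
    (c • ofN X L : Space V G₀ G₁ G₂ G₃ C) = ofN (c • X) (c • L) := by
      simp only [ofN, Prod.smul_mk, smul_zero]

@[simp] theorem ofC_zero : (ofC (0 : C) : Space V G₀ G₁ G₂ G₃ C) = 0 := rfl

@[simp] theorem ofC_add (Y Y' : C) :
    (ofC Y + ofC Y' : Space V G₀ G₁ G₂ G₃ C) = ofC (Y + Y') := by
      simp only [ofC, Prod.mk_add_mk, add_zero]

@[simp] theorem ofC_sub (Y Y' : C) :
    (ofC Y - ofC Y' : Space V G₀ G₁ G₂ G₃ C) = ofC (Y - Y') := by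
      simp only [ofC, Prod.mk_sub_mk, sub_zero]

@[simp] theorem ofC_neg (Y : C) : (-ofC Y : Space V G₀ G₁ G₂ G₃ C) = ofC (-Y) := by
  simp only [ofC, Prod.neg_mk, neg_zero]

@[simp] theorem b₂_ofV_ofG (x : V) (ξ' : V) (l' : G₀) :
    K.b₂ (ofV x) (ofG ξ' l') = ofV (K.vb x ξ') := by
  simp only [b₂, ofV, ofG, LinearMap.map_zero, LinearMap.zero_apply,
    add_zero, zero_add, sub_zero, zero_sub, neg_zero]

@[simp] theorem b₂_ofV_ofA (x : V) (A' : G₁) :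
    K.b₂ (ofV x) (ofA A') = ofG 0 (K.ι₁ x A') := by
  simp only [b₂, ofV, ofA, ofG, LinearMap.map_zero, LinearMap.zero_apply,
    add_zero, zero_add, sub_zero, zero_sub, neg_zero]

@[simp] theorem b₂_ofV_ofE (x : V) (E' : G₂) :
    K.b₂ (ofV x) (ofE E') = ofA (K.ι₂ x E') := by
  simp only [b₂, ofV, ofE, ofA, LinearMap.map_zero, LinearMap.zero_apply,
    add_zero, zero_add, sub_zero, zero_sub, neg_zero]

@[simp] theorem b₂_ofV_ofN (x : V) (X' : C) (L' : G₃) :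
    K.b₂ (ofV x) (ofN X' L') = ofE (K.ι₃ x L') := by
  simp only [b₂, ofV, ofN, ofE, LinearMap.map_zero, LinearMap.zero_apply,
    add_zero, zero_add, sub_zero, zero_sub, neg_zero]

@[simp] theorem b₂_ofV_ofC (x : V) (Y' : C) :
    K.b₂ (ofV x) (ofC Y') = ofN (K.lieC x Y') 0 := by
  simp only [b₂, ofV, ofC, ofN, LinearMap.map_zero, LinearMap.zero_apply,
    add_zero, zero_add, sub_zero, zero_sub, neg_zero]

@[simp] theorem b₂_ofG_ofV (ξ : V) (l : G₀) (x' : V) :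
    K.b₂ (ofG ξ l) (ofV x') = ofV (K.vb ξ x') := by
  simp only [b₂, ofG, ofV, LinearMap.map_zero, LinearMap.zero_apply,
    add_zero, zero_add, sub_zero, zero_sub, neg_zero]

@[simp] theorem b₂_ofG_ofG (ξ : V) (l : G₀) (ξ' : V) (l' : G₀) :
    K.b₂ (ofG ξ l) (ofG ξ' l') = ofG (K.vb ξ ξ') (K.lie₀ ξ l' - K.lie₀ ξ' l - K.br₀₀ l l') := by
  simp only [b₂, ofG, LinearMap.map_zero, LinearMap.zero_apply,
    add_zero, zero_add, sub_zero, zero_sub, neg_zero]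

@[simp] theorem b₂_ofG_ofA (ξ : V) (l : G₀) (A' : G₁) :
    K.b₂ (ofG ξ l) (ofA A') = ofA (K.lie₁ ξ A' - K.br₀₁ l A') := by
  simp only [b₂, ofG, ofA, LinearMap.map_zero, LinearMap.zero_apply,
    add_zero, zero_add, sub_zero, zero_sub, neg_zero]

@[simp] theorem b₂_ofG_ofE (ξ : V) (l : G₀) (E' : G₂) :
    K.b₂ (ofG ξ l) (ofE E') = ofE (K.lie₂ ξ E' - K.br₀₂ l E') := by
  simp only [b₂, ofG, ofE, LinearMap.map_zero, LinearMap.zero_apply,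
    add_zero, zero_add, sub_zero, zero_sub, neg_zero]

@[simp] theorem b₂_ofG_ofN (ξ : V) (l : G₀) (X' : C) (L' : G₃) :
    K.b₂ (ofG ξ l) (ofN X' L') = ofN (K.c₁₃ (K.d₀ l) L' + K.lieC ξ X')
        (K.lie₃ ξ L' - K.br₀₃ l L') := by
  simp only [b₂, ofG, ofN, LinearMap.map_zero, LinearMap.zero_apply,
    add_zero, zero_add, sub_zero, zero_sub, neg_zero]

@[simp] theorem b₂_ofG_ofC (ξ : V) (l : G₀) (Y' : C) :
    K.b₂ (ofG ξ l) (ofC Y') = ofC (K.lieC ξ Y') := by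
  simp only [b₂, ofG, ofC, LinearMap.map_zero, LinearMap.zero_apply,
    add_zero, zero_add, sub_zero, zero_sub, neg_zero]

@[simp] theorem b₂_ofA_ofV (A : G₁) (x' : V) :
    K.b₂ (ofA A) (ofV x') = ofG 0 (K.ι₁ x' A) := by
  simp only [b₂, ofA, ofV, ofG, LinearMap.map_zero, LinearMap.zero_apply,
    add_zero, zero_add, sub_zero, zero_sub, neg_zero]

@[simp] theorem b₂_ofA_ofG (A : G₁) (ξ' : V) (l' : G₀) :
    K.b₂ (ofA A) (ofG ξ' l') = ofA (-K.lie₁ ξ' A + K.br₀₁ l' A) := by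
  simp only [b₂, ofA, ofG, LinearMap.map_zero, LinearMap.zero_apply,
    add_zero, zero_add, sub_zero, zero_sub, neg_zero]

@[simp] theorem b₂_ofA_ofA (A : G₁) (A' : G₁) :
    K.b₂ (ofA A) (ofA A') = ofE (-K.br₁₁ A A') := by
  simp only [b₂, ofA, ofG, ofE, LinearMap.map_zero, LinearMap.zero_apply,
    add_zero, zero_add, sub_zero, zero_sub, neg_zero]

@[simp] theorem b₂_ofA_ofE (A : G₁) (E' : G₂) :
    K.b₂ (ofA A) (ofE E') = ofN (K.c₂₂ (K.d₁ A) E' - K.c₁₃ A (K.d₂ E')) (-K.br₁₂ A E') := by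
  simp only [b₂, ofA, ofE, ofN, LinearMap.map_zero, LinearMap.zero_apply,
    add_zero, zero_add, sub_zero, zero_sub, neg_zero]

@[simp] theorem b₂_ofA_ofN (A : G₁) (X' : C) (L' : G₃) :
    K.b₂ (ofA A) (ofN X' L') = ofC (K.c₁₃ A L') := by
  simp only [b₂, ofA, ofN, ofC, LinearMap.map_zero, LinearMap.zero_apply,
    add_zero, zero_add, sub_zero, zero_sub, neg_zero]

@[simp] theorem b₂_ofE_ofV (E : G₂) (x' : V) :
    K.b₂ (ofE E) (ofV x') = ofA (-K.ι₂ x' E) := by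
  simp only [b₂, ofE, ofV, ofA, LinearMap.map_zero, LinearMap.zero_apply,
    add_zero, zero_add, sub_zero, zero_sub, neg_zero]

@[simp] theorem b₂_ofE_ofG (E : G₂) (ξ' : V) (l' : G₀) :
    K.b₂ (ofE E) (ofG ξ' l') = ofE (-K.lie₂ ξ' E + K.br₀₂ l' E) := by
  simp only [b₂, ofE, ofG, LinearMap.map_zero, LinearMap.zero_apply,
    add_zero, zero_add, sub_zero, zero_sub, neg_zero]

@[simp] theorem b₂_ofE_ofA (E : G₂) (A' : G₁) :
    K.b₂ (ofE E) (ofA A') = ofN (-(K.c₂₂ (K.d₁ A') E - K.c₁₃ A' (K.d₂ E))) (K.br₁₂ A' E) := by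
  simp only [b₂, ofE, ofA, ofN, LinearMap.map_zero, LinearMap.zero_apply,
    add_zero, zero_add, sub_zero, zero_sub, neg_zero]

@[simp] theorem b₂_ofE_ofE (E : G₂) (E' : G₂) :
    K.b₂ (ofE E) (ofE E') = ofC (K.c₂₂ E E') := by
  simp only [b₂, ofE, ofG, ofC, LinearMap.map_zero, LinearMap.zero_apply,
    add_zero, zero_add, sub_zero, zero_sub, neg_zero]

@[simp] theorem b₂_ofN_ofV (X : C) (L : G₃) (x' : V) :
    K.b₂ (ofN X L) (ofV x') = ofE (K.ι₃ x' L) := by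
  simp only [b₂, ofN, ofV, ofE, LinearMap.map_zero, LinearMap.zero_apply,
    add_zero, zero_add, sub_zero, zero_sub, neg_zero]

@[simp] theorem b₂_ofN_ofG (X : C) (L : G₃) (ξ' : V) (l' : G₀) :
    K.b₂ (ofN X L) (ofG ξ' l') =
      ofN (-K.c₁₃ (K.d₀ l') L - K.lieC ξ' X) (-K.lie₃ ξ' L + K.br₀₃ l' L) := by
  simp only [b₂, ofN, ofG, LinearMap.map_zero, LinearMap.zero_apply,
    add_zero, zero_add, sub_zero, zero_sub, neg_zero]

@[simp] theorem b₂_ofN_ofA (X : C) (L : G₃) (A' : G₁) :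
    K.b₂ (ofN X L) (ofA A') = ofC (K.c₁₃ A' L) := by
  simp only [b₂, ofN, ofA, ofC, LinearMap.map_zero, LinearMap.zero_apply,
    add_zero, zero_add, sub_zero, zero_sub, neg_zero]

@[simp] theorem b₂_ofC_ofV (Y : C) (x' : V) :
    K.b₂ (ofC Y) (ofV x') = ofN (-K.lieC x' Y) 0 := by
  simp only [b₂, ofC, ofV, ofN, LinearMap.map_zero, LinearMap.zero_apply,
    add_zero, zero_add, sub_zero, zero_sub, neg_zero]

@[simp] theorem b₂_ofC_ofG (Y : C) (ξ' : V) (l' : G₀) :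
    K.b₂ (ofC Y) (ofG ξ' l') = ofC (-K.lieC ξ' Y) := by
  simp only [b₂, ofC, ofG, LinearMap.map_zero, LinearMap.zero_apply,
    add_zero, zero_add, sub_zero, zero_sub, neg_zero]

@[simp] theorem b₁_ofV (x : V) : K.b₁ (ofV x) = ofG x 0 := by simp [b₁, ofV, ofG]

@[simp] theorem b₁_ofG (ξ : V) (l : G₀) : K.b₁ (ofG ξ l) = ofA (K.d₀ l) := by simp [b₁, ofG, ofA]

@[simp] theorem b₁_ofA (A : G₁) : K.b₁ (ofA A) = ofE (K.d₁ A) := by simp [b₁, ofA, ofE]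

@[simp] theorem b₁_ofE (E : G₂) : K.b₁ (ofE E) = ofN 0 (K.d₂ E) := by simp [b₁, ofE, ofN]

@[simp] theorem b₁_ofN (X : C) (L : G₃) : K.b₁ (ofN X L) = ofC X := by simp [b₁, ofN, ofC]

@[simp] theorem b₁_ofC (Y : C) : K.b₁ (ofC Y) = 0 := by
  simp only [b₁, ofC, LinearMap.map_zero]
  rfl

@[simp] theorem b₁_zero : K.b₁ 0 = 0 := by
  simp only [b₁, Prod.fst_zero, Prod.snd_zero, LinearMap.map_zero]; rfl

@[simp] theorem b₂_ofV_ofV (x x' : V) : K.b₂ (ofV x) (ofV x') = 0 := by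
  simp only [b₂, ofV, LinearMap.map_zero, LinearMap.zero_apply,
    add_zero, zero_add, sub_zero, zero_sub, neg_zero]
  rfl

@[simp] theorem b₂_ofA_ofC (A : G₁) (Y : C) : K.b₂ (ofA A) (ofC Y) = 0 := by
  simp only [b₂, ofA, ofC, LinearMap.map_zero, LinearMap.zero_apply,
    add_zero, zero_add, sub_zero, zero_sub, neg_zero]
  rfl

@[simp] theorem b₂_ofE_ofN (E : G₂) (X : C) (L : G₃) : K.b₂ (ofE E) (ofN X L) = 0 := by
  simp only [b₂, ofE, ofN, LinearMap.map_zero, LinearMap.zero_apply,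
    add_zero, zero_add, sub_zero, zero_sub, neg_zero]
  rfl

@[simp] theorem ofV_eq_zero (x : V) :
    (ofV x : Space V G₀ G₁ G₂ G₃ C) = 0 ↔ x = 0 := by simp [ofV]

@[simp] theorem ofG_eq_zero (ξ : V) (l : G₀) :
    (ofG ξ l : Space V G₀ G₁ G₂ G₃ C) = 0 ↔ ξ = 0 ∧ l = 0 := by simp [ofG]

@[simp] theorem ofA_eq_zero (A : G₁) :
    (ofA A : Space V G₀ G₁ G₂ G₃ C) = 0 ↔ A = 0 := by simp [ofA]

@[simp] theorem ofE_eq_zero (E : G₂) :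
    (ofE E : Space V G₀ G₁ G₂ G₃ C) = 0 ↔ E = 0 := by simp [ofE]

@[simp] theorem ofN_eq_zero (X : C) (L : G₃) :
    (ofN X L : Space V G₀ G₁ G₂ G₃ C) = 0 ↔ X = 0 ∧ L = 0 := by simp [ofN]

@[simp] theorem ofC_eq_zero (Y : C) :
    (ofC Y : Space V G₀ G₁ G₂ G₃ C) = 0 ↔ Y = 0 := by simp [ofC]

theorem homogeneous_b₁ {i : ℤ} {u : Space V G₀ G₁ G₂ G₃ C} (hu : Homogeneous i u) :
    Homogeneous (1 + i) (K.b₁ u) := by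
  rcases hu with _ | _ | _ | _ | _ | _ | _ <;>
  simp only [b₁_zero, b₁_ofV, b₁_ofG, b₁_ofA, b₁_ofE, b₁_ofN, b₁_ofC] <;> constructor

theorem homogeneous_b₂ {i j : ℤ} {u v : Space V G₀ G₁ G₂ G₃ C} (hu : Homogeneous i u)
    (hv : Homogeneous j v) : Homogeneous (i + j) (K.b₂ u v) := by
  rcases hu with _ | _ | _ | _ | _ | _ | _ <;> rcases hv with _ | _ | _ | _ | _ | _ | _ <;>
  (try simp only [b₂_zero_left, b₂_zero_right, b₂_ofV_ofG, b₂_ofV_ofA, b₂_ofV_ofE, b₂_ofV_ofN,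
    b₂_ofV_ofC, b₂_ofG_ofV, b₂_ofG_ofG, b₂_ofG_ofA, b₂_ofG_ofE, b₂_ofG_ofN, b₂_ofG_ofC,
    b₂_ofA_ofV, b₂_ofA_ofG, b₂_ofA_ofA, b₂_ofA_ofE, b₂_ofA_ofN, b₂_ofE_ofV, b₂_ofE_ofG,
    b₂_ofE_ofA, b₂_ofE_ofE, b₂_ofN_ofV, b₂_ofN_ofG, b₂_ofN_ofA, b₂_ofC_ofV, b₂_ofC_ofG,
    b₂_ofV_ofV, b₂_ofA_ofC, b₂_ofE_ofN]) <;>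
  first
    | constructor
    | convert Homogeneous.zero _
      simp [b₂, ofV, ofG, ofA, ofE, ofN, ofC]

end CartanData
end ChernSimons

namespace ChernSimons

/-! ### Antisymmetry and Leibniz rule -/

namespace CartanData
variable {V G₀ G₁ G₂ G₃ C : Type*} [AddCommGroup V] [AddCommGroup G₀] [AddCommGroup G₁]
  [AddCommGroup G₂] [AddCommGroup G₃] [AddCommGroup C] [Module ℝ V] [Module ℝ G₀] [Module ℝ G₁]
  [Module ℝ G₂] [Module ℝ G₃] [Module ℝ C] (K : CartanData V G₀ G₁ G₂ G₃ C)

/-- Brackets of total degree greater than four vanish, as the grading ends in degree four. -/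
theorem b₂_of_four_lt {i j : ℤ} {u v : Space V G₀ G₁ G₂ G₃ C} (hu : Homogeneous i u)
    (hv : Homogeneous j v) (h : 4 < i + j) : K.b₂ u v = 0 := by
  have h1 := K.homogeneous_b₂ hu hv
  generalize K.b₂ u v = w, i + j = k at h1 h
  cases h1 <;> first | rfl | omega

/-- The bracket is graded antisymmetric. On homogeneous elements `simp` reduces this to the signs in
the definition and the symmetries of `vb`, `br₀₀`, `br₁₁` and `c₂₂`. -/
theorem b₂_antisymm {i j : ℤ} {u v : Space V G₀ G₁ G₂ G₃ C} (hu : Homogeneous i u)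
    (hv : Homogeneous j v) : K.b₂ v u = (-sgn (i * j)) • K.b₂ u v := by
  by_cases h4 : 4 < i + j
  · rw [K.b₂_of_four_lt hu hv h4, K.b₂_of_four_lt hv hu (by omega), smul_zero]
  rw [← sub_eq_zero]
  rcases hu with _ | x | ⟨ξ, l⟩ | A | E | ⟨X, L⟩ | Y <;>
  rcases hv with _ | x' | ⟨ξ', l'⟩ | A' | E' | ⟨X', L'⟩ | Y' <;>
  first | omega | (simp +decide [sgn]; done) | skip
  all_goals simp +decide [sgn]
  all_goals first
    | abel1
    | constructor <;> abel1
    | rw [K.vb_skew, neg_add_cancel, K.br₀₀_comm]; exact ⟨rfl, by abel⟩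
    | rw [K.vb_skew, neg_add_cancel]
    | rw [K.br₁₁_comm, neg_add_cancel]
    | rw [K.c₂₂_comm, neg_add_cancel]

/-- The differential is a derivation of the bracket. The cases left by `simp` are the skew-symmetry
of the bracket of vector fields, Cartan's formulas, the compatibility of Lie derivatives with `d`,
and the Leibniz rules for brackets of forms. -/
theorem leibniz {i j : ℤ} {u v : Space V G₀ G₁ G₂ G₃ C} (hu : Homogeneous i u)
    (hv : Homogeneous j v) (hij : i ≤ j) :
    K.b₁ (K.b₂ u v) = K.b₂ (K.b₁ u) v - sgn (j * i) • K.b₂ (K.b₁ v) u := by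
  by_cases h4 : 4 < i + j + 1
  · have h := K.homogeneous_b₁ (K.homogeneous_b₂ hu hv)
    rw [K.b₂_of_four_lt (K.homogeneous_b₁ hu) hv (by omega),
      K.b₂_of_four_lt (K.homogeneous_b₁ hv) hu (by omega), smul_zero, sub_zero]
    generalize K.b₁ (K.b₂ u v) = w, h' : 1 + (i + j) = k at h
    cases h <;> first | rfl | omega
  rw [← sub_eq_zero]
  rcases hu with _ | x | ⟨ξ, l⟩ | A | E | ⟨X, L⟩ | Y <;>
  rcases hv with _ | x' | ⟨ξ', l'⟩ | A' | E' | ⟨X', L'⟩ | Y' <;>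
  first | omega | (simp +decide [sgn]; done) | skip
  all_goals simp +decide [sgn]
  · rw [K.vb_skew x']; abel
  · rw [K.lie₀_eq, sub_self]
  · rw [K.lie₁_eq]; abel
  · rw [K.lie₂_eq]; abel
  · rw [K.lie₃_eq, sub_self]
  · rw [K.d₀_lie, K.d₀_lie, K.d₀_br₀₀]; abel
  · rw [K.d₁_lie, K.d₁_br₀₁]; abel
  · rw [K.d₁_d₀, LinearMap.map_zero, LinearMap.zero_apply, K.d₂_lie, K.d₂_br₀₂]
    exact ⟨rfl, by abel⟩
  · rw [K.d₂_d₁, K.d₂_d₁, K.d₂_br₁₁, K.c₂₂_comm (K.d₁ A'), LinearMap.map_zero, LinearMap.map_zero]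
    constructor <;> abel

end CartanData
end ChernSimons

namespace ChernSimons

/-! ### Jacobi identity -/

namespace CartanData
variable {V G₀ G₁ G₂ G₃ C : Type*} [AddCommGroup V] [AddCommGroup G₀] [AddCommGroup G₁]
  [AddCommGroup G₂] [AddCommGroup G₃] [AddCommGroup C] [Module ℝ V] [Module ℝ G₀] [Module ℝ G₁]
  [Module ℝ G₂] [Module ℝ G₃] [Module ℝ C] (K : CartanData V G₀ G₁ G₂ G₃ C)

set_option maxHeartbeats 1000000 in
/-- The Jacobi identity of the extended theory. By degree reasons only triples of total degree at
most four matter, and each case left by `simp` follows from a few rules of the Cartan calculus. -/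
theorem jacobi {i j k : ℤ} {u v w : Space V G₀ G₁ G₂ G₃ C} (hu : Homogeneous i u)
    (hv : Homogeneous j v) (hw : Homogeneous k w) (hij : i ≤ j) (hjk : j ≤ k) :
    jacobiator K.b₂ i j k u v w = 0 := by
  rw [jacobiator]
  by_cases h4 : 4 < i + j + k
  · rw [K.b₂_of_four_lt (K.homogeneous_b₂ hu hv) hw (by omega),
      K.b₂_of_four_lt (K.homogeneous_b₂ hu hw) hv (by omega),
      K.b₂_of_four_lt (K.homogeneous_b₂ hv hw) hu (by omega)]
    simp only [smul_zero, sub_zero, add_zero]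
  rcases hu with _ | x | ⟨ξ, l⟩ | A | E | ⟨X, L⟩ | Y <;>
  rcases hv with _ | x' | ⟨ξ', l'⟩ | A' | E' | ⟨X', L'⟩ | Y' <;> try omega
  all_goals rcases hw with _ | x'' | ⟨ξ'', l''⟩ | A'' | E'' | ⟨X'', L''⟩ | Y''
  all_goals first | omega | (simp +decide [sgn]; done) | skip
  all_goals simp +decide [sgn]
  · rw [K.ι₁_ι₂ x]; abel
  · rw [K.ι₂_ι₃ x]; abel
  · rw [K.vb_jacobi x ξ' ξ'', K.vb_skew (K.vb x ξ'') ξ', K.vb_skew (K.vb ξ' ξ'') x]; abel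
  · rw [K.vb_skew x, LinearMap.map_neg, LinearMap.neg_apply, K.vb_ι₁, K.ι_br₀₁,
      K.br₀₀_comm (K.ι₁ x A'')]
    abel
  · rw [K.vb_skew x, LinearMap.map_neg, LinearMap.neg_apply, K.vb_ι₂, K.ι_br₀₂]; abel
  · rw [K.vb_skew x, LinearMap.map_neg, LinearMap.neg_apply, K.vb_ι₃, K.ι_br₀₃]; abel
  · rw [K.vb_lieC]; abel
  · rw [K.ι_br₁₁]; abel
  · rw [K.ι_br₁₂, K.br₁₁_comm (K.ι₂ x E'')]; abel
  · rw [K.lie_c₁₃, K.lie₁_eq, K.lie₃_eq, K.c₂₂_ι₃, K.br₁₂_ι₃, LinearMap.map_add,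
        LinearMap.add_apply]
    constructor <;> abel
  · rw [K.lie_c₂₂, K.lie₂_eq, K.lie₂_eq, LinearMap.map_add, LinearMap.map_add, LinearMap.add_apply,
      K.c₂₂_ι₃, K.c₂₂_comm (K.ι₃ x (K.d₂ E')), K.c₂₂_ι₃, K.c₂₂_comm E', K.br₁₂_ι₂ x E']
    constructor <;> abel
  · rw [K.c₂₂_comm, K.c₂₂_ι₃]; abel
  · have h : ∀ m x n, K.br₀₀ m (K.lie₀ x n) = -K.br₀₀ (K.lie₀ x n) m := fun _ _ _ => K.br₀₀_comm _ _
    have j := K.jacobi₀₀₀ l l' l''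
    rw [K.br₀₀_comm l (K.br₀₀ _ _), K.br₀₀_comm l' (K.br₀₀ _ _), neg_eq_iff_eq_neg] at j
    constructor
    · rw [K.vb_jacobi ξ ξ' ξ'', K.vb_skew (K.vb ξ ξ'') ξ', K.vb_skew (K.vb ξ' ξ'') ξ]; abel
    · simp only [K.vb_lie₀, K.lie_br₀₀, h, j]; abel
  · rw [K.vb_lie₁, K.lie_br₀₁, K.lie_br₀₁, K.jacobi₀₀₁ l]; abel
  · rw [K.vb_lie₂, K.lie_br₀₂, K.lie_br₀₂, K.jacobi₀₀₂ l]; abel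
  · constructor
    · simp only [K.d₀_lie, K.d₀_br₀₀, K.vb_lieC, K.lie_c₁₃, K.c₁₃_br₀₁, LinearMap.map_sub,
        LinearMap.sub_apply]
      abel
    · rw [K.vb_lie₃, K.lie_br₀₃, K.lie_br₀₃, K.jacobi₀₀₃ l]; abel
  · rw [K.vb_lieC]; abel
  · rw [K.lie_br₁₁, K.jacobi₀₁₁, K.br₁₁_comm (K.lie₁ ξ A''), K.br₁₁_comm (K.br₀₁ l A'')]; abel
  · constructor
    · simp only [K.d₁_lie, K.d₁_br₀₁, K.d₂_lie, K.d₂_br₀₂, K.lie_c₂₂, K.lie_c₁₃, K.c₂₂_br₀₂,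
        K.c₁₃_br₀₁, K.c₂₂_br₁₁, LinearMap.map_add, LinearMap.add_apply]
      abel
    · rw [K.lie_br₁₂, K.jacobi₀₁₂]; abel
  · rw [K.lie_c₁₃, K.c₁₃_br₀₁]; abel
  · rw [K.lie_c₂₂, K.c₂₂_br₀₂, K.c₂₂_comm (K.br₀₂ l E''), K.c₂₂_comm (K.lie₂ ξ E'')]; abel
  · constructor
    · rw [K.c₂₂_comm (K.d₁ A''), K.c₂₂_comm (K.d₁ A'), K.c₂₂_comm (K.d₁ A)]
      simp only [K.c₂₂_br₁₁, K.d₂_br₁₁, LinearMap.map_neg, LinearMap.map_sub]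
      abel
    · rw [K.jacobi₁₁₁ A]; abel
  · rw [K.c₂₂_br₁₁]; abel

end CartanData
end ChernSimons

namespace ChernSimons

/-! ### The Cartan calculus of a three-manifold -/

section Tensors
variable {P P' R U W : Type*} [AddCommGroup P] [Module ℝ P] [AddCommGroup P'] [Module ℝ P']
  [AddCommGroup R] [Module ℝ R] [AddCommGroup U] [Module ℝ U] [AddCommGroup W] [Module ℝ W]

/-- The signs of a skew adjunction and of a skew-symmetric multiplication of coefficients cancel. -/
theorem map₂_adjoint_of_skew (w : P' →ₗ[ℝ] P →ₗ[ℝ] R) (D : P →ₗ[ℝ] P')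
    (h : ∀ α β, w (D α) β = -w (D β) α) (m : U →ₗ[ℝ] U →ₗ[ℝ] W) (hm : ∀ X Y, m X Y = -m Y X)
    (a b : P ⊗[ℝ] U) :
    TensorProduct.map₂ w m (D.rTensor U a) b = TensorProduct.map₂ w m (D.rTensor U b) a := by
  induction a using TensorProduct.induction_on with
  | zero => simp
  | add a a' ha ha' => simp only [map_add, LinearMap.add_apply, ha, ha']
  | tmul α X =>
    induction b using TensorProduct.induction_on with
    | zero => simp
    | add b b' hb hb' => simp only [map_add, LinearMap.add_apply, hb, hb']
    | tmul β Y =>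
      simp only [LinearMap.rTensor_tmul, TensorProduct.map₂_apply_tmul, TensorProduct.map_tmul]
      rw [h, hm, TensorProduct.neg_tmul, TensorProduct.tmul_neg, neg_neg]

end Tensors

section
variable {M : Type*} [TopologicalSpace M] [ChartedSpace E3 M] [IsManifold (𝓡 3) ∞ M]
variable {𝔤 : Type*} [LieRing 𝔤] [LieAlgebra ℝ 𝔤] (Tr : 𝔤 →ₗ[ℝ] 𝔤 →ₗ[ℝ] ℝ)

namespace GForm

/-- `dx^μ ⊗ Tr(ι_μ A Λ)` as a bilinear map. -/
noncomputable def cov₁₃ : GForm M 𝔤 1 →ₗ[ℝ] GForm M 𝔤 3 →ₗ[ℝ] CovDensity M :=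
  LinearMap.mk₂ ℝ (fun A L => (covTr Tr (p := 0) A L : CovDensity M))
    (fun A A' L => LinearMap.ext fun η =>
      (congrArg (fun x => tr₀₃ Tr x L) (map_add (contr η) A A')).trans
        (LinearMap.map_add₂ (tr₀₃ Tr) _ _ _))
    (fun c A L => LinearMap.ext fun η =>
      (congrArg (fun x => tr₀₃ Tr x L) (map_smul (contr η) c A)).trans
        (LinearMap.map_smul₂ (tr₀₃ Tr) _ _ _))
    (fun A L L' => LinearMap.ext fun η => map_add (tr₀₃ Tr (contr η A)) L L')
    (fun c A L => LinearMap.ext fun η => map_smul (tr₀₃ Tr (contr η A)) c L)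

/-- `dx^μ ⊗ Tr(ι_μ E ∧ E')` as a bilinear map. -/
noncomputable def cov₂₂ : GForm M 𝔤 2 →ₗ[ℝ] GForm M 𝔤 2 →ₗ[ℝ] CovDensity M :=
  LinearMap.mk₂ ℝ (fun E E' => (covTr Tr (p := 1) E E' : CovDensity M))
    (fun E E' F => LinearMap.ext fun η =>
      (congrArg (fun x => tr₁₂ Tr x F) (map_add (contr η) E E')).trans
        (LinearMap.map_add₂ (tr₁₂ Tr) _ _ _))
    (fun c E F => LinearMap.ext fun η =>
      (congrArg (fun x => tr₁₂ Tr x F) (map_smul (contr η) c E)).trans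
        (LinearMap.map_smul₂ (tr₁₂ Tr) _ _ _))
    (fun E F F' => LinearMap.ext fun η => map_add (tr₁₂ Tr (contr η E)) F F')
    (fun c E F => LinearMap.ext fun η => map_smul (tr₁₂ Tr (contr η E)) c F)

end GForm

namespace CovDensity

/-- The Lie derivative of a covector density is defined by the Leibniz rule. -/
theorem lie_apply (ξ : VField M) (X : CovDensity M) (η : VField M) :
    lie ξ X η = Form.lie ξ (X η) - X (ξ.bracket η) := rfl

theorem lie_add (ξ : VField M) (X Y : CovDensity M) : lie ξ (X + Y) = lie ξ X + lie ξ Y := by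
  ext1 η; simp only [lie_apply, LinearMap.add_apply, map_add]; abel

theorem lie_smul (ξ : VField M) (c : ℝ) (X : CovDensity M) : lie ξ (c • X) = c • lie ξ X := by
  ext1 η; simp only [lie_apply, LinearMap.smul_apply, map_smul, smul_sub]

theorem add_lie (ξ η : VField M) (X : CovDensity M) : lie (ξ + η) X = lie ξ X + lie η X := by
  ext1 ζ
  simp only [lie_apply, LinearMap.add_apply, Form.add_lie, VField.add_bracket, map_add]
  abel

theorem smul_lie (c : ℝ) (ξ : VField M) (X : CovDensity M) : lie (c • ξ) X = c • lie ξ X := by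
  ext1 η
  have h : (c • ξ).bracket η = (ContMDiffMap.const c : SmoothFun M) • ξ.bracket η := by
    rw [VField.const_smul_bracket]; rfl
  simp only [lie_apply, LinearMap.smul_apply, Form.smul_lie, smul_sub, h, map_smul]
  rw [Form.const_smul c (X _)]

theorem bracket_lie [T2Space M] (ξ η : VField M) (X : CovDensity M) :
    lie (ξ.bracket η) X = lie ξ (lie η X) - lie η (lie ξ X) := by
  ext1 ζ
  have h : (ξ.bracket η).bracket ζ = ξ.bracket (η.bracket ζ) - η.bracket (ξ.bracket ζ) := by
    rw [VField.jacobi ξ η ζ]; abel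
  simp only [lie_apply, LinearMap.sub_apply, map_sub, h, ← Form.lie_lie_three ξ η]
  abel

end CovDensity

namespace GForm
variable [T2Space M] [SigmaCompactSpace M]

theorem tr₀₃_sub_left (a a' : GForm M 𝔤 0) (b : GForm M 𝔤 3) :
    tr₀₃ Tr (a - a') b = tr₀₃ Tr a b - tr₀₃ Tr a' b :=
  congrArg (fun f : GForm M 𝔤 3 →ₗ[ℝ] Form M 3 => f b) (map_sub (tr₀₃ Tr) a a')

theorem tr₀₃_neg_left (a : GForm M 𝔤 0) (b : GForm M 𝔤 3) :
    tr₀₃ Tr (-a) b = -tr₀₃ Tr a b :=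
  congrArg (fun f : GForm M 𝔤 3 →ₗ[ℝ] Form M 3 => f b) (map_neg (tr₀₃ Tr) a)

theorem tr₁₂_sub_left (a a' : GForm M 𝔤 1) (b : GForm M 𝔤 2) :
    tr₁₂ Tr (a - a') b = tr₁₂ Tr a b - tr₁₂ Tr a' b :=
  congrArg (fun f : GForm M 𝔤 2 →ₗ[ℝ] Form M 3 => f b) (map_sub (tr₁₂ Tr) a a')

/-- The contraction of the four-form `[a, b]` vanishes. -/
theorem br₁₂_contr_three (ξ : VField M) (a : GForm M 𝔤 1) (b : GForm M 𝔤 3) :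
    br₁₂ a (contr ξ b) = br₀₃ (contr ξ a) b :=
  (map₂_adjoint (Form.wedgeBilin (M := M) 0 3) (Form.wedgeBilin (M := M) 1 2) (Form.contr ξ)
      (Form.contr ξ)
      (Form.contr_one_wedge_three ξ) (lieBilin 𝔤) a b).symm

/-- The contraction of the four-form `[a, b]` vanishes. -/
theorem br₁₂_contr_two (ξ : VField M) (a b : GForm M 𝔤 2) :
    br₁₂ (contr ξ a) b = br₁₂ (contr ξ b) a :=
  map₂_adjoint_of_skew (Form.wedgeBilin (M := M) 1 2) (Form.contr ξ) (Form.contr_two_wedge_two ξ)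
    (lieBilin 𝔤) lieBilin_skew a b

variable {Tr}

theorem lie_cov₁₃ (ξ : VField M) (A : GForm M 𝔤 1) (L : GForm M 𝔤 3) :
    CovDensity.lie ξ (cov₁₃ Tr A L) = cov₁₃ Tr (lie ξ A) L + cov₁₃ Tr A (lie ξ L) := by
  ext1 η
  have h : (tr₀₃ Tr (contr (ξ.bracket η) A) L : Form M 3) =
      tr₀₃ Tr (lie ξ (contr η A)) L - tr₀₃ Tr (contr η (lie ξ A)) L :=
    (congrArg (tr₀₃ Tr · L) (bracket_contr_one ξ η A)).trans (tr₀₃_sub_left Tr _ _ _)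
  change (Form.lie ξ (tr₀₃ Tr (contr η A) L) - tr₀₃ Tr (contr (ξ.bracket η) A) L : Form M 3) =
    tr₀₃ Tr (contr η (lie ξ A)) L + tr₀₃ Tr (contr η A) (lie ξ L)
  rw [h, lie_tr₀₃]
  abel

theorem lie_cov₂₂ (ξ : VField M) (E F : GForm M 𝔤 2) :
    CovDensity.lie ξ (cov₂₂ Tr E F) = cov₂₂ Tr (lie ξ E) F + cov₂₂ Tr E (lie ξ F) := by
  ext1 η
  have h : (tr₁₂ Tr (contr (ξ.bracket η) E) F : Form M 3) =
      tr₁₂ Tr (lie ξ (contr η E)) F - tr₁₂ Tr (contr η (lie ξ E)) F :=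
    (congrArg (tr₁₂ Tr · F) (bracket_contr_two ξ η E)).trans (tr₁₂_sub_left Tr _ _ _)
  change (Form.lie ξ (tr₁₂ Tr (contr η E) F) - tr₁₂ Tr (contr (ξ.bracket η) E) F : Form M 3) =
    tr₁₂ Tr (contr η (lie ξ E)) F + tr₁₂ Tr (contr η E) (lie ξ F)
  rw [h, lie_tr₁₂]
  abel

/-- The contraction of the four-form `Tr(E ∧ F)` vanishes. -/
theorem cov₂₂_comm (hsymm : ∀ X Y, Tr X Y = Tr Y X) (E F : GForm M 𝔤 2) :
    cov₂₂ Tr E F = -cov₂₂ Tr F E :=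
  LinearMap.ext fun η => tr₁₂_contr hsymm η E F

/-- The contraction of the four-form `Tr(ι_η E ∧ L)` vanishes. -/
theorem cov₂₂_contr (ξ : VField M) (E : GForm M 𝔤 2) (L : GForm M 𝔤 3) :
    cov₂₂ Tr E (contr ξ L) = -cov₁₃ Tr (contr ξ E) L := by
  ext1 η
  exact (tr₀₃_contr Tr ξ (contr η E) L).symm.trans
    ((congrArg (tr₀₃ Tr · L) (contr_contr_two ξ η E)).trans (tr₀₃_neg_left Tr _ _))

theorem cov₂₂_br₁₁ (hinv : ∀ X Y Z, Tr ⁅X, Y⁆ Z = Tr X ⁅Y, Z⁆) (A B : GForm M 𝔤 1)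
    (E : GForm M 𝔤 2) :
    cov₂₂ Tr (br₁₁ A B) E = cov₁₃ Tr A (br₁₂ B E) + cov₁₃ Tr B (br₁₂ A E) := by
  ext1 η
  exact (congrArg (tr₁₂ Tr · E) (contr_br₁₁ η A B)).trans
      ((LinearMap.map_add₂ (tr₁₂ Tr) _ _ _).trans
    (congrArg₂ (· + ·) (tr₁₂_br₀₁ hinv _ B E) (tr₁₂_br₀₁ hinv _ A E)))

theorem cov₁₃_br₀₁ (hinv : ∀ X Y Z, Tr ⁅X, Y⁆ Z = Tr X ⁅Y, Z⁆) (l : GForm M 𝔤 0)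
    (A : GForm M 𝔤 1) (L : GForm M 𝔤 3) : cov₁₃ Tr (br₀₁ l A) L = -cov₁₃ Tr A (br₀₃ l L) := by
  ext1 η
  exact (congrArg (tr₀₃ Tr · L) ((contr_br₀₁ η l A).trans (br₀₀_comm l _))).trans
    ((tr₀₃_neg_left Tr _ _).trans (congrArg Neg.neg (tr₀₃_br₀₀ hinv _ l L)))

theorem cov₂₂_br₀₂ (hsymm : ∀ X Y, Tr X Y = Tr Y X) (hinv : ∀ X Y Z, Tr ⁅X, Y⁆ Z = Tr X ⁅Y, Z⁆)
    (l : GForm M 𝔤 0) (E F : GForm M 𝔤 2) :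
    cov₂₂ Tr (br₀₂ l E) F = -cov₂₂ Tr E (br₀₂ l F) := by
  ext1 η
  exact (congrArg (tr₁₂ Tr · F) (contr_br₀₂ η l E)).trans ((tr₁₂_br₀₁ hinv l _ F).trans
    (neg_eq_iff_eq_neg.2 (tr₁₂_br₀₂ hsymm hinv l (contr η E) F)).symm)

end GForm

variable (M) in
/-- The Lie bracket of vector fields as a bilinear map. -/
noncomputable def VField.bracketBilin : VField M →ₗ[ℝ] VField M →ₗ[ℝ] VField M :=
  LinearMap.mk₂ ℝ VField.bracket VField.add_bracket VField.const_smul_bracket VField.bracket_add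
    (fun c X Y => VField.bracket_const_smul c X Y)

/-- The Lie derivative of Lie algebra valued forms as a bilinear map. -/
noncomputable def GForm.lieBil {k : ℕ} : VField M →ₗ[ℝ] GForm M 𝔤 k →ₗ[ℝ] GForm M 𝔤 k where
  toFun := GForm.lie
  map_add' ξ η := LinearMap.ext (GForm.add_lie ξ η)
  map_smul' c ξ := LinearMap.ext (GForm.smul_lie c ξ)

/-- The contraction as a bilinear map. -/
noncomputable def GForm.contrBilin (k : ℕ) :
    VField M →ₗ[ℝ] GForm M 𝔤 (k + 1) →ₗ[ℝ] GForm M 𝔤 k where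
  toFun := GForm.contr
  map_add' ξ η := LinearMap.ext (GForm.contr_add ξ η)
  map_smul' c ξ := LinearMap.ext (GForm.smul_contr c ξ)

/-- The Lie derivative of covector densities as a bilinear map. -/
noncomputable def CovDensity.lieBilin : VField M →ₗ[ℝ] CovDensity M →ₗ[ℝ] CovDensity M :=
  LinearMap.mk₂ ℝ CovDensity.lie CovDensity.add_lie CovDensity.smul_lie CovDensity.lie_add
    (fun c ξ X => CovDensity.lie_smul ξ c X)

variable [T2Space M] [SigmaCompactSpace M]

/-- The Cartan calculus of a three-manifold. -/
noncomputable def cartanData {Tr : 𝔤 →ₗ[ℝ] 𝔤 →ₗ[ℝ] ℝ} (hsymm : ∀ X Y, Tr X Y = Tr Y X)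
    (hinv : ∀ X Y Z, Tr ⁅X, Y⁆ Z = Tr X ⁅Y, Z⁆) :
    CartanData (VField M) (GForm M 𝔤 0) (GForm M 𝔤 1) (GForm M 𝔤 2) (GForm M 𝔤 3)
      (CovDensity M) where
  vb := VField.bracketBilin M
  d₀ := GForm.d₀
  d₁ := GForm.d₁
  d₂ := GForm.d₂
  lie₀ := GForm.lieBil
  lie₁ := GForm.lieBil
  lie₂ := GForm.lieBil
  lie₃ := GForm.lieBil
  lieC := CovDensity.lieBilin
  ι₁ := GForm.contrBilin 0
  ι₂ := GForm.contrBilin 1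
  ι₃ := GForm.contrBilin 2
  br₀₀ := GForm.br₀₀
  br₀₁ := GForm.br₀₁
  br₀₂ := GForm.br₀₂
  br₀₃ := GForm.br₀₃
  br₁₁ := GForm.br₁₁
  br₁₂ := GForm.br₁₂
  c₁₃ := GForm.cov₁₃ Tr
  c₂₂ := GForm.cov₂₂ Tr
  vb_skew := VField.bracket_swap
  vb_jacobi ξ η ζ := by
    have h := VField.jacobi ξ η ζ
    exact eq_sub_of_add_eq h.symm
  d₁_d₀ := GForm.d₁_d₀
  d₂_d₁ := GForm.d₂_d₁
  d₀_lie := GForm.d₀_lie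
  d₁_lie := GForm.d₁_lie
  d₂_lie := GForm.d₂_lie
  vb_lie₀ := GForm.bracket_lie_zero
  vb_lie₁ := GForm.bracket_lie_one
  vb_lie₂ := GForm.bracket_lie_two
  vb_lie₃ := GForm.bracket_lie_three
  vb_lieC := CovDensity.bracket_lie
  lie₀_eq := GForm.lie_zero_eq
  lie₁_eq := GForm.lie_one_eq
  lie₂_eq := GForm.lie_two_eq
  lie₃_eq := GForm.lie_three_eq
  vb_ι₁ := GForm.bracket_contr_one
  vb_ι₂ := GForm.bracket_contr_two
  vb_ι₃ := GForm.bracket_contr_three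
  ι₁_ι₂ := GForm.contr_contr_two
  ι₂_ι₃ := GForm.contr_contr_three
  br₀₀_comm := GForm.br₀₀_comm
  br₁₁_comm := GForm.br₁₁_comm
  d₀_br₀₀ := GForm.d₀_br₀₀
  d₁_br₀₁ := GForm.d₁_br₀₁
  d₂_br₀₂ := GForm.d₂_br₀₂
  d₂_br₁₁ := GForm.d₂_br₁₁
  lie_br₀₀ := GForm.lie_br₀₀
  lie_br₀₁ := GForm.lie_br₀₁
  lie_br₀₂ := GForm.lie_br₀₂
  lie_br₀₃ := GForm.lie_br₀₃
  lie_br₁₁ := GForm.lie_br₁₁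
  lie_br₁₂ := GForm.lie_br₁₂
  ι_br₀₁ := GForm.contr_br₀₁
  ι_br₀₂ := GForm.contr_br₀₂
  ι_br₀₃ := GForm.contr_br₀₃
  ι_br₁₁ := GForm.contr_br₁₁
  ι_br₁₂ := GForm.contr_br₁₂
  jacobi₀₀₀ := GForm.jacobi₀₀₀
  jacobi₀₀₁ := GForm.jacobi₀₀₁
  jacobi₀₀₂ := GForm.jacobi₀₀₂
  jacobi₀₀₃ := GForm.jacobi₀₀₃
  jacobi₀₁₁ := GForm.jacobi₀₁₁
  jacobi₀₁₂ := GForm.jacobi₀₁₂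
  jacobi₁₁₁ := GForm.jacobi₁₁₁
  c₂₂_comm := GForm.cov₂₂_comm hsymm
  lie_c₁₃ := GForm.lie_cov₁₃
  lie_c₂₂ := GForm.lie_cov₂₂
  c₂₂_ι₃ := GForm.cov₂₂_contr
  br₁₂_ι₃ := GForm.br₁₂_contr_three
  br₁₂_ι₂ := GForm.br₁₂_contr_two
  c₂₂_br₁₁ := GForm.cov₂₂_br₁₁ hinv
  c₁₃_br₀₁ := GForm.cov₁₃_br₀₁ hinv
  c₂₂_br₀₂ := GForm.cov₂₂_br₀₂ hsymm hinv

end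
end ChernSimons

namespace ChernSimons

/-! ### The extended theory is a differential graded Lie algebra -/

/-- A family of subspaces with finitely many compatible projections summing up to the identity is a
grading. -/
theorem isInternal_of_projections {V : Type*} [AddCommGroup V] [Module ℝ V]
    (𝒱 : ℤ → Submodule ℝ V) (P : ℤ → V →ₗ[ℝ] V) (s : Finset ℤ)
    (hmem : ∀ k v, P k v ∈ 𝒱 k) (hid : ∀ k, ∀ v ∈ 𝒱 k, P k v = v)
    (hne : ∀ j k, j ≠ k → ∀ v ∈ 𝒱 j, P k v = 0) (hsum : ∀ v, ∑ k ∈ s, P k v = v) :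
    DirectSum.IsInternal 𝒱 := by
  have key : ∀ k, P k ∘ₗ DirectSum.coeLinearMap 𝒱 =
      (𝒱 k).subtype ∘ₗ DirectSum.component ℝ ℤ (fun i => 𝒱 i) k := by
    intro k
    refine DirectSum.linearMap_ext ℝ fun j => LinearMap.ext fun v => ?_
    simp only [LinearMap.comp_apply, DirectSum.coeLinearMap_lof, Submodule.subtype_apply]
    by_cases h : j = k
    · subst h
      rw [hid j v v.2, DirectSum.component.lof_self]
    · rw [hne j k h v v.2, DirectSum.component.of, dif_neg h]; rfl
  refine ⟨(injective_iff_map_eq_zero _).2 fun x hx => ?_, fun v => ?_⟩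
  · refine DirectSum.ext_component ℝ fun k => Subtype.ext ?_
    have h1 := LinearMap.congr_fun (key k) x
    have h2 : DirectSum.coeLinearMap 𝒱 x = 0 := hx
    rw [LinearMap.comp_apply, h2, map_zero] at h1
    rw [map_zero]
    exact h1.symm
  · refine ⟨∑ k ∈ s, DirectSum.lof ℝ ℤ (fun i => 𝒱 i) k ⟨P k v, hmem k v⟩, ?_⟩
    change DirectSum.coeLinearMap 𝒱 _ = v
    rw [map_sum]
    simp only [DirectSum.coeLinearMap_lof]
    exact hsum v

section
variable {M : Type*} [TopologicalSpace M] [ChartedSpace E3 M] [IsManifold (𝓡 3) ∞ M]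
variable {𝔤 : Type*} [LieRing 𝔤] [LieAlgebra ℝ 𝔤] {Tr : 𝔤 →ₗ[ℝ] 𝔤 →ₗ[ℝ] ℝ}

open CartanData in
theorem ExtSpace.homogeneous_of_mem {k : ℤ} {u : ExtSpace M 𝔤} (hu : u ∈ ExtSpace.degree M 𝔤 k) :
    Homogeneous k (V := VField M) (G₀ := GForm M 𝔤 0) (G₁ := GForm M 𝔤 1) (G₂ := GForm M 𝔤 2)
      (G₃ := GForm M 𝔤 3) (C := CovDensity M) u := by
  obtain ⟨x, ⟨ξ, l⟩, A, E, ⟨X, L⟩, Y⟩ := u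
  obtain ⟨h1, h2, h3, h4, h5, h6⟩ := hu
  have e1 : k ≠ -1 → x = 0 := h1
  have e2 : k ≠ 0 → ξ = 0 ∧ l = 0 := h2
  have e3 : k ≠ 1 → A = 0 := h3
  have e4 : k ≠ 2 → E = 0 := h4
  have e5 : k ≠ 3 → X = 0 ∧ L = 0 := h5
  have e6 : k ≠ 4 → Y = 0 := h6
  clear h1 h2 h3 h4 h5 h6
  by_cases c1 : k = -1
  · obtain ⟨rfl, rfl⟩ := e2 (by omega); obtain rfl := e3 (by omega); obtain rfl := e4 (by omega)
    obtain ⟨rfl, rfl⟩ := e5 (by omega); obtain rfl := e6 (by omega)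
    rw [c1]; exact .ofV x
  obtain rfl := e1 c1
  by_cases c2 : k = 0
  · obtain rfl := e3 (by omega); obtain rfl := e4 (by omega)
    obtain ⟨rfl, rfl⟩ := e5 (by omega); obtain rfl := e6 (by omega)
    rw [c2]; exact .ofG ξ l
  obtain ⟨rfl, rfl⟩ := e2 c2
  by_cases c3 : k = 1
  · obtain rfl := e4 (by omega)
    obtain ⟨rfl, rfl⟩ := e5 (by omega); obtain rfl := e6 (by omega)
    rw [c3]; exact .ofA A
  obtain rfl := e3 c3
  by_cases c4 : k = 2
  · obtain ⟨rfl, rfl⟩ := e5 (by omega); obtain rfl := e6 (by omega)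
    rw [c4]; exact .ofE E
  obtain rfl := e4 c4
  by_cases c5 : k = 3
  · obtain rfl := e6 (by omega)
    rw [c5]; exact .ofN X L
  obtain ⟨rfl, rfl⟩ := e5 c5
  by_cases c6 : k = 4
  · rw [c6]; exact .ofC Y
  obtain rfl := e6 c6
  exact .zero k

open CartanData in
theorem ExtSpace.mem_of_homogeneous {k : ℤ} {u : ExtSpace M 𝔤}
    (hu : Homogeneous k (V := VField M) (G₀ := GForm M 𝔤 0) (G₁ := GForm M 𝔤 1)
      (G₂ := GForm M 𝔤 2) (G₃ := GForm M 𝔤 3) (C := CovDensity M) u) :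
    u ∈ ExtSpace.degree M 𝔤 k := by
  cases hu with
  | zero => exact Submodule.zero_mem _
  | ofV => exact ⟨fun h => absurd rfl h, fun _ => ⟨rfl, rfl⟩, fun _ => rfl, fun _ => rfl,
      fun _ => ⟨rfl, rfl⟩, fun _ => rfl⟩
  | ofG => exact ⟨fun _ => rfl, fun h => absurd rfl h, fun _ => rfl, fun _ => rfl,
      fun _ => ⟨rfl, rfl⟩, fun _ => rfl⟩
  | ofA => exact ⟨fun _ => rfl, fun _ => ⟨rfl, rfl⟩, fun h => absurd rfl h, fun _ => rfl,
      fun _ => ⟨rfl, rfl⟩, fun _ => rfl⟩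
  | ofE => exact ⟨fun _ => rfl, fun _ => ⟨rfl, rfl⟩, fun _ => rfl, fun h => absurd rfl h,
      fun _ => ⟨rfl, rfl⟩, fun _ => rfl⟩
  | ofN => exact ⟨fun _ => rfl, fun _ => ⟨rfl, rfl⟩, fun _ => rfl, fun _ => rfl,
      fun h => absurd rfl h, fun _ => rfl⟩
  | ofC => exact ⟨fun _ => rfl, fun _ => ⟨rfl, rfl⟩, fun _ => rfl, fun _ => rfl,
      fun _ => ⟨rfl, rfl⟩, fun h => absurd rfl h⟩

namespace CartanData
variable {V G₀ G₁ G₂ G₃ C : Type*} [AddCommGroup V] [AddCommGroup G₀] [AddCommGroup G₁]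
  [AddCommGroup G₂] [AddCommGroup G₃] [AddCommGroup C] [Module ℝ V] [Module ℝ G₀] [Module ℝ G₁]
  [Module ℝ G₂] [Module ℝ G₃] [Module ℝ C]

/-- The projection of the extended space to its part of degree `k`. -/
def proj (k : ℤ) : Space V G₀ G₁ G₂ G₃ C →ₗ[ℝ] Space V G₀ G₁ G₂ G₃ C :=
  LinearMap.prodMap (if k = -1 then LinearMap.id else 0)
    (LinearMap.prodMap (if k = 0 then LinearMap.id else 0)
      (LinearMap.prodMap (if k = 1 then LinearMap.id else 0)
        (LinearMap.prodMap (if k = 2 then LinearMap.id else 0)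
          (LinearMap.prodMap (if k = 3 then LinearMap.id else 0)
            (if k = 4 then LinearMap.id else 0)))))

theorem homogeneous_proj (k : ℤ) (u : Space V G₀ G₁ G₂ G₃ C) : Homogeneous k (proj k u) := by
  obtain ⟨x, ⟨ξ, l⟩, A, E, ⟨X, L⟩, Y⟩ := u
  by_cases c : -1 ≤ k ∧ k ≤ 4
  · obtain ⟨c1, c2⟩ := c
    interval_cases k
    · exact .ofV x
    · exact .ofG ξ l
    · exact .ofA A
    · exact .ofE E
    · exact .ofN X L
    · exact .ofC Y
  · rw [proj, if_neg (by omega), if_neg (by omega), if_neg (by omega), if_neg (by omega),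
      if_neg (by omega), if_neg (by omega)]
    exact .zero k

theorem proj_of_homogeneous {k : ℤ} {u : Space V G₀ G₁ G₂ G₃ C} (hu : Homogeneous k u) :
    proj k u = u := by
  cases hu <;> first | exact map_zero _ | rfl

theorem proj_of_ne {j k : ℤ} (h : j ≠ k) {u : Space V G₀ G₁ G₂ G₃ C} (hu : Homogeneous j u) :
    proj k u = 0 := by
  cases hu <;> simp only [proj, ofV, ofG, ofA, ofE, ofN, ofC, LinearMap.prodMap_apply, map_zero,
    if_neg h.symm, LinearMap.zero_apply] <;>
  first | rfl | simp only [← Prod.zero_eq_mk, map_zero]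

theorem sum_proj (u : Space V G₀ G₁ G₂ G₃ C) : ∑ k ∈ Finset.Icc (-1 : ℤ) 4, proj k u = u := by
  rw [show Finset.Icc (-1 : ℤ) 4 = {-1, 0, 1, 2, 3, 4} from rfl]
  obtain ⟨x, ⟨ξ, l⟩, A, E, ⟨X, L⟩, Y⟩ := u
  simp [proj]

variable (K : CartanData V G₀ G₁ G₂ G₃ C)

theorem b₁_add (u v : Space V G₀ G₁ G₂ G₃ C) : K.b₁ (u + v) = K.b₁ u + K.b₁ v := by
  simp only [b₁, Prod.fst_add, Prod.snd_add, LinearMap.map_add, Prod.mk_add_mk, add_zero]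

theorem b₁_smul (c : ℝ) (u : Space V G₀ G₁ G₂ G₃ C) : K.b₁ (c • u) = c • K.b₁ u := by
  simp only [b₁, Prod.smul_fst, Prod.smul_snd, LinearMap.map_smul, Prod.smul_mk, smul_zero]

end CartanData

theorem ExtSpace.isInternal_degree : DirectSum.IsInternal (ExtSpace.degree M 𝔤) :=
  isInternal_of_projections _ CartanData.proj (Finset.Icc (-1) 4)
    (fun k v => mem_of_homogeneous (CartanData.homogeneous_proj k v))
    (fun _ _ hv => CartanData.proj_of_homogeneous (homogeneous_of_mem hv))
    (fun _ _ h _ hv => CartanData.proj_of_ne h (homogeneous_of_mem hv)) CartanData.sum_proj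

variable [T2Space M] [SigmaCompactSpace M]

/-- The bracket of the extended theory is the one of its Cartan calculus. Only the order of the
factors differs, in brackets of forms whose first factor has the higher degree. -/
theorem ExtSpace.bracket₂_eq (hsymm : ∀ X Y, Tr X Y = Tr Y X)
    (hinv : ∀ X Y Z, Tr ⁅X, Y⁆ Z = Tr X ⁅Y, Z⁆) (u v : ExtSpace M 𝔤) :
    bracket₂ Tr u v = (cartanData hsymm hinv).b₂ u v := rfl

theorem ExtSpace.isDGLieAlgebra (hsymm : ∀ X Y, Tr X Y = Tr Y X)
    (hinv : ∀ X Y Z, Tr ⁅X, Y⁆ Z = Tr X ⁅Y, Z⁆) :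
    IsDGLieAlgebra (ExtSpace.degree M 𝔤) (ExtSpace.brackets Tr) :=
  isDGLieAlgebra_of _ _ (cartanData hsymm hinv).b₁ (cartanData hsymm hinv).b₂ (fun _ => rfl)
    (fun _ => rfl) (fun _ => rfl)
    (fun n hn v => by obtain ⟨m, rfl⟩ := Nat.exists_eq_add_of_le' hn; rfl)
    ExtSpace.isInternal_degree (CartanData.b₁_add _) (CartanData.b₁_smul _)
    (CartanData.b₂_add_left _) (CartanData.b₂_smul_left _) (CartanData.b₂_add_right _)
    (fun c x y => CartanData.b₂_smul_right _ c x y)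
    (fun _ _ hx => mem_of_homogeneous (CartanData.homogeneous_b₁ _ (homogeneous_of_mem hx)))
    (fun _ _ _ hx _ hy => mem_of_homogeneous
      (CartanData.homogeneous_b₂ _ (homogeneous_of_mem hx) (homogeneous_of_mem hy)))
    (fun _ _ _ hx _ hy => CartanData.b₂_antisymm _ (homogeneous_of_mem hx) (homogeneous_of_mem hy))
    (CartanData.b₁_b₁ _)
    (fun _ _ h _ hx _ hy => CartanData.leibniz _ (homogeneous_of_mem hx) (homogeneous_of_mem hy) h)
    (fun _ _ _ h h' _ hx _ hy _ hz => CartanData.jacobi _ (homogeneous_of_mem hx)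
      (homogeneous_of_mem hy) (homogeneous_of_mem hz) h h')

end
end ChernSimons

namespace ChernSimons

/-! ### Chern-Simons theory and the homotopy in the abstract Cartan calculus -/

namespace CartanData
variable {V G₀ G₁ G₂ G₃ C : Type*} [AddCommGroup V] [AddCommGroup G₀] [AddCommGroup G₁]
  [AddCommGroup G₂] [AddCommGroup G₃] [AddCommGroup C] [Module ℝ V] [Module ℝ G₀] [Module ℝ G₁]
  [Module ℝ G₂] [Module ℝ G₃] [Module ℝ C] (K : CartanData V G₀ G₁ G₂ G₃ C)

/-- The underlying space of the theory without vector fields and covector densities. -/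
abbrev FormSpace (G₀ G₁ G₂ G₃ : Type*) : Type _ := G₀ × G₁ × G₂ × G₃

/-- The Cartan calculus with the pairings into covector densities replaced by zero. -/
def withoutPairing : CartanData V G₀ G₁ G₂ G₃ C :=
  { K with
    c₁₃ := 0
    c₂₂ := 0
    c₂₂_comm := fun _ _ => by simp
    lie_c₁₃ := fun _ _ _ => by simp
    lie_c₂₂ := fun _ _ _ => by simp
    c₂₂_ι₃ := fun _ _ _ => by simp
    c₂₂_br₁₁ := fun _ _ _ => by simp
    c₁₃_br₀₁ := fun _ _ _ => by simp
    c₂₂_br₀₂ := fun _ _ _ => by simp }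

/-- The differential on forms. -/
def formB₁ (u : FormSpace G₀ G₁ G₂ G₃) : FormSpace G₀ G₁ G₂ G₃ :=
  (0, K.d₀ u.1, K.d₁ u.2.1, K.d₂ u.2.2.1)

/-- The bracket on forms, minus the Lie bracket of the wedge product. -/
def formB₂ : FormSpace G₀ G₁ G₂ G₃ → FormSpace G₀ G₁ G₂ G₃ → FormSpace G₀ G₁ G₂ G₃ :=
  fun (l, A, E, L) (l', A', E', L') =>
    (-K.br₀₀ l l', -K.br₀₁ l A' + K.br₀₁ l' A, -K.br₀₂ l E' + K.br₀₂ l' E - K.br₁₁ A A',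
      -K.br₀₃ l L' + K.br₀₃ l' L - K.br₁₂ A E' + K.br₁₂ A' E)

/-- The inclusion of the forms. -/
def inclusion (u : FormSpace G₀ G₁ G₂ G₃) : Space V G₀ G₁ G₂ G₃ C :=
  (0, (0, u.1), u.2.1, u.2.2.1, (0, u.2.2.2), 0)

/-- The second component of the morphism. -/
def homotopy : FormSpace G₀ G₁ G₂ G₃ → FormSpace G₀ G₁ G₂ G₃ → Space V G₀ G₁ G₂ G₃ C :=
  fun (_, A, E, L) (_, A', E', L') =>
    ofN (-(K.c₁₃ A L' + K.c₁₃ A' L + K.c₂₂ E E')) 0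

theorem inclusion_injective :
    Function.Injective (inclusion : FormSpace G₀ G₁ G₂ G₃ → Space V G₀ G₁ G₂ G₃ C) := by
  rintro ⟨l, A, E, L⟩ ⟨l', A', E', L'⟩ h
  simp only [inclusion, Prod.mk.injEq, true_and, and_true] at h
  simp only [Prod.mk.injEq]; exact h

theorem inclusion_add (u v : FormSpace G₀ G₁ G₂ G₃) :
    (inclusion (u + v) : Space V G₀ G₁ G₂ G₃ C) = inclusion u + inclusion v := by
  simp only [inclusion, Prod.fst_add, Prod.snd_add, Prod.mk_add_mk, add_zero]

theorem inclusion_smul (c : ℝ) (u : FormSpace G₀ G₁ G₂ G₃) :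
    (inclusion (c • u) : Space V G₀ G₁ G₂ G₃ C) = c • inclusion u := by
  simp only [inclusion, Prod.smul_fst, Prod.smul_snd, Prod.smul_mk, smul_zero]

theorem inclusion_zero : (inclusion (0 : FormSpace G₀ G₁ G₂ G₃) : Space V G₀ G₁ G₂ G₃ C) = 0 := rfl

theorem inclusion_sub (u v : FormSpace G₀ G₁ G₂ G₃) :
    (inclusion (u - v) : Space V G₀ G₁ G₂ G₃ C) = inclusion u - inclusion v := by
  simp only [inclusion, Prod.fst_sub, Prod.snd_sub, Prod.mk_sub_mk, sub_zero]

theorem inclusion_formB₁ (u : FormSpace G₀ G₁ G₂ G₃) :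
    inclusion (K.formB₁ u) = K.b₁ (inclusion u) := by
  simp only [inclusion, formB₁, b₁]

/-- Without covector densities the inclusion of forms preserves brackets. -/
theorem inclusion_formB₂ (u v : FormSpace G₀ G₁ G₂ G₃) :
    inclusion (K.formB₂ u v) = K.withoutPairing.b₂ (inclusion u) (inclusion v) := by
  obtain ⟨l, A, E, L⟩ := u
  obtain ⟨l', A', E', L'⟩ := v
  simp only [inclusion, formB₂, b₂, withoutPairing, LinearMap.map_zero, LinearMap.zero_apply,
      add_zero,
    zero_add, sub_zero, zero_sub]

theorem b₂_inclusion (u v : FormSpace G₀ G₁ G₂ G₃) :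
    K.b₂ (inclusion u) (inclusion v) = inclusion (K.formB₂ u v) +
      (ofN (K.c₁₃ (K.d₀ u.1) v.2.2.2 - K.c₁₃ (K.d₀ v.1) u.2.2.2 +
        (K.c₂₂ (K.d₁ u.2.1) v.2.2.1 - K.c₁₃ u.2.1 (K.d₂ v.2.2.1)) -
        (K.c₂₂ (K.d₁ v.2.1) u.2.2.1 - K.c₁₃ v.2.1 (K.d₂ u.2.2.1))) 0 +
        ofC (K.c₁₃ u.2.1 v.2.2.2 + K.c₁₃ v.2.1 u.2.2.2 + K.c₂₂ u.2.2.1 v.2.2.1)) := by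
  obtain ⟨l, A, E, L⟩ := u
  obtain ⟨l', A', E', L'⟩ := v
  simp only [inclusion, formB₂, b₂, ofN, ofC, LinearMap.map_zero, LinearMap.zero_apply, add_zero,
    zero_add, sub_zero, zero_sub, Prod.mk_add_mk]

/-- The homogeneous elements: forms of degree `0, …, 3`, and zero. -/
inductive FormHomogeneous : ℤ → FormSpace G₀ G₁ G₂ G₃ → Prop
  | zero (k : ℤ) : FormHomogeneous k 0
  | of₀ (l : G₀) : FormHomogeneous 0 (l, 0, 0, 0)
  | of₁ (A : G₁) : FormHomogeneous 1 (0, A, 0, 0)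
  | of₂ (E : G₂) : FormHomogeneous 2 (0, 0, E, 0)
  | of₃ (L : G₃) : FormHomogeneous 3 (0, 0, 0, L)

theorem homogeneous_inclusion {k : ℤ} {u : FormSpace G₀ G₁ G₂ G₃} (hu : FormHomogeneous k u) :
    Homogeneous k (inclusion u : Space V G₀ G₁ G₂ G₃ C) := by
  cases hu with
  | zero => exact .zero _
  | of₀ l => exact .ofG 0 l
  | of₁ A => exact .ofA A
  | of₂ E => exact .ofE E
  | of₃ L => exact .ofN 0 L

/-- The part of degree `k`. -/
def formProj (k : ℤ) : FormSpace G₀ G₁ G₂ G₃ →ₗ[ℝ] FormSpace G₀ G₁ G₂ G₃ :=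
  LinearMap.prodMap (if k = 0 then LinearMap.id else 0)
    (LinearMap.prodMap (if k = 1 then LinearMap.id else 0)
      (LinearMap.prodMap (if k = 2 then LinearMap.id else 0)
        (if k = 3 then LinearMap.id else 0)))

theorem homogeneous_formProj (k : ℤ) (u : FormSpace G₀ G₁ G₂ G₃) :
    FormHomogeneous k (formProj k u) := by
  obtain ⟨l, A, E, L⟩ := u
  by_cases c : 0 ≤ k ∧ k ≤ 3
  · obtain ⟨c1, c2⟩ := c
    interval_cases k
    · exact .of₀ l
    · exact .of₁ A
    · exact .of₂ E
    · exact .of₃ L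
  · rw [formProj, if_neg (by omega), if_neg (by omega), if_neg (by omega), if_neg (by omega)]
    exact .zero k

theorem formProj_of_homogeneous {k : ℤ} {u : FormSpace G₀ G₁ G₂ G₃} (hu : FormHomogeneous k u) :
    formProj k u = u := by
  cases hu <;> first | exact map_zero _ | rfl

theorem formProj_of_ne {j k : ℤ} (h : j ≠ k) {u : FormSpace G₀ G₁ G₂ G₃}
    (hu : FormHomogeneous j u) : formProj k u = 0 := by
  cases hu <;> simp only [formProj, LinearMap.prodMap_apply, map_zero, if_neg h.symm,
    LinearMap.zero_apply] <;> rfl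

theorem sum_formProj (u : FormSpace G₀ G₁ G₂ G₃) :
    ∑ k ∈ Finset.Icc (0 : ℤ) 3, formProj k u = u := by
  rw [show Finset.Icc (0 : ℤ) 3 = {0, 1, 2, 3} from rfl]
  obtain ⟨l, A, E, L⟩ := u
  simp [formProj]

theorem homotopy_add_left (u u' v : FormSpace G₀ G₁ G₂ G₃) :
    K.homotopy (u + u') v = K.homotopy u v + K.homotopy u' v := by
  obtain ⟨l, A, E, L⟩ := u
  simp only [homotopy, Prod.fst_add, Prod.snd_add, ofN_add, LinearMap.map_add,
    LinearMap.add_apply, add_zero]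
  congr 1; abel

theorem homotopy_add_right (u v v' : FormSpace G₀ G₁ G₂ G₃) :
    K.homotopy u (v + v') = K.homotopy u v + K.homotopy u v' := by
  obtain ⟨l, A, E, L⟩ := v
  simp only [homotopy, Prod.fst_add, Prod.snd_add, ofN_add, LinearMap.map_add,
    LinearMap.add_apply, add_zero]
  congr 1; abel

theorem homotopy_smul_left (c : ℝ) (u v : FormSpace G₀ G₁ G₂ G₃) :
    K.homotopy (c • u) v = c • K.homotopy u v := by
  simp only [homotopy, Prod.smul_fst, Prod.smul_snd, ofN_smul, LinearMap.map_smul,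
    LinearMap.smul_apply, smul_zero]
  congr 1; module

theorem homotopy_smul_right (c : ℝ) (u v : FormSpace G₀ G₁ G₂ G₃) :
    K.homotopy u (c • v) = c • K.homotopy u v := by
  simp only [homotopy, Prod.smul_fst, Prod.smul_snd, ofN_smul, LinearMap.map_smul,
    LinearMap.smul_apply, smul_zero]
  congr 1; module

@[simp] theorem homotopy_zero_left (v : FormSpace G₀ G₁ G₂ G₃) : K.homotopy 0 v = 0 := by
  simpa using K.homotopy_smul_left 0 0 v

@[simp] theorem homotopy_zero_right (u : FormSpace G₀ G₁ G₂ G₃) : K.homotopy u 0 = 0 := by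
  simpa using K.homotopy_smul_right 0 u 0

/-- The only components of the homotopy have total degree four. -/
theorem homotopy_eq_zero {i j : ℤ} {u v : FormSpace G₀ G₁ G₂ G₃} (hu : FormHomogeneous i u)
    (hv : FormHomogeneous j v) (h : i + j ≠ 4) : K.homotopy u v = 0 := by
  rcases hu with _ | _ | _ | _ | _
  · exact K.homotopy_zero_left v
  all_goals
    rcases hv with _ | _ | _ | _ | _
    · exact K.homotopy_zero_right _
    all_goals first
      | omega
      | (simp only [homotopy, LinearMap.map_zero, LinearMap.zero_apply, add_zero, neg_zero]; rfl)

theorem homogeneous_homotopy {i j : ℤ} {u v : FormSpace G₀ G₁ G₂ G₃} (hu : FormHomogeneous i u)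
    (hv : FormHomogeneous j v) : Homogeneous (-1 + (i + j)) (K.homotopy u v) := by
  by_cases h : i + j = 4
  · rw [h]; exact .ofN _ 0
  · rw [K.homotopy_eq_zero hu hv h]; exact .zero _

theorem homotopy_antisymm {i j : ℤ} {u v : FormSpace G₀ G₁ G₂ G₃} (hu : FormHomogeneous i u)
    (hv : FormHomogeneous j v) : K.homotopy v u = (-sgn (i * j)) • K.homotopy u v := by
  by_cases h : i + j = 4
  · rcases hu with _ | _ | A | E | L <;> rcases hv with _ | _ | A' | E' | L' <;>
    first
      | omega
      | rw [homotopy_zero_left, homotopy_zero_right, smul_zero]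
      | simp +decide [sgn, homotopy]; done
      | simp +decide [sgn, homotopy]; rw [K.c₂₂_comm, neg_neg]
  · rw [K.homotopy_eq_zero hu hv h, K.homotopy_eq_zero hv hu (by omega), smul_zero]

@[simp] theorem formB₂_zero_left (w : FormSpace G₀ G₁ G₂ G₃) : K.formB₂ 0 w = 0 := by
  simp only [formB₂, Prod.fst_zero, Prod.snd_zero, LinearMap.map_zero, LinearMap.zero_apply,
    neg_zero, add_zero, sub_zero]
  rfl

@[simp] theorem formB₂_zero_right (w : FormSpace G₀ G₁ G₂ G₃) : K.formB₂ w 0 = 0 := by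
  simp only [formB₂, Prod.fst_zero, Prod.snd_zero, LinearMap.map_zero, LinearMap.zero_apply,
    neg_zero, add_zero, sub_zero]
  rfl

theorem homogeneous_formB₂ {i j : ℤ} {u v : FormSpace G₀ G₁ G₂ G₃} (hu : FormHomogeneous i u)
    (hv : FormHomogeneous j v) : FormHomogeneous (i + j) (K.formB₂ u v) := by
  rcases hu with _ | _ | _ | _ | _ <;> rcases hv with _ | _ | _ | _ | _ <;>
  first
    | (simp only [formB₂_zero_left, formB₂_zero_right]; exact .zero _)
    | (simp only [formB₂, LinearMap.map_zero, LinearMap.zero_apply, neg_zero, add_zero, zero_add,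
        sub_zero, zero_sub]
       constructor)

@[simp] theorem formB₁_zero : K.formB₁ 0 = 0 := by
  simp only [formB₁, Prod.fst_zero, Prod.snd_zero, LinearMap.map_zero]; rfl

/-- The relation of the morphism for two arguments: the homotopy measures the failure of the
inclusion to preserve the brackets. -/
theorem homotopy_relation {i j : ℤ} {u v : FormSpace G₀ G₁ G₂ G₃} (hu : FormHomogeneous i u)
    (hv : FormHomogeneous j v) :
    -(K.homotopy (K.formB₁ u) v - sgn (j * i) • K.homotopy (K.formB₁ v) u) +
      inclusion (K.formB₂ u v) = K.b₁ (K.homotopy u v) + K.b₂ (inclusion u) (inclusion v) := by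
  rw [b₂_inclusion, add_comm (inclusion _), ← add_assoc]
  congr 1
  rcases hu with _ | _ | _ | _ | _
  · simp only [formB₁_zero, homotopy_zero_left, homotopy_zero_right, smul_zero, sub_zero, neg_zero,
      Prod.fst_zero, Prod.snd_zero, LinearMap.map_zero, LinearMap.zero_apply, add_zero, b₁_zero,
      ofN_zero, ofC_zero]
  all_goals
    rcases hv with _ | _ | _ | _ | _
    · simp only [formB₁_zero, homotopy_zero_left, homotopy_zero_right, smul_zero, sub_zero,
          neg_zero,
        Prod.fst_zero, Prod.snd_zero, LinearMap.map_zero, LinearMap.zero_apply, add_zero, b₁_zero,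
        ofN_zero, ofC_zero]
    all_goals
      simp only [formB₁, homotopy, b₁_ofN, LinearMap.map_zero, LinearMap.zero_apply, add_zero,
        zero_add, neg_zero, sub_zero, zero_sub, ofN_zero, ofC_zero, smul_zero, b₁_zero, ofN_neg,
        neg_neg, ofC_add, neg_add_cancel]
      try rw [sgn_even (by decide), one_smul]
      try
        simp only [ofN_neg, ofN_sub, neg_neg, neg_zero, sub_zero, zero_sub]
        congr 1
        abel

/-- The skew-symmetry of `c₂₂` and its invariance combine to a symmetry. -/
theorem c₂₂_br₀₂_swap (l : G₀) (E F : G₂) : K.c₂₂ (K.br₀₂ l E) F = K.c₂₂ (K.br₀₂ l F) E := by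
  rw [K.c₂₂_br₀₂, K.c₂₂_comm, neg_neg]

set_option maxHeartbeats 800000 in
/-- The relation of the morphism for three arguments: the homotopy is a cocycle. -/
theorem homotopy_cocycle {i j k : ℤ} {u v w : FormSpace G₀ G₁ G₂ G₃} (hu : FormHomogeneous i u)
    (hv : FormHomogeneous j v) (hw : FormHomogeneous k w) :
    K.homotopy (K.formB₂ u v) w - sgn (k * j) • K.homotopy (K.formB₂ u w) v +
      (sgn (j * i) * sgn (k * i)) • K.homotopy (K.formB₂ v w) u = 0 := by
  by_cases h : i + j + k = 4
  swap
  · rw [K.homotopy_eq_zero (K.homogeneous_formB₂ hu hv) hw h,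
      K.homotopy_eq_zero (K.homogeneous_formB₂ hu hw) hv (by omega),
      K.homotopy_eq_zero (K.homogeneous_formB₂ hv hw) hu (by omega)]
    simp only [smul_zero, sub_zero, add_zero]
  rcases hu with _ | l | A | E | L <;> rcases hv with _ | l' | A' | E' | L' <;>
  rcases hw with _ | l'' | A'' | E'' | L'' <;>
  first
    | omega
    | simp only [formB₂_zero_left, formB₂_zero_right, homotopy_zero_left, homotopy_zero_right,
        smul_zero, sub_zero, add_zero]
    | skip
  all_goals simp +decide [sgn, homotopy, formB₂, K.c₁₃_br₀₁, K.c₂₂_br₁₁]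
  all_goals try abel1
  · rw [K.c₂₂_br₀₂_swap l E', sub_self]
  · rw [K.c₂₂_br₀₂_swap l' E, neg_add_cancel]
  · rw [K.c₂₂_br₀₂_swap l'' E, add_neg_cancel]

theorem b₂_inclusion_ofN (w : FormSpace G₀ G₁ G₂ G₃) (X : C) :
    K.b₂ (inclusion w) (ofN X 0) = 0 ∧ K.b₂ (ofN X 0) (inclusion w) = 0 := by
  obtain ⟨l, A, E, L⟩ := w
  constructor <;>
  · simp only [b₂, inclusion, ofN, LinearMap.map_zero, LinearMap.zero_apply, add_zero, sub_zero,
      zero_sub, neg_zero, sub_self]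
    rfl

theorem formB₁_add (u v : FormSpace G₀ G₁ G₂ G₃) : K.formB₁ (u + v) = K.formB₁ u + K.formB₁ v :=
  inclusion_injective (V := V) (C := C) (by simp only [inclusion_formB₁, inclusion_add, b₁_add])

theorem formB₁_smul (c : ℝ) (u : FormSpace G₀ G₁ G₂ G₃) : K.formB₁ (c • u) = c • K.formB₁ u :=
  inclusion_injective (V := V) (C := C) (by simp only [inclusion_formB₁, inclusion_smul, b₁_smul])

theorem formB₂_add_left (u v w : FormSpace G₀ G₁ G₂ G₃) :
    K.formB₂ (u + v) w = K.formB₂ u w + K.formB₂ v w :=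
  inclusion_injective (V := V) (C := C)
    (by simp only [inclusion_formB₂, inclusion_add, b₂_add_left])

theorem formB₂_add_right (u v w : FormSpace G₀ G₁ G₂ G₃) :
    K.formB₂ u (v + w) = K.formB₂ u v + K.formB₂ u w :=
  inclusion_injective (V := V) (C := C)
    (by simp only [inclusion_formB₂, inclusion_add, b₂_add_right])

theorem formB₂_smul_left (c : ℝ) (u v : FormSpace G₀ G₁ G₂ G₃) :
    K.formB₂ (c • u) v = c • K.formB₂ u v :=
  inclusion_injective (V := V) (C := C)
    (by simp only [inclusion_formB₂, inclusion_smul, b₂_smul_left])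

theorem formB₂_smul_right (c : ℝ) (u v : FormSpace G₀ G₁ G₂ G₃) :
    K.formB₂ u (c • v) = c • K.formB₂ u v :=
  inclusion_injective (V := V) (C := C)
    (by simp only [inclusion_formB₂, inclusion_smul, b₂_smul_right])

theorem formB₁_formB₁ (u : FormSpace G₀ G₁ G₂ G₃) : K.formB₁ (K.formB₁ u) = 0 :=
  inclusion_injective (V := V) (C := C)
    (by rw [inclusion_formB₁, inclusion_formB₁, b₁_b₁, inclusion_zero])

theorem homogeneous_formB₁ {i : ℤ} {u : FormSpace G₀ G₁ G₂ G₃} (hu : FormHomogeneous i u) :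
    FormHomogeneous (1 + i) (K.formB₁ u) := by
  rcases hu with _ | _ | _ | _ | _
  · rw [formB₁_zero]; exact .zero _
  all_goals
    simp only [formB₁, LinearMap.map_zero]
    first | exact .of₁ _ | exact .of₂ _ | exact .of₃ _ | exact .zero _

theorem formB₂_antisymm {i j : ℤ} {u v : FormSpace G₀ G₁ G₂ G₃} (hu : FormHomogeneous i u)
    (hv : FormHomogeneous j v) : K.formB₂ v u = (-sgn (i * j)) • K.formB₂ u v :=
  inclusion_injective (V := V) (C := C) (by
    rw [inclusion_smul, inclusion_formB₂, inclusion_formB₂]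
    exact K.withoutPairing.b₂_antisymm (homogeneous_inclusion hu) (homogeneous_inclusion hv))

theorem form_leibniz {i j : ℤ} {u v : FormSpace G₀ G₁ G₂ G₃} (hu : FormHomogeneous i u)
    (hv : FormHomogeneous j v) (hij : i ≤ j) : K.formB₁ (K.formB₂ u v) =
      K.formB₂ (K.formB₁ u) v - sgn (j * i) • K.formB₂ (K.formB₁ v) u :=
  inclusion_injective (V := V) (C := C) (by
    rw [inclusion_sub, inclusion_smul, inclusion_formB₁, inclusion_formB₂, inclusion_formB₂,
      inclusion_formB₂, inclusion_formB₁, inclusion_formB₁]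
    exact K.withoutPairing.leibniz (homogeneous_inclusion hu) (homogeneous_inclusion hv) hij)

/-- The Jacobi identity is that of the Cartan calculus without pairings into covector densities, of
which the forms are a subalgebra. -/
theorem form_jacobi {i j k : ℤ} {u v w : FormSpace G₀ G₁ G₂ G₃} (hu : FormHomogeneous i u)
    (hv : FormHomogeneous j v) (hw : FormHomogeneous k w) (hij : i ≤ j) (hjk : j ≤ k) :
    jacobiator K.formB₂ i j k u v w = 0 :=
  inclusion_injective (V := V) (C := C) (by
    rw [jacobiator, inclusion_add, inclusion_sub, inclusion_smul, inclusion_smul]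
    simp only [inclusion_formB₂]
    exact K.withoutPairing.jacobi (homogeneous_inclusion hu) (homogeneous_inclusion hv)
      (homogeneous_inclusion hw) hij hjk)

end CartanData
end ChernSimons

namespace ChernSimons

/-! ### The morphism of L-infinity algebras -/

section
variable {M : Type*} [TopologicalSpace M] [ChartedSpace E3 M] [IsManifold (𝓡 3) ∞ M]
variable {𝔤 : Type*} [LieRing 𝔤] [LieAlgebra ℝ 𝔤] {Tr : 𝔤 →ₗ[ℝ] 𝔤 →ₗ[ℝ] ℝ}

open CartanData

theorem CSSpace.formHomogeneous_of_mem {k : ℤ} {u : CSSpace M 𝔤} (hu : u ∈ CSSpace.degree M 𝔤 k) :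
    FormHomogeneous k (G₀ := GForm M 𝔤 0) (G₁ := GForm M 𝔤 1) (G₂ := GForm M 𝔤 2)
      (G₃ := GForm M 𝔤 3) u := by
  obtain ⟨l, A, E, L⟩ := u
  obtain ⟨h1, h2, h3, h4⟩ := hu
  have e1 : k ≠ 0 → l = 0 := h1
  have e2 : k ≠ 1 → A = 0 := h2
  have e3 : k ≠ 2 → E = 0 := h3
  have e4 : k ≠ 3 → L = 0 := h4
  clear h1 h2 h3 h4
  by_cases c1 : k = 0
  · obtain rfl := e2 (by omega); obtain rfl := e3 (by omega); obtain rfl := e4 (by omega)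
    rw [c1]; exact .of₀ l
  obtain rfl := e1 c1
  by_cases c2 : k = 1
  · obtain rfl := e3 (by omega); obtain rfl := e4 (by omega)
    rw [c2]; exact .of₁ A
  obtain rfl := e2 c2
  by_cases c3 : k = 2
  · obtain rfl := e4 (by omega)
    rw [c3]; exact .of₂ E
  obtain rfl := e3 c3
  by_cases c4 : k = 3
  · rw [c4]; exact .of₃ L
  obtain rfl := e4 c4
  exact .zero k

theorem CSSpace.mem_of_formHomogeneous {k : ℤ} {u : CSSpace M 𝔤}
    (hu : FormHomogeneous k (G₀ := GForm M 𝔤 0) (G₁ := GForm M 𝔤 1) (G₂ := GForm M 𝔤 2)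
      (G₃ := GForm M 𝔤 3) u) : u ∈ CSSpace.degree M 𝔤 k := by
  cases hu with
  | zero => exact Submodule.zero_mem _
  | of₀ => exact ⟨fun h => absurd rfl h, fun _ => rfl, fun _ => rfl, fun _ => rfl⟩
  | of₁ => exact ⟨fun _ => rfl, fun h => absurd rfl h, fun _ => rfl, fun _ => rfl⟩
  | of₂ => exact ⟨fun _ => rfl, fun _ => rfl, fun h => absurd rfl h, fun _ => rfl⟩
  | of₃ => exact ⟨fun _ => rfl, fun _ => rfl, fun _ => rfl, fun h => absurd rfl h⟩

theorem CSSpace.isInternal_degree : DirectSum.IsInternal (CSSpace.degree M 𝔤) :=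
  isInternal_of_projections _ formProj (Finset.Icc 0 3)
    (fun k v => mem_of_formHomogeneous (homogeneous_formProj k v))
    (fun _ _ hv => formProj_of_homogeneous (formHomogeneous_of_mem hv))
    (fun _ _ h _ hv => formProj_of_ne h (formHomogeneous_of_mem hv)) sum_formProj

theorem GForm.sub_neg_eq_add' {k : ℕ} (a b : GForm M 𝔤 k) : -a - -b = -a + b := by abel

variable [T2Space M] [SigmaCompactSpace M]

theorem CSSpace.bracket₂_eq (hsymm : ∀ X Y, Tr X Y = Tr Y X)
    (hinv : ∀ X Y Z, Tr ⁅X, Y⁆ Z = Tr X ⁅Y, Z⁆) (u v : CSSpace M 𝔤) :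
    bracket₂ u v = (cartanData hsymm hinv).formB₂ u v := by
  obtain ⟨l, A, E, L⟩ := u
  obtain ⟨l', A', E', L'⟩ := v
  have h1 : -GForm.br₀₁ l A' - (GForm.bracket A l' : GForm M 𝔤 (1 + 0)) =
      -GForm.br₀₁ l A' + GForm.br₀₁ l' A :=
    (congrArg (fun x : GForm M 𝔤 1 => -GForm.br₀₁ l A' - x) (GForm.bracket₁₀ A l')).trans
      (GForm.sub_neg_eq_add' _ _)
  have h2 : -GForm.br₀₂ l E' - (GForm.bracket E l' : GForm M 𝔤 (2 + 0)) - GForm.br₁₁ A A' =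
      -GForm.br₀₂ l E' + GForm.br₀₂ l' E - GForm.br₁₁ A A' :=
    (congrArg (fun x : GForm M 𝔤 2 => -GForm.br₀₂ l E' - x - GForm.br₁₁ A A')
      (GForm.bracket₂₀ E l')).trans (congrArg (· - GForm.br₁₁ A A') (GForm.sub_neg_eq_add' _ _))
  have h3 : -GForm.br₀₃ l L' - (GForm.bracket L l' : GForm M 𝔤 (3 + 0)) - GForm.br₁₂ A E' -
        (GForm.bracket E A' : GForm M 𝔤 (2 + 1)) =
      -GForm.br₀₃ l L' + GForm.br₀₃ l' L - GForm.br₁₂ A E' + GForm.br₁₂ A' E :=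
    (congrArg₂ (fun x y : GForm M 𝔤 3 => -GForm.br₀₃ l L' - x - GForm.br₁₂ A E' - y)
      (GForm.bracket₃₀ L l') (GForm.bracket₂₁ E A')).trans (by abel)
  exact Prod.ext rfl (Prod.ext h1 (Prod.ext h2 h3))

theorem CSSpace.isDGLieAlgebra : IsDGLieAlgebra (CSSpace.degree M 𝔤) CSSpace.brackets := by
  -- Chern-Simons theory does not depend on the trace, which is taken to be zero here
  have hs : ∀ X Y, (0 : 𝔤 →ₗ[ℝ] 𝔤 →ₗ[ℝ] ℝ) X Y = (0 : 𝔤 →ₗ[ℝ] 𝔤 →ₗ[ℝ] ℝ) Y X := fun _ _ => rfl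
  have hi : ∀ X Y Z, (0 : 𝔤 →ₗ[ℝ] 𝔤 →ₗ[ℝ] ℝ) ⁅X, Y⁆ Z = (0 : 𝔤 →ₗ[ℝ] 𝔤 →ₗ[ℝ] ℝ) X ⁅Y, Z⁆ :=
    fun _ _ _ => rfl
  let K := cartanData (M := M) hs hi
  exact isDGLieAlgebra_of _ _ K.formB₁ K.formB₂ (fun _ => rfl)
    (fun v => CSSpace.bracket₂_eq hs hi (v 0) (v 1)) (fun _ => rfl)
    (fun n hn v => by obtain ⟨m, rfl⟩ := Nat.exists_eq_add_of_le' hn; rfl)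
    CSSpace.isInternal_degree K.formB₁_add K.formB₁_smul K.formB₂_add_left K.formB₂_smul_left
    K.formB₂_add_right (fun c x y => K.formB₂_smul_right c x y)
    (fun _ _ hx => mem_of_formHomogeneous (K.homogeneous_formB₁ (formHomogeneous_of_mem hx)))
    (fun _ _ _ hx _ hy => mem_of_formHomogeneous
      (K.homogeneous_formB₂ (formHomogeneous_of_mem hx) (formHomogeneous_of_mem hy)))
    (fun _ _ _ hx _ hy => K.formB₂_antisymm (formHomogeneous_of_mem hx) (formHomogeneous_of_mem hy))
    K.formB₁_formB₁
    (fun _ _ h _ hx _ hy => K.form_leibniz (formHomogeneous_of_mem hx) (formHomogeneous_of_mem hy)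
        h)
    (fun _ _ _ h h' _ hx _ hy _ hz => K.form_jacobi (formHomogeneous_of_mem hx)
      (formHomogeneous_of_mem hy) (formHomogeneous_of_mem hz) h h')

theorem incl_mem {i : ℤ} {u : CSSpace M 𝔤} (hu : u ∈ CSSpace.degree M 𝔤 i) :
    incl u ∈ ExtSpace.degree M 𝔤 i :=
  ExtSpace.mem_of_homogeneous (homogeneous_inclusion (V := VField M) (C := CovDensity M)
    (CSSpace.formHomogeneous_of_mem hu))

theorem ExtSpace.bracket₂_antisymm (hsymm : ∀ X Y, Tr X Y = Tr Y X)
    (hinv : ∀ X Y Z, Tr ⁅X, Y⁆ Z = Tr X ⁅Y, Z⁆) {i j : ℤ} {u v : ExtSpace M 𝔤}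
    (hu : u ∈ degree M 𝔤 i) (hv : v ∈ degree M 𝔤 j) :
    bracket₂ Tr v u = (-sgn (i * j)) • bracket₂ Tr u v := by
  rw [bracket₂_eq hsymm hinv, bracket₂_eq hsymm hinv]
  exact (cartanData (M := M) hsymm hinv).b₂_antisymm (homogeneous_of_mem hu) (homogeneous_of_mem hv)

theorem ExtSpace.bracket₂_zero_left (hsymm : ∀ X Y, Tr X Y = Tr Y X)
    (hinv : ∀ X Y Z, Tr ⁅X, Y⁆ Z = Tr X ⁅Y, Z⁆) (u : ExtSpace M 𝔤) : bracket₂ Tr 0 u = 0 := by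
  rw [bracket₂_eq hsymm hinv]; exact CartanData.b₂_zero_left _ _

theorem ExtSpace.bracket₂_zero_right (hsymm : ∀ X Y, Tr X Y = Tr Y X)
    (hinv : ∀ X Y Z, Tr ⁅X, Y⁆ Z = Tr X ⁅Y, Z⁆) (u : ExtSpace M 𝔤) : bracket₂ Tr u 0 = 0 := by
  rw [bracket₂_eq hsymm hinv]; exact CartanData.b₂_zero_right _ _

theorem ExtSpace.bracket₂_incl_ofNoether (hsymm : ∀ X Y, Tr X Y = Tr Y X)
    (hinv : ∀ X Y Z, Tr ⁅X, Y⁆ Z = Tr X ⁅Y, Z⁆) (w : CSSpace M 𝔤) (X : CovDensity M) :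
    bracket₂ Tr (incl w) (ofNoether X 0) = 0 ∧ bracket₂ Tr (ofNoether X 0) (incl w) = 0 := by
  rw [bracket₂_eq hsymm hinv, bracket₂_eq hsymm hinv]; exact CartanData.b₂_inclusion_ofN _ w X

theorem ExtSpace.bracket₂_ofNoether (hsymm : ∀ X Y, Tr X Y = Tr Y X)
    (hinv : ∀ X Y Z, Tr ⁅X, Y⁆ Z = Tr X ⁅Y, Z⁆) (X Y : CovDensity M) (L L' : GForm M 𝔤 3) :
    bracket₂ Tr (ofNoether X L) (ofNoether Y L') = 0 := by
  rw [bracket₂_eq hsymm hinv]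
  exact CartanData.b₂_of_four_lt _ (.ofN X L) (.ofN Y L') (by norm_num)

/-- The morphism relation for two arguments; by graded antisymmetry the two terms in the bracket on
the right hand side agree. -/
theorem psi_relation_two (hsymm : ∀ X Y, Tr X Y = Tr Y X)
    (hinv : ∀ X Y Z, Tr ⁅X, Y⁆ Z = Tr X ⁅Y, Z⁆) {i j : ℤ} {u v : CSSpace M 𝔤}
    (hu : u ∈ CSSpace.degree M 𝔤 i) (hv : v ∈ CSSpace.degree M 𝔤 j) :
    -(homotopy₂ Tr (CSSpace.bracket₁ u) v - sgn (j * i) • homotopy₂ Tr (CSSpace.bracket₁ v) u) +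
        incl (CSSpace.bracket₂ u v) = ExtSpace.bracket₁ (homotopy₂ Tr u v) +
      (1 / 2 : ℝ) • (ExtSpace.bracket₂ Tr (incl u) (incl v) -
        sgn (j * i) • ExtSpace.bracket₂ Tr (incl v) (incl u)) := by
  have ha : ExtSpace.bracket₂ Tr (incl v) (incl u) =
      (-sgn (i * j)) • ExtSpace.bracket₂ Tr (incl u) (incl v) :=
    ExtSpace.bracket₂_antisymm hsymm hinv (incl_mem hu) (incl_mem hv)
  rw [ha, mul_comm j, smul_smul, mul_neg, sgn_mul_self]
  have h2 : ∀ x : ExtSpace M 𝔤, (1 / 2 : ℝ) • (x - (-1 : ℝ) • x) = x := fun x => by module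
  rw [h2, CSSpace.bracket₂_eq hsymm hinv, mul_comm i]
  exact (cartanData (M := M) hsymm hinv).homotopy_relation (CSSpace.formHomogeneous_of_mem hu)
    (CSSpace.formHomogeneous_of_mem hv)

theorem psi_relation_three (hsymm : ∀ X Y, Tr X Y = Tr Y X)
    (hinv : ∀ X Y Z, Tr ⁅X, Y⁆ Z = Tr X ⁅Y, Z⁆) {i j k : ℤ} {u v w : CSSpace M 𝔤}
    (hu : u ∈ CSSpace.degree M 𝔤 i) (hv : v ∈ CSSpace.degree M 𝔤 j)
    (hw : w ∈ CSSpace.degree M 𝔤 k) :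
    homotopy₂ Tr (CSSpace.bracket₂ u v) w - sgn (k * j) • homotopy₂ Tr (CSSpace.bracket₂ u w) v +
      (sgn (j * i) * sgn (k * i)) • homotopy₂ Tr (CSSpace.bracket₂ v w) u = 0 := by
  rw [CSSpace.bracket₂_eq hsymm hinv, CSSpace.bracket₂_eq hsymm hinv,
    CSSpace.bracket₂_eq hsymm hinv]
  exact (cartanData (M := M) hsymm hinv).homotopy_cocycle (CSSpace.formHomogeneous_of_mem hu)
    (CSSpace.formHomogeneous_of_mem hv) (CSSpace.formHomogeneous_of_mem hw)

theorem psi_of_three_le {n : ℕ} (hn : 3 ≤ n) (v : Fin n → CSSpace M 𝔤) : psi Tr n v = 0 := by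
  obtain ⟨m, rfl⟩ := Nat.exists_eq_add_of_le' hn; rfl

theorem CSSpace.brackets_of_three_le {n : ℕ} (hn : 3 ≤ n) (v : Fin n → CSSpace M 𝔤) :
    CSSpace.brackets n v = 0 := by
  obtain ⟨m, rfl⟩ := Nat.exists_eq_add_of_le' hn; rfl

theorem ExtSpace.brackets_of_three_le {n : ℕ} (hn : 3 ≤ n) (v : Fin n → ExtSpace M 𝔤) :
    ExtSpace.brackets Tr n v = 0 := by
  obtain ⟨m, rfl⟩ := Nat.exists_eq_add_of_le' hn; rfl

/-- With three or more arguments, the right hand side of the morphism relations only consists of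
brackets with values of `ψ₂`, and these vanish. -/
theorem morphismSum_psi_eq_zero (hsymm : ∀ X Y, Tr X Y = Tr Y X)
    (hinv : ∀ X Y Z, Tr ⁅X, Y⁆ Z = Tr X ⁅Y, Z⁆) {n : ℕ} (hn : 3 ≤ n) (d : Fin n → ℤ)
    (v : Fin n → CSSpace M 𝔤) :
    morphismSum (psi Tr) (ExtSpace.brackets Tr) d v = 0 := by
  refine morphismSum_eq_zero _ _ (fun m k x hk => ?_) d v
  rcases (by omega : m = 0 ∨ m = 1 ∨ m = 2 ∨ 3 ≤ m) with rfl | rfl | rfl | hm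
  · rfl
  · rw [Fin.sum_univ_one] at hk
    have h0 : psi Tr (k 0) (x 0) = 0 := psi_of_three_le (by omega) _
    change ExtSpace.bracket₁ (psi Tr (k 0) (x 0)) = 0
    rw [h0]; exact CartanData.b₁_zero (cartanData (M := M) hsymm hinv)
  · rw [Fin.sum_univ_two] at hk
    have key : ∀ (p q : ℕ) (y : Fin p → CSSpace M 𝔤) (z : Fin q → CSSpace M 𝔤), 3 ≤ p + q →
        ExtSpace.bracket₂ Tr (psi Tr p y) (psi Tr q z) = 0 := by
      intro p q y z hpq
      rcases (by omega : 3 ≤ p ∨ 3 ≤ q ∨ (p = 1 ∧ q = 2) ∨ (p = 2 ∧ q = 1) ∨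
        (p = 2 ∧ q = 2)) with h | h | ⟨rfl, rfl⟩ | ⟨rfl, rfl⟩ | ⟨rfl, rfl⟩
      · rw [psi_of_three_le h]; exact ExtSpace.bracket₂_zero_left hsymm hinv _
      · rw [psi_of_three_le h]; exact ExtSpace.bracket₂_zero_right hsymm hinv _
      · exact (ExtSpace.bracket₂_incl_ofNoether hsymm hinv _ _).1
      · exact (ExtSpace.bracket₂_incl_ofNoether hsymm hinv _ _).2
      · exact ExtSpace.bracket₂_ofNoether hsymm hinv _ _ _ _
    exact key _ _ _ _ (by omega)
  · exact ExtSpace.brackets_of_three_le hm _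

theorem psi_relations (hsymm : ∀ X Y, Tr X Y = Tr Y X)
    (hinv : ∀ X Y Z, Tr ⁅X, Y⁆ Z = Tr X ⁅Y, Z⁆) (n : ℕ) (hn : 1 ≤ n) (d : Fin n → ℤ)
    (v : Fin n → CSSpace M 𝔤) (hv : ∀ i, v i ∈ CSSpace.degree M 𝔤 (d i)) :
    homotopySum (psi Tr) CSSpace.brackets d v =
      morphismSum (psi Tr) (ExtSpace.brackets Tr) d v := by
  rcases (by omega : n = 1 ∨ n = 2 ∨ n = 3 ∨ 4 ≤ n) with rfl | rfl | rfl | hn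
  · rw [homotopySum_one, morphismSum_one]
    rfl
  · rw [homotopySum_two, morphismSum_two]
    exact psi_relation_two hsymm hinv (hv 0) (hv 1)
  · rw [morphismSum_psi_eq_zero hsymm hinv le_rfl, homotopySum_three (psi Tr) CSSpace.brackets
      (psi_of_three_le le_rfl) (CSSpace.brackets_of_three_le le_rfl)
      (fun v hv => (congrArg incl hv).trans rfl)]
    exact psi_relation_three hsymm hinv (hv 0) (hv 1) (hv 2)
  · rw [morphismSum_psi_eq_zero hsymm hinv (by omega)]
    refine homotopySum_of_four_le _ _ (fun _ => psi_of_three_le)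
      (fun _ => CSSpace.brackets_of_three_le) (fun n v j hj => ?_) hn d v
    rcases (by omega : n = 0 ∨ n = 1 ∨ n = 2 ∨ 3 ≤ n) with rfl | rfl | rfl | hn
    · rfl
    · obtain rfl : j = 0 := Subsingleton.elim _ _
      exact (congrArg incl hj).trans rfl
    · fin_cases j
      · exact (congrArg (homotopy₂ Tr · (v 1)) hj).trans
          ((cartanData (M := M) hsymm hinv).homotopy_zero_left _)
      · exact (congrArg (homotopy₂ Tr (v 0) ·) hj).trans
          ((cartanData (M := M) hsymm hinv).homotopy_zero_right _)
    · exact psi_of_three_le hn v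

theorem isLInftyMorphism_psi (hsymm : ∀ X Y, Tr X Y = Tr Y X)
    (hinv : ∀ X Y Z, Tr ⁅X, Y⁆ Z = Tr X ⁅Y, Z⁆) :
    IsLInftyMorphism (CSSpace.degree M 𝔤) CSSpace.brackets (ExtSpace.degree M 𝔤)
      (ExtSpace.brackets Tr) (psi Tr) where
  maps := isGradedAntisymmetric_of_two _ _ _ _ inclusion (cartanData (M := M) hsymm hinv).homotopy
    (fun _ => rfl) (fun _ => rfl)
    (fun n hn v => by obtain ⟨m, rfl⟩ := Nat.exists_eq_add_of_le' hn; rfl)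
    inclusion_add (fun c x => inclusion_smul c x) (CartanData.homotopy_add_left _)
        (CartanData.homotopy_smul_left _)
    (CartanData.homotopy_add_right _) (fun c x y => CartanData.homotopy_smul_right _ c x y)
    (fun i x hx => by
      have h := ExtSpace.mem_of_homogeneous (homogeneous_inclusion (V := VField M)
        (C := CovDensity M) (CSSpace.formHomogeneous_of_mem hx))
      simpa using h)
    (fun i j x hx y hy => by
      have h := ExtSpace.mem_of_homogeneous ((cartanData (M := M) hsymm hinv).homogeneous_homotopy
        (CSSpace.formHomogeneous_of_mem hx) (CSSpace.formHomogeneous_of_mem hy))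
      exact h)
    (fun _ _ _ hx _ hy => CartanData.homotopy_antisymm _ (CSSpace.formHomogeneous_of_mem hx)
      (CSSpace.formHomogeneous_of_mem hy))
  relations := psi_relations hsymm hinv

end
end ChernSimons

namespace ChernSimons

/-! ### Integration in a chart -/

section ChartIntegral
open MeasureTheory

variable {M : Type*} [TopologicalSpace M] [ChartedSpace E3 M] [IsManifold (𝓡 3) ∞ M]

/-- `α` vanishes outside `K`. -/
def Form.SupportedIn {k : ℕ} (α : Form M k) (K : Set M) : Prop := ∀ p ∉ K, ∀ Y, α Y p = 0

/-- A function on `M`, read in a chart and extended by zero. -/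
noncomputable def extendChart (φ : OpenPartialHomeomorph M E3) (g : M → ℝ) : E3 → ℝ :=
  φ.target.indicator (g ∘ φ.symm)

theorem extendChart_eq_zero {φ : OpenPartialHomeomorph M E3} {g : M → ℝ} {K : Set M}
    (hg : ∀ p ∉ K, g p = 0) {x : E3} (hx : x ∉ φ '' K) : extendChart φ g x = 0 := by
  by_cases hxt : x ∈ φ.target
  · rw [extendChart, Set.indicator_of_mem hxt]
    exact hg _ fun h => hx ⟨_, h, φ.right_inv hxt⟩
  · exact Set.indicator_of_notMem hxt _

theorem hasCompactSupport_extendChart {φ : OpenPartialHomeomorph M E3} {g : M → ℝ} {K : Set M}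
    (hK : IsCompact K) (hKφ : K ⊆ φ.source) (hg : ∀ p ∉ K, g p = 0) :
    HasCompactSupport (extendChart φ g) :=
  HasCompactSupport.intro (hK.image_of_continuousOn (φ.continuousOn.mono hKφ))
    fun _ hx => extendChart_eq_zero hg hx

theorem contDiff_extendChart {φ : OpenPartialHomeomorph M E3}
    (hφ : φ ∈ IsManifold.maximalAtlas (𝓡 3) ∞ M) (g : SmoothFun M) {K : Set M}
    (hK : IsCompact K) (hKφ : K ⊆ φ.source) (hg : ∀ p ∉ K, g p = 0) :
    ContDiff ℝ ∞ (extendChart φ g) := by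
  have hc : IsClosed (φ '' K) := (hK.image_of_continuousOn (φ.continuousOn.mono hKφ)).isClosed
  refine contDiff_iff_contDiffAt.2 fun x => ?_
  by_cases hx : x ∈ φ.target
  · have h1 : ContMDiffAt 𝓘(ℝ, E3) 𝓘(ℝ, ℝ) ∞ (g ∘ φ.symm) x :=
      g.contMDiff.contMDiffAt.comp x ((contMDiffOn_symm_of_mem_maximalAtlas hφ).contMDiffAt
        (φ.open_target.mem_nhds hx))
    refine h1.contDiffAt.congr_of_eventuallyEq ?_
    filter_upwards [φ.open_target.mem_nhds hx] with y hy
    exact Set.indicator_of_mem hy _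
  · refine (contDiffAt_const (c := (0 : ℝ))).congr_of_eventuallyEq ?_
    have hx' : x ∉ φ '' K := fun ⟨p, hp, h⟩ => hx (h ▸ φ.map_source (hKφ hp))
    filter_upwards [hc.isOpen_compl.mem_nhds hx'] with y hy
    exact extendChart_eq_zero hg hy

/-- Partial derivatives in a chart are derivatives along coordinate vector fields. -/
theorem fderiv_extendChart {φ : OpenPartialHomeomorph M E3}
    (hφ : φ ∈ IsManifold.maximalAtlas (𝓡 3) ∞ M) (g : SmoothFun M) {q : M} (hq : q ∈ φ.source)
    (X : VField M) (i : Fin 3) (hX : X q = coordField φ i q) :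
    fderiv ℝ (extendChart φ g) (φ q) (EuclideanSpace.single i (1 : ℝ)) = X.deriv g q := by
  have hx := φ.map_source hq
  have h0 : extendChart φ g =ᶠ[nhds (φ q)] g ∘ φ.symm := by
    filter_upwards [φ.open_target.mem_nhds hx] with y hy
    exact Set.indicator_of_mem hy _
  have h2 : MDifferentiableAt 𝓘(ℝ, E3) (𝓡 3) φ.symm (φ q) :=
    (contMDiffAt_symm_of_mem_maximalAtlas hφ hx).mdifferentiableAt (by simp)
  have h3 : MDifferentiableAt (𝓡 3) 𝓘(ℝ, ℝ) g (φ.symm (φ q)) := g.mdifferentiableAt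
  rw [h0.fderiv_eq, ← mfderiv_eq_fderiv, mfderiv_comp (φ q) h3 h2]
  rw [VField.deriv_apply, hX]
  change mfderiv (𝓡 3) 𝓘(ℝ, ℝ) g (φ.symm (φ q))
    (mfderiv 𝓘(ℝ, E3) (𝓡 3) φ.symm (φ q) (EuclideanSpace.single i (1 : ℝ))) = _
  have h4 : ∀ q', q' = q → (mfderiv (𝓡 3) 𝓘(ℝ, ℝ) g q' : E3 → ℝ) = mfderiv (𝓡 3) 𝓘(ℝ, ℝ) g q := by
    rintro q' rfl; rfl
  exact congrFun (h4 (φ.symm (φ q)) (φ.left_inv hq)) _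

theorem integral_fderiv_eq_zero {g : E3 → ℝ} (hg : ContDiff ℝ ∞ g) (hs : HasCompactSupport g)
    (v : E3) : ∫ x, fderiv ℝ g x v = 0 := by
  have hd : Continuous (fderiv ℝ g) := hg.continuous_fderiv (by simp)
  have hi : Integrable (fun x => fderiv ℝ g x v) :=
    (hd.clm_apply continuous_const).integrable_of_hasCompactSupport (hs.fderiv_apply (𝕜 := ℝ) v)
  have h := integral_mul_fderiv_eq_neg_fderiv_mul_of_integrable (μ := (volume : Measure E3))
    (f := fun _ : E3 => (1 : ℝ)) (g := g) (v := v) (by simp) (by simpa using hi)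
    (by simpa using hg.continuous.integrable_of_hasCompactSupport hs)
    (fun x _ => differentiableAt_const _)
    (fun x _ => (hg.differentiable (by simp)).differentiableAt)
  simpa using h

variable [T2Space M]

/-- The coefficient of a three-form with respect to the coordinates of a chart. -/
noncomputable def chartDensity (φ : OpenPartialHomeomorph M E3) (ν : Form M 3) (x : E3) : ℝ :=
  ν.evalAt (φ.symm x) fun i =>
    mfderiv 𝓘(ℝ, E3) (𝓡 3) φ.symm x (EuclideanSpace.single i (1 : ℝ))

/-- The integral of a three-form over the source of a chart. -/
noncomputable def chartIntegral (φ : OpenPartialHomeomorph M E3) (ν : Form M 3) : ℝ :=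
  ∫ x in φ.target, chartDensity φ ν x

theorem chartDensity_eq_zero (φ : OpenPartialHomeomorph M E3) {ν : Form M 3} {K : Set M}
    (hν : ν.SupportedIn K) {x : E3} (hx : φ.symm x ∉ K) : chartDensity φ ν x = 0 := hν _ hx _

theorem chartIntegral_const_smul (φ : OpenPartialHomeomorph M E3) (c : ℝ) (ν : Form M 3) :
    chartIntegral φ (c • ν) = c * chartIntegral φ ν :=
  integral_const_mul _ _

variable [SigmaCompactSpace M]

/-- Coordinate fields may be replaced by cut-off coordinate fields, which are globally defined. -/
theorem chartDensity_eq {φ : OpenPartialHomeomorph M E3}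
    (hφ : φ ∈ IsManifold.maximalAtlas (𝓡 3) ∞ M) (ν : Form M 3) (χ : SmoothFun M)
    (hχ : tsupport χ ⊆ φ.source) {x : E3} (hx : x ∈ φ.target) (h1 : χ (φ.symm x) = 1) :
    chartDensity φ ν x = ν (cutoffField φ hφ χ hχ) (φ.symm x) := by
  refine Form.evalAt_eq _ _ _ _ fun i => ?_
  rw [cutoffField_apply, h1, one_smul]
  exact congrArg (fun y => (mfderiv 𝓘(ℝ, E3) (𝓡 3) φ.symm y
    (EuclideanSpace.single i (1 : ℝ)) : E3)) (φ.right_inv hx)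

theorem indicator_chartDensity {φ : OpenPartialHomeomorph M E3}
    (hφ : φ ∈ IsManifold.maximalAtlas (𝓡 3) ∞ M) {ν : Form M 3} {K : Set M}
    (hν : ν.SupportedIn K) (χ : SmoothFun M)
    (hχ : tsupport χ ⊆ φ.source) (h1 : ∀ q ∈ K, χ q = 1) :
    φ.target.indicator (chartDensity φ ν) = extendChart φ (ν (cutoffField φ hφ χ hχ)) := by
  refine Set.indicator_congr fun x hx => ?_
  by_cases hxK : φ.symm x ∈ K
  · exact chartDensity_eq hφ ν χ hχ hx (h1 _ hxK)
  · rw [chartDensity_eq_zero φ hν hxK, Function.comp, hν _ hxK]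

theorem chartIntegral_eq {φ : OpenPartialHomeomorph M E3}
    (hφ : φ ∈ IsManifold.maximalAtlas (𝓡 3) ∞ M) {ν : Form M 3} {K : Set M}
    (hν : ν.SupportedIn K) (χ : SmoothFun M)
    (hχ : tsupport χ ⊆ φ.source) (h1 : ∀ q ∈ K, χ q = 1) :
    chartIntegral φ ν = ∫ x, extendChart φ (ν (cutoffField φ hφ χ hχ)) x := by
  rw [chartIntegral, ← integral_indicator φ.open_target.measurableSet,
    indicator_chartDensity hφ hν χ hχ h1]

theorem integrableOn_chartDensity {φ : OpenPartialHomeomorph M E3}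
    (hφ : φ ∈ IsManifold.maximalAtlas (𝓡 3) ∞ M) {ν : Form M 3} {K : Set M} (hK : IsCompact K)
    (hKφ : K ⊆ φ.source) (hν : ν.SupportedIn K) :
    IntegrableOn (chartDensity φ ν) φ.target := by
  obtain ⟨χ, h1, hχ, -⟩ := exists_cutoff hK φ.open_source hKφ
  rw [← integrable_indicator_iff φ.open_target.measurableSet,
    indicator_chartDensity hφ hν χ hχ fun q hq => (h1 q hq).eq_of_nhds]
  have hg : ∀ p ∉ K, ν (cutoffField φ hφ χ hχ) p = 0 := fun p hp => hν p hp _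
  exact (contDiff_extendChart hφ _ hK hKφ hg).continuous.integrable_of_hasCompactSupport
    (hasCompactSupport_extendChart hK hKφ hg)

theorem chartIntegral_sum {ι : Type*} (s : Finset ι) {φ : OpenPartialHomeomorph M E3}
    (hφ : φ ∈ IsManifold.maximalAtlas (𝓡 3) ∞ M) (ν : ι → Form M 3) (K : ι → Set M)
    (hK : ∀ i ∈ s, IsCompact (K i)) (hKφ : ∀ i ∈ s, K i ⊆ φ.source)
    (hν : ∀ i ∈ s, (ν i).SupportedIn (K i)) :
    chartIntegral φ (∑ i ∈ s, ν i) = ∑ i ∈ s, chartIntegral φ (ν i) := by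
  unfold chartIntegral
  rw [← integral_finsetSum s fun i hi =>
    integrableOn_chartDensity hφ (hK i hi) (hKφ i hi) (hν i hi)]
  refine integral_congr_ae (Filter.Eventually.of_forall fun x => ?_)
  change chartDensity φ (∑ i ∈ s, ν i) x = ∑ i ∈ s, chartDensity φ (ν i) x
  let L : Form M 3 →+ ℝ :=
    { toFun := fun ν => chartDensity φ ν x
      map_zero' := rfl
      map_add' := fun _ _ => rfl }
  exact map_sum L ν s

end ChartIntegral
end ChernSimons

namespace ChernSimons

/-! ### Stokes in a chart and change of charts -/

section Stokes
open MeasureTheory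

variable {M : Type*} [TopologicalSpace M] [ChartedSpace E3 M] [IsManifold (𝓡 3) ∞ M]

theorem VField.deriv_apply_congr (X : VField M) {f g : SmoothFun M} {p : M}
    (h : (f : M → ℝ) =ᶠ[nhds p] g) : X.deriv f p = X.deriv g p := by
  have h1 : mfderiv (𝓡 3) 𝓘(ℝ, ℝ) (f : M → ℝ) p = mfderiv (𝓡 3) 𝓘(ℝ, ℝ) (g : M → ℝ) p :=
    h.mfderiv_eq
  change (mfderiv (𝓡 3) 𝓘(ℝ, ℝ) (f : M → ℝ) p (X p) : ℝ) = _
  rw [h1]; rfl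

theorem VField.deriv_apply_eq_zero (X : VField M) {f : SmoothFun M} {p : M} {c : ℝ}
    (h : ∀ᶠ q in nhds p, f q = c) : X.deriv f p = 0 := by
  have h1 := X.deriv_apply_congr (f := f) (g := ContMDiffMap.const c) (p := p) h
  rw [h1, VField.deriv_const]; rfl

theorem Form.SupportedIn.mono {k : ℕ} {α : Form M k} {K L : Set M} (h : α.SupportedIn K)
    (hKL : K ⊆ L) : α.SupportedIn L := fun p hp => h p fun hpK => hp (hKL hpK)

theorem Form.SupportedIn.add {k : ℕ} {α β : Form M k} {K : Set M} (h : α.SupportedIn K)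
    (h' : β.SupportedIn K) : (α + β).SupportedIn K := fun p hp Y => by
  change α Y p + β Y p = 0
  rw [h p hp, h' p hp, add_zero]

theorem Form.SupportedIn.smul {k : ℕ} {α : Form M k} {K : Set M} (h : α.SupportedIn K)
    (f : SmoothFun M) : (f • α).SupportedIn (K ∩ tsupport f) := fun p hp Y => by
  change f p * α Y p = 0
  by_cases hpK : p ∈ K
  · rw [image_eq_zero_of_notMem_tsupport fun h => hp ⟨hpK, h⟩, zero_mul]
  · rw [h p hpK, mul_zero]

theorem VField.deriv_apply_eq_zero_of_notMem (X : VField M) {f : SmoothFun M} {K : Set M}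
    (hK : IsClosed K) (hf : ∀ p ∉ K, f p = 0) {p : M} (hp : p ∉ K) : X.deriv f p = 0 :=
  X.deriv_apply_eq_zero (c := 0) (by
    filter_upwards [hK.isOpen_compl.mem_nhds hp] with q hq using hf q hq)

theorem Form.SupportedIn.d₂ {α : Form M 2} {K : Set M} (h : α.SupportedIn K)
    (hK : IsClosed K) : (Form.d₂ α).SupportedIn K := fun p hp Y => by
  have h1 : ∀ (X : VField M) (Z : Fin 2 → VField M), X.deriv (α Z) p = 0 := fun X Z =>
    X.deriv_apply_eq_zero_of_notMem hK (fun q hq => h q hq Z) hp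
  change (Y 0).deriv (α ![Y 1, Y 2]) p - (Y 1).deriv (α ![Y 0, Y 2]) p +
    (Y 2).deriv (α ![Y 0, Y 1]) p - α ![(Y 0).bracket (Y 1), Y 2] p +
    α ![(Y 0).bracket (Y 2), Y 1] p - α ![(Y 1).bracket (Y 2), Y 0] p = 0
  simp only [h1, h p hp]; ring

variable [T2Space M] [SigmaCompactSpace M]

/-- Coordinate vector fields commute. -/
theorem bracket_cutoffField {φ : OpenPartialHomeomorph M E3}
    (hφ : φ ∈ IsManifold.maximalAtlas (𝓡 3) ∞ M) (χ : SmoothFun M) (hχ : tsupport χ ⊆ φ.source)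
    {q : M} (hq : χ =ᶠ[nhds q] 1) (i j : Fin 3) :
    (cutoffField φ hφ χ hχ i).bracket (cutoffField φ hφ χ hχ j) q = 0 := by
  have hs : ∀ {q}, χ =ᶠ[nhds q] 1 → q ∈ φ.source := fun hq =>
    hχ (subset_tsupport _ (by simp [hq.eq_of_nhds]))
  have hd : ∀ (i k : Fin 3), ∀ᶠ q' in nhds q,
      (cutoffField φ hφ χ hχ i).deriv (cutoffCoord φ hφ χ hχ k) q' = if i = k then 1 else 0 := by
    intro i k
    filter_upwards [hq.eventuallyEq_nhds] with q' hq'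
    rw [VField.deriv_cutoffCoord _ _ _ _ _ _ _ hq', cutoffField_apply, hq'.eq_of_nhds,
      Pi.one_apply, one_smul, chartCoord_coordField hφ (hs hq')]
  have hc : ∀ k, chartCoord φ q
      ((cutoffField φ hφ χ hχ i).bracket (cutoffField φ hφ χ hχ j) q) k = 0 := by
    intro k
    rw [← VField.deriv_cutoffCoord _ hφ χ hχ _ _ _ hq, VField.bracket_deriv]
    change (cutoffField φ hφ χ hχ i).deriv _ q - (cutoffField φ hφ χ hχ j).deriv _ q = 0
    rw [VField.deriv_apply_eq_zero _ (hd j k), VField.deriv_apply_eq_zero _ (hd i k), sub_zero]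
  rw [sum_chartCoord_smul_coordField hφ (hs hq)
    ((cutoffField φ hφ χ hχ i).bracket (cutoffField φ hφ χ hχ j) q)]
  exact Finset.sum_eq_zero fun k _ => by rw [hc k, zero_smul]

theorem Form.two_apply_eq_zero (α : Form M 2) {p : M} {X : VField M} (hX : X p = 0)
    (Y : VField M) : α ![X, Y] p = 0 := by
  rw [Form.apply_congr α (Z := ![0, Y]) (p := p) fun i => by fin_cases i; exacts [hX, rfl]]
  exact congrArg (fun f : SmoothFun M => f p)
    (α.map_coord_zero (m := ![0, Y]) (0 : Fin 2) rfl)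

/-- Stokes' theorem for forms supported in a chart: as coordinate fields commute, the coefficient of
`dα` is a sum of partial derivatives of the coefficients of `α`. -/
theorem chartIntegral_d₂ {φ : OpenPartialHomeomorph M E3}
    (hφ : φ ∈ IsManifold.maximalAtlas (𝓡 3) ∞ M) {α : Form M 2} {K : Set M}
    (hK : IsCompact K) (hKφ : K ⊆ φ.source) (hα : α.SupportedIn K) :
    chartIntegral φ (Form.d₂ α) = 0 := by
  obtain ⟨χ, h1, hχ, -⟩ := exists_cutoff hK φ.open_source hKφ
  rw [chartIntegral_eq hφ (hα.d₂ hK.isClosed) χ hχ fun q hq => (h1 q hq).eq_of_nhds]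
  set c := cutoffField φ hφ χ hχ with hc
  let g : Fin 3 → Fin 3 → SmoothFun M := fun i j => α ![c i, c j]
  have hg : ∀ i j, ∀ p ∉ K, g i j p = 0 := fun i j p hp => hα p hp _
  have hsm := fun i j => contDiff_extendChart hφ (g i j) hK hKφ (hg i j)
  have hcs := fun i j => hasCompactSupport_extendChart (φ := φ) hK hKφ (hg i j)
  let D : Fin 3 → Fin 3 → Fin 3 → E3 → ℝ := fun k i j x =>
    fderiv ℝ (extendChart φ (g i j)) x (EuclideanSpace.single k (1 : ℝ))
  have hint : ∀ k i j, Integrable (D k i j) := fun k i j =>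
    (((hsm i j).continuous_fderiv (by simp)).clm_apply
      continuous_const).integrable_of_hasCompactSupport ((hcs i j).fderiv_apply (𝕜 := ℝ) _)
  have hzero : ∀ k i j, ∫ x, D k i j x = 0 := fun k i j =>
    integral_fderiv_eq_zero (hsm i j) (hcs i j) _
  have key : extendChart φ (Form.d₂ α c) = D 0 1 2 - D 1 0 2 + D 2 0 1 := by
    funext x
    change _ = D 0 1 2 x - D 1 0 2 x + D 2 0 1 x
    by_cases hx : x ∈ φ '' K
    · obtain ⟨q, hq, rfl⟩ := hx
      have hci : ∀ i, c i q = coordField φ i q := fun i => by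
        rw [hc, cutoffField_apply, (h1 q hq).eq_of_nhds, Pi.one_apply, one_smul]
      have hbr : ∀ i j k, α ![(c i).bracket (c j), c k] q = 0 := fun i j k =>
        Form.two_apply_eq_zero α (bracket_cutoffField hφ χ hχ (h1 q hq) i j) _
      simp only [D, fderiv_extendChart hφ _ (hKφ hq) _ _ (hci _)]
      rw [extendChart, Set.indicator_of_mem (φ.map_source (hKφ hq)), Function.comp,
        φ.left_inv (hKφ hq)]
      change (c 0).deriv (α ![c 1, c 2]) q - (c 1).deriv (α ![c 0, c 2]) q +
        (c 2).deriv (α ![c 0, c 1]) q - α ![(c 0).bracket (c 1), c 2] q +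
        α ![(c 0).bracket (c 2), c 1] q - α ![(c 1).bracket (c 2), c 0] q = _
      simp only [hbr, g]; ring
    · have hcl : IsClosed (φ '' K) :=
        (hK.image_of_continuousOn (φ.continuousOn.mono hKφ)).isClosed
      have hD : ∀ k i j, D k i j x = 0 := fun k i j => by
        have : extendChart φ (g i j) =ᶠ[nhds x] fun _ => 0 := by
          filter_upwards [hcl.isOpen_compl.mem_nhds hx] with y hy
          exact extendChart_eq_zero (hg i j) hy
        simp [D, this.fderiv_eq]
      rw [hD, hD, hD, extendChart_eq_zero (fun p hp => hα.d₂ hK.isClosed p hp _) hx]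
      ring
  rw [key, integral_add' ((hint _ _ _).sub (hint _ _ _)) (hint _ _ _),
    integral_sub' (hint _ _ _) (hint _ _ _), hzero, hzero, hzero]
  simp

/-- The transformation of the coefficient of a three-form under a change of charts. -/
theorem chartDensity_transition {φ ψ : OpenPartialHomeomorph M E3}
    (hφ : φ ∈ IsManifold.maximalAtlas (𝓡 3) ∞ M) (hψ : ψ ∈ IsManifold.maximalAtlas (𝓡 3) ∞ M)
    (ν : Form M 3) {x : E3} (hx : x ∈ (φ.symm.trans ψ).source) :
    DifferentiableAt ℝ (φ.symm.trans ψ) x ∧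
    chartDensity φ ν x =
      (fderiv ℝ (φ.symm.trans ψ) x).det * chartDensity ψ ν (φ.symm.trans ψ x) := by
  have hx' : x ∈ φ.target ∧ φ.symm x ∈ ψ.source := by simpa using hx
  obtain ⟨hxφ, hxψ⟩ := hx'
  have h1 : MDifferentiableAt 𝓘(ℝ, E3) (𝓡 3) φ.symm x :=
    (contMDiffAt_symm_of_mem_maximalAtlas hφ hxφ).mdifferentiableAt (by simp)
  have h2 : MDifferentiableAt (𝓡 3) 𝓘(ℝ, E3) ψ (φ.symm x) :=
    (contMDiffAt_of_mem_maximalAtlas hψ hxψ).mdifferentiableAt (by simp)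
  have hd : MDifferentiableAt 𝓘(ℝ, E3) 𝓘(ℝ, E3) (φ.symm.trans ψ) x := h2.comp x h1
  refine ⟨hd.differentiableAt, ?_⟩
  set q := φ.symm x with hq
  obtain ⟨χ, h1χ, hχ, -⟩ := exists_cutoff (isCompact_singleton (x := q)) ψ.open_source
    (Set.singleton_subset_iff.2 hxψ)
  let c := cutoffField ψ hψ χ hχ
  -- the value of `ν` at `q`, as an alternating form of the coordinates in the chart `ψ`
  let b := (EuclideanSpace.basisFun (Fin 3) ℝ).toBasis
  let lift : E3 →ₗ[ℝ] VField M :=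
    { toFun := fun w => ∑ i, w i • c i
      map_add' := fun w w' => by simp [_root_.add_smul, Finset.sum_add_distrib]
      map_smul' := fun r w => by simp [mul_smul, Finset.smul_sum] }
  have hcs : ∀ (r : ℝ) (Y : VField M), r • Y = (ContMDiffMap.const r : SmoothFun M) • Y :=
    fun r Y => VField.const_smul r Y
  let T : E3 [⋀^Fin 3]→ₗ[ℝ] ℝ :=
    { toFun := fun v => ν (fun i => lift (v i)) q
      map_update_add' := by
        intro inst v i w w'
        obtain rfl : inst = instDecidableEqFin 3 := Subsingleton.elim _ _
        have h := fun w => (Function.comp_update lift v i w)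
        simp only [Function.comp_def] at h
        simp only [h, map_add, AlternatingMap.map_update_add]
        rfl
      map_update_smul' := by
        intro inst v i r w
        obtain rfl : inst = instDecidableEqFin 3 := Subsingleton.elim _ _
        have h := fun w => (Function.comp_update lift v i w)
        simp only [Function.comp_def] at h
        simp only [h, map_smul, hcs, AlternatingMap.map_update_smul]
        rfl
      map_eq_zero_of_eq' := by
        intro v i j h hij
        have := ν.map_eq_zero_of_eq (fun i => lift (v i)) (congrArg lift h) hij
        exact congrArg (fun f : SmoothFun M => f q) this }
  have hsum : ∀ Y : Fin 3 → VField M, (∑ i, Y i) q = ∑ i, Y i q := fun Y => by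
    simp [Fin.sum_univ_three]
  have hlift : ∀ w : E3, lift w q = mfderiv 𝓘(ℝ, E3) (𝓡 3) ψ.symm (ψ q) w := by
    intro w
    have h0 : w = ∑ i, w i • EuclideanSpace.single i (1 : ℝ) := by
      ext j; simp [Pi.single_apply]
    conv_rhs => rw [h0]
    refine Eq.trans ?_ (map_sum (mfderiv 𝓘(ℝ, E3) (𝓡 3) ψ.symm (ψ q)) _ _).symm
    change (∑ i, w i • c i) q = _
    rw [hsum]
    refine Finset.sum_congr rfl fun i _ => ?_
    refine Eq.trans ?_ (map_smul (mfderiv 𝓘(ℝ, E3) (𝓡 3) ψ.symm (ψ q)) _ _).symm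
    change w i • c i q = _
    rw [cutoffField_apply, (h1χ q rfl).eq_of_nhds, Pi.one_apply, one_smul]
    rfl
  have hψT : chartDensity ψ ν (ψ q) = T b := by
    rw [chartDensity_eq hψ ν χ hχ (ψ.map_source hxψ)
      (by rw [ψ.left_inv hxψ]; exact (h1χ q rfl).eq_of_nhds), ψ.left_inv hxψ]
    refine Form.apply_congr ν fun i => ?_
    change _ = (∑ j, b i j • c j) q
    rw [hsum, Finset.sum_eq_single i]
    · change c i q = b i i • c i q
      simp [b]
    · intro j _ hji
      change b i j • c j q = 0
      simp [b, hji]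
    · simp
  have hφT : chartDensity φ ν x = T (fun i => fderiv ℝ (φ.symm.trans ψ) x (b i)) := by
    refine Form.evalAt_eq _ _ _ _ fun i => ?_
    change lift _ q = _
    rw [hlift]
    have h3 : mfderiv 𝓘(ℝ, E3) 𝓘(ℝ, E3) (φ.symm.trans ψ) x =
        (mfderiv (𝓡 3) 𝓘(ℝ, E3) ψ q).comp (mfderiv 𝓘(ℝ, E3) (𝓡 3) φ.symm x) :=
      mfderiv_comp x h2 h1
    have h4 := (mdifferentiable_chart hψ).symm_comp_deriv hxψ
    rw [← mfderiv_eq_fderiv, h3]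
    have h5 := congrArg (fun L => L (mfderiv 𝓘(ℝ, E3) (𝓡 3) φ.symm x (b i))) h4
    have hb : (EuclideanSpace.single i (1 : ℝ) : E3) = b i := by simp [b]
    rw [hb]
    exact h5
  have hdet := congrArg (fun A : E3 [⋀^Fin 3]→ₗ[ℝ] ℝ =>
    A fun i => fderiv ℝ (φ.symm.trans ψ) x (b i)) (T.eq_smul_basis_det b)
  rw [hφT, hdet]
  change T b * b.det (fun i => (fderiv ℝ (φ.symm.trans ψ) x : E3 →ₗ[ℝ] E3) (b i)) = _
  have h6 := b.det_comp (fderiv ℝ (φ.symm.trans ψ) x : E3 →ₗ[ℝ] E3) b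
  rw [b.det_self, mul_one] at h6
  refine (congrArg (T b * ·) h6).trans ?_
  rw [mul_comm, ← hψT]
  rfl

end Stokes
end ChernSimons

namespace ChernSimons

/-! ### The integral over the manifold -/

section Integral
open MeasureTheory

variable {M : Type*} [TopologicalSpace M] [ChartedSpace E3 M] [IsManifold (𝓡 3) ∞ M]
  [T2Space M] [SigmaCompactSpace M]

/-- The integral over a chart does not depend on the chart, as long as the orientations agree. -/
theorem chartIntegral_eq_of_supportedIn {φ ψ : OpenPartialHomeomorph M E3}
    (hφ : φ ∈ IsManifold.maximalAtlas (𝓡 3) ∞ M) (hψ : ψ ∈ IsManifold.maximalAtlas (𝓡 3) ∞ M)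
    (hpos : ∀ x ∈ (φ.symm.trans ψ).source, 0 < (fderiv ℝ (φ.symm.trans ψ) x).det)
    {ν : Form M 3} {K : Set M} (hKφ : K ⊆ φ.source) (hKψ : K ⊆ ψ.source)
    (hν : ν.SupportedIn K) : chartIntegral φ ν = chartIntegral ψ ν := by
  set τ := φ.symm.trans ψ with hτ
  have hs : τ.source ⊆ φ.target := fun x hx => by
    have : x ∈ φ.target ∧ φ.symm x ∈ ψ.source := by simpa [hτ] using hx
    exact this.1
  have ht : τ.target ⊆ ψ.target := fun x hx => by
    have : x ∈ ψ.target ∧ ψ.symm x ∈ φ.source := by simpa [hτ] using hx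
    exact this.1
  have h1 : chartIntegral φ ν = ∫ x in τ.source, chartDensity φ ν x := by
    refine (setIntegral_eq_of_subset_of_forall_sdiff_eq_zero φ.open_target.measurableSet hs
      fun x hx => chartDensity_eq_zero φ hν fun hxK => hx.2 ?_)
    have : x ∈ φ.target ∧ φ.symm x ∈ ψ.source := ⟨hx.1, hKψ hxK⟩
    simpa [hτ] using this
  have h2 : chartIntegral ψ ν = ∫ x in τ.target, chartDensity ψ ν x := by
    refine (setIntegral_eq_of_subset_of_forall_sdiff_eq_zero ψ.open_target.measurableSet ht
      fun x hx => chartDensity_eq_zero ψ hν fun hxK => hx.2 ?_)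
    have : x ∈ ψ.target ∧ ψ.symm x ∈ φ.source := ⟨hx.1, hKφ hxK⟩
    simpa [hτ] using this
  rw [h1, h2, ← τ.image_source_eq_target,
    integral_image_eq_integral_abs_det_fderiv_smul volume τ.open_source.measurableSet
      (fun x hx => ((chartDensity_transition hφ hψ ν
        hx).1.hasFDerivAt).hasFDerivWithinAt) τ.injOn]
  refine setIntegral_congr_fun τ.open_source.measurableSet fun x hx => ?_
  simp only [smul_eq_mul]
  rw [abs_of_pos (hpos x hx)]
  exact (chartDensity_transition hφ hψ ν hx).2

namespace OrientedAtlas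
variable (𝒜 : OrientedAtlas M)

/-- The partition of unity which enters the definition of the integral. -/
noncomputable def partition : SmoothPartitionOfUnity 𝒜.charts (𝓡 3) M Set.univ :=
  𝒜.exists_partition.choose

/-- A member of the partition of unity, as a smooth function. -/
noncomputable def partFun (φ : 𝒜.charts) : SmoothFun M := 𝒜.partition φ

theorem tsupport_partFun (φ : 𝒜.charts) : tsupport (𝒜.partFun φ) ⊆ φ.1.source :=
  𝒜.exists_partition.choose_spec φ

theorem integral_eq_finsum (ν : Form M 3) :
    𝒜.integral ν = ∑ᶠ φ : 𝒜.charts, chartIntegral φ.1 (𝒜.partFun φ • ν) := rfl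

/-- A form with compact support is a finite sum of forms supported in charts. -/
theorem exists_finset_sum_partFun {K : Set M} (hK : IsCompact K) : ∃ T : Finset 𝒜.charts,
    ∀ (k : ℕ) (α : Form M k), α.SupportedIn K →
      (∑ φ ∈ T, 𝒜.partFun φ • α = α ∧ ∀ φ ∉ T, 𝒜.partFun φ • α = 0) := by
  have hfin := 𝒜.partition.locallyFinite.finite_nonempty_inter_compact hK
  refine ⟨hfin.toFinset, fun k α hα => ?_⟩
  have h0 : ∀ φ ∉ hfin.toFinset, ∀ q ∈ K, 𝒜.partFun φ q = 0 := fun φ hφ q hq => by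
    by_contra h
    exact hφ (hfin.mem_toFinset.2 ⟨q, h, hq⟩)
  constructor
  · refine AlternatingMap.ext fun Y => ?_
    ext q
    have hsum : (∑ φ ∈ hfin.toFinset, 𝒜.partFun φ • α) Y q =
        (∑ φ ∈ hfin.toFinset, 𝒜.partFun φ q) * α Y q := by
      let L : Form M k →+ ℝ :=
        { toFun := fun β => β Y q
          map_zero' := rfl
          map_add' := fun _ _ => rfl }
      rw [Finset.sum_mul]
      exact map_sum L _ _
    rw [hsum]
    by_cases hq : q ∈ K
    · have h1 : ∑ᶠ φ, 𝒜.partFun φ q = 1 := 𝒜.partition.sum_eq_one (Set.mem_univ q)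
      rw [finsum_eq_sum_of_support_subset _ (s := hfin.toFinset)] at h1
      · rw [h1, one_mul]
      · intro φ hφ
        by_contra h
        exact hφ (h0 φ h q hq)
    · rw [hα q hq, mul_zero]
  · intro φ hφ
    refine AlternatingMap.ext fun Y => ?_
    ext q
    change 𝒜.partFun φ q * α Y q = 0
    by_cases hq : q ∈ K
    · rw [h0 φ hφ q hq, zero_mul]
    · rw [hα q hq, mul_zero]

theorem integral_eq_sum {T : Finset 𝒜.charts} {ν : Form M 3}
    (hT : ∀ φ ∉ T, 𝒜.partFun φ • ν = 0) :
    𝒜.integral ν = ∑ φ ∈ T, chartIntegral φ.1 (𝒜.partFun φ • ν) := by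
  rw [integral_eq_finsum]
  refine finsum_eq_sum_of_support_subset _ fun φ hφ => ?_
  by_contra h
  refine hφ ?_
  change chartIntegral φ.1 (𝒜.partFun φ • ν) = 0
  rw [hT φ h]
  exact (integral_zero E3 ℝ)

theorem integral_zero : 𝒜.integral (0 : Form M 3) = 0 := by
  rw [𝒜.integral_eq_sum (T := ∅) fun φ _ => smul_zero _, Finset.sum_empty]

/-- No integrability is needed here: scaling commutes with the integral over a chart and with finite
sums, also where these take default values. -/
theorem integral_smul (c : ℝ) (ν : Form M 3) : 𝒜.integral (c • ν) = c * 𝒜.integral ν := by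
  rw [integral_eq_finsum, integral_eq_finsum, ← smul_eq_mul, smul_finsum]
  refine finsum_congr fun φ => ?_
  rw [smul_eq_mul, ← chartIntegral_const_smul]
  congr 1
  exact smul_comm _ _ _

theorem integral_neg (ν : Form M 3) : 𝒜.integral (-ν) = -𝒜.integral ν := by
  rw [show -ν = (-1 : ℝ) • ν by module, integral_smul]; ring

theorem integral_add {ν ν' : Form M 3} (h : ν.IsCpt) (h' : ν'.IsCpt) :
    𝒜.integral (ν + ν') = 𝒜.integral ν + 𝒜.integral ν' := by
  obtain ⟨K, hK, hνK⟩ := h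
  obtain ⟨K', hK', hνK'⟩ := h'
  have h1 : ν.SupportedIn (K ∪ K') := Form.SupportedIn.mono hνK Set.subset_union_left
  have h2 : ν'.SupportedIn (K ∪ K') := Form.SupportedIn.mono hνK' Set.subset_union_right
  obtain ⟨T, hT⟩ := 𝒜.exists_finset_sum_partFun (hK.union hK')
  rw [𝒜.integral_eq_sum (hT 3 _ h1).2, 𝒜.integral_eq_sum (hT 3 _ h2).2,
    𝒜.integral_eq_sum (hT 3 _ (h1.add h2)).2, ← Finset.sum_add_distrib]
  refine Finset.sum_congr rfl fun φ _ => ?_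
  have hi : ∀ β : Form M 3, β.SupportedIn (K ∪ K') →
      IntegrableOn (chartDensity φ.1 (𝒜.partFun φ • β)) φ.1.target := fun β hβ =>
    integrableOn_chartDensity (𝒜.smooth φ.2) ((hK.union hK').inter_right (isClosed_tsupport _))
      (Set.inter_subset_right.trans (𝒜.tsupport_partFun φ)) (hβ.smul _)
  rw [smul_add]
  exact MeasureTheory.integral_add (hi ν h1) (hi ν' h2)

/-- The integral of a form supported in a chart can be computed in this chart. -/
theorem integral_eq_chartIntegral {φ : OpenPartialHomeomorph M E3} (hφ : φ ∈ 𝒜.charts)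
    {ν : Form M 3} {K : Set M} (hK : IsCompact K) (hKφ : K ⊆ φ.source) (hν : ν.SupportedIn K) :
    𝒜.integral ν = chartIntegral φ ν := by
  obtain ⟨T, hT⟩ := 𝒜.exists_finset_sum_partFun hK
  rw [𝒜.integral_eq_sum (hT 3 _ hν).2]
  conv_rhs => rw [← (hT 3 _ hν).1]
  rw [chartIntegral_sum T (𝒜.smooth hφ) _ (fun ψ => K ∩ tsupport (𝒜.partFun ψ))
    (fun ψ _ => hK.inter_right (isClosed_tsupport _))
    (fun ψ _ => Set.inter_subset_left.trans hKφ) fun ψ _ => hν.smul _]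
  refine Finset.sum_congr rfl fun ψ _ => ?_
  exact chartIntegral_eq_of_supportedIn (𝒜.smooth ψ.2) (𝒜.smooth hφ)
    (𝒜.positive _ ψ.2 _ hφ) (Set.inter_subset_right.trans (𝒜.tsupport_partFun ψ))
    (Set.inter_subset_left.trans hKφ) (hν.smul _)

theorem integral_sum {ι : Type*} (s : Finset ι) (ν : ι → Form M 3) (h : ∀ i ∈ s, (ν i).IsCpt) :
    𝒜.integral (∑ i ∈ s, ν i) = ∑ i ∈ s, 𝒜.integral (ν i) ∧ (∑ i ∈ s, ν i).IsCpt := by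
  classical
  induction s using Finset.induction_on with
  | empty => exact ⟨𝒜.integral_zero, ∅, isCompact_empty, fun _ _ _ => rfl⟩
  | insert i s hi ih =>
    obtain ⟨h1, h2⟩ := ih fun j hj => h j (Finset.mem_insert_of_mem hj)
    have h3 := h i (Finset.mem_insert_self i s)
    rw [Finset.sum_insert hi, Finset.sum_insert hi, 𝒜.integral_add h3 h2, h1]
    obtain ⟨K, hK, hKs⟩ := h2
    obtain ⟨K', hK', hKs'⟩ := h3
    exact ⟨rfl, _, hK'.union hK, Form.SupportedIn.add
      (Form.SupportedIn.mono hKs' Set.subset_union_left)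
      (Form.SupportedIn.mono hKs Set.subset_union_right)⟩

/-- Stokes' theorem for forms with compact support. -/
theorem integral_d₂ {α : Form M 2} (hα : α.IsCpt) : 𝒜.integral (Form.d₂ α) = 0 := by
  obtain ⟨K, hK, hα⟩ := hα
  obtain ⟨T, hT⟩ := 𝒜.exists_finset_sum_partFun hK
  have hK' : ∀ φ, IsCompact (K ∩ tsupport (𝒜.partFun φ)) :=
    fun φ => hK.inter_right (isClosed_tsupport _)
  have hs : ∀ φ, (𝒜.partFun φ • α).SupportedIn (K ∩ tsupport (𝒜.partFun φ)) :=
    fun φ => Form.SupportedIn.smul hα _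
  conv_lhs => rw [← (hT 2 _ hα).1]
  rw [map_sum, (𝒜.integral_sum T _ fun φ _ => ⟨_, hK' φ, (hs φ).d₂ (hK' φ).isClosed⟩).1]
  refine Finset.sum_eq_zero fun φ _ => ?_
  have hφ : K ∩ tsupport (𝒜.partFun φ) ⊆ φ.1.source :=
    Set.inter_subset_right.trans (𝒜.tsupport_partFun φ)
  rw [𝒜.integral_eq_chartIntegral φ.2 (hK' φ) hφ ((hs φ).d₂ (hK' φ).isClosed)]
  exact chartIntegral_d₂ (𝒜.smooth φ.2) (hK' φ) hφ (hs φ)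

/-- The fundamental lemma of the calculus of variations. -/
theorem eq_zero_of_integral_smul_eq_zero {ν : Form M 3}
    (h : ∀ f : SmoothFun M, HasCompactSupport f → 𝒜.integral (f • ν) = 0) : ν = 0 := by
  refine Form.ext_three fun X Y Z => ?_
  ext p
  obtain ⟨φ, hφ, hp⟩ := 𝒜.cover p
  have hφ' := 𝒜.smooth hφ
  obtain ⟨χ, hχ1, hχ, hχc, hχ0⟩ := exists_cutoff (isCompact_singleton (x := p)) φ.open_source
    (Set.singleton_subset_iff.2 hp)
  obtain ⟨χ', hχ'1, hχ', -⟩ := exists_cutoff hχc φ.open_source hχ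
  set c := cutoffField φ hφ' χ' hχ' with hc
  -- the test function is the coefficient of `ν` itself, cut off
  let f : SmoothFun M := χ * ν c
  have hfs : tsupport f ⊆ tsupport χ := closure_mono fun q hq => by
    intro h; exact hq (by change χ q * ν c q = 0; rw [h, zero_mul])
  have hfc : HasCompactSupport f := hχc.of_isClosed_subset (isClosed_tsupport _) hfs
  have hs : (f • ν).SupportedIn (tsupport χ) := fun q hq W => by
    change f q * ν W q = 0
    rw [image_eq_zero_of_notMem_tsupport fun h => hq (hfs h), zero_mul]
  have h1 := h f hfc
  rw [𝒜.integral_eq_chartIntegral hφ hχc hχ hs, chartIntegral_eq hφ' hs χ' hχ'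
    fun q hq => (hχ'1 q hq).eq_of_nhds] at h1
  have hGf : ∀ q ∉ tsupport χ, (f • ν) c q = 0 := fun q hq => hs q hq _
  have hnn : ∀ x, 0 ≤ extendChart φ ((f • ν) c) x := fun x =>
    Set.indicator_nonneg (fun y _ => by
      change 0 ≤ χ (φ.symm y) * ν c (φ.symm y) * ν c (φ.symm y)
      rw [mul_assoc]
      exact mul_nonneg (hχ0 _) (mul_self_nonneg _)) x
  have h2 : extendChart φ ((f • ν) c) (φ p) = 0 := by
    by_contra hne
    exact (Continuous.integral_pos_of_hasCompactSupport_nonneg_nonzero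
      (contDiff_extendChart hφ' _ hχc hχ hGf).continuous
      (hasCompactSupport_extendChart hχc hχ hGf) hnn hne).ne' h1
  rw [extendChart, Set.indicator_of_mem (φ.map_source hp), Function.comp, φ.left_inv hp] at h2
  have hχp : χ p = 1 := (hχ1 p rfl).eq_of_nhds
  have h3 : ν c p = 0 := by
    change χ p * ν c p * ν c p = 0 at h2
    simpa [hχp] using h2
  refine Form.three_apply_eq_zero ν hχp (VField.smul_eq_sum_cutoffField φ hφ' χ' hχ' χ
    fun q hq => hχ'1 q (subset_tsupport _ hq)) (fun i j k => ?_) X Y Z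
  by_cases hinj : Function.Injective ![i, j, k]
  · let σ : Equiv.Perm (Fin 3) := Equiv.ofBijective _ (Finite.injective_iff_bijective.1 hinj)
    have h4 : ![c i, c j, c k] = fun l => c (σ l) := by
      funext l; fin_cases l <;> rfl
    have h5 := congrArg (fun g : SmoothFun M => g p) (ν.map_perm c σ)
    change ν ![c i, c j, c k] p = 0
    rw [h4]
    refine h5.trans ?_
    rcases Int.units_eq_one_or (Equiv.Perm.sign σ) with h6 | h6 <;> rw [h6]
    · rw [_root_.one_smul]; exact h3
    · rw [Units.neg_smul, _root_.one_smul]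
      change -(ν c p) = 0
      rw [h3, neg_zero]
  · rw [Function.not_injective_iff] at hinj
    obtain ⟨a, b, hab, hne⟩ := hinj
    have h4 : ![c i, c j, c k] = fun l => c (![i, j, k] l) := by
      funext l; fin_cases l <;> rfl
    change ν ![c i, c j, c k] p = 0
    rw [h4, ν.map_eq_zero_of_eq (fun l => c (![i, j, k] l)) (congrArg c hab) hne]
    rfl

end OrientedAtlas
end Integral
end ChernSimons

namespace ChernSimons

/-! ### Compact supports -/

section CompactSupports
variable {M : Type*} [TopologicalSpace M] [ChartedSpace E3 M] [IsManifold (𝓡 3) ∞ M]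

/-- The evaluation of smooth functions at a point. -/
noncomputable def evalHom (p : M) : SmoothFun M →+ ℝ where
  toFun f := f p
  map_zero' := rfl
  map_add' _ _ := rfl

namespace Form

theorem SupportedIn.wedge_left {p q : ℕ} {α : Form M p} {K : Set M} (h : α.SupportedIn K)
    (β : Form M q) : (wedge α β).SupportedIn K := fun x hx Y => by
  have h1 := congrArg (evalHom x) (factorial_smul_wedge_apply α β Y)
  rw [map_nsmul, map_sum, Finset.sum_eq_zero] at h1
  · exact (smul_eq_zero.1 h1).resolve_left (by positivity)
  · intro σ _
    rw [Units.smul_def, map_zsmul]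
    change _ • (α _ x * β _ x) = 0
    rw [h x hx, zero_mul, smul_zero]

theorem SupportedIn.wedge_right {p q : ℕ} {β : Form M q} {K : Set M} (h : β.SupportedIn K)
    (α : Form M p) : (wedge α β).SupportedIn K := fun x hx Y => by
  have h1 := congrArg (evalHom x) (factorial_smul_wedge_apply α β Y)
  rw [map_nsmul, map_sum, Finset.sum_eq_zero] at h1
  · exact (smul_eq_zero.1 h1).resolve_left (by positivity)
  · intro σ _
    rw [Units.smul_def, map_zsmul]
    change _ • (α _ x * β _ x) = 0
    rw [h x hx, mul_zero, smul_zero]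

variable {k : ℕ} {α β : Form M k}

theorem IsCpt.add (h : α.IsCpt) (h' : β.IsCpt) : (α + β).IsCpt := by
  obtain ⟨K, hK, h⟩ := h
  obtain ⟨K', hK', h'⟩ := h'
  exact ⟨_, hK.union hK', SupportedIn.add (SupportedIn.mono h Set.subset_union_left)
    (SupportedIn.mono h' Set.subset_union_right)⟩

theorem IsCpt.const_smul (h : α.IsCpt) (c : ℝ) : (c • α).IsCpt := by
  obtain ⟨K, hK, h⟩ := h
  refine ⟨K, hK, fun p hp Y => ?_⟩
  change c * α Y p = 0
  rw [h p hp, mul_zero]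

theorem IsCpt.neg (h : α.IsCpt) : (-α).IsCpt := by
  rw [show -α = (-1 : ℝ) • α by module]; exact h.const_smul _

theorem IsCpt.sub (h : α.IsCpt) (h' : β.IsCpt) : (α - β).IsCpt := by
  rw [sub_eq_add_neg]; exact h.add h'.neg

theorem isCpt_zero : (0 : Form M k).IsCpt := ⟨∅, isCompact_empty, fun _ _ _ => rfl⟩

theorem IsCpt.contr {α : Form M (k + 1)} (h : α.IsCpt) (ξ : VField M) :
    (Form.contr ξ α).IsCpt := by
  obtain ⟨K, hK, h⟩ := h
  exact ⟨K, hK, fun p hp Y => h p hp _⟩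

theorem isCpt_contr {ξ : VField M} (h : ξ.IsCpt) [T2Space M] [SigmaCompactSpace M]
    (α : Form M (k + 1)) : (Form.contr ξ α).IsCpt := by
  obtain ⟨K, hK, h⟩ := h
  refine ⟨K, hK, fun p hp Y => ?_⟩
  have h1 : α (Matrix.vecCons ξ Y) p = α (Matrix.vecCons 0 Y) p :=
    apply_congr α fun i => by
      refine Fin.cases ?_ (fun j => ?_) i
      · exact h p hp
      · rfl
  refine h1.trans ?_
  exact congrArg (fun f : SmoothFun M => f p)
    (α.map_coord_zero (m := Matrix.vecCons 0 Y) (0 : Fin (k + 1)) rfl)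

theorem IsCpt.lie [T2Space M] (h : α.IsCpt) (ξ : VField M) : (Form.lie ξ α).IsCpt := by
  obtain ⟨K, hK, h⟩ := h
  refine ⟨K, hK, fun p hp Y => ?_⟩
  rw [lie_apply]
  change evalHom p (ξ.deriv (α Y) - ∑ i, α (Function.update Y i (ξ.bracket (Y i)))) = 0
  rw [map_sub, map_sum]
  change ξ.deriv (α Y) p - ∑ i, α (Function.update Y i (ξ.bracket (Y i))) p = 0
  rw [VField.deriv_apply_eq_zero_of_notMem ξ hK.isClosed (fun q hq => h q hq Y) hp,
    Finset.sum_eq_zero fun i _ => h p hp _, sub_zero]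

theorem IsCpt.d₀ [T2Space M] {α : Form M 0} (h : α.IsCpt) : (Form.d₀ α).IsCpt := by
  obtain ⟨K, hK, h⟩ := h
  exact ⟨K, hK, fun p hp Y => VField.deriv_apply_eq_zero_of_notMem _ hK.isClosed
    (fun q hq => h q hq _) hp⟩

theorem IsCpt.d₁ [T2Space M] {α : Form M 1} (h : α.IsCpt) : (Form.d₁ α).IsCpt := by
  obtain ⟨K, hK, h⟩ := h
  refine ⟨K, hK, fun p hp Y => ?_⟩
  have h1 : ∀ (X : VField M) (Z : Fin 1 → VField M), X.deriv (α Z) p = 0 := fun X Z =>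
    X.deriv_apply_eq_zero_of_notMem hK.isClosed (fun q hq => h q hq Z) hp
  change (Y 0).deriv (α ![Y 1]) p - (Y 1).deriv (α ![Y 0]) p - α ![(Y 0).bracket (Y 1)] p = 0
  rw [h1, h1, h p hp]; ring

theorem IsCpt.d₂ [T2Space M] {α : Form M 2} (h : α.IsCpt) : (Form.d₂ α).IsCpt := by
  obtain ⟨K, hK, h⟩ := h
  exact ⟨K, hK, SupportedIn.d₂ h hK.isClosed⟩

end Form

theorem VField.bracket_apply_eq_zero [T2Space M] [SigmaCompactSpace M] {ξ : VField M} {K : Set M}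
    (hK : IsClosed K) (h : ∀ p ∉ K, ξ p = 0) (η : VField M) {p : M} (hp : p ∉ K) :
    ξ.bracket η p = 0 := by
  obtain ⟨θ, h1, hθ, -⟩ := exists_cutoff (isCompact_singleton (x := p)) hK.isOpen_compl
    (Set.singleton_subset_iff.2 hp)
  have h0 : θ • ξ = 0 := by
    ext1 q
    rw [VField.smul_apply]
    by_cases hq : q ∈ K
    · rw [image_eq_zero_of_notMem_tsupport fun h => hθ h hq]; exact zero_smul ℝ (ξ q)
    · rw [h q hq]; exact smul_zero (θ q)
  have h2 := congrArg (fun X : VField M => X p) (VField.smul_bracket ξ θ η)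
  rw [h0, VField.zero_bracket] at h2
  change (0 : TangentSpace (𝓡 3) p) = θ p • ξ.bracket η p - η.deriv θ p • ξ p at h2
  rw [h p hp, (h1 p rfl).eq_of_nhds, Pi.one_apply, one_smul] at h2
  simpa using h2.symm

section
variable [T2Space M] [SigmaCompactSpace M] {ξ : VField M}

theorem VField.IsCpt.bracket_right (h : ξ.IsCpt) (η : VField M) : (ξ.bracket η).IsCpt := by
  obtain ⟨K, hK, h⟩ := h
  exact ⟨K, hK, fun p hp => VField.bracket_apply_eq_zero hK.isClosed h η hp⟩

theorem VField.IsCpt.bracket_left (h : ξ.IsCpt) (η : VField M) : (η.bracket ξ).IsCpt := by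
  obtain ⟨K, hK, h⟩ := h
  refine ⟨K, hK, fun p hp => ?_⟩
  rw [VField.bracket_swap]
  change -(ξ.bracket η p) = 0
  rw [VField.bracket_apply_eq_zero hK.isClosed h η hp, neg_zero]

theorem Form.isCpt_lie {k : ℕ} (h : ξ.IsCpt) (α : Form M k) : (Form.lie ξ α).IsCpt := by
  obtain ⟨K, hK, h⟩ := h
  refine ⟨K, hK, fun p hp Y => ?_⟩
  rw [lie_apply]
  change evalHom p (ξ.deriv (α Y) - ∑ i, α (Function.update Y i (ξ.bracket (Y i)))) = 0
  rw [map_sub, map_sum]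
  change ξ.deriv (α Y) p - ∑ i, α (Function.update Y i (ξ.bracket (Y i))) p = 0
  rw [VField.deriv_apply, h p hp, Finset.sum_eq_zero, sub_zero]
  · exact map_zero (mvfderiv (𝓡 3) (α Y) p)
  · intro i _
    rw [Form.update_apply_congr α Y i (Y := 0)
      (VField.bracket_apply_eq_zero hK.isClosed h (Y i) hp)]
    exact congrArg (fun f : SmoothFun M => f p)
      (α.map_coord_zero (m := Function.update Y i 0) i (by simp))

theorem CovDensity.IsCpt.apply {X : CovDensity M} (h : X.IsCpt) (ξ : VField M) : (X ξ).IsCpt := by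
  obtain ⟨K, hK, h⟩ := h
  exact ⟨K, hK, fun p hp Y => h p hp ξ Y⟩

theorem CovDensity.isCpt_apply (X : CovDensity M) (h : ξ.IsCpt) : (X ξ).IsCpt := by
  obtain ⟨K, hK, h⟩ := h
  refine ⟨K, hK, fun p hp Y => ?_⟩
  let L : VField M →ₗ[SmoothFun M] SmoothFun M :=
    { toFun := fun ξ => X ξ Y
      map_add' := fun ξ η => by rw [map_add, AlternatingMap.add_apply]
      map_smul' := fun f ξ => by rw [map_smul, AlternatingMap.smul_apply]; rfl }
  have h1 : L ξ p = L 0 p := linearMap_apply_congr L (h p hp)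
  rw [map_zero] at h1
  exact h1

end

section
variable {𝔤 : Type*} [LieRing 𝔤] [LieAlgebra ℝ 𝔤]

namespace GForm

theorem component_tmul {k : ℕ} (f : 𝔤 →ₗ[ℝ] ℝ) (α : Form M k) (X : 𝔤) :
    component f (α ⊗ₜ[ℝ] X : GForm M 𝔤 k) = f X • α := rfl

theorem component_rTensor {k l : ℕ} (D : Form M k →ₗ[ℝ] Form M l) (f : 𝔤 →ₗ[ℝ] ℝ)
    (a : GForm M 𝔤 k) : component f (D.rTensor 𝔤 a) = D (component f a) :=
  LinearMap.congr_fun (f := component f ∘ₗ D.rTensor 𝔤) (g := D ∘ₗ component f)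
    (TensorProduct.ext' fun α X => (map_smul D (f X) α).symm) a

theorem component_bracket {p q : ℕ} (f : 𝔤 →ₗ[ℝ] ℝ) (a : GForm M 𝔤 p) (b : GForm M 𝔤 q) :
    component f (bracket a b) = tr ((lieBilin 𝔤).compr₂ f) a b :=
  LinearMap.congr_fun₂ (f := (bracket (M := M) (𝔤 := 𝔤) (p := p) (q := q)).compr₂ (component f))
    (g := tr (p := p) (q := q) ((lieBilin 𝔤).compr₂ f))
    (TensorProduct.ext' fun _ _ => TensorProduct.ext' fun _ _ => rfl) a b

theorem tr_tmul_left (B : 𝔤 →ₗ[ℝ] 𝔤 →ₗ[ℝ] ℝ) {p q : ℕ} (α : Form M p) (X : 𝔤)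
    (b : GForm M 𝔤 q) :
    tr B (α ⊗ₜ[ℝ] X : GForm M 𝔤 p) b = Form.wedge α (component (B X) b) :=
  LinearMap.congr_fun (f := tr B (α ⊗ₜ[ℝ] X : GForm M 𝔤 p))
    (g := Form.wedgeBilin p q α ∘ₗ component (B X))
    (TensorProduct.ext' fun β Y => by
      change B X Y • Form.wedge α β = Form.wedge α (B X Y • β)
      rw [Form.const_smul, Form.const_smul, Form.wedge_smul]) b

theorem tr_tmul_right (B : 𝔤 →ₗ[ℝ] 𝔤 →ₗ[ℝ] ℝ) {p q : ℕ} (a : GForm M 𝔤 p) (β : Form M q)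
    (Y : 𝔤) : tr B a (β ⊗ₜ[ℝ] Y : GForm M 𝔤 q) = Form.wedge (component (B.flip Y) a) β :=
  LinearMap.congr_fun (f := (tr B).flip (β ⊗ₜ[ℝ] Y : GForm M 𝔤 q))
    (g := (Form.wedgeBilin p q).flip β ∘ₗ component (B.flip Y))
    (TensorProduct.ext' fun α X => by
      change B X Y • Form.wedge α β = Form.wedge (B X Y • α) β
      rw [Form.const_smul, Form.const_smul, Form.smul_wedge]) a

section
variable [T2Space M] [SigmaCompactSpace M] {k : ℕ} {a b : GForm M 𝔤 k} {ξ : VField M}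

theorem IsCpt.component (h : a.IsCpt) (f : 𝔤 →ₗ[ℝ] ℝ) : (component f a).IsCpt := by
  obtain ⟨K, hK, h⟩ := h
  exact ⟨K, hK, fun p hp => h p hp f⟩

variable [FiniteDimensional ℝ 𝔤]

theorem eq_sum_component (a : GForm M 𝔤 k) :
    a = ∑ i, component ((Module.finBasis ℝ 𝔤).coord i) a ⊗ₜ[ℝ] Module.finBasis ℝ 𝔤 i := by
  induction a using TensorProduct.induction_on with
  | zero => simp
  | add a a' ha ha' =>
    conv_lhs => rw [ha, ha']
    simp only [map_add, TensorProduct.add_tmul, Finset.sum_add_distrib]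
  | tmul α X =>
    conv_lhs => rw [← (Module.finBasis ℝ 𝔤).sum_repr X]
    rw [TensorProduct.tmul_sum]
    refine Finset.sum_congr rfl fun i _ => ?_
    rw [component_tmul, TensorProduct.tmul_smul, TensorProduct.smul_tmul']
    rfl

/-- Every component of a form is a combination of its components with respect to a basis of `𝔤`. -/
theorem component_eq_sum (f : 𝔤 →ₗ[ℝ] ℝ) (a : GForm M 𝔤 k) :
    component f a = ∑ i, f (Module.finBasis ℝ 𝔤 i) •
      component ((Module.finBasis ℝ 𝔤).coord i) a := by
  conv_lhs => rw [eq_sum_component a]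
  rw [map_sum]
  rfl

/-- The compactness of the support of a Lie algebra valued form can be tested on its components. -/
theorem isCpt_of_component (h : ∀ f, (component f a).IsCpt) : a.IsCpt := by
  choose K hK hs using fun i => h ((Module.finBasis ℝ 𝔤).coord i)
  refine ⟨⋃ i, K i, isCompact_iUnion hK, fun p hp f Y => ?_⟩
  rw [component_eq_sum]
  let L : Form M k →+ ℝ := { toFun := fun β => β Y p, map_zero' := rfl, map_add' := fun _ _ => rfl }
  refine (map_sum L _ _).trans (Finset.sum_eq_zero fun i _ => ?_)
  change f _ * component _ a Y p = 0
  rw [hs i p fun h => hp (Set.mem_iUnion.2 ⟨i, h⟩), mul_zero]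

theorem isCpt_zero : GForm.IsCpt (0 : GForm M 𝔤 k) :=
  isCpt_of_component fun f => by rw [map_zero]; exact Form.isCpt_zero

theorem IsCpt.contr {a : GForm M 𝔤 (k + 1)} (h : a.IsCpt) (ξ : VField M) :
    GForm.IsCpt (contr ξ a) :=
  isCpt_of_component fun f => by
    rw [GForm.contr, component_rTensor]; exact (h.component f).contr ξ

theorem isCpt_contr (h : ξ.IsCpt) (a : GForm M 𝔤 (k + 1)) : GForm.IsCpt (contr ξ a) :=
  isCpt_of_component fun f => by
    rw [GForm.contr, component_rTensor]; exact Form.isCpt_contr h _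

theorem IsCpt.lie (h : a.IsCpt) (ξ : VField M) : GForm.IsCpt (lie ξ a) :=
  isCpt_of_component fun f => by
    rw [GForm.lie, component_rTensor]; exact (h.component f).lie ξ

theorem isCpt_lie (h : ξ.IsCpt) (a : GForm M 𝔤 k) : GForm.IsCpt (lie ξ a) :=
  isCpt_of_component fun f => by
    rw [GForm.lie, component_rTensor]; exact Form.isCpt_lie h _

theorem IsCpt.d₀ {a : GForm M 𝔤 0} (h : a.IsCpt) : GForm.IsCpt (d₀ a) :=
  isCpt_of_component fun f => by
    rw [GForm.d₀, component_rTensor]; exact (h.component f).d₀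

theorem IsCpt.d₁ {a : GForm M 𝔤 1} (h : a.IsCpt) : GForm.IsCpt (d₁ a) :=
  isCpt_of_component fun f => by
    rw [GForm.d₁, component_rTensor]; exact (h.component f).d₁

theorem IsCpt.d₂ {a : GForm M 𝔤 2} (h : a.IsCpt) : GForm.IsCpt (d₂ a) :=
  isCpt_of_component fun f => by
    rw [GForm.d₂, component_rTensor]; exact (h.component f).d₂

theorem IsCpt.tr_left {p q : ℕ} {a : GForm M 𝔤 p} (h : a.IsCpt) (B : 𝔤 →ₗ[ℝ] 𝔤 →ₗ[ℝ] ℝ)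
    (b : GForm M 𝔤 q) : (tr B a b).IsCpt := by
  obtain ⟨K, hK, h⟩ := h
  refine ⟨K, hK, fun p hp Y => ?_⟩
  rw [eq_sum_component b, map_sum]
  let L : Form M _ →+ ℝ := { toFun := fun β => β Y p, map_zero' := rfl, map_add' := fun _ _ => rfl }
  refine (map_sum L _ _).trans (Finset.sum_eq_zero fun i _ => ?_)
  rw [tr_tmul_right]
  exact Form.SupportedIn.wedge_left (fun q hq => h q hq _) _ p hp Y

theorem IsCpt.tr_right {p q : ℕ} {b : GForm M 𝔤 q} (h : b.IsCpt) (B : 𝔤 →ₗ[ℝ] 𝔤 →ₗ[ℝ] ℝ)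
    (a : GForm M 𝔤 p) : (tr B a b).IsCpt := by
  obtain ⟨K, hK, h⟩ := h
  refine ⟨K, hK, fun p hp Y => ?_⟩
  rw [eq_sum_component a, map_sum, LinearMap.sum_apply]
  let L : Form M _ →+ ℝ := { toFun := fun β => β Y p, map_zero' := rfl, map_add' := fun _ _ => rfl }
  refine (map_sum L _ _).trans (Finset.sum_eq_zero fun i _ => ?_)
  rw [tr_tmul_left]
  exact Form.SupportedIn.wedge_right (fun q hq => h q hq _) _ p hp Y

theorem IsCpt.bracket_left {p q : ℕ} {a : GForm M 𝔤 p} (h : a.IsCpt) (b : GForm M 𝔤 q) :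
    GForm.IsCpt (bracket a b) :=
  isCpt_of_component fun f => by rw [component_bracket]; exact h.tr_left _ _

theorem IsCpt.bracket_right {p q : ℕ} {b : GForm M 𝔤 q} (h : b.IsCpt) (a : GForm M 𝔤 p) :
    GForm.IsCpt (bracket a b) :=
  isCpt_of_component fun f => by rw [component_bracket]; exact h.tr_right _ _

end
end GForm
end
end CompactSupports
end ChernSimons

namespace ChernSimons

/-! ### The pairing of the extended theory -/

section Pairing
variable {M : Type*} [TopologicalSpace M] [ChartedSpace E3 M] [IsManifold (𝓡 3) ∞ M]
  [T2Space M] [SigmaCompactSpace M] (𝒜 : OrientedAtlas M)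
  {𝔤 : Type*} [LieRing 𝔤] [LieAlgebra ℝ 𝔤] {Tr : 𝔤 →ₗ[ℝ] 𝔤 →ₗ[ℝ] ℝ}

theorem OrientedAtlas.integral_sub {ν ν' : Form M 3} (h : ν.IsCpt) (h' : ν'.IsCpt) :
    𝒜.integral (ν - ν') = 𝒜.integral ν - 𝒜.integral ν' := by
  rw [sub_eq_add_neg, 𝒜.integral_add h h'.neg, 𝒜.integral_neg, sub_eq_add_neg]

/-- In top degree `L_ξ ν = d ι_ξ ν`, so the integral vanishes by Stokes' theorem. -/
theorem OrientedAtlas.integral_lie (ξ : VField M) {ν : Form M 3} (h : ξ.IsCpt ∨ ν.IsCpt) :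
    𝒜.integral (Form.lie ξ ν) = 0 := by
  rw [Form.lie_three_eq]
  exact 𝒜.integral_d₂ (h.elim (fun h => Form.isCpt_contr h ν) fun h => h.contr ξ)

namespace ExtSpace

/-- The element `X'` of degree `4`. -/
noncomputable def ofCovCopy (Y : CovDensity M) : ExtSpace M 𝔤 := (0, (0, 0), 0, 0, (0, 0), Y)

theorem pairing_mk (x ξ : VField M) (l : GForm M 𝔤 0) (A : GForm M 𝔤 1) (E : GForm M 𝔤 2)
    (X Y : CovDensity M) (L : GForm M 𝔤 3) (w : ExtSpace M 𝔤) :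
    pairing 𝒜 Tr (x, (ξ, l), A, E, (X, L), Y) w =
      𝒜.integral (w.covCopy x) + 𝒜.integral (Y w.vecCopy) +
      𝒜.integral (w.cov ξ) + 𝒜.integral (X w.vec) +
      𝒜.integral (GForm.tr₀₃ Tr l w.noether) + 𝒜.integral (GForm.tr₁₂ Tr A w.eom) +
      𝒜.integral (GForm.tr Tr E w.field : Form M (2 + 1)) +
      𝒜.integral (GForm.tr Tr L w.gauge : Form M (3 + 0)) := rfl

theorem pairing_ofVecCopy (x : VField M) (w : ExtSpace M 𝔤) :
    pairing 𝒜 Tr (ofVecCopy x) w = 𝒜.integral (w.covCopy x) := by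
  refine (pairing_mk 𝒜 _ _ _ _ _ _ _ _ w).trans ?_
  simp only [map_zero, LinearMap.zero_apply, 𝒜.integral_zero, zero_add, add_zero]

theorem pairing_ofGauge (ξ : VField M) (l : GForm M 𝔤 0) (w : ExtSpace M 𝔤) :
    pairing 𝒜 Tr (ofGauge ξ l) w =
      𝒜.integral (w.cov ξ) + 𝒜.integral (GForm.tr₀₃ Tr l w.noether) := by
  refine (pairing_mk 𝒜 _ _ _ _ _ _ _ _ w).trans ?_
  simp only [map_zero, LinearMap.zero_apply, 𝒜.integral_zero, zero_add, add_zero]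

theorem pairing_ofField (A : GForm M 𝔤 1) (w : ExtSpace M 𝔤) :
    pairing 𝒜 Tr (ofField A) w = 𝒜.integral (GForm.tr₁₂ Tr A w.eom) := by
  refine (pairing_mk 𝒜 _ _ _ _ _ _ _ _ w).trans ?_
  simp only [map_zero, LinearMap.zero_apply, 𝒜.integral_zero, zero_add, add_zero]

theorem pairing_ofEom (hsymm : ∀ X Y, Tr X Y = Tr Y X) (E : GForm M 𝔤 2) (w : ExtSpace M 𝔤) :
    pairing 𝒜 Tr (ofEom E) w = 𝒜.integral (GForm.tr₁₂ Tr w.field E) := by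
  rw [← GForm.tr₂₁ hsymm]
  refine (pairing_mk 𝒜 _ _ _ _ _ _ _ _ w).trans ?_
  simp only [map_zero, LinearMap.zero_apply, 𝒜.integral_zero, zero_add, add_zero]

theorem pairing_ofNoether (hsymm : ∀ X Y, Tr X Y = Tr Y X) (X : CovDensity M) (L : GForm M 𝔤 3)
    (w : ExtSpace M 𝔤) : pairing 𝒜 Tr (ofNoether X L) w =
      𝒜.integral (X w.vec) + 𝒜.integral (GForm.tr₀₃ Tr w.gauge L) := by
  rw [← GForm.tr₃₀ hsymm]
  refine (pairing_mk 𝒜 _ _ _ _ _ _ _ _ w).trans ?_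
  simp only [map_zero, LinearMap.zero_apply, 𝒜.integral_zero, zero_add, add_zero]

theorem pairing_ofCovCopy (Y : CovDensity M) (w : ExtSpace M 𝔤) :
    pairing 𝒜 Tr (ofCovCopy Y) w = 𝒜.integral (Y w.vecCopy) := by
  refine (pairing_mk 𝒜 _ _ _ _ _ _ _ _ w).trans ?_
  simp only [map_zero, LinearMap.zero_apply, 𝒜.integral_zero, zero_add, add_zero]

theorem pairing_smul_left (c : ℝ) (u w : ExtSpace M 𝔤) :
    pairing 𝒜 Tr (c • u) w = c * pairing 𝒜 Tr u w := by
  have h : ∀ (X : CovDensity M) (ξ : VField M), X (c • ξ) = c • X ξ := fun X ξ => by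
    rw [VField.const_smul, map_smul, Form.const_smul]
  change 𝒜.integral (w.covCopy (c • u.vecCopy)) + 𝒜.integral (c • u.covCopy w.vecCopy) +
    𝒜.integral (w.cov (c • u.vec)) + 𝒜.integral (c • u.cov w.vec) +
    𝒜.integral (GForm.tr Tr (c • u.gauge) w.noether : Form M (0 + 3)) +
    𝒜.integral (GForm.tr Tr (c • u.field) w.eom : Form M (1 + 2)) +
    𝒜.integral (GForm.tr Tr (c • u.eom) w.field : Form M (2 + 1)) +
    𝒜.integral (GForm.tr Tr (c • u.noether) w.gauge : Form M (3 + 0)) = _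
  simp only [h, map_smul, LinearMap.smul_apply, 𝒜.integral_smul, pairing]
  ring

/-- All pairs of complementary degrees contain an even degree, so graded symmetry is symmetry. -/
theorem pairing_comm (hsymm : ∀ X Y, Tr X Y = Tr Y X) (u w : ExtSpace M 𝔤) :
    pairing 𝒜 Tr u w = pairing 𝒜 Tr w u := by
  unfold pairing
  rw [GForm.tr₂₁ hsymm, GForm.tr₂₁ hsymm, GForm.tr₃₀ hsymm, GForm.tr₃₀ hsymm]
  change _ + 𝒜.integral (GForm.tr₀₃ Tr u.gauge w.noether) +
    𝒜.integral (GForm.tr₁₂ Tr u.field w.eom) + _ + _ = _ +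
    𝒜.integral (GForm.tr₀₃ Tr w.gauge u.noether) +
    𝒜.integral (GForm.tr₁₂ Tr w.field u.eom) + _ + _
  ring

variable [FiniteDimensional ℝ 𝔤]

theorem isCpt_pairing_terms (Tr : 𝔤 →ₗ[ℝ] 𝔤 →ₗ[ℝ] ℝ) {u w : ExtSpace M 𝔤}
    (h : IsCpt u ∨ IsCpt w) :
    ((w.covCopy u.vecCopy).IsCpt ∧ (u.covCopy w.vecCopy).IsCpt ∧ (w.cov u.vec).IsCpt ∧
      (u.cov w.vec).IsCpt) ∧ (GForm.tr Tr u.gauge w.noether).IsCpt ∧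
      (GForm.tr Tr u.field w.eom).IsCpt ∧ (GForm.tr Tr u.eom w.field).IsCpt ∧
      (GForm.tr Tr u.noether w.gauge).IsCpt := by
  obtain ⟨h1, h2, h3, h4, h5, h6, h7, h8⟩ | ⟨h1, h2, h3, h4, h5, h6, h7, h8⟩ := h
  · exact ⟨⟨w.covCopy.isCpt_apply h1, h8.apply _, w.cov.isCpt_apply h2, h6.apply _⟩,
      h3.tr_left _ _, h4.tr_left _ _, h5.tr_left _ _, h7.tr_left _ _⟩
  · exact ⟨⟨h8.apply _, u.covCopy.isCpt_apply h1, h6.apply _, u.cov.isCpt_apply h2⟩,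
      h7.tr_right _ _, h5.tr_right _ _, h4.tr_right _ _, h3.tr_right _ _⟩

theorem pairing_add_left {u v w : ExtSpace M 𝔤} (h : (IsCpt u ∧ IsCpt v) ∨ IsCpt w) :
    pairing 𝒜 Tr (u + v) w = pairing 𝒜 Tr u w + pairing 𝒜 Tr v w := by
  obtain ⟨⟨a1, a2, a3, a4⟩, a5, a6, a7, a8⟩ := isCpt_pairing_terms Tr (h.imp_left And.left)
  obtain ⟨⟨b1, b2, b3, b4⟩, b5, b6, b7, b8⟩ := isCpt_pairing_terms Tr (h.imp_left And.right)
  have e1 := (congrArg 𝒜.integral (map_add w.covCopy _ _)).trans (𝒜.integral_add a1 b1)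
  have e2 := 𝒜.integral_add a2 b2
  have e3 := (congrArg 𝒜.integral (map_add w.cov _ _)).trans (𝒜.integral_add a3 b3)
  have e4 := 𝒜.integral_add a4 b4
  have e5 : 𝒜.integral (GForm.tr Tr (u.gauge + v.gauge) w.noether : Form M (0 + 3)) = _ :=
    (congrArg 𝒜.integral (LinearMap.map_add₂ (GForm.tr Tr) _ _ _)).trans (𝒜.integral_add a5 b5)
  have e6 : 𝒜.integral (GForm.tr Tr (u.field + v.field) w.eom : Form M (1 + 2)) = _ :=
    (congrArg 𝒜.integral (LinearMap.map_add₂ (GForm.tr Tr) _ _ _)).trans (𝒜.integral_add a6 b6)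
  have e7 : 𝒜.integral (GForm.tr Tr (u.eom + v.eom) w.field : Form M (2 + 1)) = _ :=
    (congrArg 𝒜.integral (LinearMap.map_add₂ (GForm.tr Tr) _ _ _)).trans (𝒜.integral_add a7 b7)
  have e8 : 𝒜.integral (GForm.tr Tr (u.noether + v.noether) w.gauge : Form M (3 + 0)) = _ :=
    (congrArg 𝒜.integral (LinearMap.map_add₂ (GForm.tr Tr) _ _ _)).trans (𝒜.integral_add a8 b8)
  refine (congrArg₂ (· + ·) (congrArg₂ (· + ·) (congrArg₂ (· + ·) (congrArg₂ (· + ·)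
    (congrArg₂ (· + ·) (congrArg₂ (· + ·) (congrArg₂ (· + ·) e1 e2) e3) e4) e5) e6) e7) e8).trans ?_
  simp only [pairing]
  ring

end ExtSpace
end Pairing
end ChernSimons

namespace ChernSimons

/-! ### Integration by parts -/

section IntegrationByParts
variable {M : Type*} [TopologicalSpace M] [ChartedSpace E3 M] [IsManifold (𝓡 3) ∞ M]
  [T2Space M] [SigmaCompactSpace M] (𝒜 : OrientedAtlas M)
  {𝔤 : Type*} [LieRing 𝔤] [LieAlgebra ℝ 𝔤] [FiniteDimensional ℝ 𝔤] {Tr : 𝔤 →ₗ[ℝ] 𝔤 →ₗ[ℝ] ℝ}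
namespace OrientedAtlas

theorem integral_lie_covDensity {x ξ : VField M} {Y : CovDensity M}
    (h : x.IsCpt ∨ ξ.IsCpt ∨ Y.IsCpt) :
    𝒜.integral (CovDensity.lie ξ Y x) = 𝒜.integral (Y (x.bracket ξ)) := by
  have h1 : ξ.IsCpt ∨ (Y x).IsCpt := by
    rcases h with h | h | h
    exacts [.inr (Y.isCpt_apply h), .inl h, .inr (h.apply x)]
  have h2 : (Form.lie ξ (Y x)).IsCpt := h1.elim (fun h => Form.isCpt_lie h _) fun h => h.lie ξ
  have h3 : (Y (ξ.bracket x)).IsCpt := by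
    rcases h with h | h | h
    exacts [Y.isCpt_apply (h.bracket_left ξ), Y.isCpt_apply (h.bracket_right x), h.apply _]
  change 𝒜.integral (Form.lie ξ (Y x) - Y (ξ.bracket x)) = _
  rw [𝒜.integral_sub h2 h3, 𝒜.integral_lie ξ h1, VField.bracket_swap x ξ, map_neg,
    𝒜.integral_neg, zero_sub]

theorem integral_tr₀₃_lie {ξ : VField M} {l : GForm M 𝔤 0} {L : GForm M 𝔤 3}
    (h : ξ.IsCpt ∨ l.IsCpt ∨ L.IsCpt) : 𝒜.integral (GForm.tr₀₃ Tr l (GForm.lie ξ L)) =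
      -𝒜.integral (GForm.tr₀₃ Tr (GForm.lie ξ l) L) := by
  have h1 : ξ.IsCpt ∨ (GForm.tr₀₃ Tr l L).IsCpt := by
    rcases h with h | h | h
    exacts [.inl h, .inr (h.tr_left _ _), .inr (h.tr_right _ _)]
  have h2 : (GForm.tr₀₃ Tr l (GForm.lie ξ L)).IsCpt := by
    rcases h with h | h | h
    exacts [(GForm.isCpt_lie h L).tr_right _ _, h.tr_left _ _, (h.lie ξ).tr_right _ _]
  have h3 : (GForm.tr₀₃ Tr (GForm.lie ξ l) L).IsCpt := by
    rcases h with h | h | h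
    exacts [(GForm.isCpt_lie h l).tr_left _ _, (h.lie ξ).tr_left _ _, h.tr_right _ _]
  have h4 := 𝒜.integral_lie ξ h1
  rw [GForm.lie_tr₀₃, 𝒜.integral_add h3 h2] at h4
  linarith

theorem integral_tr₁₂_lie {ξ : VField M} {A : GForm M 𝔤 1} {E : GForm M 𝔤 2}
    (h : ξ.IsCpt ∨ A.IsCpt ∨ E.IsCpt) : 𝒜.integral (GForm.tr₁₂ Tr A (GForm.lie ξ E)) =
      -𝒜.integral (GForm.tr₁₂ Tr (GForm.lie ξ A) E) := by
  have h1 : ξ.IsCpt ∨ (GForm.tr₁₂ Tr A E).IsCpt := by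
    rcases h with h | h | h
    exacts [.inl h, .inr (h.tr_left _ _), .inr (h.tr_right _ _)]
  have h2 : (GForm.tr₁₂ Tr A (GForm.lie ξ E)).IsCpt := by
    rcases h with h | h | h
    exacts [(GForm.isCpt_lie h E).tr_right _ _, h.tr_left _ _, (h.lie ξ).tr_right _ _]
  have h3 : (GForm.tr₁₂ Tr (GForm.lie ξ A) E).IsCpt := by
    rcases h with h | h | h
    exacts [(GForm.isCpt_lie h A).tr_left _ _, (h.lie ξ).tr_left _ _, h.tr_right _ _]
  have h4 := 𝒜.integral_lie ξ h1
  rw [GForm.lie_tr₁₂, 𝒜.integral_add h3 h2] at h4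
  linarith

theorem integral_tr₀₃_d₂ {l : GForm M 𝔤 0} {E : GForm M 𝔤 2} (h : l.IsCpt ∨ E.IsCpt) :
    𝒜.integral (GForm.tr₀₃ Tr l (GForm.d₂ E)) = -𝒜.integral (GForm.tr₁₂ Tr (GForm.d₀ l) E) := by
  have h1 : (GForm.tr₀₂ Tr l E).IsCpt := h.elim (·.tr_left _ _) (·.tr_right _ _)
  have h2 : (GForm.tr₀₃ Tr l (GForm.d₂ E)).IsCpt := h.elim (·.tr_left _ _) (·.d₂.tr_right _ _)
  have h3 : (GForm.tr₁₂ Tr (GForm.d₀ l) E).IsCpt := h.elim (·.d₀.tr_left _ _) (·.tr_right _ _)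
  have h4 := 𝒜.integral_d₂ h1
  rw [GForm.d₂_tr₀₂, 𝒜.integral_add h3 h2] at h4
  linarith

theorem integral_tr₁₂_d₁ (hsymm : ∀ X Y, Tr X Y = Tr Y X) {A B : GForm M 𝔤 1}
    (h : A.IsCpt ∨ B.IsCpt) : 𝒜.integral (GForm.tr₁₂ Tr A (GForm.d₁ B)) =
      𝒜.integral (GForm.tr₁₂ Tr B (GForm.d₁ A)) := by
  have h1 : (GForm.tr₁₁ Tr A B).IsCpt := h.elim (·.tr_left _ _) (·.tr_right _ _)
  have h2 : (GForm.tr₁₂ Tr A (GForm.d₁ B)).IsCpt := h.elim (·.tr_left _ _) (·.d₁.tr_right _ _)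
  have h3 : (GForm.tr₁₂ Tr B (GForm.d₁ A)).IsCpt := h.elim (·.d₁.tr_right _ _) (·.tr_left _ _)
  have h4 := 𝒜.integral_d₂ h1
  rw [GForm.d₂_tr₁₁ hsymm, 𝒜.integral_sub h3 h2] at h4
  linarith

end OrientedAtlas
namespace GForm

theorem isCpt_br₀₃ {a : GForm M 𝔤 0} {b : GForm M 𝔤 3} (h : a.IsCpt ∨ b.IsCpt) :
    GForm.IsCpt (br₀₃ a b) := h.elim (fun h => h.bracket_left b) fun h => h.bracket_right a

theorem isCpt_br₁₂ {a : GForm M 𝔤 1} {b : GForm M 𝔤 2} (h : a.IsCpt ∨ b.IsCpt) :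
    GForm.IsCpt (br₁₂ a b) := h.elim (fun h => h.bracket_left b) fun h => h.bracket_right a

end GForm
namespace OrientedAtlas

/-- The integrated form of cyclicity for gauge parameters `(ξ, l)`, `(ξ', l')` and Noether
identities `(X, L)`: the terms with `X` and with `L` are integrated by parts separately. -/
theorem integral_gauge_gauge_noether {ξ ξ' : VField M} {l l' : GForm M 𝔤 0}
    {X : CovDensity M} {L : GForm M 𝔤 3} (hinv : ∀ X Y Z, Tr ⁅X, Y⁆ Z = Tr X ⁅Y, Z⁆)
    (h : (ξ.IsCpt ∧ l.IsCpt) ∨ (ξ'.IsCpt ∧ l'.IsCpt) ∨ (X.IsCpt ∧ L.IsCpt)) :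
    𝒜.integral (GForm.tr₀₃ Tr (GForm.contr ξ (GForm.d₀ l')) L + CovDensity.lie ξ' X ξ) +
    𝒜.integral (GForm.tr₀₃ Tr l (GForm.lie ξ' L - GForm.br₀₃ l' L)) =
      𝒜.integral (X (ξ.bracket ξ')) + 𝒜.integral (GForm.tr₀₃ Tr
        (GForm.lie ξ l' - GForm.lie ξ' l - GForm.br₀₀ l l') L) := by
  have f1 : GForm.tr₀₃ Tr l (GForm.lie ξ' L - GForm.br₀₃ l' L) =
      GForm.tr₀₃ Tr l (GForm.lie ξ' L) - GForm.tr₀₃ Tr l (GForm.br₀₃ l' L) :=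
    map_sub (GForm.tr₀₃ Tr l) (GForm.lie ξ' L) (GForm.br₀₃ l' L)
  rw [f1, GForm.tr₀₃_sub_left, GForm.tr₀₃_sub_left, GForm.tr₀₃_br₀₀ hinv, ← GForm.lie_zero_eq]
  have c1 : (GForm.tr₀₃ Tr (GForm.lie ξ l') L).IsCpt := by
    rcases h with h | h | h
    exacts [(GForm.isCpt_lie h.1 _).tr_left _ _, (h.2.lie _).tr_left _ _, h.2.tr_right _ _]
  have c2 : (CovDensity.lie ξ' X ξ).IsCpt := by
    rcases h with h | h | h
    · exact CovDensity.isCpt_apply _ h.1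
    · exact (Form.isCpt_lie h.1 _).sub (X.isCpt_apply (h.1.bracket_right _))
    · exact ((h.1.apply _).lie _).sub (h.1.apply _)
  have c3 : (GForm.tr₀₃ Tr l (GForm.lie ξ' L)).IsCpt := by
    rcases h with h | h | h
    exacts [h.2.tr_left _ _, (GForm.isCpt_lie h.1 _).tr_right _ _, (h.2.lie _).tr_right _ _]
  have c4 : (GForm.tr₀₃ Tr l (GForm.br₀₃ l' L)).IsCpt := by
    rcases h with h | h | h
    exacts [h.2.tr_left _ _, (GForm.isCpt_br₀₃ (.inl h.2)).tr_right _ _,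
      (GForm.isCpt_br₀₃ (.inr h.2)).tr_right _ _]
  have c5 : (GForm.tr₀₃ Tr (GForm.lie ξ' l) L).IsCpt := by
    rcases h with h | h | h
    exacts [(h.2.lie _).tr_left _ _, (GForm.isCpt_lie h.1 _).tr_left _ _, h.2.tr_right _ _]
  have h1 : ξ.IsCpt ∨ ξ'.IsCpt ∨ X.IsCpt := h.imp And.left (Or.imp And.left And.left)
  have h2 : ξ'.IsCpt ∨ l.IsCpt ∨ L.IsCpt :=
    h.elim (fun h => .inr (.inl h.2)) (Or.imp And.left fun h => .inr h.2)
  rw [𝒜.integral_add c1 c2, 𝒜.integral_sub c3 c4, 𝒜.integral_sub (c1.sub c5) c4,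
    𝒜.integral_sub c1 c5, 𝒜.integral_lie_covDensity h1, 𝒜.integral_tr₀₃_lie h2]
  ring

set_option maxHeartbeats 800000 in
theorem integral_gauge_field_eom {ξ : VField M} {l : GForm M 𝔤 0} {A : GForm M 𝔤 1}
    {E : GForm M 𝔤 2}
    (hsymm : ∀ X Y, Tr X Y = Tr Y X) (hinv : ∀ X Y Z, Tr ⁅X, Y⁆ Z = Tr X ⁅Y, Z⁆)
    (h : (ξ.IsCpt ∧ l.IsCpt) ∨ A.IsCpt ∨ E.IsCpt) :
    𝒜.integral (GForm.tr₁₂ Tr (GForm.contr ξ (GForm.d₁ A)) E -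
      GForm.tr₀₃ Tr (GForm.contr ξ A) (GForm.d₂ E)) +
      𝒜.integral (GForm.tr₀₃ Tr l (-GForm.br₁₂ A E)) =
    𝒜.integral (GForm.tr₁₂ Tr (GForm.lie ξ A - GForm.br₀₁ l A) E) ∧
    𝒜.integral (GForm.tr₁₂ Tr (GForm.contr ξ (GForm.d₁ A)) E -
      GForm.tr₀₃ Tr (GForm.contr ξ A) (GForm.d₂ E)) +
      𝒜.integral (GForm.tr₀₃ Tr l (-GForm.br₁₂ A E)) =
    -𝒜.integral (GForm.tr₁₂ Tr A (GForm.lie ξ E - GForm.br₀₂ l E)) := by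
  have f1 : GForm.tr₁₂ Tr A (GForm.lie ξ E - GForm.br₀₂ l E) =
      GForm.tr₁₂ Tr A (GForm.lie ξ E) - GForm.tr₁₂ Tr A (GForm.br₀₂ l E) :=
    map_sub (GForm.tr₁₂ Tr A) (GForm.lie ξ E) (GForm.br₀₂ l E)
  have f2 : GForm.tr₀₃ Tr l (-GForm.br₁₂ A E) = -GForm.tr₀₃ Tr l (GForm.br₁₂ A E) :=
    map_neg (GForm.tr₀₃ Tr l) (GForm.br₁₂ A E)
  have f3 : GForm.tr₁₂ Tr (GForm.lie ξ A) E = GForm.tr₁₂ Tr (GForm.d₀ (GForm.contr ξ A)) E +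
      GForm.tr₁₂ Tr (GForm.contr ξ (GForm.d₁ A)) E := by
    rw [GForm.lie_one_eq]
    exact congrArg (fun f : GForm M 𝔤 2 →ₗ[ℝ] Form M 3 => f E)
      (map_add (GForm.tr₁₂ Tr) (GForm.d₀ (GForm.contr ξ A)) (GForm.contr ξ (GForm.d₁ A)))
  have c1 : (GForm.tr₁₂ Tr (GForm.contr ξ (GForm.d₁ A)) E).IsCpt := by
    rcases h with h | h | h
    exacts [(GForm.isCpt_contr h.1 _).tr_left _ _, (h.d₁.contr _).tr_left _ _, h.tr_right _ _]
  have c2 : (GForm.tr₀₃ Tr (GForm.contr ξ A) (GForm.d₂ E)).IsCpt := by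
    rcases h with h | h | h
    exacts [(GForm.isCpt_contr h.1 _).tr_left _ _, (h.contr _).tr_left _ _, h.d₂.tr_right _ _]
  have c3 : (GForm.tr₀₃ Tr l (GForm.br₁₂ A E)).IsCpt := by
    rcases h with h | h | h
    exacts [h.2.tr_left _ _, (GForm.isCpt_br₁₂ (.inl h)).tr_right _ _,
      (GForm.isCpt_br₁₂ (.inr h)).tr_right _ _]
  have c4 : (GForm.tr₁₂ Tr (GForm.d₀ (GForm.contr ξ A)) E).IsCpt := by
    rcases h with h | h | h
    exacts [(GForm.isCpt_contr h.1 _).d₀.tr_left _ _, (h.contr _).d₀.tr_left _ _, h.tr_right _ _]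
  have c5 : (GForm.tr₁₂ Tr A (GForm.lie ξ E)).IsCpt := by
    rcases h with h | h | h
    exacts [(GForm.isCpt_lie h.1 _).tr_right _ _, h.tr_left _ _, (h.lie _).tr_right _ _]
  have h1 : (GForm.contr ξ A).IsCpt ∨ E.IsCpt := by
    rcases h with h | h | h
    exacts [.inl (GForm.isCpt_contr h.1 _), .inl (h.contr _), .inr h]
  have h2 : ξ.IsCpt ∨ A.IsCpt ∨ E.IsCpt := h.imp_left And.left
  rw [f1, f2, GForm.tr₁₂_sub_left, GForm.tr₁₂_br₀₁ hinv, GForm.tr₁₂_br₀₂ hsymm hinv,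
    𝒜.integral_sub c1 c2, 𝒜.integral_sub c5 c3.neg, 𝒜.integral_tr₁₂_lie h2, f3,
    𝒜.integral_sub (c4.add c1) c3, 𝒜.integral_add c4 c1, 𝒜.integral_neg,
    𝒜.integral_tr₀₃_d₂ h1]
  constructor <;> ring

end OrientedAtlas
end IntegrationByParts

/-! ### Cyclicity on homogeneous elements -/

section Cyclicity
variable {M : Type*} [TopologicalSpace M] [ChartedSpace E3 M] [IsManifold (𝓡 3) ∞ M]
  [T2Space M] [SigmaCompactSpace M] (𝒜 : OrientedAtlas M)
  {𝔤 : Type*} [LieRing 𝔤] [LieAlgebra ℝ 𝔤] [FiniteDimensional ℝ 𝔤] {Tr : 𝔤 →ₗ[ℝ] 𝔤 →ₗ[ℝ] ℝ}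
  (hsymm : ∀ X Y, Tr X Y = Tr Y X) (hinv : ∀ X Y Z, Tr ⁅X, Y⁆ Z = Tr X ⁅Y, Z⁆)

namespace ExtSpace

theorem pairing_ofVecCopy_ofGauge_ofCovCopy {x ξ : VField M} {l : GForm M 𝔤 0} {Y : CovDensity M}
    (hsymm : ∀ X Y, Tr X Y = Tr Y X) (hinv : ∀ X Y Z, Tr ⁅X, Y⁆ Z = Tr X ⁅Y, Z⁆)
    (h : x.IsCpt ∨ ξ.IsCpt ∨ Y.IsCpt) :
    pairing 𝒜 Tr (ofVecCopy x) (bracket₂ Tr (ofGauge ξ l) (ofCovCopy Y)) =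
        pairing 𝒜 Tr (ofCovCopy Y) (bracket₂ Tr (ofVecCopy x) (ofGauge ξ l)) ∧
      pairing 𝒜 Tr (ofVecCopy x) (bracket₂ Tr (ofGauge ξ l) (ofCovCopy Y)) =
        -pairing 𝒜 Tr (ofGauge ξ l) (bracket₂ Tr (ofVecCopy x) (ofCovCopy Y)) := by
  have e1 : bracket₂ Tr (ofGauge ξ l) (ofCovCopy Y) = ofCovCopy (CovDensity.lie ξ Y) :=
    (bracket₂_eq hsymm hinv _ _).trans (CartanData.b₂_ofG_ofC _ ξ l Y)
  have e2 : bracket₂ Tr (ofVecCopy x) (ofGauge ξ l) = ofVecCopy (x.bracket ξ) :=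
    (bracket₂_eq hsymm hinv _ _).trans (CartanData.b₂_ofV_ofG _ x ξ l)
  have e3 : bracket₂ Tr (ofVecCopy x) (ofCovCopy Y) = ofNoether (CovDensity.lie x Y) 0 :=
    (bracket₂_eq hsymm hinv _ _).trans (CartanData.b₂_ofV_ofC _ x Y)
  rw [e1, e2, e3, pairing_ofVecCopy, pairing_ofCovCopy, pairing_ofGauge]
  change 𝒜.integral (CovDensity.lie ξ Y x) = 𝒜.integral (Y (x.bracket ξ)) ∧
    𝒜.integral (CovDensity.lie ξ Y x) =
      -(𝒜.integral (CovDensity.lie x Y ξ) + 𝒜.integral (GForm.tr₀₃ Tr l 0))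
  have h' : ξ.IsCpt ∨ x.IsCpt ∨ Y.IsCpt := by tauto
  rw [𝒜.integral_lie_covDensity h, 𝒜.integral_lie_covDensity h', map_zero, 𝒜.integral_zero,
    VField.bracket_swap ξ x, map_neg, 𝒜.integral_neg]
  exact ⟨rfl, by ring⟩

theorem pairing_ofVecCopy_ofField_ofNoether {x : VField M} {A : GForm M 𝔤 1} {X : CovDensity M}
    {L : GForm M 𝔤 3}
    (hsymm : ∀ X Y, Tr X Y = Tr Y X) (hinv : ∀ X Y Z, Tr ⁅X, Y⁆ Z = Tr X ⁅Y, Z⁆) :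
    pairing 𝒜 Tr (ofVecCopy x) (bracket₂ Tr (ofField A) (ofNoether X L)) =
        pairing 𝒜 Tr (ofNoether X L) (bracket₂ Tr (ofVecCopy x) (ofField A)) ∧
      pairing 𝒜 Tr (ofVecCopy x) (bracket₂ Tr (ofField A) (ofNoether X L)) =
        pairing 𝒜 Tr (ofField A) (bracket₂ Tr (ofVecCopy x) (ofNoether X L)) := by
  have e1 : bracket₂ Tr (ofField A) (ofNoether X L) = ofCovCopy (GForm.cov₁₃ Tr A L) :=
    (bracket₂_eq hsymm hinv _ _).trans (CartanData.b₂_ofA_ofN _ A X L)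
  have e2 : bracket₂ Tr (ofVecCopy x) (ofField A) = ofGauge 0 (GForm.contr x A) :=
    (bracket₂_eq hsymm hinv _ _).trans (CartanData.b₂_ofV_ofA _ x A)
  have e3 : bracket₂ Tr (ofVecCopy x) (ofNoether X L) = ofEom (GForm.contr x L) :=
    (bracket₂_eq hsymm hinv _ _).trans (CartanData.b₂_ofV_ofN _ x X L)
  rw [e1, e2, e3, pairing_ofVecCopy, pairing_ofNoether 𝒜 hsymm, pairing_ofField]
  change 𝒜.integral (GForm.tr₀₃ Tr (GForm.contr x A) L) =
    𝒜.integral (X 0) + 𝒜.integral (GForm.tr₀₃ Tr (GForm.contr x A) L) ∧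
    𝒜.integral (GForm.tr₀₃ Tr (GForm.contr x A) L) =
      𝒜.integral (GForm.tr₁₂ Tr A (GForm.contr x L))
  rw [map_zero, 𝒜.integral_zero]
  exact ⟨(zero_add _).symm, congrArg 𝒜.integral (GForm.tr₀₃_contr Tr x A L)⟩

theorem pairing_ofVecCopy_ofEom_ofEom {x : VField M} {E E' : GForm M 𝔤 2}
    (hsymm : ∀ X Y, Tr X Y = Tr Y X) (hinv : ∀ X Y Z, Tr ⁅X, Y⁆ Z = Tr X ⁅Y, Z⁆) :
    pairing 𝒜 Tr (ofVecCopy x) (bracket₂ Tr (ofEom E) (ofEom E')) =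
        pairing 𝒜 Tr (ofEom E') (bracket₂ Tr (ofVecCopy x) (ofEom E)) ∧
      pairing 𝒜 Tr (ofVecCopy x) (bracket₂ Tr (ofEom E) (ofEom E')) =
        -pairing 𝒜 Tr (ofEom E) (bracket₂ Tr (ofVecCopy x) (ofEom E')) := by
  have e1 : bracket₂ Tr (ofEom E) (ofEom E') = ofCovCopy (GForm.cov₂₂ Tr E E') :=
    (bracket₂_eq hsymm hinv _ _).trans (CartanData.b₂_ofE_ofE _ E E')
  have e2 : ∀ E : GForm M 𝔤 2, bracket₂ Tr (ofVecCopy x) (ofEom E) = ofField (GForm.contr x E) :=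
    fun E => (bracket₂_eq hsymm hinv _ _).trans (CartanData.b₂_ofV_ofE _ x E)
  rw [e1, e2, e2, pairing_ofVecCopy, pairing_ofEom 𝒜 hsymm, pairing_ofEom 𝒜 hsymm]
  change 𝒜.integral (GForm.tr₁₂ Tr (GForm.contr x E) E') =
    𝒜.integral (GForm.tr₁₂ Tr (GForm.contr x E) E') ∧
    𝒜.integral (GForm.tr₁₂ Tr (GForm.contr x E) E') =
      -𝒜.integral (GForm.tr₁₂ Tr (GForm.contr x E') E)
  rw [← 𝒜.integral_neg, GForm.tr₁₂_contr hsymm x E E']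
  exact ⟨rfl, rfl⟩

theorem pairing_ofGauge_ofGauge_ofNoether {ξ ξ' : VField M} {l l' : GForm M 𝔤 0}
    {X : CovDensity M} {L : GForm M 𝔤 3}
    (hsymm : ∀ X Y, Tr X Y = Tr Y X) (hinv : ∀ X Y Z, Tr ⁅X, Y⁆ Z = Tr X ⁅Y, Z⁆)
    (h : (ξ.IsCpt ∧ l.IsCpt) ∨ (ξ'.IsCpt ∧ l'.IsCpt) ∨ (X.IsCpt ∧ L.IsCpt)) :
    pairing 𝒜 Tr (ofGauge ξ l) (bracket₂ Tr (ofGauge ξ' l') (ofNoether X L)) =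
        pairing 𝒜 Tr (ofNoether X L) (bracket₂ Tr (ofGauge ξ l) (ofGauge ξ' l')) := by
  have e1 : bracket₂ Tr (ofGauge ξ' l') (ofNoether X L) =
      ofNoether (GForm.cov₁₃ Tr (GForm.d₀ l') L + CovDensity.lie ξ' X)
        (GForm.lie ξ' L - GForm.br₀₃ l' L) :=
    (bracket₂_eq hsymm hinv _ _).trans (CartanData.b₂_ofG_ofN _ ξ' l' X L)
  have e2 : bracket₂ Tr (ofGauge ξ l) (ofGauge ξ' l') = ofGauge (ξ.bracket ξ')
      (GForm.lie ξ l' - GForm.lie ξ' l - GForm.br₀₀ l l') :=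
    (bracket₂_eq hsymm hinv _ _).trans (CartanData.b₂_ofG_ofG _ ξ l ξ' l')
  rw [e1, e2, pairing_ofGauge, pairing_ofNoether 𝒜 hsymm]
  change 𝒜.integral (GForm.tr₀₃ Tr (GForm.contr ξ (GForm.d₀ l')) L + CovDensity.lie ξ' X ξ) +
    𝒜.integral (GForm.tr₀₃ Tr l (GForm.lie ξ' L - GForm.br₀₃ l' L)) =
      𝒜.integral (X (ξ.bracket ξ')) + 𝒜.integral (GForm.tr₀₃ Tr
        (GForm.lie ξ l' - GForm.lie ξ' l - GForm.br₀₀ l l') L)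
  exact 𝒜.integral_gauge_gauge_noether hinv h

theorem pairing_ofGauge_ofField_ofEom {ξ : VField M} {l : GForm M 𝔤 0} {A : GForm M 𝔤 1}
    {E : GForm M 𝔤 2}
    (hsymm : ∀ X Y, Tr X Y = Tr Y X) (hinv : ∀ X Y Z, Tr ⁅X, Y⁆ Z = Tr X ⁅Y, Z⁆)
    (h : (ξ.IsCpt ∧ l.IsCpt) ∨ A.IsCpt ∨ E.IsCpt) :
    pairing 𝒜 Tr (ofGauge ξ l) (bracket₂ Tr (ofField A) (ofEom E)) =
        pairing 𝒜 Tr (ofEom E) (bracket₂ Tr (ofGauge ξ l) (ofField A)) ∧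
      pairing 𝒜 Tr (ofGauge ξ l) (bracket₂ Tr (ofField A) (ofEom E)) =
        -pairing 𝒜 Tr (ofField A) (bracket₂ Tr (ofGauge ξ l) (ofEom E)) := by
  have e1 : bracket₂ Tr (ofField A) (ofEom E) = ofNoether
      (GForm.cov₂₂ Tr (GForm.d₁ A) E - GForm.cov₁₃ Tr A (GForm.d₂ E)) (-GForm.br₁₂ A E) :=
    (bracket₂_eq hsymm hinv _ _).trans (CartanData.b₂_ofA_ofE _ A E)
  have e2 : bracket₂ Tr (ofGauge ξ l) (ofField A) = ofField (GForm.lie ξ A - GForm.br₀₁ l A) :=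
    (bracket₂_eq hsymm hinv _ _).trans (CartanData.b₂_ofG_ofA _ ξ l A)
  have e3 : bracket₂ Tr (ofGauge ξ l) (ofEom E) = ofEom (GForm.lie ξ E - GForm.br₀₂ l E) :=
    (bracket₂_eq hsymm hinv _ _).trans (CartanData.b₂_ofG_ofE _ ξ l E)
  rw [e1, e2, e3, pairing_ofGauge, pairing_ofEom 𝒜 hsymm, pairing_ofField]
  exact 𝒜.integral_gauge_field_eom hsymm hinv h

theorem pairing_ofField_ofField_ofField {A B C : GForm M 𝔤 1}
    (hsymm : ∀ X Y, Tr X Y = Tr Y X) (hinv : ∀ X Y Z, Tr ⁅X, Y⁆ Z = Tr X ⁅Y, Z⁆) :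
    pairing 𝒜 Tr (ofField A) (bracket₂ Tr (ofField B) (ofField C)) =
        pairing 𝒜 Tr (ofField C) (bracket₂ Tr (ofField A) (ofField B)) := by
  have e1 : ∀ A B : GForm M 𝔤 1, bracket₂ Tr (ofField A) (ofField B) = ofEom (-GForm.br₁₁ A B) :=
    fun A B => (bracket₂_eq hsymm hinv _ _).trans (CartanData.b₂_ofA_ofA _ A B)
  have f1 : ∀ A B C : GForm M 𝔤 1, GForm.tr₁₂ Tr A (-GForm.br₁₁ B C) =
      -GForm.tr₁₂ Tr A (GForm.br₁₁ B C) := fun A B C =>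
    map_neg (GForm.tr₁₂ Tr A) (GForm.br₁₁ B C)
  rw [e1, e1, pairing_ofField, pairing_ofField]
  change 𝒜.integral (GForm.tr₁₂ Tr A (-GForm.br₁₁ B C)) =
    𝒜.integral (GForm.tr₁₂ Tr C (-GForm.br₁₁ A B))
  rw [f1, f1, GForm.tr₁₂_br₁₁ hsymm hinv A B C]

end ExtSpace
end Cyclicity
end ChernSimons

namespace ChernSimons

/-! ### Cyclicity of the extended theory -/

/-- A trilinear expression which is graded antisymmetric in its last two arguments is graded
cyclic as soon as it is totally graded antisymmetric on arguments of non-decreasing degree. -/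
theorem cyclic_of_sorted {V : Type*} (P : V → V → V → Prop) (H : ℤ → V → Prop)
    (c : V → V → V → ℝ) (hP : ∀ {u v w}, P u v w → P v u w ∧ P u w v)
    (hanti : ∀ {i j k u v w}, H i u → H j v → H k w → c u w v = -sgn (j * k) * c u v w)
    (hsort : ∀ {i j k u v w}, H i u → H j v → H k w → P u v w → i ≤ j → j ≤ k →
      c u v w = sgn (k * (i + j)) * c w u v ∧ c u v w = -sgn (i * j) * c v u w)
    {i j k : ℤ} {u v w : V} (hu : H i u) (hv : H j v) (hw : H k w) (h : P u v w) :
    c u v w = sgn (k * (i + j)) * c w u v := by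
  have a1 := hanti hu hv hw
  have a2 := hanti hv hu hw
  have a3 := hanti hw hu hv
  have p1 := (hP h).1
  have p2 := (hP h).2
  have p3 := (hP p1).2
  have p4 := (hP p2).1
  have p5 := (hP p3).1
  have key : (c u v w = sgn (k * (i + j)) * c w u v ∧ c u v w = -sgn (i * j) * c v u w) ∨
      (c v u w = sgn (k * (j + i)) * c w v u ∧ c v u w = -sgn (j * i) * c u v w) ∨
      (c u w v = sgn (j * (i + k)) * c v u w ∧ c u w v = -sgn (i * k) * c w u v) ∨
      (c w u v = sgn (j * (k + i)) * c v w u ∧ c w u v = -sgn (k * i) * c u w v) ∨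
      (c v w u = sgn (i * (j + k)) * c u v w ∧ c v w u = -sgn (j * k) * c w v u) ∨
      (c w v u = sgn (i * (k + j)) * c u w v ∧ c w v u = -sgn (k * j) * c v w u) := by
    rcases le_total i j with h1 | h1 <;> rcases le_total j k with h2 | h2 <;>
      rcases le_total i k with h3 | h3
    · exact .inl (hsort hu hv hw h h1 h2)
    · exact .inl (hsort hu hv hw h h1 h2)
    · exact .inr (.inr (.inl (hsort hu hw hv p2 h3 h2)))
    · exact .inr (.inr (.inr (.inl (hsort hw hu hv p4 h3 h1))))
    · exact .inr (.inl (hsort hv hu hw p1 h1 h3))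
    · exact .inr (.inr (.inr (.inr (.inl (hsort hv hw hu p3 h2 h3)))))
    · exact .inr (.inr (.inr (.inr (.inr (hsort hw hv hu p5 h2 h1)))))
    · exact .inr (.inr (.inr (.inr (.inr (hsort hw hv hu p5 h2 h1)))))
  generalize c u v w = x1 at *
  generalize c u w v = x2 at *
  generalize c v u w = x3 at *
  generalize c v w u = x4 at *
  generalize c w u v = x5 at *
  generalize c w v u = x6 at *
  by_cases hi : Even i <;> by_cases hj : Even j <;> by_cases hk : Even k <;>
    simp only [sgn, Int.even_mul, Int.even_add, hi, hj, hk, or_true, or_self, iff_self,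
      if_true, if_false, iff_false, iff_true, not_true_eq_false, or_false] at key a1 a2 a3 ⊢ <;>
    rcases key with ⟨h1, h2⟩ | ⟨h1, h2⟩ | ⟨h1, h2⟩ | ⟨h1, h2⟩ | ⟨h1, h2⟩ | ⟨h1, h2⟩ <;> linarith

section CyclicPairing
variable {M : Type*} [TopologicalSpace M] [ChartedSpace E3 M] [IsManifold (𝓡 3) ∞ M]
  [T2Space M] [SigmaCompactSpace M] (𝒜 : OrientedAtlas M)
  {𝔤 : Type*} [LieRing 𝔤] [LieAlgebra ℝ 𝔤] [FiniteDimensional ℝ 𝔤] {Tr : 𝔤 →ₗ[ℝ] 𝔤 →ₗ[ℝ] ℝ}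
namespace ExtSpace

theorem pairing_zero_left (w : ExtSpace M 𝔤) : pairing 𝒜 Tr 0 w = 0 := by
  have h := pairing_smul_left 𝒜 (Tr := Tr) (0 : ℝ) 0 w
  rwa [show (0 : ℝ) • (0 : ExtSpace M 𝔤) = 0 from smul_zero _, zero_mul] at h

theorem pairing_zero_right (hsymm : ∀ X Y, Tr X Y = Tr Y X) (w : ExtSpace M 𝔤) :
    pairing 𝒜 Tr w 0 = 0 := by
  rw [pairing_comm 𝒜 hsymm, pairing_zero_left]

theorem pairing_smul_right (hsymm : ∀ X Y, Tr X Y = Tr Y X) (c : ℝ) (u w : ExtSpace M 𝔤) :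
    pairing 𝒜 Tr u (c • w) = c * pairing 𝒜 Tr u w := by
  rw [pairing_comm 𝒜 hsymm, pairing_smul_left, pairing_comm 𝒜 hsymm]

/-- The pairing has degree `-3`. -/
theorem pairing_eq_zero {i j : ℤ} (hij : i + j ≠ 3) {u w : ExtSpace M 𝔤} (hu : u ∈ degree M 𝔤 i)
    (hw : w ∈ degree M 𝔤 j) : pairing 𝒜 Tr u w = 0 := by
  obtain ⟨a1, a2, a3, a4, a5, a6⟩ := hu
  obtain ⟨b1, b2, b3, b4, b5, b6⟩ := hw
  have f1 : 𝒜.integral (w.covCopy u.vecCopy) = 0 := by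
    by_cases h : i = -1
    · rw [b6 (by omega), LinearMap.zero_apply, 𝒜.integral_zero]
    · rw [a1 h, map_zero, 𝒜.integral_zero]
  have f2 : 𝒜.integral (u.covCopy w.vecCopy) = 0 := by
    by_cases h : j = -1
    · rw [a6 (by omega), LinearMap.zero_apply, 𝒜.integral_zero]
    · rw [b1 h, map_zero, 𝒜.integral_zero]
  have f3 : 𝒜.integral (w.cov u.vec) = 0 := by
    by_cases h : i = 0
    · rw [(b5 (by omega)).1, LinearMap.zero_apply, 𝒜.integral_zero]
    · rw [(a2 h).1, map_zero, 𝒜.integral_zero]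
  have f4 : 𝒜.integral (u.cov w.vec) = 0 := by
    by_cases h : j = 0
    · rw [(a5 (by omega)).1, LinearMap.zero_apply, 𝒜.integral_zero]
    · rw [(b2 h).1, map_zero, 𝒜.integral_zero]
  have f5 : 𝒜.integral (GForm.tr Tr u.gauge w.noether : Form M (0 + 3)) = 0 := by
    by_cases h : i = 0
    · rw [(b5 (by omega)).2, map_zero]; exact 𝒜.integral_zero
    · rw [(a2 h).2, map_zero, LinearMap.zero_apply]; exact 𝒜.integral_zero
  have f6 : 𝒜.integral (GForm.tr Tr u.field w.eom : Form M (1 + 2)) = 0 := by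
    by_cases h : i = 1
    · rw [b4 (by omega), map_zero]; exact 𝒜.integral_zero
    · rw [a3 h, map_zero, LinearMap.zero_apply]; exact 𝒜.integral_zero
  have f7 : 𝒜.integral (GForm.tr Tr u.eom w.field : Form M (2 + 1)) = 0 := by
    by_cases h : i = 2
    · rw [b3 (by omega), map_zero]; exact 𝒜.integral_zero
    · rw [a4 h, map_zero, LinearMap.zero_apply]; exact 𝒜.integral_zero
  have f8 : 𝒜.integral (GForm.tr Tr u.noether w.gauge : Form M (3 + 0)) = 0 := by
    by_cases h : j = 0
    · rw [(a5 (by omega)).2, map_zero, LinearMap.zero_apply]; exact 𝒜.integral_zero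
    · rw [(b2 h).2, map_zero]; exact 𝒜.integral_zero
  unfold pairing
  rw [f1, f2, f3, f4, f5, f6, f7, f8]
  norm_num

theorem exists_of_mem_degree {k : ℤ} {u : ExtSpace M 𝔤} (hu : u ∈ degree M 𝔤 k) (h : u ≠ 0) :
    (k = -1 ∧ ∃ x, u = ofVecCopy x) ∨ (k = 0 ∧ ∃ ξ l, u = ofGauge ξ l) ∨
      (k = 1 ∧ ∃ A, u = ofField A) ∨ (k = 2 ∧ ∃ E, u = ofEom E) ∨
      (k = 3 ∧ ∃ X L, u = ofNoether X L) ∨ (k = 4 ∧ ∃ Y, u = ofCovCopy Y) := by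
  cases homogeneous_of_mem hu with
  | zero => exact absurd rfl h
  | ofV x => exact .inl ⟨rfl, x, rfl⟩
  | ofG ξ l => exact .inr (.inl ⟨rfl, ξ, l, rfl⟩)
  | ofA A => exact .inr (.inr (.inl ⟨rfl, A, rfl⟩))
  | ofE E => exact .inr (.inr (.inr (.inl ⟨rfl, E, rfl⟩)))
  | ofN X L => exact .inr (.inr (.inr (.inr (.inl ⟨rfl, X, L, rfl⟩))))
  | ofC Y => exact .inr (.inr (.inr (.inr (.inr ⟨rfl, Y, rfl⟩))))

theorem bracket₁_mem (hsymm : ∀ X Y, Tr X Y = Tr Y X) (hinv : ∀ X Y Z, Tr ⁅X, Y⁆ Z = Tr X ⁅Y, Z⁆)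
    {i : ℤ} {u : ExtSpace M 𝔤} (hu : u ∈ degree M 𝔤 i) : bracket₁ u ∈ degree M 𝔤 (1 + i) :=
  mem_of_homogeneous ((cartanData (M := M) hsymm hinv).homogeneous_b₁ (homogeneous_of_mem hu))

theorem bracket₂_mem (hsymm : ∀ X Y, Tr X Y = Tr Y X) (hinv : ∀ X Y Z, Tr ⁅X, Y⁆ Z = Tr X ⁅Y, Z⁆)
    {i j : ℤ} {u v : ExtSpace M 𝔤} (hu : u ∈ degree M 𝔤 i) (hv : v ∈ degree M 𝔤 j) :
    bracket₂ Tr u v ∈ degree M 𝔤 (i + j) :=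
  mem_of_homogeneous ((cartanData (M := M) hsymm hinv).homogeneous_b₂ (homogeneous_of_mem hu)
    (homogeneous_of_mem hv))

/-- The differential is graded symmetric for the pairing: this is Stokes' theorem together with
the Leibniz rule. -/
theorem pairing_bracket₁ (hsymm : ∀ X Y, Tr X Y = Tr Y X)
    (hinv : ∀ X Y Z, Tr ⁅X, Y⁆ Z = Tr X ⁅Y, Z⁆) {i j : ℤ} {u v : ExtSpace M 𝔤}
    (hu : u ∈ degree M 𝔤 i) (hv : v ∈ degree M 𝔤 j) (h : IsCpt u ∨ IsCpt v) :
    pairing 𝒜 Tr u (bracket₁ v) = sgn (1 + (i + j) + j * i) * pairing 𝒜 Tr v (bracket₁ u) := by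
  by_cases hij : i + j = 2
  swap
  · rw [pairing_eq_zero 𝒜 (by omega) hu (bracket₁_mem hsymm hinv hv),
      pairing_eq_zero 𝒜 (by omega) hv (bracket₁_mem hsymm hinv hu), mul_zero]
  have b0 : bracket₁ (0 : ExtSpace M 𝔤) = 0 :=
    (cartanData (M := M) hsymm hinv).b₁_zero
  by_cases hu0 : u = 0
  · rw [hu0, b0, pairing_zero_left, pairing_zero_right 𝒜 hsymm, mul_zero]
  by_cases hv0 : v = 0
  · rw [hv0, b0, pairing_zero_left, pairing_zero_right 𝒜 hsymm, mul_zero]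
  have e₁ : ∀ x, bracket₁ (ofVecCopy x) = ofGauge x (0 : GForm M 𝔤 0) :=
    (cartanData (M := M) hsymm hinv).b₁_ofV
  have e₂ : ∀ ξ (l : GForm M 𝔤 0), bracket₁ (ofGauge ξ l) = ofField (GForm.d₀ l) :=
    (cartanData (M := M) hsymm hinv).b₁_ofG
  have e₃ : ∀ A : GForm M 𝔤 1, bracket₁ (ofField A) = ofEom (GForm.d₁ A) :=
    (cartanData (M := M) hsymm hinv).b₁_ofA
  have e₄ : ∀ E : GForm M 𝔤 2, bracket₁ (ofEom E) = ofNoether 0 (GForm.d₂ E) :=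
    (cartanData (M := M) hsymm hinv).b₁_ofE
  have e₅ : ∀ X (L : GForm M 𝔤 3), bracket₁ (ofNoether X L) = ofCovCopy X :=
    (cartanData (M := M) hsymm hinv).b₁_ofN
  have f₁ : ∀ x X (L : GForm M 𝔤 3), pairing 𝒜 Tr (ofVecCopy x) (bracket₁ (ofNoether X L)) =
      pairing 𝒜 Tr (ofNoether X L) (bracket₁ (ofVecCopy x)) := fun x X L => by
    rw [e₁, e₅, pairing_ofVecCopy, pairing_ofNoether 𝒜 hsymm]
    change 𝒜.integral (X x) = 𝒜.integral (X x) + 𝒜.integral (GForm.tr₀₃ Tr 0 L)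
    rw [map_zero, LinearMap.zero_apply, 𝒜.integral_zero, add_zero]
  have f₂ : ∀ ξ (l : GForm M 𝔤 0) E, l.IsCpt ∨ E.IsCpt →
      pairing 𝒜 Tr (ofGauge ξ l) (bracket₁ (ofEom E)) =
      -pairing 𝒜 Tr (ofEom E) (bracket₁ (ofGauge ξ l)) := fun ξ l E h => by
    rw [e₂, e₄, pairing_ofGauge, pairing_ofEom 𝒜 hsymm]
    change 𝒜.integral ((0 : CovDensity M) ξ) + 𝒜.integral (GForm.tr₀₃ Tr l (GForm.d₂ E)) =
      -𝒜.integral (GForm.tr₁₂ Tr (GForm.d₀ l) E)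
    rw [LinearMap.zero_apply, 𝒜.integral_zero, zero_add, 𝒜.integral_tr₀₃_d₂ h]
  rcases exists_of_mem_degree hu hu0 with ⟨hi, x, rfl⟩ | ⟨hi, ξ, l, rfl⟩ | ⟨hi, A, rfl⟩ |
    ⟨hi, E, rfl⟩ | ⟨hi, X, L, rfl⟩ | ⟨hi, Y, rfl⟩ <;>
  rcases exists_of_mem_degree hv hv0 with ⟨hj, x', rfl⟩ | ⟨hj, ξ', l', rfl⟩ | ⟨hj, A', rfl⟩ |
    ⟨hj, E', rfl⟩ | ⟨hj, X', L', rfl⟩ | ⟨hj, Y', rfl⟩ <;>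
  first
    | (exfalso; omega)
    | (rw [hi, hj])
  · rw [sgn_even (by decide), one_mul, f₁]
  · rw [sgn_odd (by decide), f₂ ξ l E' (h.imp (·.2.2.1) (·.2.2.2.2.1)), neg_one_mul]
  · rw [sgn_even (by decide), one_mul, e₃, e₃, pairing_ofField, pairing_ofField]
    exact 𝒜.integral_tr₁₂_d₁ hsymm (h.imp (·.2.2.2.1) (·.2.2.2.1))
  · rw [sgn_odd (by decide), f₂ ξ' l' E (h.symm.imp (·.2.2.1) (·.2.2.2.2.1)), neg_one_mul, neg_neg]
  · rw [sgn_even (by decide), one_mul, f₁]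

/-- The trilinear expression `⟨u, ℓ₂(v, w)⟩` is graded antisymmetric. On arguments of
non-decreasing degree this amounts to the integrations by parts for the six combinations of
degrees of total degree three. -/
theorem pairing_bracket₂_of_le (hsymm : ∀ X Y, Tr X Y = Tr Y X)
    (hinv : ∀ X Y Z, Tr ⁅X, Y⁆ Z = Tr X ⁅Y, Z⁆) {i j k : ℤ} {u v w : ExtSpace M 𝔤}
    (hu : u ∈ degree M 𝔤 i) (hv : v ∈ degree M 𝔤 j) (hw : w ∈ degree M 𝔤 k)
    (h : IsCpt u ∨ IsCpt v ∨ IsCpt w) (hij : i ≤ j) (hjk : j ≤ k) :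
    pairing 𝒜 Tr u (bracket₂ Tr v w) =
        sgn (k * (i + j)) * pairing 𝒜 Tr w (bracket₂ Tr u v) ∧
      pairing 𝒜 Tr u (bracket₂ Tr v w) = -sgn (i * j) * pairing 𝒜 Tr v (bracket₂ Tr u w) := by
  by_cases hd : i + j + k = 3
  swap
  · rw [pairing_eq_zero 𝒜 (by omega) hu (bracket₂_mem hsymm hinv hv hw),
      pairing_eq_zero 𝒜 (by omega) hv (bracket₂_mem hsymm hinv hu hw),
      pairing_eq_zero 𝒜 (by omega) hw (bracket₂_mem hsymm hinv hu hv), mul_zero, mul_zero]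
    exact ⟨rfl, rfl⟩
  have z₁ := bracket₂_zero_left (M := M) hsymm hinv
  have z₂ := bracket₂_zero_right (M := M) hsymm hinv
  have p₁ := pairing_zero_left 𝒜 (Tr := Tr)
  have p₂ := pairing_zero_right 𝒜 hsymm
  by_cases hu0 : u = 0
  · rw [hu0, z₁, z₁, p₁, p₂, p₂, mul_zero, mul_zero]; exact ⟨rfl, rfl⟩
  by_cases hv0 : v = 0
  · rw [hv0, z₁, z₂, p₁, p₂, p₂, mul_zero, mul_zero]; exact ⟨rfl, rfl⟩
  by_cases hw0 : w = 0
  · rw [hw0, z₂, z₂, p₁, p₂, p₂, mul_zero, mul_zero]; exact ⟨rfl, rfl⟩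
  rcases exists_of_mem_degree hu hu0 with ⟨hi, x, rfl⟩ | ⟨hi, ξ, l, rfl⟩ | ⟨hi, A, rfl⟩ |
    ⟨hi, -⟩ | ⟨hi, -⟩ | ⟨hi, -⟩ <;> first | (exfalso; omega) | skip
  all_goals rcases exists_of_mem_degree hv hv0 with ⟨hj, -⟩ | ⟨hj, ξ', l', rfl⟩ | ⟨hj, A', rfl⟩ |
    ⟨hj, E', rfl⟩ | ⟨hj, -⟩ | ⟨hj, -⟩ <;> first | (exfalso; omega) | skip
  all_goals rcases exists_of_mem_degree hw hw0 with ⟨hk, -⟩ | ⟨hk, -⟩ |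
    ⟨hk, A'', rfl⟩ | ⟨hk, E'', rfl⟩ | ⟨hk, X'', L'', rfl⟩ | ⟨hk, Y'', rfl⟩ <;>
    first | (exfalso; omega) | rw [hi, hj, hk]
  · obtain ⟨h1, h2⟩ := pairing_ofVecCopy_ofGauge_ofCovCopy 𝒜 (x := x) (ξ := ξ') (l := l')
      (Y := Y'') hsymm hinv (h.imp (·.1) (·.imp (·.2.1) (·.2.2.2.2.2.2.2)))
    rw [sgn_even (by decide), sgn_even (by decide), one_mul, neg_one_mul]
    exact ⟨h1, h2⟩
  · obtain ⟨h1, h2⟩ := pairing_ofVecCopy_ofField_ofNoether 𝒜 (x := x) (A := A') (X := X'')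
      (L := L'') hsymm hinv
    rw [sgn_even (by decide), sgn_odd (by decide), one_mul, neg_neg, one_mul]
    exact ⟨h1, h2⟩
  · obtain ⟨h1, h2⟩ := pairing_ofVecCopy_ofEom_ofEom 𝒜 (x := x) (E := E') (E' := E'') hsymm hinv
    rw [sgn_even (by decide), sgn_even (by decide), one_mul, neg_one_mul]
    exact ⟨h1, h2⟩
  · have h1 := pairing_ofGauge_ofGauge_ofNoether 𝒜 (ξ := ξ) (l := l) (ξ' := ξ') (l' := l')
      (X := X'') (L := L'') hsymm hinv (h.imp (fun h => ⟨h.2.1, h.2.2.1⟩)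
        (·.imp (fun h => ⟨h.2.1, h.2.2.1⟩) fun h => ⟨h.2.2.2.2.2.1, h.2.2.2.2.2.2.1⟩))
    have h2 := pairing_ofGauge_ofGauge_ofNoether 𝒜 (ξ := ξ') (l := l') (ξ' := ξ) (l' := l)
      (X := X'') (L := L'') hsymm hinv (or_left_comm.1 (h.imp (fun h => ⟨h.2.1, h.2.2.1⟩)
        (·.imp (fun h => ⟨h.2.1, h.2.2.1⟩) fun h => ⟨h.2.2.2.2.2.1, h.2.2.2.2.2.2.1⟩)))
    have h3 := bracket₂_antisymm hsymm hinv hu hv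
    rw [hi, hj] at h3
    rw [h3, pairing_smul_right 𝒜 hsymm, sgn_even (by decide)] at h2
    rw [sgn_even (by decide), sgn_even (by decide), h1, h2]
    exact ⟨by ring, by ring⟩
  · obtain ⟨h1, h2⟩ := pairing_ofGauge_ofField_ofEom 𝒜 (ξ := ξ) (l := l) (A := A') (E := E'')
      hsymm hinv (h.imp (fun h => ⟨h.2.1, h.2.2.1⟩) (·.imp (·.2.2.2.1) (·.2.2.2.2.1)))
    rw [sgn_even (by decide), sgn_even (by decide), one_mul, neg_one_mul]
    exact ⟨h1, h2⟩
  · have h1 := pairing_ofField_ofField_ofField 𝒜 (A := A) (B := A') (C := A'') hsymm hinv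
    have h2 := pairing_ofField_ofField_ofField 𝒜 (A := A') (B := A) (C := A'') hsymm hinv
    have h3 := bracket₂_antisymm hsymm hinv hu hv
    rw [hi, hj] at h3
    rw [h3, pairing_smul_right 𝒜 hsymm, sgn_odd (by decide)] at h2
    rw [sgn_even (by decide), sgn_odd (by decide), h1, h2]
    exact ⟨by ring, by ring⟩

/-- Cyclicity for `ℓ₁` is `pairing_bracket₁`, and cyclicity for `ℓ₂` follows from
`pairing_bracket₂_of_le` by permutation of the arguments. -/
theorem isCyclicPairing (hsymm : ∀ X Y, Tr X Y = Tr Y X)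
    (hinv : ∀ X Y Z, Tr ⁅X, Y⁆ Z = Tr X ⁅Y, Z⁆) :
    IsCyclicPairing (degree M 𝔤) (brackets Tr) 3 IsCpt (pairing 𝒜 Tr) where
  add_left _ _ _ h := pairing_add_left 𝒜 h
  smul_left c u w _ := pairing_smul_left 𝒜 c u w
  add_right u v w h := by
    rw [pairing_comm 𝒜 hsymm, pairing_add_left 𝒜 h.symm, pairing_comm 𝒜 hsymm v,
      pairing_comm 𝒜 hsymm w]
  smul_right c u w _ := pairing_smul_right 𝒜 hsymm c u w
  degree _ _ h _ hu _ hw := pairing_eq_zero 𝒜 h hu hw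
  symm i j u hu w hw _ := by
    by_cases h : i + j = 3
    · have : Even (i * j) := by
        rw [show j = 3 - i by omega, Int.even_mul, Int.even_sub]
        by_cases hi : Even i <;> simp [hi]; decide
      rw [sgn_even this, one_mul, pairing_comm 𝒜 hsymm]
    · rw [pairing_eq_zero 𝒜 h hu hw, pairing_eq_zero 𝒜 (by omega) hw hu, mul_zero]
  cyclic n hn d v hv hc := by
    obtain _ | _ | _ | n := n
    · omega
    · have h := pairing_bracket₁ 𝒜 hsymm hinv (hv 0) (hv 1) (by
        obtain ⟨i, hi⟩ := hc
        fin_cases i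
        exacts [.inl hi, .inr hi])
      simpa [Fin.last, brackets] using h
    · have h := cyclic_of_sorted (fun u v w => IsCpt u ∨ IsCpt v ∨ IsCpt w)
        (fun i u => u ∈ degree M 𝔤 i) (fun u v w => pairing 𝒜 Tr u (bracket₂ Tr v w))
        (fun h => ⟨by tauto, by tauto⟩)
        (fun _ hv hw => by
          rw [bracket₂_antisymm hsymm hinv hv hw, pairing_smul_right 𝒜 hsymm])
        (fun hu hv hw h => pairing_bracket₂_of_le 𝒜 hsymm hinv hu hv hw h)
        (hv 0) (hv 1) (hv 2) (by
          obtain ⟨i, hi⟩ := hc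
          fin_cases i
          exacts [.inl hi, .inr (.inl hi), .inr (.inr hi)])
      refine h.trans ?_
      congr 1
      rw [Fin.sum_univ_two]
      change sgn (d 2 * (d 0 + d 1)) = sgn ((2 : ℕ) + (d 0 + d 2) * (2 : ℕ) + d 2 * (d 0 + d 1))
      have e : Even (((2 : ℕ) : ℤ) + (d 0 + d 2) * (2 : ℕ)) := ⟨1 + (d 0 + d 2), by push_cast; ring⟩
      unfold sgn
      simp only [Int.even_add.trans (iff_true_left e)]
    · rw [brackets_of_three_le (by omega), brackets_of_three_le (by omega),
        pairing_zero_right 𝒜 hsymm, pairing_zero_right 𝒜 hsymm, mul_zero]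

end ExtSpace
end CyclicPairing
end ChernSimons

namespace ChernSimons

/-! ### The quasi-isomorphism -/

section Morphism
variable {M : Type*} [TopologicalSpace M] [ChartedSpace E3 M] [IsManifold (𝓡 3) ∞ M]
  [T2Space M] [SigmaCompactSpace M]
  {𝔤 : Type*} [LieRing 𝔤] [LieAlgebra ℝ 𝔤] {Tr : 𝔤 →ₗ[ℝ] 𝔤 →ₗ[ℝ] ℝ}

/-- The component in Chern-Simons theory of an element of the extended theory: a left inverse
of the inclusion. -/
def forms (w : ExtSpace M 𝔤) : CSSpace M 𝔤 := (w.gauge, w.field, w.eom, w.noether)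

theorem forms_mem {k : ℤ} {w : ExtSpace M 𝔤} (hw : w ∈ ExtSpace.degree M 𝔤 k) :
    forms w ∈ CSSpace.degree M 𝔤 k := by
  obtain ⟨-, h2, h3, h4, h5, -⟩ := hw
  exact ⟨fun h => (h2 h).2, h3, h4, fun h => (h5 h).2⟩

theorem forms_bracket₂_incl (hsymm : ∀ X Y, Tr X Y = Tr Y X)
    (hinv : ∀ X Y Z, Tr ⁅X, Y⁆ Z = Tr X ⁅Y, Z⁆) (u v : CSSpace M 𝔤) :
    forms (ExtSpace.bracket₂ Tr (incl u) (incl v)) = CSSpace.bracket₂ u v := by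
  rw [CSSpace.bracket₂_eq hsymm hinv]
  refine (congrArg forms (CartanData.b₂_inclusion (cartanData (M := M) hsymm hinv) u v)).trans ?_
  exact Prod.ext (add_zero _) (Prod.ext (add_zero _) (Prod.ext (add_zero _)
    ((congrArg (_ + ·) (add_zero _)).trans (add_zero _))))

/-- The complement of the forms is the acyclic complex of two copies of the vector fields and
two copies of the densities, so the inclusion is a quasi-isomorphism. -/
theorem isLInftyQuasiIso_psi (hsymm : ∀ X Y, Tr X Y = Tr Y X)
    (hinv : ∀ X Y Z, Tr ⁅X, Y⁆ Z = Tr X ⁅Y, Z⁆) :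
    IsLInftyQuasiIso (CSSpace.degree M 𝔤) CSSpace.brackets
      (ExtSpace.degree M 𝔤) (ExtSpace.brackets Tr) (psi Tr) where
  toIsLInftyMorphism := isLInftyMorphism_psi hsymm hinv
  injective k v _ _ := by
    rintro ⟨w, hw, h⟩
    refine ⟨forms w, forms_mem hw, ?_⟩
    exact congrArg forms h
  surjective k w hw h := by
    have h' : ((0, (w.vecCopy, 0), GForm.d₀ w.gauge, GForm.d₁ w.field, (0, GForm.d₂ w.eom), w.cov) :
      ExtSpace M 𝔤) = 0 := h
    have e1 : w.vecCopy = 0 := congrArg (fun x : ExtSpace M 𝔤 => x.vec) h'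
    have e2 : w.cov = 0 := congrArg (fun x : ExtSpace M 𝔤 => x.covCopy) h'
    -- a cocycle differs from its forms by the boundary of its vector field and covector density
    refine ⟨forms w, forms_mem hw, congrArg forms h', (w.vec, (0, 0), 0, 0, (w.covCopy, 0), 0),
      ?_, ?_⟩
    · obtain ⟨-, h2, -, -, -, h6⟩ := hw
      exact ⟨fun h => (h2 (by omega)).1, fun _ => ⟨rfl, rfl⟩, fun _ => rfl, fun _ => rfl,
        fun h => ⟨h6 (by omega), rfl⟩, fun _ => rfl⟩
    · change w = ((0, (0, w.gauge), w.field, w.eom, (0, w.noether), 0) : ExtSpace M 𝔤) +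
        (0, (w.vec, 0), GForm.d₀ 0, GForm.d₁ 0, (0, GForm.d₂ 0), w.covCopy)
      rw [map_zero, map_zero, map_zero]
      exact Prod.ext (e1.trans (add_zero _).symm) (Prod.ext (Prod.ext (zero_add _).symm
        (add_zero _).symm) (Prod.ext (add_zero _).symm (Prod.ext (add_zero _).symm
        (Prod.ext (Prod.ext (e2.trans (add_zero _).symm) (add_zero _).symm) (zero_add _).symm))))

end Morphism

/-! ### Chern-Simons theory as a cyclic subspace -/

section CyclicMorphism
variable {M : Type*} [TopologicalSpace M] [ChartedSpace E3 M] [IsManifold (𝓡 3) ∞ M]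
  [T2Space M] [SigmaCompactSpace M] (𝒜 : OrientedAtlas M)
  {𝔤 : Type*} [LieRing 𝔤] [LieAlgebra ℝ 𝔤] [FiniteDimensional ℝ 𝔤] {Tr : 𝔤 →ₗ[ℝ] 𝔤 →ₗ[ℝ] ℝ}

theorem pairing_incl_left (u : CSSpace M 𝔤) (w : ExtSpace M 𝔤) :
    ExtSpace.pairing 𝒜 Tr (incl u) w = CSSpace.pairing 𝒜 Tr u (forms w) := by
  have h : ExtSpace.pairing 𝒜 Tr (incl u) w = 𝒜.integral (w.covCopy 0) +
      𝒜.integral ((0 : CovDensity M) w.vecCopy) + 𝒜.integral (w.cov 0) +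
      𝒜.integral ((0 : CovDensity M) w.vec) +
      𝒜.integral (GForm.tr Tr u.gauge w.noether : Form M (0 + 3)) +
      𝒜.integral (GForm.tr Tr u.field w.eom : Form M (1 + 2)) +
      𝒜.integral (GForm.tr Tr u.eom w.field : Form M (2 + 1)) +
      𝒜.integral (GForm.tr Tr u.noether w.gauge : Form M (3 + 0)) := rfl
  rw [h, map_zero, map_zero, LinearMap.zero_apply, LinearMap.zero_apply, 𝒜.integral_zero]
  simp only [zero_add]
  rfl

theorem pairing_incl (u v : CSSpace M 𝔤) :
    ExtSpace.pairing 𝒜 Tr (incl u) (incl v) = CSSpace.pairing 𝒜 Tr u v :=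
  pairing_incl_left 𝒜 u (incl v)

theorem isCpt_incl {u : CSSpace M 𝔤} (h : CSSpace.IsCpt u) : ExtSpace.IsCpt (incl u) :=
  ⟨⟨∅, isCompact_empty, fun _ _ => rfl⟩, ⟨∅, isCompact_empty, fun _ _ => rfl⟩, h.1, h.2.1, h.2.2.1,
    ⟨∅, isCompact_empty, fun _ _ _ _ => rfl⟩, h.2.2.2, ⟨∅, isCompact_empty, fun _ _ _ _ => rfl⟩⟩

theorem incl_add (u v : CSSpace M 𝔤) : incl (u + v) = incl u + incl v :=
  Prod.ext (add_zero _).symm (Prod.ext (Prod.ext (add_zero _).symm rfl) (Prod.ext rfl (Prod.ext rfl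
    (Prod.ext (Prod.ext (add_zero _).symm rfl) (add_zero _).symm))))

theorem incl_smul (c : ℝ) (u : CSSpace M 𝔤) : incl (c • u) = c • incl u :=
  Prod.ext (smul_zero c).symm (Prod.ext (Prod.ext (smul_zero c).symm rfl) (Prod.ext rfl
    (Prod.ext rfl (Prod.ext (Prod.ext (smul_zero c).symm rfl) (smul_zero c).symm))))

/-- Since the pairing with forms only sees forms, the cyclic structures of Chern-Simons theory are
restrictions of those of the extended theory. -/
theorem pairing_incl_brackets (hsymm : ∀ X Y, Tr X Y = Tr Y X)
    (hinv : ∀ X Y Z, Tr ⁅X, Y⁆ Z = Tr X ⁅Y, Z⁆) (n : ℕ) (u : CSSpace M 𝔤)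
    (v : Fin n → CSSpace M 𝔤) :
    ExtSpace.pairing 𝒜 Tr (incl u) (ExtSpace.brackets Tr n fun i => incl (v i)) =
      CSSpace.pairing 𝒜 Tr u (CSSpace.brackets n v) := by
  rw [pairing_incl_left]
  congr 1
  match n with
  | 0 => rfl
  | 1 => rfl
  | 2 => exact forms_bracket₂_incl hsymm hinv (v 0) (v 1)
  | n + 3 => rfl

theorem CSSpace.isCyclicPairing (hsymm : ∀ X Y, Tr X Y = Tr Y X)
    (hinv : ∀ X Y Z, Tr ⁅X, Y⁆ Z = Tr X ⁅Y, Z⁆) :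
    IsCyclicPairing (CSSpace.degree M 𝔤) CSSpace.brackets 3 CSSpace.IsCpt
      (CSSpace.pairing 𝒜 Tr) := by
  have H := ExtSpace.isCyclicPairing (M := M) 𝒜 hsymm hinv
  refine ⟨fun u v w h => ?_, fun c u w h => ?_, fun u v w h => ?_, fun c u w h => ?_,
    fun i j h u hu w hw => ?_, fun i j u hu w hw h => ?_, fun n hn d v hv hc => ?_⟩
  · rw [← pairing_incl, ← pairing_incl, ← pairing_incl, incl_add]
    exact H.add_left _ _ _ (h.imp (fun h => ⟨isCpt_incl h.1, isCpt_incl h.2⟩) isCpt_incl)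
  · rw [← pairing_incl, ← pairing_incl, incl_smul]
    exact H.smul_left _ _ _ (h.imp isCpt_incl isCpt_incl)
  · rw [← pairing_incl, ← pairing_incl, ← pairing_incl, incl_add]
    exact H.add_right _ _ _ (h.imp isCpt_incl fun h => ⟨isCpt_incl h.1, isCpt_incl h.2⟩)
  · rw [← pairing_incl, ← pairing_incl, incl_smul]
    exact H.smul_right _ _ _ (h.imp isCpt_incl isCpt_incl)
  · rw [← pairing_incl]
    exact H.degree i j h _ (incl_mem hu) _ (incl_mem hw)
  · rw [← pairing_incl, ← pairing_incl]
    exact H.symm i j _ (incl_mem hu) _ (incl_mem hw) (h.imp isCpt_incl isCpt_incl)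
  · rw [← pairing_incl_brackets 𝒜 hsymm hinv, ← pairing_incl_brackets 𝒜 hsymm hinv]
    exact H.cyclic n hn d (fun i => incl (v i)) (fun i => incl_mem (hv i))
      (hc.imp fun i hi => isCpt_incl hi)

theorem isCyclicMorphism_psi (hsymm : ∀ X Y, Tr X Y = Tr Y X) :
    IsCyclicMorphism (CSSpace.degree M 𝔤) CSSpace.IsCpt (CSSpace.pairing 𝒜 Tr)
      (ExtSpace.pairing 𝒜 Tr) (psi Tr) where
  preserves u v _ := pairing_incl 𝒜 u v
  higher n hn d v _ _ := by
    have h1 : ∀ (u : CSSpace M 𝔤) X, ExtSpace.pairing 𝒜 Tr (incl u) (ExtSpace.ofNoether X 0) = 0 :=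
      fun u X => by
        rw [pairing_incl_left, ← pairing_incl]
        exact ExtSpace.pairing_zero_right 𝒜 hsymm _
    have key : ∀ (p q : ℕ) (y : Fin p → CSSpace M 𝔤) (z : Fin q → CSSpace M 𝔤), 3 ≤ p + q →
        ExtSpace.pairing 𝒜 Tr (psi Tr p y) (psi Tr q z) = 0 := by
      intro p q y z hpq
      rcases (by omega : 3 ≤ p ∨ 3 ≤ q ∨ (p = 1 ∧ q = 2) ∨ (p = 2 ∧ q = 1) ∨
        (p = 2 ∧ q = 2)) with h | h | ⟨rfl, rfl⟩ | ⟨rfl, rfl⟩ | ⟨rfl, rfl⟩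
      · rw [psi_of_three_le h, ExtSpace.pairing_zero_left]
      · rw [psi_of_three_le h, ExtSpace.pairing_zero_right 𝒜 hsymm]
      · exact h1 _ _
      · rw [ExtSpace.pairing_comm 𝒜 hsymm]; exact h1 _ _
      · refine (ExtSpace.pairing_ofNoether 𝒜 hsymm _ _ _).trans ?_
        exact (congrArg₂ (· + ·) ((congrArg 𝒜.integral (map_zero _)).trans 𝒜.integral_zero)
          ((congrArg 𝒜.integral (map_zero _)).trans 𝒜.integral_zero)).trans (add_zero 0)
    exact Finset.sum_eq_zero fun i _ => by rw [key _ _ _ _ (by omega), mul_zero]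

end CyclicMorphism
end ChernSimons

namespace ChernSimons

/-! ### Non-degeneracy of the pairings -/

section Nondegeneracy
variable {M : Type*} [TopologicalSpace M] [ChartedSpace E3 M] [IsManifold (𝓡 3) ∞ M]
  [T2Space M] [SigmaCompactSpace M] (𝒜 : OrientedAtlas M)

namespace Form

/-- A smooth function as a form of degree `0`. -/
noncomputable def ofFun (f : SmoothFun M) : Form M 0 :=
  AlternatingMap.constOfIsEmpty (SmoothFun M) (VField M) (Fin 0) f

theorem d₀_ofFun (f : SmoothFun M) (X : VField M) : d₀ (ofFun f) ![X] = X.deriv f := rfl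

/-- The product of the differentials of cut-off coordinates is a three-form that does not vanish at
a given point. -/
theorem exists_three_ne_zero (p : M) : ∃ (ν : Form M 3) (Y : Fin 3 → VField M), ν Y p ≠ 0 := by
  obtain ⟨E, x, -, -, -, hx⟩ := exists_frame p
  let e : Fin 3 → Form M 1 := fun i => d₀ (ofFun (x i))
  refine ⟨(wedge (e 0) (wedge (e 1) (e 2) : Form M (1 + 1)) : Form M (1 + 2)),
    ![E 0, E 1, E 2], ?_⟩
  have h : ∀ i j, e i ![E j] p = if j = i then 1 else 0 := fun i j => hx j i
  have h1 := congrArg (fun f : SmoothFun M => f p) (wedge_one_two (e 0)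
    (wedge (e 1) (e 2) : Form M (1 + 1)) (E 0) (E 1) (E 2))
  refine (h1.trans ?_).trans_ne one_ne_zero
  rw [wedge_one_one, wedge_one_one, wedge_one_one]
  change e 0 ![E 0] p * (e 1 ![E 1] p * e 2 ![E 2] p - e 1 ![E 2] p * e 2 ![E 1] p) -
    e 0 ![E 1] p * (e 1 ![E 0] p * e 2 ![E 2] p - e 1 ![E 2] p * e 2 ![E 0] p) +
    e 0 ![E 2] p * (e 1 ![E 0] p * e 2 ![E 1] p - e 1 ![E 1] p * e 2 ![E 0] p) = 1
  simp [h]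

theorem fun_eq_zero_of_smul {f : SmoothFun M} (h : ∀ ν : Form M 3, f • ν = 0) : f = 0 := by
  ext p
  obtain ⟨ν, Y, hν⟩ := exists_three_ne_zero p
  have h1 : f p * ν Y p = 0 := congrArg (fun ν : Form M 3 => ν Y p) (h ν)
  exact (mul_eq_zero.1 h1).resolve_right hν

/-- A one-form which vanishes on a frame at a point vanishes at this point. -/
theorem one_eq_zero_of_frame (β : Form M 1) {p : M} {E : Fin 3 → VField M}
    {x : Fin 3 → SmoothFun M} {θ : SmoothFun M} (hθ : θ p = 1)
    (h : ∀ X : VField M, θ • X = ∑ i, (θ * X.deriv (x i)) • E i) (hE : ∀ i, β ![E i] p = 0)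
    (X : VField M) : β ![X] p = 0 :=
  linearMap_apply_eq_zero
    { toFun := fun X => β ![X], map_add' := one_add β, map_smul' := one_smul β }
    hθ h hE X

/-- The products with `dx₀`, `dx₁`, `dx₂` detect the three coefficients of a two-form. -/
theorem two_eq_zero_of_wedge {β : Form M 2}
    (h : ∀ α : Form M 1, (wedge α β : Form M (1 + 2)) = 0) : β = 0 := by
  refine ext_two fun X Y => ?_
  ext p
  obtain ⟨E, x, θ, hθ, hE, hx⟩ := exists_frame p
  have key : ∀ i j, β ![E i, E j] p = 0 := by
    intro i j
    by_cases hij : i = j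
    · rw [hij, two_self]; rfl
    obtain ⟨k, hik, hjk⟩ : ∃ k, i ≠ k ∧ j ≠ k := by revert i j; decide
    have h1 := congrArg (fun f : SmoothFun M => f p)
      (wedge_one_two (d₀ (ofFun (x k))) β (E k) (E i) (E j))
    rw [h, d₀_ofFun, d₀_ofFun, d₀_ofFun] at h1
    change 0 = (E k).deriv (x k) p * β ![E i, E j] p - (E i).deriv (x k) p * β ![E k, E j] p +
      (E j).deriv (x k) p * β ![E k, E i] p at h1
    rw [hx, hx, hx, if_pos rfl, if_neg hik, if_neg hjk] at h1
    linarith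
  have h2 : ∀ i Y, β ![E i, Y] p = 0 := fun i =>
    one_eq_zero_of_frame (contr (E i) β) hθ hE fun j => key i j
  rw [two_swap]
  have h3 : β ![Y, X] p = 0 := one_eq_zero_of_frame (contr Y β) hθ hE (fun i => by
    have h4 : β ![Y, E i] p = -β ![E i, Y] p :=
      congrArg (fun f : SmoothFun M => f p) (two_swap β _ _)
    exact h4.trans (by rw [h2, neg_zero])) X
  change -β ![Y, X] p = 0
  rw [h3, neg_zero]

/-- The products with `dxᵢ ∧ dxⱼ` detect the coefficients of a one-form. -/
theorem one_eq_zero_of_wedge {β : Form M 1}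
    (h : ∀ α : Form M 2, (wedge α β : Form M (2 + 1)) = 0) : β = 0 := by
  refine ext_one fun X => ?_
  ext p
  obtain ⟨E, x, θ, hθ, hE, hx⟩ := exists_frame p
  refine one_eq_zero_of_frame β hθ hE (fun k => ?_) X
  obtain ⟨i, j, hij, hik, hjk⟩ : ∃ i j, i ≠ j ∧ i ≠ k ∧ j ≠ k := by revert k; decide
  let e : Fin 3 → Form M 1 := fun i => d₀ (ofFun (x i))
  have he : ∀ i j, e i ![E j] p = if j = i then 1 else 0 := fun i j => hx j i
  have h1 := congrArg (fun f : SmoothFun M => f p)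
    (wedge_two_one (wedge (e i) (e j) : Form M (1 + 1)) β (E k) (E i) (E j))
  rw [h, wedge_one_one, wedge_one_one, wedge_one_one] at h1
  change 0 = β ![E k] p * (e i ![E i] p * e j ![E j] p - e i ![E j] p * e j ![E i] p) -
    β ![E i] p * (e i ![E k] p * e j ![E j] p - e i ![E j] p * e j ![E k] p) +
    β ![E j] p * (e i ![E k] p * e j ![E i] p - e i ![E i] p * e j ![E k] p) at h1
  simp only [he, if_true, if_neg hij, if_neg hij.symm, if_neg hik.symm, if_neg hjk.symm] at h1
  linarith

theorem isCpt_smul {k : ℕ} {f : SmoothFun M} (hf : HasCompactSupport f) (α : Form M k) :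
    (f • α).IsCpt :=
  ⟨tsupport f, hf, fun p hp Y => by
    change f p * α Y p = 0
    rw [image_eq_zero_of_notMem_tsupport hp, zero_mul]⟩

end Form

namespace OrientedAtlas

theorem eq_zero_of_integral_zero_three {ν : Form M 3}
    (h : ∀ f : Form M 0, f.IsCpt → 𝒜.integral (Form.wedge f ν : Form M (0 + 3)) = 0) : ν = 0 :=
  𝒜.eq_zero_of_integral_smul_eq_zero fun f hf => by
    refine (congrArg 𝒜.integral ?_).trans (h (f • Form.ofFun 1) (Form.isCpt_smul hf _))
    refine .trans ?_ (Form.zero_wedge_three _ ν).symm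
    exact congrArg (· • ν) (mul_one f).symm

theorem eq_zero_of_integral_one_two {β : Form M 2}
    (h : ∀ α : Form M 1, α.IsCpt → 𝒜.integral (Form.wedge α β : Form M (1 + 2)) = 0) : β = 0 :=
  Form.two_eq_zero_of_wedge fun α => 𝒜.eq_zero_of_integral_smul_eq_zero fun f hf =>
    (congrArg 𝒜.integral (Form.smul_wedge f α β).symm).trans (h _ (Form.isCpt_smul hf α))

theorem eq_zero_of_integral_two_one {β : Form M 1}
    (h : ∀ α : Form M 2, α.IsCpt → 𝒜.integral (Form.wedge α β : Form M (2 + 1)) = 0) : β = 0 :=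
  Form.one_eq_zero_of_wedge fun α => 𝒜.eq_zero_of_integral_smul_eq_zero fun f hf =>
    (congrArg 𝒜.integral (Form.smul_wedge f α β).symm).trans (h _ (Form.isCpt_smul hf α))

theorem eq_zero_of_integral_three_zero {g : Form M 0}
    (h : ∀ ν : Form M 3, ν.IsCpt → 𝒜.integral (Form.wedge ν g : Form M (3 + 0)) = 0) : g = 0 := by
  refine Form.ext_zero (Form.fun_eq_zero_of_smul fun ν => ?_)
  refine 𝒜.eq_zero_of_integral_smul_eq_zero fun f hf => ?_
  refine (congrArg 𝒜.integral ?_).trans (h (f • ν) (Form.isCpt_smul hf ν))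
  exact (smul_comm f (g ![]) ν).trans (Form.wedge_zero (f • ν) g).symm

/-- The covector densities `f dg ⊗ ν` detect all derivatives `x(g)`, hence the vector field `x`. -/
theorem vField_eq_zero {x : VField M}
    (h : ∀ Y : CovDensity M, Y.IsCpt → 𝒜.integral (Y x) = 0) : x = 0 := by
  have key : ∀ g : SmoothFun M, x.deriv g = 0 := fun g =>
    Form.fun_eq_zero_of_smul fun ν => 𝒜.eq_zero_of_integral_smul_eq_zero fun f hf => by
      let Y : CovDensity M :=
        { toFun := fun ξ => f • ξ.deriv g • ν
          map_add' := fun ξ η => by rw [VField.add_deriv, add_smul, smul_add]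
          map_smul' := fun u ξ => by
            rw [VField.smul_deriv, mul_smul, smul_comm f u]; rfl }
      refine h Y ⟨tsupport f, hf, fun p hp η Z => ?_⟩
      change f p * (η.deriv g p * ν Z p) = 0
      rw [image_eq_zero_of_notMem_tsupport hp, zero_mul]
  ext p
  obtain ⟨E, y, θ, hθ, hE, -⟩ := exists_frame p
  have h1 := congrArg (fun X : VField M => X p) (hE x)
  simp only [key, mul_zero, zero_smul, Finset.sum_const_zero, VField.smul_apply, hθ, one_smul] at h1
  exact h1

/-- A covector density is detected by testing it with the vector fields `f ξ`. -/
theorem covDensity_eq_zero {X : CovDensity M}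
    (h : ∀ x : VField M, x.IsCpt → 𝒜.integral (X x) = 0) : X = 0 :=
  LinearMap.ext fun ξ => 𝒜.eq_zero_of_integral_smul_eq_zero fun f hf => by
    rw [← map_smul]
    refine h _ ⟨tsupport f, hf, fun p hp => ?_⟩
    rw [VField.smul_apply, image_eq_zero_of_notMem_tsupport hp, zero_smul]

end OrientedAtlas

variable {𝔤 : Type*} [LieRing 𝔤] [LieAlgebra ℝ 𝔤] [FiniteDimensional ℝ 𝔤]
  {Tr : 𝔤 →ₗ[ℝ] 𝔤 →ₗ[ℝ] ℝ}

/-- For a non-degenerate form `Tr`, testing a `𝔤`-valued form against elements `α ⊗ X` with `X`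
running through a dual basis reduces non-degeneracy to that of the wedge pairing. -/
theorem GForm.eq_zero_of_tr (hTr : ∀ X, (∀ Y, Tr X Y = 0) → X = 0) {p q : ℕ}
    (I : Form M (p + q) → ℝ)
    (hI : ∀ β : Form M q, (∀ α : Form M p, α.IsCpt → I (Form.wedge α β) = 0) → β = 0)
    {b : GForm M 𝔤 q} (hb : ∀ a : GForm M 𝔤 p, a.IsCpt → I (GForm.tr Tr a b) = 0) : b = 0 := by
  -- in finite dimensions, a non-degenerate form represents every coordinate function
  have hs : Function.Surjective Tr :=
    (LinearMap.injective_iff_surjective_of_finrank_eq_finrank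
      (Subspace.dual_finrank_eq (K := ℝ) (V := 𝔤)).symm).1
      ((injective_iff_map_eq_zero Tr).2 fun X hX => hTr X fun Y => by rw [hX]; rfl)
  rw [GForm.eq_sum_component b]
  refine Finset.sum_eq_zero fun i _ => ?_
  obtain ⟨X, hX⟩ := hs ((Module.finBasis ℝ 𝔤).coord i)
  rw [hI (GForm.component ((Module.finBasis ℝ 𝔤).coord i) b) fun α hα => ?_,
    TensorProduct.zero_tmul]
  rw [← hX, ← GForm.tr_tmul_left]
  exact hb _ (GForm.isCpt_of_component fun f => by
    rw [GForm.component_tmul]; exact hα.const_smul _)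

theorem isCpt_zero_vField : (0 : VField M).IsCpt := ⟨∅, isCompact_empty, fun _ _ => rfl⟩

theorem isCpt_zero_covDensity : (0 : CovDensity M).IsCpt :=
  ⟨∅, isCompact_empty, fun _ _ _ _ => rfl⟩

theorem ExtSpace.pairingNondegenerate (hsymm : ∀ X Y, Tr X Y = Tr Y X)
    (hTr : ∀ X, (∀ Y, Tr X Y = 0) → X = 0) :
    PairingNondegenerate ExtSpace.IsCpt (ExtSpace.pairing (M := M) 𝒜 Tr) := by
  have key : ∀ w : ExtSpace M 𝔤, (∀ u, IsCpt u → pairing 𝒜 Tr u w = 0) → w = 0 := by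
    intro w h
    have zV := isCpt_zero_vField (M := M)
    have zC := isCpt_zero_covDensity (M := M)
    have z0 : (0 : GForm M 𝔤 0).IsCpt := GForm.isCpt_zero
    have z1 : (0 : GForm M 𝔤 1).IsCpt := GForm.isCpt_zero
    have z2 : (0 : GForm M 𝔤 2).IsCpt := GForm.isCpt_zero
    have z3 : (0 : GForm M 𝔤 3).IsCpt := GForm.isCpt_zero
    have h1 : w.vecCopy = 0 := 𝒜.vField_eq_zero fun Y hY => by
      rw [← pairing_ofCovCopy 𝒜 (Tr := Tr) Y w]; exact h _ ⟨zV, zV, z0, z1, z2, zC, z3, hY⟩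
    have h2 : w.covCopy = 0 := 𝒜.covDensity_eq_zero fun x hx => by
      rw [← pairing_ofVecCopy 𝒜 (Tr := Tr) x w]; exact h _ ⟨hx, zV, z0, z1, z2, zC, z3, zC⟩
    have h3 : w.cov = 0 := 𝒜.covDensity_eq_zero fun ξ hξ => by
      have := (pairing_ofGauge 𝒜 (Tr := Tr) ξ 0 w).symm.trans
        (h _ ⟨zV, hξ, z0, z1, z2, zC, z3, zC⟩)
      rwa [map_zero, LinearMap.zero_apply, 𝒜.integral_zero, add_zero] at this
    have h4 : w.vec = 0 := 𝒜.vField_eq_zero fun X hX => by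
      have := (pairing_ofNoether 𝒜 hsymm X 0 w).symm.trans
        (h _ ⟨zV, zV, z0, z1, z2, hX, z3, zC⟩)
      rwa [map_zero, 𝒜.integral_zero, add_zero] at this
    have h5 : w.noether = 0 := GForm.eq_zero_of_tr hTr (p := 0) (q := 3) 𝒜.integral
      (fun _ => 𝒜.eq_zero_of_integral_zero_three) fun l hl => by
      have := (pairing_ofGauge 𝒜 (Tr := Tr) 0 l w).symm.trans
        (h _ ⟨zV, zV, hl, z1, z2, zC, z3, zC⟩)
      rwa [map_zero, 𝒜.integral_zero, zero_add] at this
    have h6 : w.eom = 0 := GForm.eq_zero_of_tr hTr (p := 1) (q := 2) 𝒜.integral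
      (fun _ => 𝒜.eq_zero_of_integral_one_two) fun A hA =>
      (pairing_ofField 𝒜 A w).symm.trans (h _ ⟨zV, zV, z0, hA, z2, zC, z3, zC⟩)
    have h7 : w.field = 0 := GForm.eq_zero_of_tr hTr (p := 2) (q := 1) 𝒜.integral
      (fun _ => 𝒜.eq_zero_of_integral_two_one) fun E hE =>
      (congrArg 𝒜.integral (GForm.tr₂₁ hsymm E w.field)).trans <|
        (pairing_ofEom 𝒜 hsymm E w).symm.trans (h _ ⟨zV, zV, z0, z1, hE, zC, z3, zC⟩)
    have h8 : w.gauge = 0 := GForm.eq_zero_of_tr hTr (p := 3) (q := 0) 𝒜.integral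
      (fun _ => 𝒜.eq_zero_of_integral_three_zero) fun L hL => by
      have := (pairing_ofNoether 𝒜 hsymm 0 L w).symm.trans
        (h _ ⟨zV, zV, z0, z1, z2, zC, hL, zC⟩)
      rw [LinearMap.zero_apply, 𝒜.integral_zero, zero_add] at this
      exact (congrArg 𝒜.integral (GForm.tr₃₀ hsymm L w.gauge)).trans this
    exact Prod.ext h1 (Prod.ext (Prod.ext h4 h8) (Prod.ext h7 (Prod.ext h6
      (Prod.ext (Prod.ext h3 h5) h2))))
  exact ⟨fun u h => key u fun w hw => by rw [pairing_comm 𝒜 hsymm]; exact h w hw, key⟩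

theorem CSSpace.pairingNondegenerate (hsymm : ∀ X Y, Tr X Y = Tr Y X)
    (hTr : ∀ X, (∀ Y, Tr X Y = 0) → X = 0) :
    PairingNondegenerate CSSpace.IsCpt (CSSpace.pairing (M := M) 𝒜 Tr) := by
  have hforms : ∀ w : ExtSpace M 𝔤, ExtSpace.IsCpt w → CSSpace.IsCpt (forms w) := fun w h =>
    ⟨h.2.2.1, h.2.2.2.1, h.2.2.2.2.1, h.2.2.2.2.2.2.1⟩
  obtain ⟨h1, h2⟩ := ExtSpace.pairingNondegenerate (M := M) 𝒜 hsymm hTr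
  refine ⟨fun u h => congrArg forms (h1 (incl u) fun w hw => ?_),
    fun u h => congrArg forms (h2 (incl u) fun w hw => ?_)⟩
  · rw [pairing_incl_left]; exact h _ (hforms w hw)
  · rw [ExtSpace.pairing_comm 𝒜 hsymm, pairing_incl_left, ← pairing_incl,
      ExtSpace.pairing_comm 𝒜 hsymm, pairing_incl]
    exact h _ (hforms w hw)

end Nondegeneracy
end ChernSimons

namespace ChernSimons

/-! ### Curvature and gauge variations -/

namespace CartanData
variable {V G₀ G₁ G₂ G₃ C : Type*} [AddCommGroup V] [AddCommGroup G₀] [AddCommGroup G₁]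
  [AddCommGroup G₂] [AddCommGroup G₃] [AddCommGroup C] [Module ℝ V] [Module ℝ G₀] [Module ℝ G₁]
  [Module ℝ G₂] [Module ℝ G₃] [Module ℝ C] (K : CartanData V G₀ G₁ G₂ G₃ C)

/-- The curvature `F = dA + ½ [A, A]`. -/
noncomputable def curvature (A : G₁) : G₂ := K.d₁ A + (1 / 2 : ℝ) • K.br₁₁ A A

/-- The Bianchi identity: `[A, [A, A]]` vanishes by the Jacobi identity. -/
theorem d₂_curvature (A : G₁) : K.d₂ (K.curvature A) = -K.br₁₂ A (K.curvature A) := by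
  have h := K.jacobi₁₁₁ A A A
  have h0 : K.br₁₂ A (K.br₁₁ A A) = 0 := by
    have : (3 : ℝ) • K.br₁₂ A (K.br₁₁ A A) = 0 := by
      rw [show (3 : ℝ) • K.br₁₂ A (K.br₁₁ A A) = K.br₁₂ A (K.br₁₁ A A) -
        (-K.br₁₂ A (K.br₁₁ A A) - K.br₁₂ A (K.br₁₁ A A)) by module, ← h, sub_self]
    exact (smul_eq_zero.1 this).resolve_left (by norm_num)
  simp only [curvature, LinearMap.map_add, LinearMap.map_smul, K.d₂_d₁, K.d₂_br₁₁, h0]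
  module

/-- The Noether identity of diffeomorphisms follows from the Bianchi identity. -/
theorem noether_curvature (A : G₁) :
    K.c₂₂ (K.d₁ A) (K.curvature A) - K.c₁₃ A (K.d₂ (K.curvature A)) = 0 := by
  -- `Tr(ι_ξ F ∧ F)` vanishes as `ι_ξ` is a derivation and there are no four-forms.
  have h0 : K.c₂₂ (K.curvature A) (K.curvature A) = 0 := by
    have h := K.c₂₂_comm (K.curvature A) (K.curvature A)
    have h2 := add_eq_zero_iff_eq_neg.2 h
    rw [← two_smul ℝ] at h2
    exact (smul_eq_zero.1 h2).resolve_left two_ne_zero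
  have h1 : K.d₁ A = K.curvature A - (1 / 2 : ℝ) • K.br₁₁ A A := by
    rw [curvature, add_sub_cancel_right]
  rw [d₂_curvature, h1, LinearMap.map_sub, LinearMap.sub_apply, h0, LinearMap.map_smul,
    LinearMap.smul_apply, K.c₂₂_br₁₁, LinearMap.map_neg]
  module

/-- The redundancy of diffeomorphisms is Cartan's formula for `L_η A`. -/
theorem variation_redundancy (ξ η : V) (l : G₀) (A : G₁) :
    K.lie₁ (ξ + η) A + K.d₀ (l - K.ι₁ η A) + -K.br₀₁ (l - K.ι₁ η A) A =
      K.lie₁ ξ A + K.d₀ l + -K.br₀₁ l A + K.ι₂ η (K.curvature A) := by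
  simp only [curvature, LinearMap.map_add, LinearMap.add_apply, LinearMap.map_sub,
    LinearMap.sub_apply, LinearMap.map_smul, K.ι_br₁₁, K.lie₁_eq η]
  module

theorem b_gauge (ξ : V) (l : G₀) (A : G₁) :
    K.b₁ (ofG ξ l) + K.b₂ (ofG ξ l) (ofA A) = ofA (K.lie₁ ξ A + K.d₀ l + -K.br₀₁ l A) := by
  rw [b₁_ofG, b₂_ofG_ofA, ofA_add]; congr 1; abel

theorem b_field (A : G₁) :
    K.b₁ (ofA A) - (1 / 2 : ℝ) • K.b₂ (ofA A) (ofA A) = ofE (K.curvature A) := by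
  rw [b₁_ofA, b₂_ofA_ofA, ofE_smul, ofE_sub, curvature]; congr 1; module

theorem b_vecCopy (η : V) (A : G₁) :
    K.b₁ (ofV η) - K.b₂ (ofA A) (ofV η) = ofG η (-K.ι₁ η A) := by
  rw [b₁_ofV, b₂_ofA_ofV, ofG_sub, sub_zero, zero_sub]

theorem b_eom (A : G₁) (E : G₂) :
    K.b₁ (ofE E) - K.b₂ (ofA A) (ofE E) =
      ofN (-(K.c₂₂ (K.d₁ A) E - K.c₁₃ A (K.d₂ E))) (K.d₂ E + K.br₁₂ A E) := by
  rw [b₁_ofE, b₂_ofA_ofE, ofN_sub, zero_sub, sub_neg_eq_add]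

end CartanData

/-! ### Failure of strictness and redundancy of diffeomorphisms -/

section GaugeTheory
variable {M : Type*} [TopologicalSpace M] [ChartedSpace E3 M] [IsManifold (𝓡 3) ∞ M]
  [T2Space M] [SigmaCompactSpace M]
  {𝔤 : Type*} [LieRing 𝔤] [LieAlgebra ℝ 𝔤] {Tr : 𝔤 →ₗ[ℝ] 𝔤 →ₗ[ℝ] ℝ}

/-- The inclusion does not preserve brackets: for `A = dx ⊗ X` and `Λ = ν ⊗ Y` with `Tr(X, Y)` and
`dx(ξ) ν` nonzero somewhere, `[A, Λ]` vanishes for reasons of degree while `ℓ₂(A, Λ)` and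
`ψ₂(A, Λ)` are given by the nonzero `dx^μ ⊗ Tr(ι_μ A Λ)`. -/
theorem exists_psi_ne (hsymm : ∀ X Y, Tr X Y = Tr Y X)
    (hinv : ∀ X Y Z, Tr ⁅X, Y⁆ Z = Tr X ⁅Y, Z⁆) [Nonempty M] (hTr : Tr ≠ 0) :
    ∃ u v : CSSpace M 𝔤, psi Tr 2 ![u, v] ≠ 0 ∧ psi Tr 1 ![CSSpace.brackets 2 ![u, v]] ≠
      ExtSpace.brackets Tr 2 ![psi Tr 1 ![u], psi Tr 1 ![v]] := by
  obtain ⟨p⟩ := ‹Nonempty M›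
  obtain ⟨X, Y, hXY⟩ : ∃ X Y, Tr X Y ≠ 0 := by
    by_contra! h
    exact hTr (LinearMap.ext₂ h)
  obtain ⟨E, x, -, -, -, hx⟩ := exists_frame p
  obtain ⟨ν, Z, hν⟩ := Form.exists_three_ne_zero p
  set A : GForm M 𝔤 1 := Form.d₀ (Form.ofFun (x 0)) ⊗ₜ[ℝ] X with hA
  set L : GForm M 𝔤 3 := ν ⊗ₜ[ℝ] Y with hL
  have hc : GForm.cov₁₃ Tr A L ≠ 0 := fun h => by
    have h1 : Tr X Y • (Form.wedge (Form.contr (E 0) (Form.d₀ (Form.ofFun (x 0))) : Form M 0) ν :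
        Form M (0 + 3)) = 0 := congrArg (fun T : CovDensity M => T (E 0)) h
    rw [Form.zero_wedge_three] at h1
    have h2 : Tr X Y * ((E 0).deriv (x 0) p * ν Z p) = 0 :=
      congrArg (fun α : Form M 3 => α Z p) h1
    rw [hx, if_pos rfl, one_mul] at h2
    exact (mul_ne_zero hXY hν) h2
  refine ⟨(0, A, 0, 0), (0, 0, 0, L), fun h => hc ?_, fun h => hc ?_⟩
  · have h1 : -(GForm.cov₁₃ Tr A L + GForm.cov₁₃ Tr 0 0 + GForm.cov₂₂ Tr 0 0) = 0 :=
      congrArg (fun w : ExtSpace M 𝔤 => w.cov) h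
    rw [LinearMap.map_zero, LinearMap.map_zero, add_zero, add_zero] at h1
    exact LinearMap.ext fun η => neg_eq_zero.1 (congrArg (fun T : CovDensity M => T η) h1)
  · have e1 : ExtSpace.bracket₂ Tr (ExtSpace.ofField A) (ExtSpace.ofNoether 0 L) =
        ExtSpace.ofCovCopy (GForm.cov₁₃ Tr A L) :=
      (ExtSpace.bracket₂_eq hsymm hinv _ _).trans (CartanData.b₂_ofA_ofN _ A 0 L)
    exact (congrArg (fun w : ExtSpace M 𝔤 => w.covCopy) (h.trans e1)).symm

namespace ExtSpace

theorem gaugeVariation_eq (ξ : VField M) (l : GForm M 𝔤 0) (A : GForm M 𝔤 1) :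
    gaugeVariation ξ l A = GForm.lie ξ A + GForm.d₀ l + -GForm.br₀₁ l A :=
  congrArg (GForm.lie ξ A + GForm.d₀ l + ·) (GForm.bracket₁₀ A l)

theorem bianchi_eq_zero (hsymm : ∀ X Y, Tr X Y = Tr Y X)
    (hinv : ∀ X Y Z, Tr ⁅X, Y⁆ Z = Tr X ⁅Y, Z⁆) (A : GForm M 𝔤 1) : bianchi A = 0 :=
  (congrArg (· + GForm.br₁₂ A (curvature A))
    ((cartanData (M := M) hsymm hinv).d₂_curvature A)).trans (neg_add_cancel _)

theorem gaugeVariation_add (hsymm : ∀ X Y, Tr X Y = Tr Y X)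
    (hinv : ∀ X Y Z, Tr ⁅X, Y⁆ Z = Tr X ⁅Y, Z⁆) (η ξ : VField M) (l : GForm M 𝔤 0)
    (A : GForm M 𝔤 1) : gaugeVariation (ξ + η) (l - GForm.contr η A) A =
      gaugeVariation ξ l A + GForm.contr η (curvature A) := by
  rw [gaugeVariation_eq, gaugeVariation_eq]
  exact (cartanData (M := M) hsymm hinv).variation_redundancy ξ η l A

end ExtSpace
end GaugeTheory
end ChernSimons

theorem mainTheorem5 (M : Type*) [TopologicalSpace M] [ChartedSpace E3 M] [IsManifold (𝓡 3) ∞ M]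
    [T2Space M] [SigmaCompactSpace M] (𝒜 : OrientedAtlas M)
    (𝔤 : Type*) [LieRing 𝔤] [LieAlgebra ℝ 𝔤] [FiniteDimensional ℝ 𝔤]
    (Tr : 𝔤 →ₗ[ℝ] 𝔤 →ₗ[ℝ] ℝ) (hsymm : ∀ X Y, Tr X Y = Tr Y X)
    (hinv : ∀ X Y Z, Tr ⁅X, Y⁆ Z = Tr X ⁅Y, Z⁆) :
    -- both brackets define differential graded Lie algebras
    IsDGLieAlgebra (CSSpace.degree M 𝔤) CSSpace.brackets ∧
    IsDGLieAlgebra (ExtSpace.degree M 𝔤) (ExtSpace.brackets Tr) ∧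
    -- which are cyclic, with pairings of degree `-3`
    IsCyclicPairing (CSSpace.degree M 𝔤) CSSpace.brackets 3 CSSpace.IsCpt
      (CSSpace.pairing 𝒜 Tr) ∧
    IsCyclicPairing (ExtSpace.degree M 𝔤) (ExtSpace.brackets Tr) 3 ExtSpace.IsCpt
      (ExtSpace.pairing 𝒜 Tr) ∧
    ((∀ X, (∀ Y, Tr X Y = 0) → X = 0) →
      PairingNondegenerate CSSpace.IsCpt (CSSpace.pairing (M := M) 𝒜 Tr) ∧
      PairingNondegenerate ExtSpace.IsCpt (ExtSpace.pairing (M := M) 𝒜 Tr)) ∧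
    -- `ψ` is a cyclic quasi-isomorphism
    IsLInftyQuasiIso (CSSpace.degree M 𝔤) CSSpace.brackets
      (ExtSpace.degree M 𝔤) (ExtSpace.brackets Tr) (psi Tr) ∧
    IsCyclicMorphism (CSSpace.degree M 𝔤) CSSpace.IsCpt (CSSpace.pairing 𝒜 Tr)
      (ExtSpace.pairing 𝒜 Tr) (psi Tr) ∧
    -- but not a morphism of differential graded Lie algebras
    (Nonempty M → Tr ≠ 0 →
      ¬ IsDGLieMorphism (CSSpace.degree M 𝔤) CSSpace.brackets
        (ExtSpace.degree M 𝔤) (ExtSpace.brackets Tr) (psi Tr) ∧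
      ∃ u v : CSSpace M 𝔤, psi Tr 1 ![CSSpace.brackets 2 ![u, v]] ≠
        ExtSpace.brackets Tr 2 ![psi Tr 1 ![u], psi Tr 1 ![v]]) ∧
    -- the brackets encode gauge variations, field equation, higher gauge variations and
    -- Noether identities
    (∀ (ξ : VField M) (l : GForm M 𝔤 0) (A : GForm M 𝔤 1),
      ExtSpace.brackets Tr 1 ![ExtSpace.ofGauge ξ l] +
          ExtSpace.brackets Tr 2 ![ExtSpace.ofGauge ξ l, ExtSpace.ofField A] =
        ExtSpace.ofField (ExtSpace.gaugeVariation ξ l A)) ∧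
    (∀ A : GForm M 𝔤 1, ExtSpace.brackets Tr 1 ![ExtSpace.ofField A] -
        (1 / 2 : ℝ) • ExtSpace.brackets Tr 2 ![ExtSpace.ofField A, ExtSpace.ofField A] =
      ExtSpace.ofEom (ExtSpace.curvature A)) ∧
    (∀ (η : VField M) (A : GForm M 𝔤 1), ExtSpace.brackets Tr 1 ![ExtSpace.ofVecCopy η] -
        ExtSpace.brackets Tr 2 ![ExtSpace.ofField A, ExtSpace.ofVecCopy η] =
      ExtSpace.ofGauge η (-GForm.contr η A)) ∧
    (∀ A : GForm M 𝔤 1, ExtSpace.brackets Tr 1 ![ExtSpace.ofEom (ExtSpace.curvature A)] -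
        ExtSpace.brackets Tr 2 ![ExtSpace.ofField A, ExtSpace.ofEom (ExtSpace.curvature A)] =
      ExtSpace.ofNoether (-ExtSpace.diffNoether Tr A) (ExtSpace.bianchi A)) ∧
    (∀ A : GForm M 𝔤 1, ExtSpace.diffNoether Tr A = 0 ∧ ExtSpace.bianchi A = 0) ∧
    -- the redundancy of diffeomorphisms up to terms proportional to the field equation
    (∀ (η ξ : VField M) (l : GForm M 𝔤 0) (A : GForm M 𝔤 1),
      ExtSpace.gaugeVariation (ξ + η) (l - GForm.contr η A) A =
        ExtSpace.gaugeVariation ξ l A + GForm.contr η (ExtSpace.curvature A)) ∧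
    (∀ (ξ : VField M) (l : GForm M 𝔤 0) (A : GForm M 𝔤 1),
      ExtSpace.gaugeVariation ξ l A =
        ExtSpace.gaugeVariation 0 (l + GForm.contr ξ A) A +
          GForm.contr ξ (ExtSpace.curvature A)) := by
  refine ⟨CSSpace.isDGLieAlgebra, ExtSpace.isDGLieAlgebra hsymm hinv,
    CSSpace.isCyclicPairing 𝒜 hsymm hinv, ExtSpace.isCyclicPairing 𝒜 hsymm hinv,
    fun hTr => ⟨CSSpace.pairingNondegenerate 𝒜 hsymm hTr, ExtSpace.pairingNondegenerate 𝒜 hsymm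
        hTr⟩,
    isLInftyQuasiIso_psi hsymm hinv, isCyclicMorphism_psi 𝒜 hsymm, fun _ hTr => ?_,
    fun ξ l A => ?_, (cartanData (M := M) hsymm hinv).b_field,
    (cartanData (M := M) hsymm hinv).b_vecCopy, fun A => ?_, fun A =>
      ⟨(cartanData (M := M) hsymm hinv).noether_curvature A, ExtSpace.bianchi_eq_zero hsymm hinv A⟩,
    ExtSpace.gaugeVariation_add hsymm hinv, fun ξ l A => ?_⟩
  · obtain ⟨u, v, h2, h⟩ := exists_psi_ne (M := M) hsymm hinv hTr
    exact ⟨fun H => h2 (H.strict 2 le_rfl _), u, v, h⟩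
  · rw [ExtSpace.gaugeVariation_eq]
    exact (cartanData (M := M) hsymm hinv).b_gauge ξ l A
  · exact (cartanData (M := M) hsymm hinv).b_eom A (ExtSpace.curvature A)
  · have h := ExtSpace.gaugeVariation_add hsymm hinv ξ 0 (l + GForm.contr ξ A) A
    have e : l + GForm.contr ξ A - GForm.contr ξ A = l := by abel
    rwa [zero_add, e] at h
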